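/- Let $b\in\mathbb R$, $\kappa>0$, $k>0$. For $a\in\mathbb R$ call $(w,c)$ a *wave of amplitude $a$* if $c\in\mathbb R$ and $w:\mathbb R\to\mathbb R$ is smooth, even, $2\pi$-periodic, satisfies $$(\kappa-c)w+ck^2w''+\tfrac{b+1}{2}w^2-k^2ww''-\tfrac{b-1}{2}k^2(w')^2=0,$$ and has first cosine coefficient $\frac1\pi\int_0^{2\pi}w(z)\cos z\,dz=a$. Call it *$\delta$-small* if $|w|,|w'|,|w''|<\delta$ everywhere and $|c-\frac{\kappa}{1+k^2}|<\delta$. Such waves give the small $2\pi/k$-periodic travelling waves $u=w(k(x-ct))$ of the $b$-KP equation $[(1-\partial_x^2)u_t+(b+1)uu_x+\kappa u_x-bu_xu_{xx}-uu_{xxx}]_x+\sigma u_{yy}=0$. For $\sigma=1$ ($b$-KP-II) and transverse wave number $\ell\in\mathbb R$, let $$\mathcal A_a(\ell)=\partial_z(1-k^2\partial_z^2)^{-1}\Big[c(1-k^2\partial_z^2)-\big(\kappa+(b+1)w-k^2w_{zz}-k^2(b-1)w_z\partial_z-k^2w\partial_z^2-\ell^2\partial_z^{-2}\big)\Big],$$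 acting in $L^2_0(\mathbb T)$, the complex $2\pi$-periodic $L^2$ functions with zero mean, with domain $H^1(\mathbb T)\cap L_0^2(\mathbb T)$. Put $$\ell_a^2:=\big[(b+1)+(7-2b)k^2\big]\frac{(b+1)(1+k^2)^2}{12\kappa k^2}\,a^2\in\mathbb R$$ (this number may be negative). Then there are $\delta,\varepsilon,C>0$, depending only on $b,\kappa,k$, such that for every $a$ with $0<|a|<\varepsilon$ a $\delta$-small wave of amplitude $a$ exists, and for every such wave $(w,c)$: 1. If $\ell_a^2<0$, there is a number $\ell_{**}^2>0$ with $|\ell_{**}^2-(-\ell_a^2)|\le Ca^4$ such that for every real $\ell$ with $|\ell|<\varepsilon$: (i) if $\ell^2>\ell_{**}^2$, the spectrum of $\mathcal A_a(\ell)$ is contained in $i\mathbb R$; (ii) if $0<\ell^2<\ell_{**}^2$, the spectrum of $\mathcal A_a(\ell)$ is contained in $i\mathbb R$ except for a pair of real eigenvalues $\pm\mu$, $\mu>0$, both algebraically simple. 2. If $\ell_a^2>0$, the spectrum of $\mathcal A_a(\ell)$ is contained in $i\mathbb R$ for every real $\ell$ with $|\ell|<\varepsilon$. -/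

import Mathlib

open MeasureTheory AddCircle
open scoped Real ENNReal ContDiff

noncomputable section

namespace BKP

instance fact_two_pi_pos : Fact ((0 : ℝ) < 2 * π) := ⟨Real.two_pi_pos⟩

/-- The circle `ℝ / 2πℤ`. -/
abbrev Circ : Type := AddCircle (2 * π)

/-- Complex `L²(𝕋)`, with respect to the normalized Lebesgue measure `dz / 2π`. -/
abbrev L2 : Type := Lp ℂ 2 (haarAddCircle (T := 2 * π))

/-- Smooth real `2π`-periodic functions of a real variable. -/
structure Profile where
  /-- the underlying function -/
  fn : ℝ → ℝ
  smooth : ContDiff ℝ ∞ fn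
  periodic : Function.Periodic fn (2 * π)

namespace Profile

/-- The derivative of a smooth periodic function. -/
def deriv (w : Profile) : Profile where
  fn := _root_.deriv w.fn
  smooth := (contDiff_infty_iff_deriv.1 w.smooth).2
  periodic := fun x => by
    have h : (fun y => w.fn (y + 2 * π)) = w.fn := funext w.periodic
    have h2 := deriv_comp_add_const (f := w.fn) (a := 2 * π) (x := x)
    rw [h] at h2
    exact h2.symm

/-- A smooth periodic function as a continuous complex function on the circle. -/
def onCirc (w : Profile) : C(Circ, ℂ) where
  toFun x := ((w.periodic.lift x : ℝ) : ℂ)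
  continuous_toFun := by
    refine Complex.continuous_ofReal.comp ?_
    exact continuous_coinduced_dom.mpr w.smooth.continuous

end Profile

/-! ### Operators on `L²(𝕋)` -/

theorem memLp_mul (g : C(Circ, ℂ)) (V : L2) :
    MemLp (fun x => g x * V x) 2 (haarAddCircle (T := 2 * π)) := by
  have hg : MemLp (fun x => g x) ∞ (haarAddCircle (T := 2 * π)) :=
    memLp_top_of_bound g.continuous.aestronglyMeasurable ‖g‖
      (Filter.Eventually.of_forall fun x => g.norm_coe_le_norm x)
  exact (Lp.memLp V).mul hg

/-- Multiplication of an `L²` function by a smooth periodic function. -/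
def mulOp (w : Profile) : L2 →ₗ[ℂ] L2 where
  toFun V := (memLp_mul w.onCirc V).toLp _
  map_add' U V := by
    rw [← MemLp.toLp_add]
    refine MemLp.toLp_congr _ _ ?_
    filter_upwards [Lp.coeFn_add U V] with x hx
    simp only [hx, Pi.add_apply, mul_add]
  map_smul' r V := by
    rw [RingHom.id_apply, ← MemLp.toLp_const_smul]
    refine MemLp.toLp_congr _ _ ?_
    filter_upwards [Lp.coeFn_smul r V] with x hx
    simp only [hx, Pi.smul_apply, smul_eq_mul]
    ring

/-- The Fourier coefficient `(2π)⁻¹ ∫ V(z) e^{-inz} dz`. -/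
def coeff (n : ℤ) : L2 →ₗ[ℂ] ℂ where
  toFun V := fourierCoeff (V : Circ → ℂ) n
  map_add' U V := by
    simp only [← fourierBasis_repr, map_add, lp.coeFn_add, Pi.add_apply]
  map_smul' r V := by
    simp only [← fourierBasis_repr, map_smul, lp.coeFn_smul, Pi.smul_apply, RingHom.id_apply]

theorem memlp_coeff (V : L2) : Memℓp (fun n : ℤ => coeff n V) 2 := by
  have h := lp.memℓp (fourierBasis.repr V)
  have e : (fun n : ℤ => coeff n V) = (fourierBasis.repr V : ℤ → ℂ) :=
    funext fun n => (fourierBasis_repr V n).symm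
  rw [e]
  exact h

/-- The domain `{V ∈ L²(𝕋) : (m(n) V̂(n))ₙ ∈ ℓ²}` of the Fourier multiplier with symbol `m`. -/
def multDomain (m : ℤ → ℂ) : Submodule ℂ L2 where
  carrier := {V | Memℓp (fun n : ℤ => m n * coeff n V) 2}
  zero_mem' := by
    simpa [Set.mem_ofPred_eq] using (zero_mem_ℓp' : Memℓp (fun _ : ℤ => (0 : ℂ)) 2)
  add_mem' {U V} hU hV := by
    have := Memℓp.add hU hV
    simp only [Set.mem_ofPred_eq, map_add, mul_add]
    exact this
  smul_mem' r V hV := by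
    have := Memℓp.const_mul hV r
    simp only [Set.mem_ofPred_eq, map_smul, smul_eq_mul]
    have e : (fun n : ℤ => m n * (r * coeff n V)) = fun n : ℤ => r * (m n * coeff n V) :=
      funext fun n => by ring
    rw [e]
    exact this

/-- The Fourier multiplier `V̂(n) ↦ m(n) V̂(n)`, on its maximal domain. -/
def mult (m : ℤ → ℂ) : multDomain m →ₗ[ℂ] L2 where
  toFun V := fourierBasis.repr.symm ⟨fun n : ℤ => m n * coeff n V.1, V.2⟩
  map_add' U V := by
    rw [← map_add]
    congr 1
    ext n
    simp [mul_add]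
    rfl
  map_smul' r V := by
    rw [RingHom.id_apply, ← map_smul]
    congr 1
    ext n
    simp only [SetLike.val_smul, map_smul, smul_eq_mul, lp.coeFn_smul, Pi.smul_apply]
    ring

theorem coeff_mult (m : ℤ → ℂ) (V : multDomain m) (n : ℤ) :
    coeff n (mult m V) = m n * coeff n V.1 := by
  change fourierCoeff (mult m V : Circ → ℂ) n = _
  rw [← fourierBasis_repr]
  simp [mult]

/-- A bounded symbol gives an everywhere defined multiplier. -/
theorem multDomain_of_bounded {m : ℤ → ℂ} (h : ∃ C : ℝ, ∀ n, ‖m n‖ ≤ C) (V : L2) :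
    V ∈ multDomain m := by
  obtain ⟨C, hC⟩ := h
  refine Memℓp.mono (g := fun n : ℤ => C * ‖coeff n V‖) ?_ ?_
  · exact ((memlp_coeff V).norm).const_mul C
  · intro n
    rw [norm_mul]
    exact mul_le_mul_of_nonneg_right (hC n) (norm_nonneg _)

/-- The everywhere defined Fourier multiplier with a bounded symbol. -/
def bmult (m : ℤ → ℂ) (h : ∃ C : ℝ, ∀ n, ‖m n‖ ≤ C) : L2 →ₗ[ℂ] L2 :=
  (mult m).comp (LinearMap.codRestrict _ LinearMap.id (multDomain_of_bounded h))

theorem coeff_bmult (m : ℤ → ℂ) (h : ∃ C : ℝ, ∀ n, ‖m n‖ ≤ C) (V : L2) (n : ℤ) :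
    coeff n (bmult m h V) = m n * coeff n V :=
  coeff_mult m _ n

/-- The symbol `i n` of `∂_z`. -/
def symD (n : ℤ) : ℂ := Complex.I * n

/-- The symbol `1 / (1 + k² n²)` of `(1 - k² ∂_z²)⁻¹`. -/
def symS (k : ℝ) (n : ℤ) : ℂ := ((1 / (1 + k ^ 2 * (n : ℝ) ^ 2) : ℝ) : ℂ)

theorem norm_symS_mul_le {k x : ℝ} (hk : 0 < k) {r : ℝ} (hr : |r| ≤ x)
    (n : ℤ) (hx : x ≤ (1 / k ^ 2 + 1) * (1 + k ^ 2 * (n : ℝ) ^ 2)) :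
    ‖symS k n * (r : ℂ)‖ ≤ 1 / k ^ 2 + 1 := by
  have hpos : 0 < 1 + k ^ 2 * (n : ℝ) ^ 2 := by positivity
  rw [symS, ← Complex.ofReal_mul, Complex.norm_real, Real.norm_eq_abs, abs_mul,
    abs_of_pos (by positivity : 0 < 1 / (1 + k ^ 2 * (n : ℝ) ^ 2)), one_div_mul_eq_div,
    div_le_iff₀ hpos]
  linarith

theorem sq_le_aux {k : ℝ} (hk : 0 < k) (n : ℤ) :
    (n : ℝ) ^ 2 ≤ (1 / k ^ 2 + 1) * (1 + k ^ 2 * (n : ℝ) ^ 2) := by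
  have e : (1 / k ^ 2 + 1) * (1 + k ^ 2 * (n : ℝ) ^ 2)
      = 1 / k ^ 2 + 1 + (n : ℝ) ^ 2 + k ^ 2 * (n : ℝ) ^ 2 := by
    field_simp
    ring
  rw [e]
  have : 0 ≤ 1 / k ^ 2 := by positivity
  have : 0 ≤ k ^ 2 * (n : ℝ) ^ 2 := by positivity
  linarith

theorem abs_le_sq (n : ℤ) : |(n : ℝ)| ≤ (n : ℝ) ^ 2 := by
  rw [← sq_abs]
  rcases eq_or_ne n 0 with rfl | h
  · simp
  · have : (1 : ℝ) ≤ |(n : ℝ)| := by exact_mod_cast Int.one_le_abs h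
    nlinarith

theorem bdd_DS {k : ℝ} (hk : 0 < k) : ∃ C : ℝ, ∀ n, ‖symD n * symS k n‖ ≤ C := by
  refine ⟨1 / k ^ 2 + 1, fun n => ?_⟩
  have h := norm_symS_mul_le hk (le_refl |(n : ℝ)|) n ((abs_le_sq n).trans (sq_le_aux hk n))
  rw [symD, mul_comm, ← mul_assoc, mul_comm _ Complex.I, mul_assoc, norm_mul, Complex.norm_I,
    one_mul]
  exact_mod_cast h

theorem bdd_DDS {k : ℝ} (hk : 0 < k) : ∃ C : ℝ, ∀ n, ‖symD n ^ 2 * symS k n‖ ≤ C := by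
  refine ⟨1 / k ^ 2 + 1, fun n => ?_⟩
  have h := norm_symS_mul_le (r := (n : ℝ) ^ 2) hk (abs_of_nonneg (sq_nonneg _)).le n
    (sq_le_aux hk n)
  rw [symD, mul_comm, mul_pow, Complex.I_sq, neg_one_mul, mul_neg, norm_neg]
  exact_mod_cast h

theorem bdd_DinvS {k : ℝ} (hk : 0 < k) : ∃ C : ℝ, ∀ n, ‖(symD n)⁻¹ * symS k n‖ ≤ C := by
  refine ⟨1 / k ^ 2 + 1, fun n => ?_⟩
  have h1 : |(n : ℝ)⁻¹| ≤ 1 := by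
    rcases eq_or_ne n 0 with rfl | h
    · simp
    · rw [abs_inv]
      exact inv_le_one_of_one_le₀ (by exact_mod_cast Int.one_le_abs h)
  have h := norm_symS_mul_le hk h1 n (by
    have : 0 ≤ 1 / k ^ 2 := by positivity
    have : 0 ≤ k ^ 2 * (n : ℝ) ^ 2 := by positivity
    nlinarith)
  rw [symD, mul_comm, mul_inv, Complex.inv_I, neg_mul, mul_neg, norm_neg, mul_left_comm, norm_mul,
    Complex.norm_I, one_mul]
  push_cast at h
  exact h

/-- The derivative `∂_z`, with domain `H¹(𝕋)`. -/
abbrev H1 : Submodule ℂ L2 := multDomain symD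

/-- The derivative `∂_z : H¹(𝕋) → L²(𝕋)`. -/
abbrev dz : H1 →ₗ[ℂ] L2 := mult symD

/-- The space `L²₀(𝕋)` of functions with zero mean. -/
def L20 : Submodule ℂ L2 := LinearMap.ker (coeff 0)

/-- `∂_z (1 - k² ∂_z²)⁻¹`, a bounded operator on `L²(𝕋)`. -/
def opDS (k : ℝ) (hk : 0 < k) : L2 →ₗ[ℂ] L2 := bmult (fun n => symD n * symS k n) (bdd_DS hk)

/-- `∂_z² (1 - k² ∂_z²)⁻¹`, a bounded operator on `L²(𝕋)`. -/
def opDDS (k : ℝ) (hk : 0 < k) : L2 →ₗ[ℂ] L2 :=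
  bmult (fun n => symD n ^ 2 * symS k n) (bdd_DDS hk)

/-- `∂_z⁻¹ (1 - k² ∂_z²)⁻¹`, used on functions with zero mean
(the coefficient with `n = 0` of the result is `0`). -/
def opDinvS (k : ℝ) (hk : 0 < k) : L2 →ₗ[ℂ] L2 :=
  bmult (fun n => (symD n)⁻¹ * symS k n) (bdd_DinvS hk)

/-- The linearized operator
`𝒜 V = ∂_z (1 - k²∂_z²)⁻¹ [ c (1 - k²∂_z²) V
  - (κ V + (b+1) w V - k² w'' V - k² (b-1) w' V' - k² w V'' - σ ℓ² ∂_z⁻² V) ]`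
as a map from `H¹(𝕋)` to `L²(𝕋)`.  For `V ∈ H¹` the product `w V''` is the distribution
`(w V')' - w' V'`, so that
`∂_z (1 - k²∂_z²)⁻¹ (w V'') = ∂_z² (1 - k²∂_z²)⁻¹ (w V') - ∂_z (1 - k²∂_z²)⁻¹ (w' V')`. -/
def linOp (σ b κ k : ℝ) (hk : 0 < k) (w : Profile) (c ℓ : ℝ) : H1 →ₗ[ℂ] L2 :=
  (c : ℂ) • dz
  - (opDS k hk).comp
      ((κ : ℂ) • H1.subtype
        + ((b + 1 : ℝ) : ℂ) • (mulOp w).comp H1.subtype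
        - ((k ^ 2 : ℝ) : ℂ) • (mulOp w.deriv.deriv).comp H1.subtype
        - ((k ^ 2 * (b - 1) : ℝ) : ℂ) • (mulOp w.deriv).comp dz)
  + ((k ^ 2 : ℝ) : ℂ) •
      ((opDDS k hk).comp ((mulOp w).comp dz) - (opDS k hk).comp ((mulOp w.deriv).comp dz))
  + ((σ * ℓ ^ 2 : ℝ) : ℂ) • (opDinvS k hk).comp H1.subtype

theorem linOp_mem_L20 (σ b κ k : ℝ) (hk : 0 < k) (w : Profile) (c ℓ : ℝ) (V : H1) :
    linOp σ b κ k hk w c ℓ V ∈ L20 := by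
  rw [L20, LinearMap.mem_ker]
  have h : coeff 0 (dz V) = 0 := by simp [coeff_mult, symD]
  simp only [linOp, LinearMap.add_apply, LinearMap.sub_apply, LinearMap.smul_apply, map_add,
    map_sub, map_smul, h, LinearMap.comp_apply, opDS, opDDS, opDinvS, coeff_bmult]
  simp [symD]

/-- The operator `𝒜_a(ℓ)` in `L²₀(𝕋)`, with domain `H¹(𝕋) ∩ L²₀(𝕋)`. -/
def A (σ b κ k : ℝ) (hk : 0 < k) (w : Profile) (c ℓ : ℝ) : L20 →ₗ.[ℂ] L20 where
  domain := H1.comap L20.subtype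
  toFun := LinearMap.codRestrict L20
    ((linOp σ b κ k hk w c ℓ).comp
      (LinearMap.codRestrict H1 (L20.subtype.comp (H1.comap L20.subtype).subtype)
        (fun V => V.2)))
    (fun _ => linOp_mem_L20 σ b κ k hk w c ℓ _)

/-! ### Spectral notions for an unbounded operator -/

section Spectrum

variable {E : Type*} [NormedAddCommGroup E] [NormedSpace ℂ E]

/-- `z` is in the resolvent set of `T` if `T - z` maps its domain bijectively onto the space, with
a bounded inverse. -/
def resolventSet (T : E →ₗ.[ℂ] E) : Set ℂ :=
  {z | ∃ R : E →L[ℂ] E,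
    (∀ y : E, ∃ x : T.domain, (x : E) = R y ∧ T x - z • (x : E) = y) ∧
    ∀ x : T.domain, R (T x - z • (x : E)) = x}

/-- The spectrum of an unbounded operator. -/
def spec (T : E →ₗ.[ℂ] E) : Set ℂ := (resolventSet T)ᶜ

/-- `z` is an algebraically simple eigenvalue: the kernel of `T - z` is spanned by one vector
`v ≠ 0`, and `v` is not in the range of `T - z` (there is no Jordan chain of length two). -/
def IsSimpleEigenvalue (T : E →ₗ.[ℂ] E) (z : ℂ) : Prop :=
  ∃ v : T.domain, v ≠ 0 ∧ T v = z • (v : E) ∧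
    (∀ u : T.domain, T u = z • (u : E) → ∃ t : ℂ, u = t • v) ∧
    ∀ u : T.domain, T u - z • (u : E) ≠ v

/-- The spectrum is contained in the imaginary axis. -/
def ImaginarySpectrum (T : E →ₗ.[ℂ] E) : Prop := ∀ z ∈ spec T, z.re = 0

end Spectrum

/-! ### The periodic waves -/

/-- `w` is an even `2π`-periodic profile of a travelling wave of speed `c` with amplitude
(first cosine coefficient) `a`: it solves
`(κ - c) w + c k² w'' + (b+1)/2 w² - k² w w'' - (b-1)/2 k² (w')² = 0`. -/
structure IsWave (b κ k a : ℝ) (w : Profile) (c : ℝ) : Prop where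
  even : Function.Even w.fn
  equation : ∀ z : ℝ,
    (κ - c) * w.fn z + c * k ^ 2 * w.deriv.deriv.fn z + (b + 1) / 2 * w.fn z ^ 2
      - k ^ 2 * w.fn z * w.deriv.deriv.fn z - (b - 1) / 2 * k ^ 2 * w.deriv.fn z ^ 2 = 0
  amplitude : 1 / π * ∫ z in (0 : ℝ)..2 * π, w.fn z * Real.cos z = a

/-- The pair `(w, c)` is `δ`-close to the bifurcation point `(0, κ / (1 + k²))`, in the `C²` norm
for the profile. -/
structure IsSmall (κ k δ : ℝ) (w : Profile) (c : ℝ) : Prop where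
  fn_lt : ∀ z : ℝ, |w.fn z| < δ
  deriv_lt : ∀ z : ℝ, |w.deriv.fn z| < δ
  deriv2_lt : ∀ z : ℝ, |w.deriv.deriv.fn z| < δ
  speed_lt : |c - κ / (1 + k ^ 2)| < δ

/-- The (possibly negative) quantity `ℓ_a²`. -/
def ellSq (b κ k a : ℝ) : ℝ :=
  ((b + 1) + (7 - 2 * b) * k ^ 2) * ((b + 1) * (1 + k ^ 2) ^ 2 / (12 * κ * k ^ 2)) * a ^ 2

end BKP

end

open MeasureTheory AddCircle
open scoped Real ENNReal ContDiff

noncomputable section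

namespace BKP

open ComplexConjugate

/-! ### Fourier coefficients of `L²` functions -/

/-! In Fourier variables the operator is i ν_n on the diagonal plus a term `nop` which is
proportional to the size of the wave and costs one derivative. For w = 0, c = κ/(1+k²), ℓ = 0 the
frequencies ν_n vanish exactly at n = ±1 (the mode 0 is excluded by the zero mean), and apart from
this pair they are at least `gap` away from each other. For small waves only the double eigenvalue 0
can therefore leave the imaginary axis. The work consists in proving this uniformly for the
infinitely many other eigenvalues, and in following the two eigenvalues near 0.

Away from 0: the spectrum consists of eigenvalues (`exists_eigen_of_mem_spec`), since after
inverting ∂_z the operator minus z is a boundedly invertible operator plus a compact one. As the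
wave is even and real, V(z) ↦ conj V(-z) sends the eigenvalue λ to -conj λ, which has the same
imaginary part. It thus suffices that two such eigenvalues coincide, and then Re λ = 0. For bounded
Im λ at most one mode is resonant, and a Lyapunov–Schmidt estimate shows it
(`re_eq_zero_of_intermediate`). For large Im λ this breaks down, because w∂_z on the mode n has size
|w||n| while the gaps stay bounded. There the eigenvalue equation is read as a transport equation (c
- w)V' = (λ + (b-2)w')V minus a smoothing term. With the integrating factor, the smoothing term
contributes only O(1/|λ|), and periodicity leaves one value of Re λ for each value of Im λ
(`transport_unique`, `re_eq_zero_of_large`).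

Near 0: a contraction yields an invariant plane spanned by an even real function cos + E and an odd
real function sin + O (`exists_invPair`). The operator exchanges the parities, so on this plane it
is an off-diagonal matrix with real entries p, q, and every eigenvalue with |Im λ| ≤ gap/2 satisfies
λ² = pq (`InvPair.eq_of_solution`, `InvPair.sq_eq_of_isEigen`). As functions of s = ℓ², p and q have
slopes -1/(1+k²) and 1/(1+k²) up to O(a²) (`InvPair.entries_sub`). The translation mode w' forces
p(0) = 0 (`InvPair.odd_entry_eq_zero`), so p < 0 for s > 0 and the sign of q decides: q ≥ 0 gives
imaginary λ, q < 0 gives a simple real pair. As q increases in s, the transition is its zero, close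
to -(1+k²) q(0).

It remains to show q(0) = ℓ_a²/(1+k²) + O(a⁴) (`exists_entry_asymptotics`). Subtracting from the row
n = 1 of the equation for cos + E the row n = 1 of the wave equation divided by 2a cancels the speed
correction and the second order coefficients of the wave. Only the coefficient E_2 survives, and its
leading term comes from the row n = 2 (`exists_entry_eq`, `exists_second_coeff_eq`). Hence no
expansion of the wave is needed, only a priori bounds valid for every small wave
(`IsWave.waveBounds`).

Waves exist by a contraction for the forcing x in v'' + v = x, where w = a(cos + v) and the speed is
fixed by the solvability condition (`exists_small_wave`). -/

theorem hasSum_sq_coeff (V : L2) : HasSum (fun n : ℤ => ‖coeff n V‖ ^ 2) (‖V‖ ^ 2) := by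
  have h := lp.hasSum_norm (p := 2) (by norm_num) (fourierBasis.repr V)
  have e : ‖fourierBasis.repr V‖ = ‖V‖ := LinearIsometryEquiv.norm_map _ _
  rw [e] at h
  have e2 : (2 : ℝ≥0∞).toReal = ((2 : ℕ) : ℝ) := by norm_num
  simp only [e2, Real.rpow_natCast] at h
  convert h using 3 with n
  exact congrArg _ (fourierBasis_repr V n).symm

theorem norm_coeff_le (n : ℤ) (V : L2) : ‖coeff n V‖ ≤ ‖V‖ := by
  have h := (hasSum_sq_coeff V)
  have := le_hasSum h n (fun _ _ => by positivity)
  exact (sq_le_sq₀ (norm_nonneg _) (norm_nonneg _)).1 this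

theorem ext_coeff {U V : L2} (h : ∀ n, coeff n U = coeff n V) : U = V := by
  apply fourierBasis.repr.injective
  ext n
  rw [fourierBasis_repr, fourierBasis_repr]
  exact h n

theorem norm_le_of_coeff_le {X Y : L2} {K : ℝ} (hK : 0 ≤ K)
    (h : ∀ n, ‖coeff n X‖ ≤ K * ‖coeff n Y‖) : ‖X‖ ≤ K * ‖Y‖ := by
  have h1 := hasSum_sq_coeff X
  have h2 := (hasSum_sq_coeff Y).mul_left (K ^ 2)
  have := hasSum_le (fun n => by
    have := pow_le_pow_left₀ (norm_nonneg _) (h n) 2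
    rwa [mul_pow] at this) h1 h2
  rw [← mul_pow] at this
  exact (sq_le_sq₀ (norm_nonneg _) (by positivity)).1 this

theorem exists_coeff_eq {x : ℤ → ℂ} (hx : Memℓp x 2) : ∃ V : L2, ∀ n, coeff n V = x n := by
  refine ⟨fourierBasis.repr.symm ⟨x, hx⟩, fun n => ?_⟩
  change fourierCoeff _ n = _
  rw [← fourierBasis_repr]
  simp

theorem exists_coeff_eq_of_le {x : ℤ → ℂ} {K : ℝ} {Y : L2} (h : ∀ n, ‖x n‖ ≤ K * ‖coeff n Y‖) :
    ∃ V : L2, ∀ n, coeff n V = x n :=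
  exists_coeff_eq (Memℓp.mono (((memlp_coeff Y).norm).const_mul K) h)

/-- The Fourier coefficient as a continuous functional. -/
def coeffL (n : ℤ) : L2 →L[ℂ] ℂ :=
  (coeff n).mkContinuous 1 (fun V => by rw [one_mul]; exact norm_coeff_le n V)

@[simp] theorem coeffL_apply (n : ℤ) (V : L2) : coeffL n V = coeff n V := rfl

theorem continuous_coeff (n : ℤ) : Continuous (coeff n) := (coeffL n).continuous

/-- The exponential `z ↦ e^{inz}`. -/
def expo (n : ℤ) : L2 := fourierLp 2 n

theorem coeff_eq_inner (n : ℤ) (V : L2) : coeff n V = inner ℂ (expo n) V := by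
  change fourierCoeff _ n = _
  rw [← fourierBasis_repr, HilbertBasis.repr_apply_apply, coe_fourierBasis]
  rfl

theorem coeff_expo (m n : ℤ) : coeff m (expo n) = if m = n then 1 else 0 := by
  rw [coeff_eq_inner]
  exact (orthonormal_iff_ite.1 orthonormal_fourier) m n

theorem norm_expo (n : ℤ) : ‖expo n‖ = 1 := orthonormal_fourier.1 n

/-! ### Multiplication operators -/

theorem coeFn_mulOp (w : Profile) (V : L2) :
    (mulOp w V : Circ → ℂ) =ᵐ[haarAddCircle] fun x => w.onCirc x * V x :=
  MemLp.coeFn_toLp (memLp_mul w.onCirc V)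

theorem onCirc_coe (w : Profile) (z : ℝ) : w.onCirc (z : Circ) = (w.fn z : ℂ) := rfl

theorem norm_onCirc_le (w : Profile) {K : ℝ} (h : ∀ z, |w.fn z| ≤ K) (x : Circ) :
    ‖w.onCirc x‖ ≤ K := by
  induction x using QuotientAddGroup.induction_on with
  | H z =>
    have := h z
    change ‖w.onCirc (z : Circ)‖ ≤ K
    rw [onCirc_coe, Complex.norm_real]
    exact this

theorem norm_mulOp_le (w : Profile) {K : ℝ} (h : ∀ z, |w.fn z| ≤ K) (V : L2) :
    ‖mulOp w V‖ ≤ K * ‖V‖ := by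
  apply Lp.norm_le_mul_norm_of_ae_le_mul
  filter_upwards [coeFn_mulOp w V] with x hx
  rw [hx, norm_mul]
  exact mul_le_mul_of_nonneg_right (norm_onCirc_le w h x) (norm_nonneg _)

theorem conj_onCirc (w : Profile) (x : Circ) : conj (w.onCirc x) = w.onCirc x := by
  induction x using QuotientAddGroup.induction_on with
  | H z => exact Complex.conj_ofReal _

theorem inner_mulOp_left (w : Profile) (U V : L2) :
    inner ℂ (mulOp w U) V = inner ℂ U (mulOp w V) := by
  rw [L2.inner_def, L2.inner_def]
  refine integral_congr_ae ?_
  filter_upwards [coeFn_mulOp w U, coeFn_mulOp w V] with x hx hy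
  rw [hx, hy]
  simp only [RCLike.inner_apply, map_mul, conj_onCirc]
  ring

namespace Profile

/-- The Fourier coefficients of a profile. -/
def hat (w : Profile) (n : ℤ) : ℂ := fourierCoeff w.onCirc n

end Profile

theorem coeff_mulOp_expo (w : Profile) (n m : ℤ) :
    coeff n (mulOp w (expo m)) = w.hat (n - m) := by
  change fourierCoeff _ n = fourierCoeff _ _
  rw [fourierCoeff, fourierCoeff]
  refine integral_congr_ae ?_
  filter_upwards [coeFn_mulOp w (expo m), coeFn_fourierLp (T := 2 * π) 2 m] with x hx hy
  rw [hx]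
  have : (expo m : Circ → ℂ) x = fourier m x := hy
  rw [this, show -(n - m) = -n + m by ring, fourier_add]
  simp only [smul_eq_mul]
  ring

/-- The Fourier coefficients of a product are given by a convolution. -/
theorem hasSum_coeff_mulOp (w : Profile) (V : L2) (n : ℤ) :
    HasSum (fun m => w.hat (n - m) * coeff m V) (coeff n (mulOp w V)) := by
  -- Parseval for the pair w·e^{inz} and V. Multiplication by a real profile is symmetric, so it can
  -- be moved from one factor to the other.
  have h := fourierBasis.hasSum_inner_mul_inner (mulOp w (expo n)) V
  rw [inner_mulOp_left, ← coeff_eq_inner] at h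
  have e : (fun m => w.hat (n - m) * coeff m V) = fun m =>
      inner ℂ (mulOp w (expo n)) (fourierBasis m) * inner ℂ (fourierBasis m) V := by
    ext m
    rw [coe_fourierBasis, inner_mulOp_left]
    change _ = inner ℂ (expo n) (mulOp w (expo m)) * inner ℂ (expo m) V
    rw [← coeff_eq_inner, ← coeff_eq_inner, coeff_mulOp_expo]
  rw [e]
  exact h

/-- A profile as an element of `L²`. -/
def Profile.toL2 (w : Profile) : L2 := mulOp w (expo 0)

theorem coeff_toL2 (w : Profile) (n : ℤ) : coeff n w.toL2 = w.hat n := by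
  rw [Profile.toL2, coeff_mulOp_expo, sub_zero]

theorem norm_toL2_le (w : Profile) {K : ℝ} (h : ∀ z, |w.fn z| ≤ K) : ‖w.toL2‖ ≤ K := by
  have := norm_mulOp_le w h (expo 0)
  rwa [norm_expo, mul_one] at this

theorem coeFn_toL2 (w : Profile) : (w.toL2 : Circ → ℂ) =ᵐ[haarAddCircle] w.onCirc := by
  filter_upwards [coeFn_mulOp w (expo 0), coeFn_fourierLp (T := 2 * π) 2 0] with x hx hy
  have : (expo 0 : Circ → ℂ) x = fourier 0 x := hy
  rw [Profile.toL2, hx, this, fourier_zero, mul_one]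

theorem hat_eq_integral (w : Profile) (n : ℤ) :
    w.hat n = (1 / (2 * π) : ℝ) • ∫ z in (0 : ℝ)..2 * π, fourier (-n) (z : Circ) * (w.fn z : ℂ) :=
        by
  rw [Profile.hat, fourierCoeff_eq_intervalIntegral _ _ 0, zero_add]
  rfl

/-- Integration by parts. Periodicity is required only at the two end points, so that the lemma
applies to profiles and also to the primitives in `hasDerivAt_of_rep`. -/
theorem integral_fourier_mul_deriv {f f' : ℝ → ℂ} (hd : ∀ z, HasDerivAt f (f' z) z)
    (hc : Continuous f') (hp : f (2 * π) = f 0) (n : ℤ) :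
    ∫ z in (0 : ℝ)..2 * π, fourier (-n) (z : Circ) * f' z
      = Complex.I * n * ∫ z in (0 : ℝ)..2 * π, fourier (-n) (z : Circ) * f z := by
  have h1 : ∀ z : ℝ, HasDerivAt (fun z : ℝ => fourier (-n) (z : Circ))
      (-2 * π * Complex.I * n / (2 * π : ℝ) * fourier (-n) (z : Circ)) z := fun z =>
    hasDerivAt_fourier_neg (2 * π) n z
  have := intervalIntegral.integral_mul_deriv_eq_deriv_mul (a := 0) (b := 2 * π)
    (u := fun z : ℝ => fourier (-n) (z : Circ)) (fun z _ => h1 z) (fun z _ => hd z)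
    (Continuous.intervalIntegrable (by fun_prop) _ _) (hc.intervalIntegrable _ _)
  rw [this, hp]
  have e : ((2 * π : ℝ) : Circ) = ((0 : ℝ) : Circ) := by
    rw [AddCircle.coe_period]; rfl
  rw [e]
  have e2 : ∀ z : ℝ, -2 * (π : ℂ) * Complex.I * n / (2 * π : ℝ) * fourier (-n) (z : Circ)
      * f z = -(Complex.I * n) * (fourier (-n) (z : Circ) * f z) := by
    intro z
    have : (π : ℂ) ≠ 0 := by exact_mod_cast Real.pi_ne_zero
    push_cast
    field_simp
  rw [intervalIntegral.integral_congr (fun z _ => e2 z), intervalIntegral.integral_const_mul,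
    sub_self, zero_sub]
  ring

theorem hat_deriv (w : Profile) (n : ℤ) : w.deriv.hat n = Complex.I * n * w.hat n := by
  have hp : (w.fn (2 * π) : ℂ) = w.fn 0 := by
    have := w.periodic 0
    rw [zero_add] at this
    rw [this]
  rw [hat_eq_integral, hat_eq_integral, integral_fourier_mul_deriv (f := fun z => (w.fn z : ℂ))
    (f' := fun z => (w.deriv.fn z : ℂ))
    (fun z => ((w.smooth.differentiable (by simp)) z).hasDerivAt.ofReal_comp)
    (Complex.continuous_ofReal.comp w.deriv.smooth.continuous) hp, Complex.real_smul,
    Complex.real_smul]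
  ring

theorem conj_hat (w : Profile) (n : ℤ) : conj (w.hat n) = w.hat (-n) := by
  rw [Profile.hat, Profile.hat, fourierCoeff, fourierCoeff, ← integral_conj]
  congr 1
  ext x
  rw [smul_eq_mul, smul_eq_mul, map_mul, conj_onCirc, ← fourier_neg]

theorem hat_neg_of_even (w : Profile) (hw : Function.Even w.fn) (n : ℤ) :
    w.hat (-n) = w.hat n := by
  rw [Profile.hat, Profile.hat, fourierCoeff, fourierCoeff, ← integral_neg_eq_self]
  congr 1
  ext x
  induction x using QuotientAddGroup.induction_on with
  | H z =>
    have h1 : w.onCirc (-(z : Circ)) = w.onCirc (z : Circ) := by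
      rw [← AddCircle.coe_neg, onCirc_coe, onCirc_coe, hw z]
    change fourier (- -n) (-(z : Circ)) • w.onCirc (-(z : Circ))
        = fourier (-n) (z : Circ) • w.onCirc (z : Circ)
    rw [h1, fourier_apply, fourier_apply]
    congr 3
    simp

end BKP

end

open MeasureTheory AddCircle
open scoped Real ENNReal ContDiff

noncomputable section

namespace BKP

open ComplexConjugate

/-! ### The linearized operator in Fourier variables -/

theorem norm_bmult_le {m : ℤ → ℂ} (h : ∃ C : ℝ, ∀ n, ‖m n‖ ≤ C) {K : ℝ} (hK : ∀ n, ‖m n‖ ≤ K)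
    (V : L2) : ‖bmult m h V‖ ≤ K * ‖V‖ := by
  refine norm_le_of_coeff_le ((norm_nonneg _).trans (hK 0)) fun n => ?_
  rw [coeff_bmult, norm_mul]
  exact mul_le_mul_of_nonneg_right (hK n) (norm_nonneg _)

theorem symD_ne_zero {n : ℤ} (hn : n ≠ 0) : symD n ≠ 0 := by
  simp [symD, hn]

theorem norm_symD (n : ℤ) : ‖symD n‖ = |(n : ℝ)| := by
  rw [symD, norm_mul, Complex.norm_I, one_mul, Complex.norm_intCast]

theorem one_le_abs_cast {n : ℤ} (hn : n ≠ 0) : 1 ≤ |(n : ℝ)| := by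
  exact_mod_cast Int.one_le_abs hn

theorem norm_inv_symD_le (n : ℤ) : ‖(symD n)⁻¹‖ ≤ 1 := by
  rcases eq_or_ne n 0 with rfl | h
  · simp [symD]
  · rw [norm_inv, norm_symD]
    exact inv_le_one_of_one_le₀ (one_le_abs_cast h)

/-- The antiderivative with zero mean of (the zero mean part of) an `L²` function. -/
def anti : L2 →ₗ[ℂ] H1 :=
  LinearMap.codRestrict H1 (bmult (fun n => (symD n)⁻¹) ⟨1, norm_inv_symD_le⟩) (fun f => by
    change Memℓp _ 2
    refine Memℓp.mono (memlp_coeff f).norm fun n => ?_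
    rw [coeff_bmult, ← mul_assoc, norm_mul]
    rcases eq_or_ne n 0 with rfl | h
    · simp [symD]
    · simp [mul_inv_cancel₀ (symD_ne_zero h)])

theorem coeff_anti (f : L2) (n : ℤ) : coeff n (anti f : L2) = (symD n)⁻¹ * coeff n f :=
  coeff_bmult _ _ _ _

theorem coeff_dz_anti (f : L2) {n : ℤ} (hn : n ≠ 0) : coeff n (dz (anti f)) = coeff n f := by
  rw [coeff_mult, coeff_anti, mul_inv_cancel_left₀ (symD_ne_zero hn)]

theorem coeff_zero_dz (V : H1) : coeff 0 (dz V) = 0 := by simp [coeff_mult, symD]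

theorem norm_dz_anti_le (f : L2) : ‖dz (anti f)‖ ≤ ‖f‖ := by
  have := norm_le_of_coeff_le (X := dz (anti f)) (Y := f) zero_le_one fun n => by
    rw [one_mul]
    rcases eq_or_ne n 0 with rfl | h
    · rw [coeff_zero_dz]; simp
    · rw [coeff_dz_anti f h]
  rwa [one_mul] at this

theorem anti_dz (V : H1) (hV : coeff 0 (V : L2) = 0) : anti (dz V) = V := by
  refine Subtype.ext (ext_coeff fun n => ?_)
  rw [coeff_anti, coeff_mult]
  rcases eq_or_ne n 0 with rfl | h
  · simp [hV, symD]
  · rw [inv_mul_cancel_left₀ (symD_ne_zero h)]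

theorem norm_le_norm_dz (V : H1) (hV : coeff 0 (V : L2) = 0) : ‖(V : L2)‖ ≤ ‖dz V‖ := by
  have := norm_le_of_coeff_le (X := (V : L2)) (Y := dz V) zero_le_one fun n => by
    rw [one_mul, coeff_mult, norm_mul, norm_symD]
    rcases eq_or_ne n 0 with rfl | h
    · simp [hV]
    · exact le_mul_of_one_le_left (norm_nonneg _) (one_le_abs_cast h)
  rwa [one_mul] at this

/-- The part of the linearized operator that depends on the profile. -/
def nop (b k : ℝ) (hk : 0 < k) (w : Profile) : H1 →ₗ[ℂ] L2 :=
  ((k ^ 2 : ℝ) : ℂ) •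
      ((opDDS k hk).comp ((mulOp w).comp dz) - (opDS k hk).comp ((mulOp w.deriv).comp dz))
  - (opDS k hk).comp
      (((b + 1 : ℝ) : ℂ) • (mulOp w).comp H1.subtype
        - ((k ^ 2 : ℝ) : ℂ) • (mulOp w.deriv.deriv).comp H1.subtype
        - ((k ^ 2 * (b - 1) : ℝ) : ℂ) • (mulOp w.deriv).comp dz)

/-- The frequencies of the constant coefficient part of the linearized operator. -/
def nu (κ k c s : ℝ) (n : ℤ) : ℝ :=
  n * (c - κ / (1 + k ^ 2 * (n : ℝ) ^ 2)) - s / (n * (1 + k ^ 2 * (n : ℝ) ^ 2))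

theorem one_add_pos (k : ℝ) (n : ℤ) : 0 < 1 + k ^ 2 * (n : ℝ) ^ 2 := by positivity

/-- The identity includes n = 0: both the symbol of ∂_z⁻¹ and the last fraction in `nu` vanish
there, by the convention for division by zero. -/
theorem coeff_linOp (b κ k : ℝ) (hk : 0 < k) (w : Profile) (c ℓ : ℝ) (V : H1) (n : ℤ) :
    coeff n (linOp 1 b κ k hk w c ℓ V)
      = Complex.I * nu κ k c (ℓ ^ 2) n * coeff n (V : L2) + coeff n (nop b k hk w V) := by
  have h : Complex.I * nu κ k c (ℓ ^ 2) n
      = c * symD n - κ * (symD n * symS k n) + (ℓ ^ 2 : ℝ) * ((symD n)⁻¹ * symS k n) := by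
    have hp : (1 + (k : ℂ) ^ 2 * (n : ℂ) ^ 2) ≠ 0 := by exact_mod_cast (one_add_pos k n).ne'
    rcases eq_or_ne n 0 with rfl | hn
    · simp [nu, symD]
    · have hn' : (n : ℂ) ≠ 0 := by exact_mod_cast hn
      rw [nu, symD, symS, mul_inv, Complex.inv_I]
      push_cast
      field_simp
      ring
  rw [h]
  simp only [linOp, nop, LinearMap.add_apply, LinearMap.sub_apply, LinearMap.smul_apply, map_add,
    map_sub, map_smul, LinearMap.comp_apply, opDS, opDDS, opDinvS, coeff_bmult, one_mul,
    smul_eq_mul, Submodule.subtype_apply, coeff_mult symD V]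
  push_cast
  ring

/-- The symbol of the symmetric bilinear form of the nonlinearity. -/
def kern (b k : ℝ) (j m : ℤ) : ℝ :=
  (b + 1) + k ^ 2 * ((j : ℝ) ^ 2 + (m : ℝ) ^ 2 + (b - 1) * (j * m))

theorem kern_comm (b k : ℝ) (j m : ℤ) : kern b k j m = kern b k m j := by
  rw [kern, kern]; ring

/-- The value of the bilinear form on the Fourier side. -/
def conv (b k : ℝ) (w : Profile) (V : H1) (n : ℤ) : ℂ :=
  (b + 1 : ℝ) * coeff n (mulOp w V) - (k ^ 2 : ℝ) * coeff n (mulOp w.deriv.deriv V)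
    - (k ^ 2 * (b - 2) : ℝ) * coeff n (mulOp w.deriv (dz V))
    - (k ^ 2 : ℝ) * symD n * coeff n (mulOp w (dz V))

theorem coeff_nop (b k : ℝ) (hk : 0 < k) (w : Profile) (V : H1) (n : ℤ) :
    coeff n (nop b k hk w V) = -(symD n * symS k n) * conv b k w V n := by
  simp only [nop, conv, LinearMap.sub_apply, LinearMap.smul_apply,
    map_sub, map_smul, LinearMap.comp_apply, opDS, opDDS, coeff_bmult,
    smul_eq_mul, Submodule.subtype_apply]
  push_cast
  ring

/-- The kernel is the polarization of the quadratic part of the wave equation, hence symmetric in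
the frequencies of w and V. This symmetry gives the translation mode and the cancellations in the
computation of the entry q. -/
theorem hasSum_conv (b k : ℝ) (w : Profile) (V : H1) (n : ℤ) :
    HasSum (fun m => kern b k (n - m) m * (w.hat (n - m) * coeff m (V : L2))) (conv b k w V n) := by
  have h1 := (hasSum_coeff_mulOp w V n).mul_left ((b + 1 : ℝ) : ℂ)
  have h2 := (hasSum_coeff_mulOp w.deriv.deriv V n).mul_left ((k ^ 2 : ℝ) : ℂ)
  have h3 := (hasSum_coeff_mulOp w.deriv (dz V) n).mul_left ((k ^ 2 * (b - 2) : ℝ) : ℂ)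
  have h4 := (hasSum_coeff_mulOp w (dz V) n).mul_left ((k ^ 2 : ℝ) * symD n : ℂ)
  have h := ((h1.sub h2).sub h3).sub h4
  refine h.congr_fun fun m => ?_
  rw [hat_deriv, hat_deriv, coeff_mult, symD, symD, kern]
  push_cast
  linear_combination ((k : ℂ) ^ 2 * w.hat (n - m) * coeff m (V : L2) *
    ((n - m) ^ 2 + (b - 2) * ((n - m) * m) + n * m)) * Complex.I_sq

/-- A bound for the profile and its first two derivatives. -/
def C2Bound (w : Profile) (K : ℝ) : Prop :=
  ∀ z, |w.fn z| ≤ K ∧ |w.deriv.fn z| ≤ K ∧ |w.deriv.deriv.fn z| ≤ K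

theorem C2Bound.nonneg {w : Profile} {K : ℝ} (h : C2Bound w K) : 0 ≤ K :=
  (abs_nonneg _).trans (h 0).1

/-- The constant in the bound for `nop`. -/
def nopC (b k : ℝ) : ℝ :=
  k ^ 2 * ((1 / k ^ 2 + 1) + (1 / k ^ 2 + 1))
    + (1 / k ^ 2 + 1) * (|b + 1| + k ^ 2 + |k ^ 2 * (b - 1)|)

theorem nopC_nonneg (b k : ℝ) : 0 ≤ nopC b k := by unfold nopC; positivity

theorem norm_DS_le {k : ℝ} (hk : 0 < k) (n : ℤ) : ‖symD n * symS k n‖ ≤ 1 / k ^ 2 + 1 := by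
  have h := norm_symS_mul_le hk (le_refl |(n : ℝ)|) n ((abs_le_sq n).trans (sq_le_aux hk n))
  rw [symD, mul_comm, ← mul_assoc, mul_comm _ Complex.I, mul_assoc, norm_mul, Complex.norm_I,
    one_mul]
  exact_mod_cast h

theorem norm_DDS_le {k : ℝ} (hk : 0 < k) (n : ℤ) :
    ‖symD n ^ 2 * symS k n‖ ≤ 1 / k ^ 2 + 1 := by
  have h := norm_symS_mul_le (r := (n : ℝ) ^ 2) hk (abs_of_nonneg (sq_nonneg _)).le n
    (sq_le_aux hk n)
  rw [symD, mul_comm, mul_pow, Complex.I_sq, neg_one_mul, mul_neg, norm_neg]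
  exact_mod_cast h

/-- Two derivatives are regained from (1 - k²∂²)⁻¹, which leaves a loss of one, and zero mean bounds
V by V'. To absorb this term one therefore needs frequencies separated by a multiple of |n|. -/
theorem norm_nop_le (b k : ℝ) (hk : 0 < k) {w : Profile} {K : ℝ} (hw : C2Bound w K) (V : H1)
    (hV : coeff 0 (V : L2) = 0) : ‖nop b k hk w V‖ ≤ nopC b k * K * ‖dz V‖ := by
  have hK := hw.nonneg
  have hV' := norm_le_norm_dz V hV
  have hd := norm_nonneg (dz V)
  have m0 : ‖mulOp w V‖ ≤ K * ‖dz V‖ := (norm_mulOp_le w (fun z => (hw z).1) _).trans (by gcongr)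
  have m2 : ‖mulOp w.deriv.deriv V‖ ≤ K * ‖dz V‖ :=
    (norm_mulOp_le w.deriv.deriv (fun z => (hw z).2.2) _).trans (by gcongr)
  have m1 : ‖mulOp w.deriv (dz V)‖ ≤ K * ‖dz V‖ := norm_mulOp_le w.deriv (fun z => (hw z).2.1) _
  have m3 : ‖mulOp w (dz V)‖ ≤ K * ‖dz V‖ := norm_mulOp_le w (fun z => (hw z).1) _
  have a1 : ‖opDDS k hk (mulOp w (dz V))‖ ≤ (1 / k ^ 2 + 1) * (K * ‖dz V‖) :=
    (norm_bmult_le _ (norm_DDS_le hk) _).trans (by gcongr)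
  have a2 : ‖opDS k hk (mulOp w.deriv (dz V))‖ ≤ (1 / k ^ 2 + 1) * (K * ‖dz V‖) :=
    (norm_bmult_le _ (norm_DS_le hk) _).trans (by gcongr)
  have a3 : ‖opDS k hk (((b + 1 : ℝ) : ℂ) • mulOp w V
        - ((k ^ 2 : ℝ) : ℂ) • mulOp w.deriv.deriv V
        - ((k ^ 2 * (b - 1) : ℝ) : ℂ) • mulOp w.deriv (dz V))‖
      ≤ (1 / k ^ 2 + 1) * (|b + 1| * (K * ‖dz V‖) + k ^ 2 * (K * ‖dz V‖)
        + |k ^ 2 * (b - 1)| * (K * ‖dz V‖)) := by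
    refine (norm_bmult_le _ (norm_DS_le hk) _).trans ?_
    gcongr
    refine (norm_sub_le _ _).trans (add_le_add ((norm_sub_le _ _).trans (add_le_add ?_ ?_)) ?_)
    · rw [norm_smul, Complex.norm_real, Real.norm_eq_abs]; gcongr
    · rw [norm_smul, Complex.norm_real, Real.norm_eq_abs, abs_of_pos (by positivity)]; gcongr
    · rw [norm_smul, Complex.norm_real, Real.norm_eq_abs]; gcongr
  have e : nop b k hk w V = ((k ^ 2 : ℝ) : ℂ) • (opDDS k hk (mulOp w (dz V))
        - opDS k hk (mulOp w.deriv (dz V)))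
      - opDS k hk (((b + 1 : ℝ) : ℂ) • mulOp w V
        - ((k ^ 2 : ℝ) : ℂ) • mulOp w.deriv.deriv V
        - ((k ^ 2 * (b - 1) : ℝ) : ℂ) • mulOp w.deriv (dz V)) := rfl
  rw [e]
  refine (norm_sub_le _ _).trans ?_
  rw [norm_smul, Complex.norm_real, Real.norm_eq_abs, abs_of_pos (by positivity : 0 < k ^ 2)]
  have a12 := (norm_sub_le (opDDS k hk (mulOp w (dz V))) (opDS k hk (mulOp w.deriv (dz V)))).trans
    (add_le_add a1 a2)
  refine (add_le_add (mul_le_mul_of_nonneg_left a12 (by positivity)) a3).trans (le_of_eq ?_)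
  rw [nopC]
  ring

/-! ### Spectral gaps of the frequencies -/

/-- The gap between the unperturbed frequencies. -/
def gap (κ k : ℝ) : ℝ := κ * k ^ 2 / (1 + k ^ 2) * (3 / (1 + 4 * k ^ 2))

theorem gap_pos {κ k : ℝ} (hκ : 0 < κ) (hk : 0 < k) : 0 < gap κ k := by unfold gap; positivity

/-- The unperturbed frequencies. -/
def nu0 (κ k : ℝ) (n : ℤ) : ℝ := nu κ k (κ / (1 + k ^ 2)) 0 n

theorem nu0_eq (κ k : ℝ) (n : ℤ) :
    nu0 κ k n = κ * k ^ 2 / (1 + k ^ 2) * (n * (((n : ℝ) ^ 2 - 1) / (1 + k ^ 2 * (n : ℝ) ^ 2))) :=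
        by
  have h1 : 1 + k ^ 2 ≠ 0 := by positivity
  have h2 := (one_add_pos k n).ne'
  rw [nu0, nu, zero_div, sub_zero]
  field_simp
  ring

theorem nu0_neg (κ k : ℝ) (n : ℤ) : nu0 κ k (-n) = - nu0 κ k n := by
  rw [nu0_eq, nu0_eq]; push_cast; ring

theorem nu0_one (κ k : ℝ) : nu0 κ k 1 = 0 := by rw [nu0_eq]; simp

theorem ratio_mono {k x y : ℝ} (hx : 1 ≤ x) (hxy : x ≤ y) :
    (x ^ 2 - 1) / (1 + k ^ 2 * x ^ 2) ≤ (y ^ 2 - 1) / (1 + k ^ 2 * y ^ 2) := by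
  rw [div_le_div_iff₀ (by positivity) (by positivity)]
  have h : x ^ 2 ≤ y ^ 2 := by gcongr
  nlinarith [mul_nonneg (sq_nonneg k) (sub_nonneg.2 h)]

/-- The ratio (n² - 1)/(1 + k²n²) is nondecreasing for n ≥ 1, and `gap` contains its value at n = 2.
-/
theorem gap_mul_le_nu0 {κ k : ℝ} (hκ : 0 < κ) {n : ℤ} (hn : 2 ≤ n) :
    gap κ k * n ≤ nu0 κ k n := by
  have hn' : (2 : ℝ) ≤ n := by exact_mod_cast hn
  rw [nu0_eq, gap, mul_assoc, mul_comm (3 / _)]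
  have := ratio_mono (k := k) (by norm_num : (1 : ℝ) ≤ 2) hn'
  have e : ((2 : ℝ) ^ 2 - 1) / (1 + k ^ 2 * 2 ^ 2) = 3 / (1 + 4 * k ^ 2) := by norm_num; ring_nf
  rw [e] at this
  gcongr

theorem gap_mul_le_abs_nu0 {κ k : ℝ} (hκ : 0 < κ) {n : ℤ} (hn : 2 ≤ |n|) :
    gap κ k * |(n : ℝ)| ≤ |nu0 κ k n| := by
  have hg : 0 ≤ gap κ k := by unfold gap; positivity
  rcases le_abs.1 hn with h | h
  · have := gap_mul_le_nu0 (k := k) hκ h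
    rw [abs_of_nonneg (by exact_mod_cast (by lia : 0 ≤ n))]
    exact this.trans (le_abs_self _)
  · have := gap_mul_le_nu0 (k := k) hκ h
    rw [nu0_neg] at this
    rw [abs_of_nonpos (by exact_mod_cast (by lia : n ≤ 0))]
    push_cast at this
    exact this.trans (neg_le_abs _)

theorem nu0_add_gap_le {κ k : ℝ} (hκ : 0 < κ) {m n : ℤ} (hm : 1 ≤ m) (hmn : m < n) :
    nu0 κ k m + gap κ k ≤ nu0 κ k n := by
  have hm' : (1 : ℝ) ≤ m := by exact_mod_cast hm
  have hmn' : (m : ℝ) + 1 ≤ n := by exact_mod_cast hmn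
  rw [nu0_eq, nu0_eq, gap, ← mul_add]
  have h1 := ratio_mono (k := k) hm' (by linarith : (m : ℝ) ≤ n)
  have h2 := ratio_mono (k := k) (by norm_num : (1 : ℝ) ≤ 2) (by linarith : (2 : ℝ) ≤ n)
  have e : ((2 : ℝ) ^ 2 - 1) / (1 + k ^ 2 * 2 ^ 2) = 3 / (1 + 4 * k ^ 2) := by norm_num; ring_nf
  rw [e] at h2
  have h0 : 0 ≤ 3 / (1 + 4 * k ^ 2) := by positivity
  gcongr
  set f := ((n : ℝ) ^ 2 - 1) / (1 + k ^ 2 * (n : ℝ) ^ 2)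
  nlinarith

/-- By oddness it is enough to compare nonnegative frequencies, which start from 0 at n = 1 and
increase by at least `gap`. The hypothesis `h1` removes the only coincidence, that of n = 1 with n =
-1. -/
theorem gap_le_abs_sub {κ k : ℝ} (hκ : 0 < κ) {m n : ℤ} (hm : m ≠ 0) (hn : n ≠ 0) (hmn : m ≠ n)
    (h1 : ¬(|m| = 1 ∧ |n| = 1)) : gap κ k ≤ |nu0 κ k m - nu0 κ k n| := by
  have hg : 0 ≤ gap κ k := by unfold gap; positivity
  have hp : ∀ {j : ℤ}, 1 ≤ j → 0 ≤ nu0 κ k j := fun {j} hj => by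
    rcases hj.eq_or_lt with rfl | h
    · rw [nu0_one]
    · have := gap_mul_le_nu0 (k := k) hκ (by lia : 2 ≤ j)
      have h' : (0 : ℝ) ≤ j := by exact_mod_cast (by lia : 0 ≤ j)
      nlinarith
  have hp2 : ∀ {j : ℤ}, 2 ≤ j → gap κ k ≤ nu0 κ k j := fun {j} hj => by
    have := nu0_add_gap_le (k := k) hκ le_rfl (by lia : 1 < j)
    rwa [nu0_one, zero_add] at this
  have key : ∀ {i j : ℤ}, i ≠ 0 → j ≠ 0 → i < j → ¬(|i| = 1 ∧ |j| = 1) →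
      nu0 κ k i + gap κ k ≤ nu0 κ k j := by
    intro i j hi hj hij h
    rcases lt_or_gt_of_ne hi with hi' | hi'
    · rcases lt_or_gt_of_ne hj with hj' | hj'
      · have := nu0_add_gap_le (k := k) hκ (by lia : 1 ≤ -j) (by lia : -j < -i)
        rw [nu0_neg, nu0_neg] at this
        linarith
      · have a := hp (j := -i) (by lia)
        have b := hp (j := j) (by lia)
        rw [nu0_neg] at a
        by_cases h2 : 2 ≤ j
        · linarith [hp2 h2]
        · have : 2 ≤ -i := by
            by_contra h3
            exact h ⟨by rw [abs_of_neg hi']; lia, by rw [abs_of_pos hj']; lia⟩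
          have := hp2 this
          rw [nu0_neg] at this
          linarith
    · exact nu0_add_gap_le hκ (by lia) hij
  rcases lt_or_gt_of_ne hmn with h | h
  · have := key hm hn h h1
    rw [abs_sub_comm]
    exact le_trans (by linarith) (le_abs_self _)
  · have := key hn hm h (fun h => h1 ⟨h.2, h.1⟩)
    exact le_trans (by linarith) (le_abs_self _)

theorem abs_nu_sub_nu0_le (κ k c s : ℝ) {n : ℤ} (hn : n ≠ 0) :
    |nu κ k c s n - nu0 κ k n| ≤ (|c - κ / (1 + k ^ 2)| + |s|) * |(n : ℝ)| := by
  have e : nu κ k c s n - nu0 κ k n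
      = (c - κ / (1 + k ^ 2)) * n - s / (n * (1 + k ^ 2 * (n : ℝ) ^ 2)) := by
    rw [nu0, nu, nu]; ring
  rw [e, add_mul]
  refine (abs_sub _ _).trans (add_le_add (abs_mul _ _).le ?_)
  rw [abs_div, abs_mul, abs_of_pos (one_add_pos k n)]
  have h1 := one_le_abs_cast hn
  have h2 : 1 ≤ 1 + k ^ 2 * (n : ℝ) ^ 2 := by linarith [show 0 ≤ k ^ 2 * (n : ℝ) ^ 2 by positivity]
  have h3 : 1 ≤ |(n : ℝ)| * (1 + k ^ 2 * (n : ℝ) ^ 2) := by nlinarith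
  calc |s| / (|(n : ℝ)| * (1 + k ^ 2 * (n : ℝ) ^ 2)) ≤ |s| := div_le_self (abs_nonneg _) h3
    _ ≤ |s| * |(n : ℝ)| := le_mul_of_one_le_right (abs_nonneg _) h1

end BKP

end

open MeasureTheory AddCircle
open scoped Real ENNReal ContDiff

noncomputable section

namespace BKP

open ComplexConjugate

/-! ### Eigenfunctions away from the origin, with bounded eigenvalue -/

/-- `V` solves the eigenvalue equation, written for the Fourier coefficients
(with `s` in place of `ℓ²`). -/
def IsEigen (b κ k : ℝ) (hk : 0 < k) (w : Profile) (c s : ℝ) (lam : ℂ) (V : H1) : Prop :=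
  coeff 0 (V : L2) = 0 ∧ ∀ n, Complex.I * nu κ k c s n * coeff n (V : L2)
    + coeff n (nop b k hk w V) = lam * coeff n (V : L2)

theorem IsEigen.smul {b κ k : ℝ} {hk : 0 < k} {w : Profile} {c s : ℝ} {lam : ℂ} {V : H1}
    (h : IsEigen b κ k hk w c s lam V) (t : ℂ) : IsEigen b κ k hk w c s lam (t • V) := by
  refine ⟨by simp [h.1], fun n => ?_⟩
  have := h.2 n
  simp only [map_smul, SetLike.val_smul, smul_eq_mul]
  linear_combination t * this

/-- Invertibility of the linearized operator on the modes outside of `P`. -/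
theorem norm_dz_le_of_gap {b κ k : ℝ} (hk : 0 < k) {w : Profile} {c s K g : ℝ} {lam : ℂ}
    (hw : C2Bound w K) (hg : 0 < g) (hK : nopC b k * K ≤ g / 2) (P : Set ℤ)
    (hgap : ∀ n : ℤ, n ≠ 0 → n ∉ P → g * |(n : ℝ)| ≤ ‖Complex.I * nu κ k c s n - lam‖)
    {D : H1} (hD0 : coeff 0 (D : L2) = 0) (hDP : ∀ n ∈ P, coeff n (D : L2) = 0) {Y : L2}
    (hY : ∀ n : ℤ, n ≠ 0 → n ∉ P → (Complex.I * nu κ k c s n - lam) * coeff n (D : L2)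
      + coeff n (nop b k hk w D) = coeff n Y) : ‖dz D‖ ≤ 2 / g * ‖Y‖ := by
  -- Dividing each row by its frequency difference gains exactly the factor |n| of the derivative.
  -- The term `nop` on the right then has norm at most half of g‖dz D‖ and is absorbed below.
  have h1 : ‖dz D‖ ≤ 1 / g * ‖Y - nop b k hk w D‖ := by
    refine norm_le_of_coeff_le (by positivity) fun n => ?_
    rw [coeff_mult, norm_mul, norm_symD, one_div, ← div_eq_inv_mul, le_div_iff₀' hg]
    rcases eq_or_ne n 0 with rfl | hn
    · simp
    by_cases hP : n ∈ P
    · simp [hDP n hP]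
    · have e : coeff n (Y - nop b k hk w D)
          = (Complex.I * nu κ k c s n - lam) * coeff n (D : L2) := by
        rw [map_sub, ← hY n hn hP]; ring
      rw [e, norm_mul, ← mul_assoc]
      exact mul_le_mul_of_nonneg_right (hgap n hn hP) (norm_nonneg _)
  have h2 := (norm_sub_le Y (nop b k hk w D)).trans
    (add_le_add_right (norm_nop_le b k hk hw D hD0) _)
  have h3 : nopC b k * K * ‖dz D‖ ≤ g / 2 * ‖dz D‖ :=
    mul_le_mul_of_nonneg_right hK (norm_nonneg _)
  rw [one_div, ← div_eq_inv_mul, le_div_iff₀' hg] at h1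
  rw [div_mul_eq_mul_div, le_div_iff₀' hg]
  linarith

theorem conj_hat_of_even {w : Profile} (hw : Function.Even w.fn) (n : ℤ) :
    conj (w.hat n) = w.hat n := by
  rw [conj_hat, hat_neg_of_even w hw]

theorem exists_conj (V : H1) : ∃ U : H1, ∀ n, coeff n (U : L2) = conj (coeff n (V : L2)) := by
  obtain ⟨U, hU⟩ := exists_coeff_eq_of_le (x := fun n => conj (coeff n (V : L2))) (K := 1)
    (Y := (V : L2)) fun n => by simp
  refine ⟨⟨U, ?_⟩, hU⟩
  refine Memℓp.mono (g := fun n => ‖symD n * coeff n (V : L2)‖) (Memℓp.norm V.2) fun n => ?_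
  rw [hU, norm_mul, RCLike.norm_conj, ← norm_mul]

/-- An even real profile has real Fourier coefficients and the kernel is real, while the symbol of
∂_z is imaginary. This produces the minus sign. -/
theorem coeff_nop_conj {b k : ℝ} {hk : 0 < k} {w : Profile} (hw : Function.Even w.fn) {U V : H1}
    (h : ∀ n, coeff n (U : L2) = conj (coeff n (V : L2))) (n : ℤ) :
    coeff n (nop b k hk w U) = - conj (coeff n (nop b k hk w V)) := by
  have h1 := hasSum_conv b k w U n
  have h2 := (Complex.hasSum_conj'.2 (hasSum_conv b k w V n))
  have e : conv b k w U n = conj (conv b k w V n) := by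
    refine h1.unique (h2.congr_fun fun m => ?_)
    simp only [map_mul, Complex.conj_ofReal, conj_hat_of_even hw, h]
  rw [coeff_nop, coeff_nop, e, map_mul, map_neg, map_mul, symD, symS]
  simp

/-- Reversibility: conjugating the coefficients is the map V(z) ↦ conj V(-z), and it anticommutes
with the operator. -/
theorem IsEigen.conj {b κ k : ℝ} {hk : 0 < k} {w : Profile} {c s : ℝ} {lam : ℂ} {V : H1}
    (hw : Function.Even w.fn) (h : IsEigen b κ k hk w c s lam V) {U : H1}
    (hU : ∀ n, coeff n (U : L2) = conj (coeff n (V : L2))) :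
    IsEigen b κ k hk w c s (-conj lam) U := by
  refine ⟨by rw [hU, h.1, map_zero], fun n => ?_⟩
  have := congrArg conj (h.2 n)
  rw [coeff_nop_conj hw hU, hU]
  simp only [map_add, map_mul, Complex.conj_I, Complex.conj_ofReal] at this
  linear_combination -this

theorem coeff_eq_zero_of_dz {V : H1} (h0 : coeff 0 (V : L2) = 0) (h : ‖dz V‖ ≤ 0) : V = 0 := by
  rw [← anti_dz V h0, norm_le_zero_iff.1 h, map_zero]

/-- The exponentials as elements of `H¹`. -/
def expoH (n : ℤ) : H1 := symD n • anti (expo n)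

theorem coeff_expoH {n : ℤ} (hn : n ≠ 0) (m : ℤ) :
    coeff m (expoH n : L2) = if m = n then 1 else 0 := by
  rw [expoH, SetLike.val_smul, map_smul, coeff_anti, coeff_expo, smul_eq_mul]
  split_ifs with h
  · rw [h, mul_one, mul_inv_cancel₀ (symD_ne_zero hn)]
  · simp

theorem norm_dz_expoH_le (n : ℤ) : ‖dz (expoH n)‖ ≤ |(n : ℝ)| := by
  rw [expoH, map_smul, norm_smul, norm_symD]
  have := norm_dz_anti_le (expo n)
  rw [norm_expo] at this
  exact mul_le_of_le_one_right (abs_nonneg _) this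

theorem abs_sub_le_norm (x : ℝ) (lam : ℂ) : |x - lam.im| ≤ ‖Complex.I * x - lam‖ := by
  have := Complex.abs_im_le_norm (Complex.I * x - lam)
  simpa using this

/-- Modes whose frequency is not close to `τ` are separated from `τ`, proportionally to the
wave number. -/
theorem separation {κ k : ℝ} (hκ : 0 < κ) {M τ : ℝ} (hM : gap κ k ≤ M)
    (hτ : |τ| ≤ M) {n : ℤ} (hn : n ≠ 0) (h : gap κ k / 2 ≤ |nu0 κ k n - τ|) :
    gap κ k ^ 2 / (4 * M) * |(n : ℝ)| ≤ |nu0 κ k n - τ| := by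
  have hg : 0 ≤ gap κ k := by unfold gap; positivity
  rcases hg.eq_or_lt with h0 | h0
  · rw [← h0]; simp
  have hMp : 0 < M := lt_of_lt_of_le h0 hM
  have hn1 := one_le_abs_cast hn
  have hle : gap κ k ^ 2 / (4 * M) ≤ gap κ k / 2 := by
    rw [div_le_div_iff₀ (by positivity) (by norm_num)]
    nlinarith
  by_cases h1 : |n| = 1
  · have : |(n : ℝ)| = 1 := by exact_mod_cast h1
    rw [this, mul_one]
    linarith
  have h2 : 2 ≤ |n| := by
    have := Int.one_le_abs hn
    lia
  have h3 := gap_mul_le_abs_nu0 (k := k) hκ h2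
  by_cases h4 : 2 * M ≤ |nu0 κ k n|
  · have : |nu0 κ k n| - |τ| ≤ |nu0 κ k n - τ| := abs_sub_abs_le_abs_sub _ _
    have h5 := mul_le_mul_of_nonneg_right hle (abs_nonneg (n : ℝ))
    linarith
  · have h5 : gap κ k * |(n : ℝ)| ≤ 2 * M := by linarith
    refine le_trans ?_ h
    rw [div_mul_eq_mul_div, div_le_div_iff₀ (by positivity) (by norm_num)]
    nlinarith

theorem abs_cast_le_of_near {κ k : ℝ} (hκ : 0 < κ) (hk : 0 < k) {M τ : ℝ} (hM : gap κ k ≤ M)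
    (hτ : |τ| ≤ M) {n : ℤ} (hn : n ≠ 0) (h : |nu0 κ k n - τ| < gap κ k / 2) :
    |(n : ℝ)| ≤ 2 * M / gap κ k := by
  have h0 := gap_pos hκ hk
  rw [le_div_iff₀ h0]
  by_cases h1 : |n| = 1
  · have : |(n : ℝ)| = 1 := by exact_mod_cast h1
    rw [this, one_mul]
    linarith
  have h2 : 2 ≤ |n| := by
    have := Int.one_le_abs hn
    lia
  have h3 := gap_mul_le_abs_nu0 (k := k) hκ h2
  have : |nu0 κ k n| - |τ| ≤ |nu0 κ k n - τ| := abs_sub_abs_le_abs_sub _ _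
  linarith

theorem separation_perturbed {κ k : ℝ} {c s g : ℝ} {lam : ℂ}
    (hs : |c - κ / (1 + k ^ 2)| + |s| ≤ g / 2) {n : ℤ} (hn : n ≠ 0)
    (h : g * |(n : ℝ)| ≤ |nu0 κ k n - lam.im|) :
    g / 2 * |(n : ℝ)| ≤ ‖Complex.I * nu κ k c s n - lam‖ := by
  refine le_trans ?_ (abs_sub_le_norm _ _)
  have h1 := (abs_nu_sub_nu0_le κ k c s hn).trans
    (mul_le_mul_of_nonneg_right hs (abs_nonneg (n : ℝ)))
  have h2 := abs_sub_abs_le_abs_sub (nu0 κ k n - lam.im) (nu0 κ k n - nu κ k c s n)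
  rw [abs_sub_comm (nu0 κ k n) (nu κ k c s n)] at h2
  have e : nu0 κ k n - lam.im - (nu0 κ k n - nu κ k c s n) = nu κ k c s n - lam.im := by ring
  rw [e] at h2
  linarith

/-- The eigenvalue λ and its mirror image -conj λ share their imaginary part, hence the same single
resonant mode n₀. With eigenfunctions normalized at n₀, their difference is a small multiple of λ +
conj λ. The row n₀ bounds λ + conj λ by a small multiple of that difference, so it vanishes. -/
theorem re_eq_zero_of_intermediate (b κ k : ℝ) (hκ : 0 < κ) (hk : 0 < k) (M : ℝ)
    (hM : gap κ k ≤ M) :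
    ∃ ε > 0, ∀ (w : Profile) (c s K : ℝ) (lam : ℂ) (V : H1), Function.Even w.fn → C2Bound w K →
      K ≤ ε → |c - κ / (1 + k ^ 2)| + |s| ≤ ε → gap κ k / 2 ≤ |lam.im| → |lam.im| ≤ M → V ≠ 0 →
      IsEigen b κ k hk w c s lam V → lam.re = 0 := by
  have h0 := gap_pos hκ hk
  have hMp : 0 < M := lt_of_lt_of_le h0 hM
  -- Half of the constant in `separation`: the other half pays for replacing the unperturbed
  -- frequencies by those with the actual c and s.
  set g := gap κ k ^ 2 / (4 * M) / 2 with hg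
  have hgp : 0 < g := by positivity
  set N := 2 * M / gap κ k with hN
  have hNp : 0 < N := by positivity
  have hC := nopC_nonneg b k
  -- smallness of the profile
  obtain ⟨K0, hK0, hK1, hK2⟩ : ∃ K0 > 0, nopC b k * K0 ≤ g / 2 ∧
      (nopC b k * K0) * (2 / g * (2 / g * (nopC b k * K0 * N))) < 1 := by
    -- For x = nopC·K0 the two entries of the minimum give 2x/g ≤ 1 and 2xN/g < 1. The product of
    -- these is the contraction factor; the denominator nopC + 1 is positive even if nopC = 0.
    refine ⟨min (g / 2) (g / (2 * (N + 1))) / (nopC b k + 1), by positivity, ?_, ?_⟩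
    · calc nopC b k * (min (g / 2) (g / (2 * (N + 1))) / (nopC b k + 1))
          = min (g / 2) (g / (2 * (N + 1))) * (nopC b k / (nopC b k + 1)) := by ring
        _ ≤ min (g / 2) (g / (2 * (N + 1))) * 1 := by
          gcongr
          rw [div_le_one (by positivity)]; linarith
        _ ≤ g / 2 := by rw [mul_one]; exact min_le_left _ _
    · set x := nopC b k * (min (g / 2) (g / (2 * (N + 1))) / (nopC b k + 1)) with hx
      have hx0 : 0 ≤ x := by positivity
      have hx1 : x ≤ min (g / 2) (g / (2 * (N + 1))) := by
        calc x = min (g / 2) (g / (2 * (N + 1))) * (nopC b k / (nopC b k + 1)) := by rw [hx]; ring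
          _ ≤ min (g / 2) (g / (2 * (N + 1))) * 1 := by
            gcongr
            rw [div_le_one (by positivity)]; linarith
          _ = _ := mul_one _
      have hxa : 2 / g * x ≤ 1 := by
        have := hx1.trans (min_le_left _ _)
        rw [div_mul_eq_mul_div, div_le_one hgp]; linarith
      have hxb : 2 / g * (x * N) < 1 := by
        have := hx1.trans (min_le_right _ _)
        rw [le_div_iff₀ (by positivity)] at this
        rw [div_mul_eq_mul_div, div_lt_one hgp]
        rcases hx0.eq_or_lt with h | h
        · rw [← h]; simpa using hgp
        · nlinarith
      calc x * (2 / g * (2 / g * (x * N))) = (2 / g * x) * (2 / g * (x * N)) := by ring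
        _ ≤ 1 * (2 / g * (x * N)) := by gcongr
        _ < 1 := by rwa [one_mul]
  refine ⟨min K0 g, by positivity, ?_⟩
  intro w c s K lam V hev hw hK hs hl hl2 hV hE
  have hKK : K ≤ K0 := hK.trans (min_le_left _ _)
  have hK' : nopC b k * K ≤ g / 2 := (mul_le_mul_of_nonneg_left hKK hC).trans hK1
  have hs' : |c - κ / (1 + k ^ 2)| + |s| ≤ 2 * g / 2 := by
    have := hs.trans (min_le_right _ _)
    linarith
  -- The resonant modes. There is at most one: two distinct frequencies differ by at least `gap`,
  -- and n = ±1 are excluded since their frequency is 0 while |Im λ| ≥ gap/2.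
  set P : Set ℤ := {n | n ≠ 0 ∧ |nu0 κ k n - lam.im| < gap κ k / 2} with hP
  have hsep : ∀ (lam' : ℂ), lam'.im = lam.im → ∀ n : ℤ, n ≠ 0 → n ∉ P →
      g * |(n : ℝ)| ≤ ‖Complex.I * nu κ k c s n - lam'‖ := by
    intro lam' hlam n hn hnP
    have h1 : gap κ k / 2 ≤ |nu0 κ k n - lam.im| := by
      by_contra h
      exact hnP ⟨hn, not_le.1 h⟩
    have h2 := separation hκ hM hl2 hn h1
    have h3 := separation_perturbed (g := 2 * g) (lam := lam') (c := c) (s := s) hs' hn (by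
      rw [hlam, hg]
      linarith)
    linarith
  have hPs : ∀ n ∈ P, ∀ m ∈ P, m = n := by
    intro n hn m hm
    by_contra hne
    have h1 : ¬(|m| = 1 ∧ |n| = 1) := by
      rintro ⟨-, h⟩
      have hz : nu0 κ k n = 0 := by
        rcases abs_eq (by norm_num : (0 : ℤ) ≤ 1) |>.1 h with h | h
        · rw [h, nu0_one]
        · rw [h, nu0_neg, nu0_one, neg_zero]
      have := hn.2
      rw [hz, zero_sub, abs_neg] at this
      linarith
    have h2 := gap_le_abs_sub (k := k) hκ hm.1 hn.1 hne h1
    have h3 := abs_sub_le (nu0 κ k m) lam.im (nu0 κ k n)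
    rw [abs_sub_comm lam.im] at h3
    have := hn.2
    have := hm.2
    linarith
  have key : (∀ n ∈ P, coeff n (V : L2) = 0) → False := by
    intro hz
    have := norm_dz_le_of_gap (b := b) hk hw hgp hK' P (hsep lam rfl) hE.1 hz (Y := 0)
      (fun n _ _ => by rw [map_zero]; linear_combination hE.2 n)
    rw [norm_zero, mul_zero] at this
    exact hV (coeff_eq_zero_of_dz hE.1 this)
  obtain ⟨n₀, hn₀, hVn⟩ : ∃ n ∈ P, coeff n (V : L2) ≠ 0 := by
    by_contra h
    push Not at h
    exact key h
  obtain ⟨U, hU1, hUE⟩ : ∃ U : H1, coeff n₀ (U : L2) = 1 ∧ IsEigen b κ k hk w c s lam U :=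
    ⟨(coeff n₀ (V : L2))⁻¹ • V, by simp [hVn], hE.smul _⟩
  obtain ⟨U', hU'⟩ := exists_conj U
  have hUE' := hUE.conj hev hU'
  have hU1' : coeff n₀ (U' : L2) = 1 := by rw [hU', hU1, map_one]
  set lam' := -conj lam with hlam'
  have him : lam'.im = lam.im := by simp [hlam']
  have hn0 : n₀ ≠ 0 := hn₀.1
  have hN0 : |(n₀ : ℝ)| ≤ N := abs_cast_le_of_near hκ hk hM hl2 hn0 hn₀.2
  -- the remainder of the second eigenfunction is small
  have hR : ‖dz (U' - expoH n₀)‖ ≤ 2 / g * (nopC b k * K0 * N) := by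
    have h1 := norm_dz_le_of_gap (b := b) hk hw hgp hK' P (hsep lam' him) (D := U' - expoH n₀)
      (Y := -nop b k hk w (expoH n₀)) (by
        simp [hUE'.1, coeff_expoH hn0, hn0.symm]) (fun n hn => by
        rw [hPs n₀ hn₀ n hn]
        simp [hU1', coeff_expoH hn0]) (fun n hn hnP => by
        have hne : n ≠ n₀ := fun h => hnP (h ▸ hn₀)
        have := hUE'.2 n
        simp only [map_sub, map_neg, AddSubgroupClass.coe_sub, coeff_expoH hn0, if_neg hne]
        linear_combination this)
    refine h1.trans ?_
    rw [norm_neg]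
    gcongr
    refine (norm_nop_le b k hk hw _ (by simp [coeff_expoH hn0, hn0.symm])).trans ?_
    gcongr
    exact (norm_dz_expoH_le n₀).trans hN0
  have hR' : ‖((U' - expoH n₀ : H1) : L2)‖ ≤ 2 / g * (nopC b k * K0 * N) :=
    (norm_le_norm_dz _ (by simp [hUE'.1, coeff_expoH hn0, hn0.symm])).trans hR
  have hD0 : coeff 0 ((U - U' : H1) : L2) = 0 := by simp [hUE.1, hUE'.1]
  -- Outside P the difference solves the equation at λ with right side (λ - λ')U'. On these modes U'
  -- equals its small remainder, since the exponential at n₀ lives on P only.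
  have hD : ‖dz (U - U')‖ ≤ 2 / g * (‖lam - lam'‖ * (2 / g * (nopC b k * K0 * N))) := by
    have h1 := norm_dz_le_of_gap (b := b) hk hw hgp hK' P (hsep lam rfl) (D := U - U')
      (Y := (lam - lam') • ((U' - expoH n₀ : H1) : L2)) hD0 (fun n hn => by
        rw [hPs n₀ hn₀ n hn]
        simp [hU1', hU1]) (fun n hn hnP => by
        have hne : n ≠ n₀ := fun h => hnP (h ▸ hn₀)
        have h1 := hUE'.2 n
        have h2 := hUE.2 n
        simp only [map_sub, map_smul, AddSubgroupClass.coe_sub, coeff_expoH hn0, if_neg hne,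
          smul_eq_mul]
        linear_combination h2 - h1)
    refine h1.trans ?_
    rw [norm_smul]
    gcongr
  have hfin : ‖lam - lam'‖ ≤ (nopC b k * K0) *
      (2 / g * (‖lam - lam'‖ * (2 / g * (nopC b k * K0 * N)))) := by
    -- The rows n₀ of both equations are subtracted: the normalization to 1 cancels the diagonal
    -- term.
    have e : lam - lam' = coeff n₀ (nop b k hk w (U - U')) := by
      have h1 := hUE'.2 n₀
      have h2 := hUE.2 n₀
      rw [hU1'] at h1
      rw [hU1] at h2
      rw [map_sub, map_sub]
      linear_combination h1 - h2
    calc ‖lam - lam'‖ = ‖coeff n₀ (nop b k hk w (U - U'))‖ := by rw [← e]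
      _ ≤ nopC b k * K * ‖dz (U - U')‖ := (norm_coeff_le _ _).trans (norm_nop_le b k hk hw _ hD0)
      _ ≤ _ := by gcongr
  have hz : ‖lam - lam'‖ = 0 := by
    by_contra hne
    have hpos : 0 < ‖lam - lam'‖ := lt_of_le_of_ne (norm_nonneg _) (Ne.symm hne)
    have : (nopC b k * K0) * (2 / g * (‖lam - lam'‖ * (2 / g * (nopC b k * K0 * N))))
        = ((nopC b k * K0) * (2 / g * (2 / g * (nopC b k * K0 * N)))) * ‖lam - lam'‖ := by ring
    rw [this] at hfin
    nlinarith
  have hre := congrArg Complex.re (norm_eq_zero.1 hz)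
  simp only [hlam', Complex.sub_re, Complex.neg_re, Complex.conj_re, Complex.zero_re] at hre
  linarith

end BKP

end

open MeasureTheory AddCircle
open scoped Real ENNReal ContDiff

noncomputable section

namespace BKP

/-! ### The spectrum consists of eigenvalues -/

/-- The Fourier multiplier with a bounded symbol, as a continuous operator. -/
def bmultL (m : ℤ → ℂ) (h : ∃ C : ℝ, ∀ n, ‖m n‖ ≤ C) : L2 →L[ℂ] L2 :=
  (bmult m h).mkContinuous h.choose (norm_bmult_le h h.choose_spec)

theorem coeff_bmultL (m : ℤ → ℂ) (h : ∃ C : ℝ, ∀ n, ‖m n‖ ≤ C) (V : L2) (n : ℤ) :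
    coeff n (bmultL m h V) = m n * coeff n V := coeff_bmult m h V n

theorem isCompactOperator_finset_sum {ι : Type*} (F : ι → L2 →L[ℂ] L2) (t : Finset ι)
    (h : ∀ i, IsCompactOperator (F i)) : IsCompactOperator (∑ i ∈ t, F i : L2 →L[ℂ] L2) := by
  classical
  induction t using Finset.induction_on with
  | empty => simpa using isCompactOperator_zero
  | insert i t hi ih =>
    rw [Finset.sum_insert hi]
    exact (h i).add ih

/-- The truncations to |n| ≤ N have finite rank, and the decay of the symbol bounds the error by
C/(N+1). -/
theorem isCompactOperator_bmultL {m : ℤ → ℂ} (h : ∃ C : ℝ, ∀ n, ‖m n‖ ≤ C) {C : ℝ}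
    (hC : 0 ≤ C) (hm : ∀ n : ℤ, n ≠ 0 → ‖m n‖ ≤ C / |(n : ℝ)|) :
    IsCompactOperator (bmultL m h) := by
  set F : ℕ → L2 →L[ℂ] L2 := fun N => ∑ n ∈ Finset.Icc (-(N : ℤ)) N,
    (m n) • (coeffL n).smulRight (expo n) with hF
  have hFc : ∀ N V n, coeff n (F N V) = if n ∈ Finset.Icc (-(N : ℤ)) N then m n * coeff n V else 0
      := by
    intro N V n
    simp only [hF, sum_apply, smul_apply, map_sum, map_smul,
      ContinuousLinearMap.smulRight_apply, coeffL_apply, coeff_expo, smul_eq_mul, mul_ite, mul_one,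
      mul_zero]
    rw [Finset.sum_ite_eq]
  refine isCompactOperator_of_tendsto (l := Filter.atTop) (F := F) ?_ (Filter.Eventually.of_forall
    fun N => ?_)
  · have hb : ∀ N : ℕ, ‖F N - bmultL m h‖ ≤ C / ((N : ℝ) + 1) := by
      intro N
      refine ContinuousLinearMap.opNorm_le_bound _ (by positivity) fun V => ?_
      refine norm_le_of_coeff_le (by positivity) fun n => ?_
      rw [sub_apply, map_sub, hFc, coeff_bmultL]
      split_ifs with hn
      · simp; positivity
      · rw [zero_sub, norm_neg, norm_mul]
        have hN : (N : ℤ) + 1 ≤ |n| := by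
          by_contra hlt
          have hle : |n| ≤ (N : ℤ) := by lia
          exact hn (Finset.mem_Icc.2 (abs_le.1 hle))
        have hN' : (N : ℝ) + 1 ≤ |(n : ℝ)| := by exact_mod_cast hN
        have hn0 : n ≠ 0 := by
          rintro rfl
          simp at hN
          lia
        gcongr
        exact (hm n hn0).trans (by gcongr)
    rw [tendsto_iff_norm_sub_tendsto_zero]
    refine squeeze_zero (fun _ => norm_nonneg _) hb ?_
    exact tendsto_const_nhds.div_atTop
      (Filter.tendsto_atTop_add_const_right _ _ tendsto_natCast_atTop_atTop)
  · refine isCompactOperator_finset_sum _ _ fun n => ?_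
    refine IsCompactOperator.smul (f := (coeffL n).smulRight (expo n)) ?_ (m n)
    have : IsCompactOperator (ContinuousLinearMap.toSpanSingleton ℂ (expo n)) :=
      isCompactOperator_of_locallyCompactSpace_rng (ContinuousLinearMap.toSpanSingleton ℂ (expo n))
    exact this.comp_clm (coeffL n)

/-- `nop` as a bounded operator acting on the derivative. -/
def nopL (b k : ℝ) (hk : 0 < k) (w : Profile) {K : ℝ} (hw : C2Bound w K) : L2 →L[ℂ] L2 :=
  ((nop b k hk w).comp anti).mkContinuous (nopC b k * K) fun f =>
    (norm_nop_le b k hk hw _ (by simp [coeff_anti, symD])).trans (by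
      gcongr
      · exact mul_nonneg (nopC_nonneg b k) hw.nonneg
      · exact norm_dz_anti_le f)

theorem norm_nopL_le (b k : ℝ) (hk : 0 < k) (w : Profile) {K : ℝ} (hw : C2Bound w K) :
    ‖nopL b k hk w hw‖ ≤ nopC b k * K :=
  LinearMap.mkContinuous_norm_le _ (mul_nonneg (nopC_nonneg b k) hw.nonneg) _

theorem coeff_zero_nop (b k : ℝ) (hk : 0 < k) (w : Profile) (V : H1) :
    coeff 0 (nop b k hk w V) = 0 := by
  rw [coeff_nop]; simp [symD]

/-- The symbol of the compact part of `𝒜 - z` acting on the derivative. -/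
def compactSymbol (κ k c s : ℝ) (z : ℂ) (n : ℤ) : ℂ :=
  if n = 0 then 0 else (Complex.I * nu κ k c s n - z) * (symD n)⁻¹ - c

theorem norm_compactSymbol_le {κ k c s : ℝ} (hκ : 0 < κ) (hk : 0 < k) (z : ℂ) {n : ℤ}
    (hn : n ≠ 0) :
    ‖compactSymbol κ k c s z n‖ ≤ (κ / k ^ 2 + |s| + ‖z‖) / |(n : ℝ)| := by
  have hn' : (n : ℝ) ≠ 0 := by exact_mod_cast hn
  have h1 := one_le_abs_cast hn
  have hp := one_add_pos k n
  have e : compactSymbol κ k c s z n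
      = ((-(κ / (1 + k ^ 2 * (n : ℝ) ^ 2)) - s / ((n : ℝ) ^ 2 * (1 + k ^ 2 * (n : ℝ) ^ 2)) : ℝ) : ℂ)
        - z * (symD n)⁻¹ := by
    rw [compactSymbol, if_neg hn, sub_mul, symD, mul_inv, nu]
    have hnc : (n : ℂ) ≠ 0 := by exact_mod_cast hn
    have hpc : (1 + (k : ℂ) ^ 2 * (n : ℂ) ^ 2) ≠ 0 := by exact_mod_cast hp.ne'
    have : Complex.I * Complex.I⁻¹ = 1 := mul_inv_cancel₀ Complex.I_ne_zero
    push_cast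
    field_simp
    ring
  have hk2 : k ^ 2 * |(n : ℝ)| ≤ 1 + k ^ 2 * (n : ℝ) ^ 2 := by
    have := mul_le_mul_of_nonneg_left (abs_le_sq n) (sq_nonneg k)
    linarith
  have hq : |(n : ℝ)| ≤ (n : ℝ) ^ 2 * (1 + k ^ 2 * (n : ℝ) ^ 2) := by
    have h2 := abs_le_sq n
    have h3 : 0 ≤ (n : ℝ) ^ 2 * (k ^ 2 * (n : ℝ) ^ 2) := by positivity
    linarith
  rw [e]
  refine (norm_sub_le _ _).trans ?_
  rw [Complex.norm_real, Real.norm_eq_abs, add_div, add_div, norm_mul, norm_inv, norm_symD,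
    ← div_eq_mul_inv]
  gcongr
  refine (abs_sub _ _).trans (add_le_add ?_ ?_)
  · rw [abs_neg, abs_of_pos (by positivity), div_div]
    gcongr
  · rw [abs_div, abs_of_pos (by positivity : 0 < (n : ℝ) ^ 2 * (1 + k ^ 2 * (n : ℝ) ^ 2))]
    gcongr

theorem bdd_compactSymbol {κ k c s : ℝ} (hκ : 0 < κ) (hk : 0 < k) (z : ℂ) :
    ∃ C : ℝ, ∀ n, ‖compactSymbol κ k c s z n‖ ≤ C := by
  refine ⟨κ / k ^ 2 + |s| + ‖z‖, fun n => ?_⟩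
  rcases eq_or_ne n 0 with rfl | hn
  · simp only [compactSymbol, if_true, norm_zero]; positivity
  · exact (norm_compactSymbol_le hκ hk z hn).trans
      (div_le_self (by positivity) (one_le_abs_cast hn))

/-- The unknown is the derivative f = V'. On f the operator minus z becomes c + `nop`∘`anti` + B,
with B a multiplier of symbol O(1/|n|). The first two terms form a unit by a Neumann series, and the
Fredholm alternative for the unit's inverse times the compact B turns injectivity into
invertibility. -/
theorem exists_inverse_of_injective {b κ k c s K : ℝ} (hκ : 0 < κ) (hk : 0 < k) {w : Profile}
    (hw : C2Bound w K) (hK : nopC b k * K < c) {z : ℂ}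
    (hz : ∀ V : H1, IsEigen b κ k hk w c s z V → V = 0) :
    ∃ R : L2 →L[ℂ] L2, ∀ y, (c : ℂ) • R y + nop b k hk w (anti (R y))
      + bmultL _ (bdd_compactSymbol (c := c) (s := s) hκ hk z) (R y) = y := by
  have hc : 0 < c := lt_of_le_of_lt (mul_nonneg (nopC_nonneg b k) hw.nonneg) hK
  have hc' : (c : ℂ) ≠ 0 := by exact_mod_cast hc.ne'
  set T := nopL b k hk w hw
  set B := bmultL _ (bdd_compactSymbol (c := c) (s := s) hκ hk z) with hB
  have hT : ‖-((c : ℂ)⁻¹ • T)‖ < 1 := by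
    rw [norm_neg, norm_smul, norm_inv, Complex.norm_real, Real.norm_eq_abs, abs_of_pos hc,
      inv_mul_lt_iff₀ hc, mul_one]
    exact (norm_nopL_le b k hk w hw).trans_lt hK
  obtain ⟨u, hu⟩ : IsUnit ((c : ℂ) • (1 : L2 →L[ℂ] L2) + T) := by
    have h1 := isUnit_one_sub_of_norm_lt_one hT
    have h2 := h1.smul (Units.mk0 (c : ℂ) hc')
    convert h2 using 1
    rw [sub_neg_eq_add, smul_add]
    congr 1
    change T = (c : ℂ) • ((c : ℂ)⁻¹ • T)
    rw [smul_inv_smul₀ hc']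
  have hBc : IsCompactOperator B := isCompactOperator_bmultL _ (by positivity)
    (fun n hn => norm_compactSymbol_le hκ hk z hn)
  have hcomp : IsCompactOperator ((↑u⁻¹ : L2 →L[ℂ] L2) * B) := hBc.clm_comp (↑u⁻¹ : L2 →L[ℂ] L2)
  have hWinj : ∀ f : L2, (c : ℂ) • f + T f + B f = 0 → f = 0 := by
    intro f hf
    have hcoef : ∀ n, (c : ℂ) * coeff n f + coeff n (nop b k hk w (anti f))
        + compactSymbol κ k c s z n * coeff n f = 0 := by
      intro n
      have := congrArg (coeff n) hf
      rw [map_add, map_add, map_smul, hB, coeff_bmultL, map_zero] at this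
      exact this
    -- On the mode 0 the whole operator is multiplication by c ≠ 0, because both `nop` and the
    -- compact symbol vanish there. Extending from L²₀ to L² thus creates no kernel.
    have h0 : coeff 0 f = 0 := by
      have := hcoef 0
      rw [coeff_zero_nop, compactSymbol, if_pos rfl, zero_mul, add_zero, add_zero] at this
      exact (mul_eq_zero.1 this).resolve_left hc'
    have hV := hz (anti f) ⟨by simp [coeff_anti, symD], fun n => by
      rcases eq_or_ne n 0 with rfl | hn
      · rw [coeff_zero_nop]; simp [coeff_anti, symD]
      · have := hcoef n
        rw [compactSymbol, if_neg hn] at this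
        rw [coeff_anti]
        linear_combination this⟩
    refine ext_coeff fun n => ?_
    rcases eq_or_ne n 0 with rfl | hn
    · rw [h0, map_zero]
    · rw [← coeff_dz_anti f hn, hV, map_zero]
  -- The value -1 is an eigenvalue of u⁻¹B exactly if u + B has a kernel.
  rcases hcomp.hasEigenvalue_or_mem_resolventSet (μ := -1) (by norm_num) with h | h
  · exfalso
    obtain ⟨f, hf⟩ := h.exists_hasEigenvector
    refine hf.2 (hWinj f ?_)
    have h1 : (↑u⁻¹ : L2 →L[ℂ] L2) (B f) = -f := by simpa using hf.apply_eq_smul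
    have h2 : (u : L2 →L[ℂ] L2) ((↑u⁻¹ : L2 →L[ℂ] L2) (B f)) = B f := by
      rw [← mul_apply_eq_comp, Units.mul_inv, one_apply_eq_self]
    rw [h1, map_neg, hu] at h2
    have h3 : ((c : ℂ) • (1 : L2 →L[ℂ] L2) + T) f = (c : ℂ) • f + T f := rfl
    rw [h3] at h2
    rw [← h2]
    abel
  · rw [spectrum.mem_resolventSet_iff] at h
    obtain ⟨v, hv⟩ := h
    refine ⟨-((↑v⁻¹ : L2 →L[ℂ] L2) * (↑u⁻¹ : L2 →L[ℂ] L2)), fun y => ?_⟩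
    set f := (-((↑v⁻¹ : L2 →L[ℂ] L2) * (↑u⁻¹ : L2 →L[ℂ] L2))) y with hf
    have h1 : (v : L2 →L[ℂ] L2) f = -(↑u⁻¹ : L2 →L[ℂ] L2) y := by
      rw [hf, neg_apply, map_neg, mul_apply_eq_comp,
        ← mul_apply_eq_comp, Units.mul_inv, one_apply_eq_self]
    have h2 : (v : L2 →L[ℂ] L2) f = -f - (↑u⁻¹ : L2 →L[ℂ] L2) (B f) := by
      rw [hv]; simp
    have h3 : f + (↑u⁻¹ : L2 →L[ℂ] L2) (B f) = (↑u⁻¹ : L2 →L[ℂ] L2) y := by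
      have := h1.symm.trans h2
      rw [← neg_inj, this]; abel
    have h4 := congrArg (u : L2 →L[ℂ] L2) h3
    have huu : ∀ x, (u : L2 →L[ℂ] L2) ((↑u⁻¹ : L2 →L[ℂ] L2) x) = x := fun x => by
      rw [← mul_apply_eq_comp, Units.mul_inv, one_apply_eq_self]
    rw [map_add, huu, huu, hu] at h4
    exact h4

theorem coe_A_apply (b κ k : ℝ) (hk : 0 < k) (w : Profile) (c ℓ : ℝ)
    (x : (A 1 b κ k hk w c ℓ).domain) :
    ((A 1 b κ k hk w c ℓ x : L20) : L2) = linOp 1 b κ k hk w c ℓ ⟨((x : L20) : L2), x.2⟩ := rfl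

theorem coeff_zero_L20 (y : L20) : coeff 0 (y : L2) = 0 := y.2

theorem A_eq_smul_iff {b κ k : ℝ} {hk : 0 < k} {w : Profile} {c ℓ : ℝ} {z : ℂ}
    (x : (A 1 b κ k hk w c ℓ).domain) : A 1 b κ k hk w c ℓ x = z • (x : L20) ↔
      IsEigen b κ k hk w c (ℓ ^ 2) z ⟨((x : L20) : L2), x.2⟩ := by
  constructor
  · intro h
    refine ⟨coeff_zero_L20 _, fun n => ?_⟩
    have := congrArg (fun y : L20 => coeff n (y : L2)) h
    simp only [coe_A_apply, coeff_linOp, Submodule.coe_smul, map_smul, smul_eq_mul] at this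
    exact this
  · intro h
    refine Subtype.ext (ext_coeff fun n => ?_)
    rw [coe_A_apply, coeff_linOp, Submodule.coe_smul, map_smul, smul_eq_mul]
    exact h.2 n

/-- If z is not an eigenvalue, the resolvent is the antiderivative of the inverse just built. It is
a right inverse by construction, and injectivity makes it a left inverse. -/
theorem exists_eigen_of_mem_spec {b κ k c ℓ K : ℝ} (hκ : 0 < κ) (hk : 0 < k) {w : Profile}
    (hw : C2Bound w K) (hK : nopC b k * K < c) {z : ℂ} (hz : z ∈ spec (A 1 b κ k hk w c ℓ)) :
    ∃ V : H1, V ≠ 0 ∧ IsEigen b κ k hk w c (ℓ ^ 2) z V := by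
  by_contra hne
  push Not at hne
  have hinj : ∀ V : H1, IsEigen b κ k hk w c (ℓ ^ 2) z V → V = 0 := fun V hV => by
    by_contra h
    exact hne V h hV
  have hc : 0 < c := lt_of_le_of_lt (mul_nonneg (nopC_nonneg b k) hw.nonneg) hK
  have hc' : (c : ℂ) ≠ 0 := by exact_mod_cast hc.ne'
  obtain ⟨R, hR⟩ := exists_inverse_of_injective hκ hk hw hK hinj
  refine hz ?_
  set aL := bmultL (fun n => (symD n)⁻¹) ⟨1, norm_inv_symD_le⟩ with haL
  have haLe : ∀ f, aL f = (anti f : L2) := fun f => ext_coeff fun n => by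
    rw [coeff_bmultL, coeff_anti]
  set R' : L20 →L[ℂ] L20 := ((aL.comp R).comp L20.subtypeL).codRestrict L20 (fun y => by
    change coeff 0 (aL (R y)) = 0
    rw [coeff_bmultL]; simp [symD]) with hR'
  have hR'e : ∀ y : L20, ((R' y : L20) : L2) = (anti (R y) : L2) := fun y => haLe _
  have hsolve : ∀ y : L20, ∃ x : (A 1 b κ k hk w c ℓ).domain, (x : L20) = R' y ∧
      A 1 b κ k hk w c ℓ x - z • (x : L20) = y := by
    intro y
    have hmem : R' y ∈ (A 1 b κ k hk w c ℓ).domain := by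
      change ((R' y : L20) : L2) ∈ H1
      rw [hR'e]
      exact (anti (R y)).2
    refine ⟨⟨R' y, hmem⟩, rfl, Subtype.ext (ext_coeff fun n => ?_)⟩
    have e : (⟨((R' y : L20) : L2), hmem⟩ : H1) = anti (R y) := Subtype.ext (hR'e y)
    rw [AddSubgroupClass.coe_sub, map_sub, coe_A_apply, Submodule.coe_smul, map_smul, smul_eq_mul]
    change coeff n (linOp 1 b κ k hk w c ℓ ⟨((R' y : L20) : L2), hmem⟩)
      - z * coeff n ((R' y : L20) : L2) = _
    rw [e, hR'e, coeff_linOp, coeff_anti]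
    have h := congrArg (coeff n) (hR (y : L2))
    rw [map_add, map_add, map_smul, coeff_bmultL, smul_eq_mul] at h
    rcases eq_or_ne n 0 with rfl | hn
    · rw [coeff_zero_nop, coeff_zero_L20]; simp [symD]
    · rw [compactSymbol, if_neg hn] at h
      linear_combination h
  refine ⟨R', hsolve, fun x => ?_⟩
  obtain ⟨x', hx', he⟩ := hsolve (A 1 b κ k hk w c ℓ x - z • (x : L20))
  have hd : A 1 b κ k hk w c ℓ (x' - x) = z • ((x' - x : (A 1 b κ k hk w c ℓ).domain) : L20) := by
    rw [LinearPMap.map_sub, AddSubgroupClass.coe_sub, smul_sub]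
    have := he
    rw [sub_eq_iff_eq_add] at this
    rw [this]
    abel
  have h0 := hinj _ ((A_eq_smul_iff _).1 hd)
  have h1 : (((x' - x : (A 1 b κ k hk w c ℓ).domain) : L20) : L2) = 0 := congrArg Subtype.val h0
  have h2 : (x' : L20) = x := by
    have : ((x' - x : (A 1 b κ k hk w c ℓ).domain) : L20) = 0 := Subtype.ext h1
    rw [AddSubgroupClass.coe_sub] at this
    exact sub_eq_zero.1 this
  rw [← hx', h2]

end BKP

end

open MeasureTheory AddCircle
open scoped Real ENNReal ContDiff

noncomputable section

namespace BKP

/-! ### Continuous representatives -/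

/-- Cauchy-Schwarz for the Fourier coefficients, with a permutation of the modes. -/
theorem exists_hasSum_mul_norm_coeff (X Y : L2) (σ : ℤ ≃ ℤ) :
    ∃ t, HasSum (fun m => ‖coeff (σ m) X‖ * ‖coeff m Y‖) t ∧ t ≤ ‖X‖ * ‖Y‖ := by
  have hX := (hasSum_sq_coeff X)
  have hY := (hasSum_sq_coeff Y)
  have hX' : HasSum (fun m => ‖coeff (σ m) X‖ ^ 2) (‖X‖ ^ 2) := (Equiv.hasSum_iff σ).2 hX
  have hs : Summable (fun m => ‖coeff (σ m) X‖ * ‖coeff m Y‖) := by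
    refine Summable.of_nonneg_of_le (fun m => by positivity) (fun m => ?_)
      (hX'.summable.add hY.summable)
    nlinarith [sq_nonneg (‖coeff (σ m) X‖ - ‖coeff m Y‖), sq_nonneg (‖coeff (σ m) X‖),
      sq_nonneg ‖coeff m Y‖]
  refine ⟨_, hs.hasSum, ?_⟩
  refine hs.tsum_le_of_sum_le fun t => ?_
  refine (Real.sum_mul_le_sqrt_mul_sqrt _ _ _).trans ?_
  refine mul_le_mul ?_ ?_ (by positivity) (norm_nonneg _)
  · rw [← Real.sqrt_sq (norm_nonneg X)]
    exact Real.sqrt_le_sqrt (sum_le_hasSum _ (fun _ _ => by positivity) hX')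
  · rw [← Real.sqrt_sq (norm_nonneg Y)]
    exact Real.sqrt_le_sqrt (sum_le_hasSum _ (fun _ _ => by positivity) hY)

/-- `v` is a continuous representative of `V`. -/
def Rep (V : L2) (v : C(Circ, ℂ)) : Prop := ContinuousMap.toLp 2 haarAddCircle ℂ v = V

theorem Rep.coeFn {V : L2} {v : C(Circ, ℂ)} (h : Rep V v) : (V : Circ → ℂ) =ᵐ[haarAddCircle] v := by
  rw [← h]
  exact ContinuousMap.coeFn_toLp haarAddCircle v

theorem rep_of_coeFn {V : L2} {v : C(Circ, ℂ)} (h : (V : Circ → ℂ) =ᵐ[haarAddCircle] v) : Rep V v :=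
  Lp.ext ((ContinuousMap.coeFn_toLp haarAddCircle v).trans h.symm)

theorem Rep.coeff {V : L2} {v : C(Circ, ℂ)} (h : Rep V v) (n : ℤ) :
    coeff n V = fourierCoeff v n := by
  rw [← h]
  exact fourierCoeff_toLp v n

theorem Rep.unique {V : L2} {v u : C(Circ, ℂ)} (h : Rep V v) (h' : Rep V u) : v = u :=
  ContinuousMap.toLp_injective haarAddCircle (h.trans h'.symm)

theorem Rep.norm_le {V : L2} {v : C(Circ, ℂ)} (h : Rep V v) : ‖V‖ ≤ ‖v‖ := by
  have := Lp.norm_le_mul_norm_of_ae_le_mul (f := V) (g := expo 0) (c := ‖v‖) (by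
    filter_upwards [h.coeFn, coeFn_fourierLp (T := 2 * π) 2 0] with x hx hy
    have e : (expo 0 : Circ → ℂ) x = fourier 0 x := hy
    rw [hx, e, fourier_zero, norm_one, mul_one]
    exact v.norm_coe_le_norm x)
  rwa [norm_expo, mul_one] at this

theorem Rep.add {V U : L2} {v u : C(Circ, ℂ)} (h : Rep V v) (h' : Rep U u) : Rep (V + U) (v + u) :=
    by
  rw [Rep, map_add, h, h']

theorem Rep.sub {V U : L2} {v u : C(Circ, ℂ)} (h : Rep V v) (h' : Rep U u) : Rep (V - U) (v - u) :=
    by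
  rw [Rep, map_sub, h, h']

theorem Rep.smul {V : L2} {v : C(Circ, ℂ)} (h : Rep V v) (t : ℂ) : Rep (t • V) (t • v) := by
  rw [Rep, map_smul, h]

theorem Rep.mulOp {V : L2} {v : C(Circ, ℂ)} (h : Rep V v) (w : Profile) :
    Rep (mulOp w V) (w.onCirc * v) := by
  refine rep_of_coeFn ?_
  filter_upwards [coeFn_mulOp w V, h.coeFn] with x hx hy
  rw [hx, hy]
  rfl

theorem exists_reciprocal : ∃ G : L2, ∀ n : ℤ, coeff n G = ((n : ℝ)⁻¹ : ℝ) := by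
  refine exists_coeff_eq ?_
  refine memℓp_gen ?_
  have e : (2 : ℝ≥0∞).toReal = ((2 : ℕ) : ℝ) := by norm_num
  simp only [e, Real.rpow_natCast, Complex.norm_real, Real.norm_eq_abs, sq_abs, inv_pow]
  exact Real.summable_one_div_int_pow.2 (by norm_num : 1 < 2) |>.congr fun n => by simp

/-- The constant of the Sobolev embedding. -/
def sobC : ℝ := ‖exists_reciprocal.choose‖

theorem sobC_nonneg : 0 ≤ sobC := norm_nonneg _

/-- The Sobolev embedding `H¹ ⊆ C⁰`. -/
theorem exists_rep {V Y : L2} (h : ∀ n, coeff n Y = symD n * coeff n V) :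
    ∃ v, Rep V v ∧ ‖v‖ ≤ ‖V‖ + sobC * ‖Y‖ := by
  have hG := exists_reciprocal.choose_spec
  -- Cauchy–Schwarz for the sequences 1/n and n·V̂(n) makes the Fourier series absolutely
  -- convergent. The mode 0 is added separately, as 1/n stands for 0 there.
  obtain ⟨t, ht, htle⟩ := exists_hasSum_mul_norm_coeff exists_reciprocal.choose Y (Equiv.refl ℤ)
  have ht' := ht.add (hasSum_ite_eq (0 : ℤ) ‖coeff 0 V‖)
  have hle : ∀ n, ‖coeff n V‖ ≤ ‖coeff n exists_reciprocal.choose‖ * ‖coeff n Y‖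
      + if n = 0 then ‖coeff 0 V‖ else 0 := by
    intro n
    rw [hG]
    rcases eq_or_ne n 0 with rfl | hn
    · simp
    · rw [if_neg hn, add_zero, h, norm_mul, norm_symD, Complex.norm_real, Real.norm_eq_abs, abs_inv,
        inv_mul_cancel_left₀ (by have := one_le_abs_cast hn; positivity)]
  have hle' : ∀ n, ‖coeff n V • fourier (T := 2 * π) n‖
      ≤ ‖coeff n exists_reciprocal.choose‖ * ‖coeff n Y‖ + if n = 0 then ‖coeff 0 V‖ else 0 := by
    intro n
    rw [norm_smul, fourier_norm, mul_one]
    exact hle n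
  have hs : Summable fun n => coeff n V • fourier (T := 2 * π) n :=
    Summable.of_norm_bounded ht'.summable hle'
  refine ⟨∑' n, coeff n V • fourier n, ?_, ?_⟩
  · have h1 := ((ContinuousMap.toLp (E := ℂ) 2 (haarAddCircle (T := 2 * π)) ℂ).hasSum hs.hasSum)
    have h2 := hasSum_fourier_series_L2 V
    refine h1.unique ?_
    convert h2 using 1
    ext n : 1
    rw [map_smul]
    rfl
  · refine (tsum_of_norm_bounded ht' hle').trans ?_
    have := norm_coeff_le 0 V
    rw [sobC]
    linarith

/-- The primitive of y is periodic, as y has zero mean, and has the Fourier coefficients of v for n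
≠ 0. So v is this primitive plus a constant, and the weak derivative is a classical one. -/
theorem hasDerivAt_of_rep {V Y : L2} (h : ∀ n, coeff n Y = symD n * coeff n V) {v y : C(Circ, ℂ)}
    (hv : Rep V v) (hy : Rep Y y) (z : ℝ) : HasDerivAt (fun z : ℝ =>
        v (z : Circ)) (y (z : Circ)) z := by
  have hyc : Continuous fun z : ℝ => y (z : Circ) := y.continuous.comp (AddCircle.continuous_mk' _)
  set P : ℝ → ℂ := fun z => ∫ t in (0 : ℝ)..z, y (t : Circ) with hP
  have hPd : ∀ z : ℝ, HasDerivAt P (y (z : Circ)) z := fun z =>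
    intervalIntegral.integral_hasDerivAt_right (hyc.intervalIntegrable _ _)
      (hyc.stronglyMeasurableAtFilter _ _) hyc.continuousAt
  have hPc : Continuous P := continuous_iff_continuousAt.2 fun z => (hPd z).continuousAt
  have hyper : Function.Periodic (fun z : ℝ => y (z : Circ)) (2 * π) := fun z => by
    change y ((z + 2 * π : ℝ) : Circ) = y (z : Circ)
    rw [AddCircle.coe_add_period]
  have hint : ∀ u : C(Circ, ℂ), fourierCoeff u 0 = (1 / (2 * π) : ℝ) • ∫ t in (0 : ℝ)..2 * π,
      u (t : Circ) := by
    intro u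
    rw [fourierCoeff_eq_intervalIntegral _ _ 0, zero_add]
    simp
  have hzero : ∫ t in (0 : ℝ)..2 * π, y (t : Circ) = 0 := by
    have h0 := hy.coeff 0
    rw [h 0, hint y] at h0
    have hpi := Real.pi_ne_zero
    simpa [symD, hpi] using h0.symm
  have hPper : Function.Periodic P (2 * π) := by
    intro z
    have h1 := hyper.intervalIntegral_add_eq z 0
    rw [zero_add, hzero] at h1
    have h2 := intervalIntegral.integral_add_adjacent_intervals (μ := volume)
      (hyc.intervalIntegrable 0 z) (hyc.intervalIntegrable z (z + 2 * π))
    change (∫ t in (0 : ℝ)..(z + 2 * π), y (t : Circ)) = ∫ t in (0 : ℝ)..z, y (t : Circ)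
    rw [← h2, h1, add_zero]
  set p : C(Circ, ℂ) := ⟨hPper.lift, continuous_coinduced_dom.mpr hPc⟩ with hp
  have hpz : ∀ z : ℝ, p (z : Circ) = P z := fun _ => rfl
  set C : ℂ := fourierCoeff v 0 - fourierCoeff p 0 with hC
  have hcoef : ∀ n : ℤ, fourierCoeff v n = fourierCoeff (p + C • fourier 0 : C(Circ, ℂ)) n := by
    intro n
    have e : fourierCoeff (p + C • fourier 0 : C(Circ, ℂ)) n
        = fourierCoeff p n + C * if n = 0 then 1 else 0 := by
      have h1 := (show Rep _ (p + C • fourier (T := 2 * π) 0) from rfl).coeff n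
      rw [← h1, map_add, map_add, map_smul, map_smul]
      have h2 := (show Rep _ p from rfl).coeff n
      rw [h2]
      congr 1
      rw [smul_eq_mul]
      congr 1
      exact coeff_expo n 0
    rw [e]
    rcases eq_or_ne n 0 with rfl | hn
    · rw [if_pos rfl, hC]; ring
    · rw [if_neg hn, mul_zero, add_zero]
      have h1 := integral_fourier_mul_deriv hPd hyc (by
        have := hPper 0
        rwa [zero_add] at this) n
      have h2 : fourierCoeff y n = symD n * fourierCoeff p n := by
        rw [fourierCoeff_eq_intervalIntegral _ _ 0, fourierCoeff_eq_intervalIntegral _ _ 0,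
            zero_add]
        simp only [smul_eq_mul]
        rw [h1, symD, Complex.real_smul, Complex.real_smul]
        simp only [hpz]
        ring
      have h3 := h n
      rw [hy.coeff, hv.coeff, h2] at h3
      exact (mul_left_cancel₀ (symD_ne_zero hn) h3).symm
  have hvp : v = p + C • fourier 0 := by
    have h1 : Rep V (p + C • fourier 0) := ext_coeff fun n => by
      rw [hv.coeff, hcoef]
      exact (show Rep _ (p + C • fourier (T := 2 * π) 0) from rfl).coeff n
    exact hv.unique h1
  rw [hvp]
  have : (fun z : ℝ => (p + C • fourier 0 : C(Circ, ℂ)) (z : Circ)) = fun z => P z + C := by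
    ext z
    rw [ContinuousMap.add_apply, ContinuousMap.smul_apply, hpz, fourier_zero]
    simp
  rw [this]
  exact (hPd z).add_const C

/-! ### The linearized operator as a transport operator with a smoothing perturbation -/

theorem symD_mul_coeff_mulOp (w : Profile) (V : H1) (n : ℤ) :
    symD n * coeff n (mulOp w V) = coeff n (mulOp w.deriv V) + coeff n (mulOp w (dz V)) := by
  refine ((hasSum_coeff_mulOp w V n).mul_left (symD n)).unique
    (((hasSum_coeff_mulOp w.deriv V n).add (hasSum_coeff_mulOp w (dz V) n)).congr_fun fun m => ?_)
  rw [hat_deriv, coeff_mult, symD, symD]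
  push_cast
  ring

theorem norm_symS_le {k : ℝ} (hk : 0 < k) (n : ℤ) : ‖symS k n‖ ≤ 1 / k ^ 2 + 1 := by
  have := norm_symS_mul_le hk (r := 1) (x := 1) (by simp) n (by
    have : 0 ≤ 1 / k ^ 2 := by positivity
    have : 0 ≤ k ^ 2 * (n : ℝ) ^ 2 := by positivity
    nlinarith)
  simpa using this

theorem norm_DinvS_le {k : ℝ} (hk : 0 < k) (n : ℤ) :
    ‖(symD n)⁻¹ * symS k n‖ ≤ 1 / k ^ 2 + 1 := by
  rw [norm_mul]
  exact (mul_le_of_le_one_left (norm_nonneg _) (norm_inv_symD_le n)).trans (norm_symS_le hk n)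

/-- `(1 - k² ∂_z²)⁻¹`. -/
def opS (k : ℝ) (hk : 0 < k) : L2 →ₗ[ℂ] L2 := bmult (symS k) ⟨_, norm_symS_le hk⟩

theorem sq_mul_symD_sq_symS (k : ℝ) (n : ℤ) : (k : ℂ) ^ 2 * (symD n ^ 2 * symS k n)
    = symS k n - 1 := by
  have hp : (1 + (k : ℂ) ^ 2 * (n : ℂ) ^ 2) ≠ 0 := by exact_mod_cast (one_add_pos k n).ne'
  rw [symD, symS, mul_pow, Complex.I_sq]
  push_cast
  field_simp
  ring

/-- The coefficient function of the smoothing part. -/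
def smoothCoef (b κ k : ℝ) (w : Profile) (V : L2) : L2 :=
  (-κ : ℂ) • V - (b : ℂ) • mulOp w V - (k ^ 2 * (b - 3) : ℂ) • mulOp w.deriv.deriv V

/-- The smoothing part of the linearized operator. -/
def smoothOp (b κ k : ℝ) (hk : 0 < k) (w : Profile) (s : ℝ) (V : L2) : L2 :=
  opDS k hk (smoothCoef b κ k w V) + (b - 3 : ℂ) • opS k hk (mulOp w.deriv V)
    + (s : ℂ) • opDinvS k hk V

/-- The identity k²∂²(1 - k²∂²)⁻¹ = (1 - k²∂²)⁻¹ - 1 splits the terms of highest order into the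
local operators -w∂_z and -(b-2)w' and a remainder that gains one derivative. -/
theorem transport_form (b κ k : ℝ) (hk : 0 < k) (w : Profile) (c s : ℝ) (V : H1) (n : ℤ) :
    Complex.I * nu κ k c s n * coeff n (V : L2) + coeff n (nop b k hk w V)
      = coeff n ((c : ℂ) • dz V - mulOp w (dz V) - (b - 2 : ℂ) • mulOp w.deriv V
          + smoothOp b κ k hk w s V) := by
  have h : Complex.I * nu κ k c s n
      = c * symD n - κ * (symD n * symS k n) + s * ((symD n)⁻¹ * symS k n) := by
    have hp : (1 + (k : ℂ) ^ 2 * (n : ℂ) ^ 2) ≠ 0 := by exact_mod_cast (one_add_pos k n).ne'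
    rcases eq_or_ne n 0 with rfl | hn
    · simp [nu, symD]
    · have hn' : (n : ℂ) ≠ 0 := by exact_mod_cast hn
      rw [nu, symD, symS, mul_inv, Complex.inv_I]
      push_cast
      field_simp
      ring
  have p0 := symD_mul_coeff_mulOp w V n
  have p1 := symD_mul_coeff_mulOp w.deriv V n
  have q := sq_mul_symD_sq_symS k n
  rw [h, coeff_nop, conv]
  simp only [smoothOp, smoothCoef, map_add, map_sub, map_smul, smul_eq_mul, opDS, opS, opDinvS,
    coeff_bmult, coeff_mult symD V]
  push_cast
  linear_combination (-symS k n) * p0 + (-(b - 2) * (k : ℂ) ^ 2 * symD n * symS k n) * p1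
    + (coeff n (mulOp w (dz V)) + (b - 2) * coeff n (mulOp w.deriv V)) * q

end BKP

end

/-! ### The smoothing part in the sup norm, and the eigenvalue equation as an ordinary differential
equation -/

open MeasureTheory AddCircle
open scoped Real ENNReal ContDiff

noncomputable section

namespace BKP

theorem norm_onCirc_mul_le (w : Profile) (h : ∀ z, |w.fn z| ≤ 1) (v : C(Circ, ℂ)) :
    ‖w.onCirc * v‖ ≤ ‖v‖ := by
  refine (norm_mul_le _ _).trans (mul_le_of_le_one_left (norm_nonneg _) ?_)
  exact (ContinuousMap.norm_le _ zero_le_one).2 (norm_onCirc_le w h)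

/-- The smoothing part maps continuous functions to continuously differentiable functions. -/
theorem exists_rep_smoothOp (b κ k : ℝ) (hk : 0 < k) : ∃ C ≥ 0, ∀ (w : Profile) (s : ℝ) (V : L2)
    (v : C(Circ, ℂ)), C2Bound w 1 → |s| ≤ 1 → coeff 0 V = 0 → Rep V v →
    ∃ k₁ k₂ : C(Circ, ℂ), Rep (smoothOp b κ k hk w s V) k₁ ∧
      (∀ z : ℝ, HasDerivAt (fun z : ℝ => k₁ (z : Circ)) (k₂ (z : Circ)) z) ∧
      ‖k₁‖ ≤ C * ‖v‖ ∧ ‖k₂‖ ≤ C * ‖v‖ := by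
  set q := 1 / k ^ 2 + 1 with hq
  have hq0 : 0 ≤ q := by positivity
  have hsob := sobC_nonneg
  set Cg := |κ| + |b| + |k ^ 2 * (b - 3)| with hCg
  have hCg0 : 0 ≤ Cg := by positivity
  set C₂ := (k ^ 2)⁻¹ * ((q + sobC * q) * Cg + Cg) + |b - 3| * (q + sobC * q) + (q + sobC * q)
    with hC₂
  have hC₂0 : 0 ≤ C₂ := by positivity
  set C₁ := q * Cg + |b - 3| * q + q with hC₁
  have hC₁0 : 0 ≤ C₁ := by positivity
  refine ⟨C₁ + sobC * C₂ + C₂, by positivity, ?_⟩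
  intro w s V v hw hs hV0 hv
  have hv0 := norm_nonneg v
  have hVv := hv.norm_le
  have hreal : ∀ x : ℝ, ‖(x : ℂ)‖ = |x| := fun x => by rw [Complex.norm_real, Real.norm_eq_abs]
  have hb3 : ‖(b - 3 : ℂ)‖ = |b - 3| := by rw [← hreal]; push_cast; rfl
  -- the coefficient function
  obtain ⟨g, hg, hgn⟩ : ∃ g, Rep (smoothCoef b κ k w V) g ∧ ‖g‖ ≤ Cg * ‖v‖ := by
    refine ⟨_, ((hv.smul (-κ : ℂ)).sub ((hv.mulOp w).smul (b : ℂ))).sub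
      ((hv.mulOp w.deriv.deriv).smul (k ^ 2 * (b - 3) : ℂ)), ?_⟩
    rw [hCg, add_mul, add_mul]
    refine (norm_sub_le _ _).trans (add_le_add ((norm_sub_le _ _).trans (add_le_add ?_ ?_)) ?_)
    · rw [norm_smul, norm_neg, hreal]
    · rw [norm_smul, hreal]
      gcongr
      exact norm_onCirc_mul_le w (fun z => (hw z).1) v
    · have e : (k ^ 2 * (b - 3) : ℂ) = ((k ^ 2 * (b - 3) : ℝ) : ℂ) := by push_cast; rfl
      rw [norm_smul, e, hreal]
      gcongr
      exact norm_onCirc_mul_le w.deriv.deriv (fun z => (hw z).2.2) v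
  have hw' := hv.mulOp w.deriv
  have hw'n : ‖w.deriv.onCirc * v‖ ≤ ‖v‖ := norm_onCirc_mul_le w.deriv (fun z => (hw z).2.1) v
  have repS : ∀ (U : L2) (u : C(Circ, ℂ)), Rep U u →
      ∃ f, Rep (opS k hk U) f ∧ ‖f‖ ≤ (q + sobC * q) * ‖u‖ := by
    intro U u hu
    obtain ⟨f, hf, hfn⟩ := exists_rep (V := opS k hk U) (Y := opDS k hk U) (fun n => by
      rw [opDS, opS, coeff_bmult, coeff_bmult]; ring)
    refine ⟨f, hf, hfn.trans ?_⟩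
    have h1 := norm_bmult_le ⟨_, norm_symS_le hk⟩ (norm_symS_le hk) U
    have h2 := norm_bmult_le (bdd_DS hk) (norm_DS_le hk) U
    have h3 := hu.norm_le
    rw [add_mul, mul_assoc]
    gcongr
    · exact h1.trans (by gcongr)
    · exact h2.trans (by gcongr)
  have repDS : ∀ (U : L2) (u : C(Circ, ℂ)), Rep U u →
      ∃ f, Rep (opDS k hk U) f ∧ ‖f‖ ≤ (q + sobC * q) * ‖u‖ := by
    intro U u hu
    obtain ⟨f, hf, hfn⟩ := exists_rep (V := opDS k hk U) (Y := opDDS k hk U) (fun n => by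
      rw [opDS, opDDS, coeff_bmult, coeff_bmult]; ring)
    refine ⟨f, hf, hfn.trans ?_⟩
    have h1 := norm_bmult_le (bdd_DS hk) (norm_DS_le hk) U
    have h2 := norm_bmult_le (bdd_DDS hk) (norm_DDS_le hk) U
    have h3 := hu.norm_le
    rw [add_mul, mul_assoc]
    gcongr
    · exact h1.trans (by gcongr)
    · exact h2.trans (by gcongr)
  obtain ⟨f₁, hf₁, hn₁⟩ := repS _ _ hg
  obtain ⟨f₂, hf₂, hn₂⟩ := repDS _ _ hw'
  obtain ⟨f₃, hf₃, hn₃⟩ := repS _ _ hv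
  have hkc : ((k : ℂ) ^ 2) ≠ 0 := by exact_mod_cast (pow_pos hk 2).ne'
  -- The derivative of the smoothing part, written without differentiating V: ∂²(1 - k²∂²)⁻¹ is
  -- replaced by k⁻²((1 - k²∂²)⁻¹ - 1). For the ∂⁻¹ term the zero mean of V is used.
  set dK : L2 := ((k ^ 2 : ℂ)⁻¹) • (opS k hk (smoothCoef b κ k w V) - smoothCoef b κ k w V)
    + (b - 3 : ℂ) • opDS k hk (mulOp w.deriv V) + (s : ℂ) • opS k hk V with hdK
  have hdrep := (((hf₁.sub hg).smul ((k ^ 2 : ℂ)⁻¹)).add (hf₂.smul (b - 3 : ℂ))).add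
    (hf₃.smul (s : ℂ))
  set k₂ : C(Circ, ℂ) := ((k ^ 2 : ℂ)⁻¹) • (f₁ - g) + (b - 3 : ℂ) • f₂ + (s : ℂ) • f₃ with hk₂
  have hk₂n : ‖k₂‖ ≤ C₂ * ‖v‖ := by
    rw [hC₂, add_mul, add_mul]
    refine (norm_add_le _ _).trans (add_le_add ((norm_add_le _ _).trans (add_le_add ?_ ?_)) ?_)
    · rw [norm_smul, norm_inv, norm_pow, hreal, abs_of_pos hk, mul_assoc, add_mul]
      gcongr
      refine (norm_sub_le _ _).trans (add_le_add (hn₁.trans ?_) hgn)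
      rw [mul_assoc]
      gcongr
    · rw [norm_smul, hb3, mul_assoc]
      gcongr
      exact hn₂.trans (by gcongr)
    · rw [norm_smul, hreal]
      exact (mul_le_of_le_one_left (norm_nonneg _) hs).trans hn₃
  have hcoef : ∀ n, coeff n dK = symD n * coeff n (smoothOp b κ k hk w s V) := by
    intro n
    have h1 := sq_mul_symD_sq_symS k n
    have h2 : symD n * ((symD n)⁻¹ * symS k n) * coeff n V = symS k n * coeff n V := by
      rcases eq_or_ne n 0 with rfl | hn
      · rw [hV0, mul_zero, mul_zero]
      · rw [mul_inv_cancel_left₀ (symD_ne_zero hn)]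
    have h3 : symS k n - 1 = (k : ℂ) ^ 2 * (symD n ^ 2 * symS k n) := h1.symm
    have h4 : ((k : ℂ) ^ 2)⁻¹ * (symS k n * coeff n (smoothCoef b κ k w V)
        - coeff n (smoothCoef b κ k w V))
        = symD n ^ 2 * symS k n * coeff n (smoothCoef b κ k w V) := by
      rw [← sub_one_mul, h3, mul_assoc ((k : ℂ) ^ 2), inv_mul_cancel_left₀ hkc]
    rw [hdK]
    simp only [smoothOp, map_add, map_sub, map_smul, smul_eq_mul, opDS, opS, opDinvS, coeff_bmult]
    rw [h4]
    linear_combination (-(s : ℂ)) * h2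
  obtain ⟨k₁, hk₁, hk₁n⟩ := exists_rep hcoef
  refine ⟨k₁, k₂, hk₁, fun z => hasDerivAt_of_rep hcoef hk₁ hdrep z, ?_, ?_⟩
  · refine hk₁n.trans ?_
    have h1 : ‖smoothOp b κ k hk w s V‖ ≤ C₁ * ‖v‖ := by
      rw [hC₁, add_mul, add_mul]
      refine (norm_add_le _ _).trans (add_le_add ((norm_add_le _ _).trans (add_le_add ?_ ?_)) ?_)
      · refine (norm_bmult_le _ (norm_DS_le hk) _).trans ?_
        rw [mul_assoc]
        gcongr
        exact hg.norm_le.trans hgn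
      · rw [norm_smul, hb3, mul_assoc]
        gcongr
        refine (norm_bmult_le _ (norm_symS_le hk) _).trans ?_
        gcongr
        exact hw'.norm_le.trans hw'n
      · rw [norm_smul, hreal]
        refine (mul_le_of_le_one_left (norm_nonneg _) hs).trans ?_
        exact (norm_bmult_le _ (norm_DinvS_le hk) _).trans (by gcongr)
    have h2 : ‖dK‖ ≤ C₂ * ‖v‖ := hdrep.norm_le.trans hk₂n
    calc ‖smoothOp b κ k hk w s V‖ + sobC * ‖dK‖ ≤ C₁ * ‖v‖ + sobC * (C₂ * ‖v‖) := by gcongr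
      _ ≤ (C₁ + sobC * C₂ + C₂) * ‖v‖ := by nlinarith [mul_nonneg hC₂0 hv0]
  · refine hk₂n.trans ?_
    gcongr
    have : 0 ≤ sobC * C₂ := by positivity
    linarith

/-- Classical form of the (inhomogeneous) eigenvalue equation. -/
theorem classical_equation {b κ k c s : ℝ} {hk : 0 < k} {w : Profile} {lam μ : ℂ} {V : H1} {U : L2}
    {v u k₁ : C(Circ, ℂ)} (hc : ∀ z, w.fn z < c)
    (hE : ∀ n, Complex.I * nu κ k c s n * coeff n (V : L2) + coeff n (nop b k hk w V)
      = lam * coeff n (V : L2) + μ * coeff n U)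
    (hv : Rep V v) (hu : Rep U u) (hk₁ : Rep (smoothOp b κ k hk w s V) k₁) :
    ∀ z : ℝ, HasDerivAt (fun z : ℝ => v (z : Circ)) ((((c - w.fn z)⁻¹ : ℝ) : ℂ) *
      (lam * v (z : Circ) + μ * u (z : Circ) + ((b - 2) * w.deriv.fn z : ℝ) * v (z : Circ)
        - k₁ (z : Circ))) z := by
  set R : L2 := lam • (V : L2) + μ • U + (b - 2 : ℂ) • mulOp w.deriv V - smoothOp b κ k hk w s V
    with hR
  set r : C(Circ, ℂ) := lam • v + μ • u + (b - 2 : ℂ) • (w.deriv.onCirc * v) - k₁ with hr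
  have hRr : Rep R r := (((hv.smul lam).add (hu.smul μ)).add ((hv.mulOp w.deriv).smul _)).sub hk₁
  have hid : (c : ℂ) • dz V - mulOp w (dz V) = R := by
    refine ext_coeff fun n => ?_
    have h1 := hE n
    rw [transport_form] at h1
    simp only [hR, map_add, map_sub, map_smul, smul_eq_mul] at h1 ⊢
    linear_combination h1
  have hcne : ∀ x : Circ, (c : ℂ) - w.onCirc x ≠ 0 := by
    intro x
    induction x using QuotientAddGroup.induction_on with
    | H z =>
      change (c : ℂ) - (w.fn z : ℂ) ≠ 0
      exact_mod_cast (sub_pos.2 (hc z)).ne'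
  -- The transport term is (c - w)V'. As c - w never vanishes, V' has a continuous representative.
  set y : C(Circ, ℂ) := ⟨fun x => ((c : ℂ) - w.onCirc x)⁻¹ * r x, by
    refine Continuous.mul (Continuous.inv₀ (by fun_prop) hcne) r.continuous⟩ with hy
  have hyrep : Rep (dz V) y := by
    refine rep_of_coeFn ?_
    have h1 := hRr.coeFn
    rw [← hid] at h1
    filter_upwards [h1, Lp.coeFn_sub ((c : ℂ) • dz V) (mulOp w (dz V)),
      Lp.coeFn_smul (c : ℂ) (dz V), coeFn_mulOp w (dz V)] with x h1 h2 h3 h4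
    rw [h2, Pi.sub_apply, h3, h4, Pi.smul_apply, smul_eq_mul, ← sub_mul] at h1
    change _ = ((c : ℂ) - w.onCirc x)⁻¹ * r x
    rw [← h1, inv_mul_cancel_left₀ (hcne x)]
  intro z
  have := hasDerivAt_of_rep (fun n => coeff_mult symD V n) hv hyrep z
  convert this using 1
  change _ = ((c : ℂ) - (w.fn z : ℂ))⁻¹ * (lam * v (z : Circ) + μ * u (z : Circ)
    + (b - 2) * ((w.deriv.fn z : ℂ) * v (z : Circ)) - k₁ (z : Circ))
  push_cast
  ring

end BKP

end

open MeasureTheory AddCircle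
open scoped Real ENNReal ContDiff

noncomputable section

namespace BKP

open ComplexConjugate

/-! ### Transport equations with a smoothing perturbation and a large eigenvalue -/

/-- The reciprocal of the transport speed. -/
def slow (w : Profile) (c : ℝ) (z : ℝ) : ℝ := (c - w.fn z)⁻¹

/-- The integrating factor of the transport equation. -/
def integFactor (w : Profile) (c β : ℝ) (lam : ℂ) (z : ℝ) : ℂ :=
  Complex.exp (-∫ t in (0 : ℝ)..z, (slow w c t : ℂ) * (lam + (β * w.deriv.fn t : ℝ)))

/-- Bounds for the coefficients of the transport equation. -/
structure TransportBds (w : Profile) (c R R₀ : ℝ) : Prop where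
  pos : 0 < R₀
  lower : ∀ z, R₀ ≤ slow w c z
  upper : ∀ z, slow w c z ≤ R
  deriv : ∀ z, |w.deriv.fn z| ≤ 1

namespace TransportBds

theorem slow_pos {w : Profile} {c R R₀ : ℝ} (h : TransportBds w c R R₀) (z : ℝ) : 0 < slow w c z :=
    h.pos.trans_le (h.lower z)

theorem R_pos {w : Profile} {c R R₀ : ℝ} (h : TransportBds w c R R₀) : 0 < R :=
    (h.slow_pos 0).trans_le (h.upper 0)

theorem lt {w : Profile} {c R R₀ : ℝ} (h : TransportBds w c R R₀) (z : ℝ) : w.fn z < c := by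
  have := h.slow_pos z
  rw [slow, inv_pos] at this
  linarith

theorem continuous_slow {w : Profile} {c R R₀ : ℝ} (h : TransportBds w c R R₀) :
    Continuous (slow w c) :=
  Continuous.inv₀ (continuous_const.sub w.smooth.continuous) fun z => (sub_pos.2 (h.lt z)).ne'

theorem continuous_rate {w : Profile} {c R R₀ : ℝ} (h : TransportBds w c R R₀) (β : ℝ) (lam : ℂ) :
    Continuous fun t => (slow w c t : ℂ) * (lam + (β * w.deriv.fn t : ℝ)) := by
  have h1 := h.continuous_slow
  have h2 := w.deriv.smooth.continuous
  fun_prop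

theorem hasDerivAt_integFactor {w : Profile} {c R R₀ : ℝ} (h : TransportBds w c R R₀) (β : ℝ) (lam
    : ℂ) (z : ℝ) :
    HasDerivAt (integFactor w c β lam)
      (-((slow w c z : ℂ) * (lam + (β * w.deriv.fn z : ℝ))) * integFactor w c β lam z) z := by
  have hc := h.continuous_rate β lam
  have := (intervalIntegral.integral_hasDerivAt_right (hc.intervalIntegrable 0 z)
    (hc.stronglyMeasurableAtFilter _ _) hc.continuousAt).neg.cexp
  rw [mul_comm]
  exact this

theorem continuous_integFactor {w : Profile} {c R R₀ : ℝ} (h : TransportBds w c R R₀) (β : ℝ) (lam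
    : ℂ) : Continuous (integFactor w c β lam) :=
  continuous_iff_continuousAt.2 fun z => (h.hasDerivAt_integFactor β lam z).continuousAt

theorem integFactor_zero {w : Profile} {c : ℝ} (β : ℝ) (lam : ℂ) : integFactor w c β lam 0 = 1 := by
  simp [integFactor]

theorem norm_integFactor {w : Profile} {c R R₀ : ℝ} (h : TransportBds w c R R₀) (β : ℝ) {lam : ℂ}
    {Λ : ℝ} (hl : |lam.re| ≤ Λ) {z : ℝ}
    (hz : z ∈ Set.Icc 0 (2 * π)) :
    ‖integFactor w c β lam z‖ ≤ Real.exp (2 * π * (R * (Λ + |β|))) ∧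
      (Real.exp (2 * π * (R * (Λ + |β|))))⁻¹ ≤ ‖integFactor w c β lam z‖ := by
  have hc := h.continuous_rate β lam
  have hre : (∫ t in (0 : ℝ)..z, (slow w c t : ℂ) * (lam + (β * w.deriv.fn t : ℝ))).re
      = ∫ t in (0 : ℝ)..z, slow w c t * (lam.re + β * w.deriv.fn t) := by
    have := Complex.reCLM.intervalIntegral_comp_comm (hc.intervalIntegrable (μ := volume) 0 z)
    simp only [Complex.reCLM_apply] at this
    rw [← this]
    congr 1
    ext t
    simp
  have hb : |∫ t in (0 : ℝ)..z, slow w c t * (lam.re + β * w.deriv.fn t)|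
      ≤ 2 * π * (R * (Λ + |β|)) := by
    have h1 := intervalIntegral.norm_integral_le_of_norm_le_const (a := 0) (b := z)
      (f := fun t => slow w c t * (lam.re + β * w.deriv.fn t)) (C := R * (Λ + |β|)) (fun t _ => by
        rw [norm_mul, Real.norm_eq_abs, Real.norm_eq_abs, abs_of_pos (h.slow_pos t)]
        have hR := h.R_pos
        refine mul_le_mul (h.upper t) ?_ (abs_nonneg _) hR.le
        refine (abs_add_le _ _).trans (add_le_add hl ?_)
        rw [abs_mul]
        exact mul_le_of_le_one_right (abs_nonneg _) (h.deriv t))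
    rw [Real.norm_eq_abs, sub_zero, abs_of_nonneg hz.1] at h1
    have hR := h.R_pos
    have hΛ : 0 ≤ Λ := (abs_nonneg _).trans hl
    refine h1.trans ?_
    rw [mul_comm]
    gcongr
    exact hz.2
  rw [integFactor, Complex.norm_exp, Complex.neg_re, hre, ← Real.exp_neg, Real.exp_le_exp,
    Real.exp_le_exp]
  have := abs_le.1 hb
  constructor <;> linarith [this.1, this.2]

/-- Integration by parts against the oscillating integrating factor. -/
theorem norm_integral_le {w : Profile} {c R R₀ : ℝ} (h : TransportBds w c R R₀) {β : ℝ} {lam : ℂ}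
    {Λ C : ℝ} (hl : |lam.re| ≤ Λ) (hl0 : 0 < ‖lam‖)
    {k₁ k₂ : ℝ → ℂ} (hd : ∀ z, HasDerivAt k₁ (k₂ z) z) (hk₂ : Continuous k₂)
    (h1 : ∀ z, ‖k₁ z‖ ≤ C) (h2 : ∀ z, ‖k₂ z‖ ≤ C) {z : ℝ} (hz : z ∈ Set.Icc 0 (2 * π)) :
    ‖∫ t in (0 : ℝ)..z, (slow w c t : ℂ) * integFactor w c β lam t * k₁ t‖
      ≤ Real.exp (2 * π * (R * (Λ + |β|))) * (2 + 2 * π + 2 * π * (R * |β|)) * C / ‖lam‖ := by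
  set E := Real.exp (2 * π * (R * (Λ + |β|))) with hE
  have hE0 : 0 < E := Real.exp_pos _
  have hR := h.R_pos
  have hC : 0 ≤ C := (norm_nonneg _).trans (h1 0)
  have hk₁ : Continuous k₁ := continuous_iff_continuousAt.2 fun z => (hd z).continuousAt
  have hP := h.continuous_integFactor β lam
  have hs := h.continuous_slow
  have hw := w.deriv.smooth.continuous
  set Φ := integFactor w c β lam with hΦ
  have hEz : ∀ t ∈ Set.Icc 0 (2 * π), ‖Φ t‖ ≤ E := fun t ht => (h.norm_integFactor β hl ht).1
  have hder : ∀ t, HasDerivAt (fun t => Φ t * k₁ t)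
      (-((slow w c t : ℂ) * (lam + (β * w.deriv.fn t : ℝ))) * Φ t * k₁ t + Φ t * k₂ t) t := fun t =>
    (h.hasDerivAt_integFactor β lam t).mul (hd t)
  have hint := intervalIntegral.integral_eq_sub_of_hasDerivAt (a := 0) (b := z)
    (fun t _ => hder t) (Continuous.intervalIntegrable (by fun_prop) _ _)
  -- The integrand to be estimated appears in (Φk₁)' with the factor λ. All other terms are bounded
  -- independently of Im λ, so the integral decays like 1/|λ|.
  have e : ∀ t, -((slow w c t : ℂ) * (lam + (β * w.deriv.fn t : ℝ))) * Φ t * k₁ t + Φ t * k₂ t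
      = (Φ t * k₂ t - ((slow w c t * (β * w.deriv.fn t) : ℝ) : ℂ) * Φ t * k₁ t)
        - lam * ((slow w c t : ℂ) * Φ t * k₁ t) := fun t => by push_cast; ring
  rw [intervalIntegral.integral_congr (fun t _ => e t), intervalIntegral.integral_sub
    (Continuous.intervalIntegrable (by fun_prop) _ _)
    (Continuous.intervalIntegrable (by fun_prop) _ _), intervalIntegral.integral_const_mul] at hint
  have hI : ‖∫ t in (0 : ℝ)..z, (Φ t * k₂ t
      - ((slow w c t * (β * w.deriv.fn t) : ℝ) : ℂ) * Φ t * k₁ t)‖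
      ≤ (E * C + R * |β| * E * C) * (2 * π) := by
    have h3 := intervalIntegral.norm_integral_le_of_norm_le_const (a := 0) (b := z)
      (f := fun t => Φ t * k₂ t - ((slow w c t * (β * w.deriv.fn t) : ℝ) : ℂ) * Φ t * k₁ t)
      (C := E * C + R * |β| * E * C) (fun t ht => by
        rw [Set.uIoc_of_le hz.1] at ht
        have ht' : t ∈ Set.Icc 0 (2 * π) := ⟨ht.1.le, ht.2.trans hz.2⟩
        refine (norm_sub_le _ _).trans (add_le_add ?_ ?_)
        · rw [norm_mul]
          exact mul_le_mul (hEz t ht') (h2 t) (norm_nonneg _) hE0.le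
        · rw [norm_mul, norm_mul, Complex.norm_real, Real.norm_eq_abs, abs_mul, abs_mul,
            abs_of_pos (h.slow_pos t)]
          have := h.deriv t
          have h5 : |β| * |w.deriv.fn t| ≤ |β| := mul_le_of_le_one_right (abs_nonneg _) this
          have h6 := h.slow_pos t
          have h7 := h.upper t
          have h8 := h1 t
          have h9 := hEz t ht'
          gcongr)
    rw [sub_zero, abs_of_nonneg hz.1] at h3
    exact h3.trans (by gcongr; exact hz.2)
  have hb1 : ‖Φ z * k₁ z‖ ≤ E * C := by
    rw [norm_mul]; exact mul_le_mul (hEz z hz) (h1 z) (norm_nonneg _) hE0.le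
  have hb0 : ‖Φ 0 * k₁ 0‖ ≤ E * C := by
    rw [norm_mul]
    exact mul_le_mul (hEz 0 ⟨le_rfl, Real.two_pi_pos.le⟩) (h1 0) (norm_nonneg _) hE0.le
  rw [le_div_iff₀ hl0, mul_comm, ← norm_mul]
  have e2 : lam * ∫ t in (0 : ℝ)..z, (slow w c t : ℂ) * Φ t * k₁ t
      = (∫ t in (0 : ℝ)..z, (Φ t * k₂ t - ((slow w c t * (β * w.deriv.fn t) : ℝ) : ℂ) * Φ t * k₁ t))
        - (Φ z * k₁ z - Φ 0 * k₁ 0) := by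
    rw [← hint]; ring
  rw [e2]
  refine (norm_sub_le _ _).trans ?_
  have h4 := norm_sub_le (Φ z * k₁ z) (Φ 0 * k₁ 0)
  have : E * (2 + 2 * π + 2 * π * (R * |β|)) * C
      = (E * C + R * |β| * E * C) * (2 * π) + (E * C + E * C) := by ring
  rw [this]
  linarith

/-- Duhamel's formula. -/
theorem duhamel {w : Profile} {c R R₀ : ℝ} (h : TransportBds w c R R₀) {β : ℝ} {lam : ℂ} {v f : ℝ →
    ℂ} (hf : Continuous f)
    (hv : ∀ z, HasDerivAt v ((slow w c z : ℂ) *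
      (lam * v z + ((β * w.deriv.fn z : ℝ) : ℂ) * v z + f z)) z) (z : ℝ) :
    integFactor w c β lam z * v z - v 0
      = ∫ t in (0 : ℝ)..z, (slow w c t : ℂ) * integFactor w c β lam t * f t := by
  have hP := h.continuous_integFactor β lam
  have hs := h.continuous_slow
  have hder : ∀ t, HasDerivAt (fun t => integFactor w c β lam t * v t)
      ((slow w c t : ℂ) * integFactor w c β lam t * f t) t := fun t => by
    have := (h.hasDerivAt_integFactor β lam t).mul (hv t)
    refine this.congr_deriv ?_
    push_cast
    ring
  rw [intervalIntegral.integral_eq_sub_of_hasDerivAt (fun t _ => hder t)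
    (Continuous.intervalIntegrable (by fun_prop) _ _), integFactor_zero, one_mul]

end TransportBds

theorem exists_coe_eq (x : Circ) : ∃ z ∈ Set.Icc 0 (2 * π), (z : Circ) = x := by
  obtain ⟨z, hz, h⟩ := AddCircle.eq_coe_Ico x
  exact ⟨z, ⟨hz.1, hz.2.le⟩, h⟩

theorem norm_le_of_Icc {v : C(Circ, ℂ)} {C : ℝ} (hC : 0 ≤ C)
    (h : ∀ z ∈ Set.Icc 0 (2 * π), ‖v (z : Circ)‖ ≤ C) : ‖v‖ ≤ C := by
  refine (ContinuousMap.norm_le _ hC).2 fun x => ?_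
  obtain ⟨z, hz, rfl⟩ := exists_coe_eq x
  exact h z hz

/-- `v` solves the transport equation with eigenvalue `lam`, source `μ u`, and a smoothing
perturbation whose size is controlled by `C`. -/
def IsTransportSol (w : Profile) (c β C : ℝ) (lam μ : ℂ) (v u : C(Circ, ℂ)) : Prop :=
  ∃ k₁ k₂ : C(Circ, ℂ), (∀ z : ℝ, HasDerivAt (fun z : ℝ => k₁ (z : Circ)) (k₂ (z : Circ)) z) ∧
    ‖k₁‖ ≤ C * ‖v‖ ∧ ‖k₂‖ ≤ C * ‖v‖ ∧
    ∀ z : ℝ, HasDerivAt (fun z : ℝ => v (z : Circ)) ((slow w c z : ℂ) *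
      (lam * v (z : Circ) + ((β * w.deriv.fn z : ℝ) : ℂ) * v (z : Circ)
        + (μ * u (z : Circ) - k₁ (z : Circ)))) z

/-- At a maximum of |v|² its derivative vanishes. Taking the real part of conj v times the equation
leaves Re λ + βw' balanced against the perturbation, which is at most C times the maximum of |v|. -/
theorem abs_re_le_of_isTransportSol {w : Profile} {c R R₀ β C : ℝ} {lam : ℂ} {v : C(Circ, ℂ)}
    (h : TransportBds w c R R₀) (hv : IsTransportSol w c β C lam 0 v 0) (hv0 : v ≠ 0) :
    |lam.re| ≤ |β| + C := by
  obtain ⟨k₁, k₂, -, hk₁, -, hd⟩ := hv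
  obtain ⟨x, -, hx⟩ := isCompact_univ.exists_isMaxOn (f := fun x => ‖v x‖) Set.univ_nonempty
    v.continuous.norm.continuousOn
  obtain ⟨z, -, rfl⟩ := exists_coe_eq x
  have hS : ‖v‖ = ‖v (z : Circ)‖ := le_antisymm
    ((ContinuousMap.norm_le _ (norm_nonneg _)).2 fun y => hx (Set.mem_univ y))
    (v.norm_coe_le_norm _)
  have hSp : 0 < ‖v (z : Circ)‖ := by rw [← hS]; exact norm_pos_iff.2 hv0
  have hmax : IsLocalMax (fun t : ℝ => ‖v (t : Circ)‖ ^ 2) z := by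
    refine Filter.Eventually.of_forall fun t => ?_
    have := hx (Set.mem_univ (t : Circ))
    exact pow_le_pow_left₀ (norm_nonneg _) this 2
  have hz := hmax.hasDerivAt_eq_zero (hd z).norm_sq
  set V := v (z : Circ)
  set k := k₁ (z : Circ)
  have hk : ‖k‖ ≤ C * ‖V‖ := (k₁.norm_coe_le_norm _).trans (by rw [← hS]; exact hk₁)
  have hin : (lam.re + β * w.deriv.fn z) * ‖V‖ ^ 2 = (conj V * k).re := by
    have h1 := (mul_eq_zero.1 hz).resolve_left two_ne_zero
    rw [Complex.inner] at h1
    have e : (slow w c z : ℂ) * (lam * V + ((β * w.deriv.fn z : ℝ) : ℂ) * V + (0 * 0 - k)) * conj V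
        = ((slow w c z : ℝ) : ℂ) * ((lam + ((β * w.deriv.fn z : ℝ) : ℂ)) * ((‖V‖ ^ 2 : ℝ) : ℂ)
          - conj V * k) := by
      have := Complex.mul_conj' V
      push_cast
      rw [← this]
      ring
    rw [mul_comm] at h1
    have h2 : ((slow w c z : ℂ) * (lam * V + ((β * w.deriv.fn z : ℝ) : ℂ) * V + (0 * 0 - k)) * conj
        V).re
        = 0 := by
      rw [← h1, mul_comm]; rfl
    rw [e, Complex.re_ofReal_mul] at h2
    have h3 := (mul_eq_zero.1 h2).resolve_left (h.slow_pos z).ne'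
    rw [Complex.sub_re, mul_comm (lam + _), Complex.re_ofReal_mul, Complex.add_re,
      Complex.ofReal_re] at h3
    linarith
  have hb : |(conj V * k).re| ≤ C * ‖V‖ ^ 2 := by
    refine (Complex.abs_re_le_norm _).trans ?_
    rw [norm_mul, RCLike.norm_conj]
    calc ‖V‖ * ‖k‖ ≤ ‖V‖ * (C * ‖V‖) := by gcongr
      _ = C * ‖V‖ ^ 2 := by ring
  rw [← hin, abs_mul, abs_of_pos (by positivity : 0 < ‖V‖ ^ 2)] at hb
  have h1 : |lam.re + β * w.deriv.fn z| ≤ C := le_of_mul_le_mul_right hb (by positivity)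
  have h2 : |β * w.deriv.fn z| ≤ |β| := by
    rw [abs_mul]; exact mul_le_of_le_one_right (abs_nonneg _) (h.deriv z)
  have h3 := abs_sub (lam.re + β * w.deriv.fn z) (β * w.deriv.fn z)
  rw [add_sub_cancel_right] at h3
  linarith

section Uniqueness

variable {w : Profile} {c R R₀ β C Λ : ℝ}

theorem continuous_coe (v : C(Circ, ℂ)) : Continuous fun z : ℝ => v (z : Circ) :=
  v.continuous.comp (AddCircle.continuous_mk' _)

/-- An eigenfunction with large eigenvalue is close to a solution of the transport equation. -/
theorem transport_approx (h : TransportBds w c R R₀) {lam : ℂ} (hl : |lam.re| ≤ Λ)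
    (hl0 : 0 < ‖lam‖) {v : C(Circ, ℂ)} (hv : IsTransportSol w c β C lam 0 v 0) {z : ℝ}
    (hz : z ∈ Set.Icc 0 (2 * π)) :
    ‖integFactor w c β lam z * v (z : Circ) - v ((0 : ℝ) : Circ)‖
      ≤ Real.exp (2 * π * (R * (Λ + |β|))) * (2 + 2 * π + 2 * π * (R * |β|)) * (C * ‖v‖) / ‖lam‖ :=
          by
  obtain ⟨k₁, k₂, hk, hk₁, hk₂, hd⟩ := hv
  have h1 := h.duhamel (f := fun z : ℝ => 0 * (0 : C(Circ, ℂ)) (z : Circ) - k₁ (z : Circ))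
    (by have := continuous_coe k₁; fun_prop) hd z
  rw [h1]
  have h2 := h.norm_integral_le (β := β) (C := C * ‖v‖) hl hl0 hk (continuous_coe k₂)
    (fun z => (k₁.norm_coe_le_norm _).trans hk₁) (fun z => (k₂.norm_coe_le_norm _).trans hk₂) hz
  have e : ∀ t : ℝ, (slow w c t : ℂ) * integFactor w c β lam t *
      (0 * (0 : C(Circ, ℂ)) (t : Circ) - k₁ (t : Circ))
      = -((slow w c t : ℂ) * integFactor w c β lam t * k₁ (t : Circ)) := fun t => by ring
  rw [intervalIntegral.integral_congr (fun t _ => e t), intervalIntegral.integral_neg, norm_neg]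
  exact h2

theorem norm_le_of_integFactor (h : TransportBds w c R R₀) {lam : ℂ} (hl : |lam.re| ≤ Λ) {x : ℂ}
    {z : ℝ} (hz : z ∈ Set.Icc 0 (2 * π)) :
    ‖x‖ ≤ Real.exp (2 * π * (R * (Λ + |β|))) * ‖integFactor w c β lam z * x‖ := by
  have h1 := (h.norm_integFactor β hl hz).2
  have hE := Real.exp_pos (2 * π * (R * (Λ + |β|)))
  rw [inv_le_iff_one_le_mul₀' hE] at h1
  rw [norm_mul, ← mul_assoc]
  exact le_mul_of_one_le_left (norm_nonneg _) h1

/-- Once |λ| is large, the deviation of Φv from v(0) costs at most half of ‖v‖ and is absorbed. In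
particular v(0) ≠ 0 for a nonzero solution, so that eigenfunctions can be normalized by v(0) = 1. -/
theorem transport_norm_le (h : TransportBds w c R R₀) {lam : ℂ} (hl : |lam.re| ≤ Λ)
    (hl0 : 0 < ‖lam‖) {v : C(Circ, ℂ)} (hv : IsTransportSol w c β C lam 0 v 0)
    (hlarge : 2 * (Real.exp (2 * π * (R * (Λ + |β|))) * (Real.exp (2 * π * (R * (Λ + |β|))) *
      (2 + 2 * π + 2 * π * (R * |β|)) * C)) ≤ ‖lam‖) :
    ‖v‖ ≤ 2 * Real.exp (2 * π * (R * (Λ + |β|))) * ‖v ((0 : ℝ) : Circ)‖ := by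
  set E := Real.exp (2 * π * (R * (Λ + |β|))) with hE
  have hE0 : 0 < E := Real.exp_pos _
  set C' := E * (2 + 2 * π + 2 * π * (R * |β|)) * C with hC'
  have key : ‖v‖ ≤ E * ‖v ((0 : ℝ) : Circ)‖ + ‖v‖ / 2 := by
    refine norm_le_of_Icc (by positivity) fun z hz => ?_
    have h1 := transport_approx h hl hl0 hv hz
    have h2 := norm_le_of_integFactor (β := β) h hl (x := v (z : Circ)) hz
    have h3 := norm_le_norm_sub_add (integFactor w c β lam z * v (z : Circ)) (v ((0 : ℝ) : Circ))
    have h4 : E * (E * (2 + 2 * π + 2 * π * (R * |β|)) * (C * ‖v‖) / ‖lam‖) ≤ ‖v‖ / 2 := by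
      have e : E * (E * (2 + 2 * π + 2 * π * (R * |β|)) * (C * ‖v‖) / ‖lam‖)
          = (E * C') / ‖lam‖ * ‖v‖ := by rw [hC']; ring
      rw [e, div_eq_inv_mul ‖v‖]
      gcongr
      rw [div_le_iff₀ hl0]
      linarith
    calc ‖v (z : Circ)‖ ≤ E * ‖integFactor w c β lam z * v (z : Circ)‖ := h2
      _ ≤ E * (E * (2 + 2 * π + 2 * π * (R * |β|)) * (C * ‖v‖) / ‖lam‖ + ‖v ((0 : ℝ) : Circ)‖) := by
        gcongr
        exact h3.trans (by gcongr)
      _ ≤ _ := by rw [mul_add]; linarith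
  linarith

/-- Two eigenvalues with the same large imaginary part coincide. -/
theorem transport_unique (β C Λ R R₀ : ℝ) (hC : 0 ≤ C) (hR₀ : 0 < R₀) (hR : 0 < R) :
    ∃ M > 0, ∀ (w : Profile) (c : ℝ) (lam lam' : ℂ) (v v' : C(Circ, ℂ)),
      TransportBds w c R R₀ → |lam.re| ≤ Λ → |lam'.re| ≤ Λ → lam.im = lam'.im → M ≤ ‖lam‖ →
      M ≤ ‖lam'‖ → IsTransportSol w c β C lam' 0 v' 0 →
      IsTransportSol w c β C lam (lam - lam') (v - v') v' →
      v ((0 : ℝ) : Circ) = 1 → v' ((0 : ℝ) : Circ) = 1 → lam = lam' := by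
  set E := Real.exp (2 * π * (R * (Λ + |β|))) with hE
  have hE0 : 0 < E := Real.exp_pos _
  set C' := E * (2 + 2 * π + 2 * π * (R * |β|)) * C with hC'
  have hC'0 : 0 ≤ C' := by positivity
  -- The first summand keeps Φ'v' within 1/2 of 1, where Φ' is the integrating factor for λ', and
  -- bounds v - v' by μ. The second closes the final inequality, and 1 makes the threshold positive.
  refine ⟨C' * (4 * E) + C' * (16 * E ^ 5 * R / R₀) + 1, by positivity, ?_⟩
  intro w c lam lam' v v' h hl hl' him hM hM' hv' hD h0 h0'
  have hπ := Real.pi_pos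
  have hn : 0 < ‖lam‖ := lt_of_lt_of_le (by positivity) hM
  have hn' : 0 < ‖lam'‖ := lt_of_lt_of_le (by positivity) hM'
  have hq : 0 ≤ C' * (16 * E ^ 5 * R / R₀) := by positivity
  have hq2 : 0 ≤ C' * (4 * E) := by positivity
  have hS : ‖v'‖ ≤ 2 * E := by
    have := transport_norm_le h hl' hn' hv' (by
      change 2 * (E * C') ≤ ‖lam'‖
      nlinarith [mul_nonneg hC'0 hE0.le])
    rwa [h0', norm_one, mul_one] at this
  have hnear : ∀ z ∈ Set.Icc 0 (2 * π), 1 / 2 ≤ (integFactor w c β lam' z * v' (z : Circ)).re := by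
    intro z hz
    have h1 := transport_approx h hl' hn' hv' hz
    rw [h0'] at h1
    have h2 : E * (2 + 2 * π + 2 * π * (R * |β|)) * (C * ‖v'‖) / ‖lam'‖ ≤ 1 / 2 := by
      rw [div_le_iff₀ hn']
      calc E * (2 + 2 * π + 2 * π * (R * |β|)) * (C * ‖v'‖) = C' * ‖v'‖ := by rw [hC']; ring
        _ ≤ C' * (2 * E) := by gcongr
        _ ≤ 1 / 2 * ‖lam'‖ := by linarith
    have h3 := (Complex.abs_re_le_norm _).trans (h1.trans h2)
    rw [Complex.sub_re, Complex.one_re] at h3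
    have := (abs_le.1 h3).1
    linarith
  obtain ⟨k₁, k₂, hk, hk₁, hk₂, hd⟩ := hD
  set μ := lam - lam' with hμ
  have hcv := continuous_coe v'
  have hck := continuous_coe k₁
  have hcs := h.continuous_slow
  have hcP := h.continuous_integFactor β lam
  have hcP' := h.continuous_integFactor β lam'
  -- Duhamel for v - v', which vanishes at 0 by the normalization and therefore also at 2π.
  have hduh : ∀ z, integFactor w c β lam z * (v - v') (z : Circ) =
      μ * (∫ t in (0 : ℝ)..z, (slow w c t : ℂ) * integFactor w c β lam t * v' (t : Circ))
      - ∫ t in (0 : ℝ)..z, (slow w c t : ℂ) * integFactor w c β lam t * k₁ (t : Circ) := by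
    intro z
    have h1 := h.duhamel (f := fun z : ℝ => μ * v' (z : Circ) - k₁ (z : Circ)) (by fun_prop) hd z
    have e0 : (v - v') ((0 : ℝ) : Circ) = 0 := by
      rw [ContinuousMap.sub_apply, h0, h0', sub_self]
    have e : ∀ t : ℝ, (slow w c t : ℂ) * integFactor w c β lam t * (μ * v' (t : Circ) - k₁ (t :
        Circ))
        = μ * ((slow w c t : ℂ) * integFactor w c β lam t * v' (t : Circ))
          - (slow w c t : ℂ) * integFactor w c β lam t * k₁ (t : Circ) := fun t => by ring
    rw [e0, sub_zero, intervalIntegral.integral_congr (fun t _ => e t),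
      intervalIntegral.integral_sub (Continuous.intervalIntegrable (by fun_prop) _ _)
      (Continuous.intervalIntegrable (by fun_prop) _ _), intervalIntegral.integral_const_mul] at h1
    exact h1
  have hkint : ∀ z ∈ Set.Icc 0 (2 * π),
      ‖∫ t in (0 : ℝ)..z, (slow w c t : ℂ) * integFactor w c β lam t * k₁ (t : Circ)‖
        ≤ C' / ‖lam‖ * ‖v - v'‖ := by
    intro z hz
    have h2 := h.norm_integral_le (β := β) (C := C * ‖v - v'‖) hl hn hk (continuous_coe k₂)
      (fun z => (k₁.norm_coe_le_norm _).trans hk₁) (fun z => (k₂.norm_coe_le_norm _).trans hk₂) hz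
    refine h2.trans (le_of_eq ?_)
    rw [hC']; ring
  have hδ : C' / ‖lam‖ * (4 * E) ≤ 1 := by
    rw [div_mul_eq_mul_div, div_le_one hn]; linarith
  have hδ2 : C' / ‖lam‖ * (16 * E ^ 5 * R / R₀) ≤ 1 := by
    rw [div_mul_eq_mul_div, div_le_one hn]; linarith
  have hδ0 : 0 ≤ C' / ‖lam‖ := by positivity
  -- The smoothing term contributes at most ‖v - v'‖/2 and is absorbed, so the difference is
  -- controlled by μ = λ - λ' alone.
  have hDn : ‖v - v'‖ ≤ 8 * π * E ^ 3 * R * ‖μ‖ := by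
    have hbd : ‖v - v'‖ ≤ 4 * π * E ^ 3 * R * ‖μ‖ + ‖v - v'‖ / 2 := by
      refine norm_le_of_Icc (by positivity) fun z hz => ?_
      have h2 := norm_le_of_integFactor (β := β) h hl (x := (v - v') (z : Circ)) hz
      have h3 : ‖∫ t in (0 : ℝ)..z, (slow w c t : ℂ) * integFactor w c β lam t * v' (t : Circ)‖
          ≤ R * E * (2 * E) * (2 * π) := by
        have h4 := intervalIntegral.norm_integral_le_of_norm_le_const (a := 0) (b := z)
          (f := fun t : ℝ => (slow w c t : ℂ) * integFactor w c β lam t * v' (t : Circ))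
          (C := R * E * (2 * E)) (fun t ht => by
            rw [Set.uIoc_of_le hz.1] at ht
            have ht' : t ∈ Set.Icc 0 (2 * π) := ⟨ht.1.le, ht.2.trans hz.2⟩
            have h5 := (h.norm_integFactor β hl ht').1
            have h6 := h.slow_pos t
            have h7 := h.upper t
            have h8 := (v'.norm_coe_le_norm (t : Circ)).trans hS
            rw [norm_mul, norm_mul, Complex.norm_real, Real.norm_eq_abs, abs_of_pos h6]
            gcongr)
        rw [sub_zero, abs_of_nonneg hz.1] at h4
        exact h4.trans (by gcongr; exact hz.2)
      have h5 := hkint z hz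
      have h6 : ‖integFactor w c β lam z * (v - v') (z : Circ)‖
          ≤ ‖μ‖ * (R * E * (2 * E) * (2 * π)) + C' / ‖lam‖ * ‖v - v'‖ := by
        rw [hduh z]
        refine (norm_sub_le _ _).trans (add_le_add ?_ h5)
        rw [norm_mul]
        gcongr
      have h7 : E * (C' / ‖lam‖ * ‖v - v'‖) ≤ ‖v - v'‖ / 2 := by
        have := mul_le_mul_of_nonneg_right hδ (norm_nonneg (v - v'))
        have hp : 0 ≤ E * (C' / ‖lam‖ * ‖v - v'‖) := by positivity
        nlinarith
      calc _ ≤ _ := h2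
        _ ≤ E * (‖μ‖ * (R * E * (2 * E) * (2 * π)) + C' / ‖lam‖ * ‖v - v'‖) := by gcongr
        _ = 4 * π * E ^ 3 * R * ‖μ‖ + E * (C' / ‖lam‖ * ‖v - v'‖) := by ring
        _ ≤ _ := by gcongr
    linarith
  -- the solvability condition
  have hπmem : 2 * π ∈ Set.Icc 0 (2 * π) := ⟨Real.two_pi_pos.le, le_rfl⟩
  have hper : (v - v') ((2 * π : ℝ) : Circ) = 0 := by
    have : ((2 * π : ℝ) : Circ) = ((0 : ℝ) : Circ) := by rw [AddCircle.coe_period]; rfl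
    rw [this, ContinuousMap.sub_apply, h0, h0', sub_self]
  have hsolv : ‖μ‖ * ‖∫ t in (0 : ℝ)..2 * π, (slow w c t : ℂ) * integFactor w c β lam t
      * v' (t : Circ)‖ ≤ C' / ‖lam‖ * ‖v - v'‖ := by
    have h1 := hduh (2 * π)
    rw [hper, mul_zero, eq_comm, sub_eq_zero] at h1
    rw [← norm_mul, h1]
    exact hkint _ hπmem
  have hlow : π * R₀ / E ^ 2 ≤ ‖∫ t in (0 : ℝ)..2 * π, (slow w c t : ℂ) * integFactor w c β lam t
      * v' (t : Circ)‖ := by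
    refine le_trans ?_ (Complex.re_le_norm _)
    have hI : IntervalIntegrable (fun t : ℝ => (slow w c t : ℂ) * integFactor w c β lam t
      * v' (t : Circ)) volume 0 (2 * π) := Continuous.intervalIntegrable (by fun_prop) _ _
    have h1 := Complex.reCLM.intervalIntegral_comp_comm hI
    simp only [Complex.reCLM_apply] at h1
    rw [← h1]
    have h2 : ∫ _ in (0 : ℝ)..2 * π, R₀ * (1 / E ^ 2) * (1 / 2) = π * R₀ / E ^ 2 := by
      rw [intervalIntegral.integral_const, smul_eq_mul]
      ring
    rw [← h2]
    refine intervalIntegral.integral_mono_on Real.two_pi_pos.le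
      (continuous_const.intervalIntegrable _ _) (Continuous.intervalIntegrable (by fun_prop) _ _)
      fun t ht => ?_
    -- the quotient of the two integrating factors is real and positive
    have hμr : μ = ((lam.re - lam'.re : ℝ) : ℂ) := by
      refine Complex.ext ?_ ?_
      · rw [hμ, Complex.sub_re, Complex.ofReal_re]
      · rw [hμ, Complex.sub_im, him, sub_self, Complex.ofReal_im]
    have hcr := h.continuous_rate β lam
    have hcr' := h.continuous_rate β lam'
    obtain ⟨p, hp0, hp⟩ : ∃ p : ℝ, 0 < p ∧ integFactor w c β lam t
        = p * integFactor w c β lam' t := by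
      refine ⟨Real.exp (-((lam.re - lam'.re) * ∫ x in (0 : ℝ)..t, slow w c x)), Real.exp_pos _, ?_⟩
      rw [integFactor, integFactor, Complex.ofReal_exp, ← Complex.exp_add]
      congr 1
      push_cast
      rw [← intervalIntegral.integral_ofReal]
      have e : ∀ x, (slow w c x : ℂ) * (lam + β * w.deriv.fn x)
          = μ * (slow w c x : ℂ) + (slow w c x : ℂ) * (lam' + β * w.deriv.fn x) := by
        intro x; rw [hμ]; ring
      push_cast at hcr hcr'
      rw [intervalIntegral.integral_congr (fun x _ => e x), intervalIntegral.integral_add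
        (Continuous.intervalIntegrable (by fun_prop) _ _) (hcr'.intervalIntegrable _ _),
        intervalIntegral.integral_const_mul, hμr]
      push_cast
      ring
    have hpl : 1 / E ^ 2 ≤ p := by
      have a1 := (h.norm_integFactor β hl ht).2
      have a2 := (h.norm_integFactor β hl' ht).1
      rw [hp, norm_mul, Complex.norm_real, Real.norm_eq_abs, abs_of_pos hp0] at a1
      have a3 : E⁻¹ ≤ p * E := a1.trans (by gcongr)
      rw [inv_le_iff_one_le_mul₀' hE0] at a3
      rw [div_le_iff₀ (by positivity)]
      linarith
    have e : ((slow w c t : ℂ) * integFactor w c β lam t * v' (t : Circ)).re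
        = slow w c t * p * (integFactor w c β lam' t * v' (t : Circ)).re := by
      rw [hp, ← Complex.re_ofReal_mul]
      congr 1
      push_cast
      ring
    rw [e]
    have h3 := hnear t ht
    have h4 := h.lower t
    have h5 := h.slow_pos t
    gcongr
  -- Both sides are linear in |μ|. After division by |μ| the right side carries the factor 1/|λ|,
  -- and the choice of the threshold leaves πR₀ ≤ πR₀/2.
  by_contra hne
  have hμ0 : 0 < ‖μ‖ := norm_pos_iff.2 (sub_ne_zero.2 hne)
  have h1 : ‖μ‖ * (π * R₀ / E ^ 2) ≤ C' / ‖lam‖ * (8 * π * E ^ 3 * R * ‖μ‖) :=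
    (mul_le_mul_of_nonneg_left hlow hμ0.le).trans (hsolv.trans (by gcongr))
  have h2 : π * R₀ / E ^ 2 ≤ C' / ‖lam‖ * (8 * π * E ^ 3 * R) := by
    refine le_of_mul_le_mul_left ?_ hμ0
    linarith
  rw [div_le_iff₀ (by positivity)] at h2
  have h3 : C' / ‖lam‖ * (16 * E ^ 5 * R) ≤ R₀ := by
    rw [mul_div_assoc', div_le_one hR₀] at hδ2
    exact hδ2
  have h4 : C' / ‖lam‖ * (8 * π * E ^ 3 * R) * E ^ 2 = π / 2 * (C' / ‖lam‖ * (16 * E ^ 5 * R)) := by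
    ring
  rw [h4] at h2
  nlinarith [mul_pos hπ hR₀]

end Uniqueness

end BKP

end

/-! ### Eigenvalues with large imaginary part -/

open MeasureTheory AddCircle
open scoped Real ENNReal ContDiff

noncomputable section

namespace BKP

open ComplexConjugate

theorem exists_rep_H1 (V : H1) : ∃ v, Rep (V : L2) v := by
  obtain ⟨v, hv, -⟩ := exists_rep (fun n => coeff_mult symD V n)
  exact ⟨v, hv⟩

theorem Rep.ne_zero {V : L2} {v : C(Circ, ℂ)} (h : Rep V v) (hV : V ≠ 0) : v ≠ 0 := by
  rintro rfl
  exact hV (by rw [← h, map_zero])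

/-- The eigenvalue λ and its mirror image -conj λ have the same imaginary part. After normalization
at z = 0 their eigenfunctions satisfy the hypotheses of `transport_unique`, hence λ = -conj λ. -/
theorem re_eq_zero_of_large (b κ k : ℝ) (hκ : 0 < κ) (hk : 0 < k) :
    ∃ M > 0, ∃ ε > 0, ∀ (w : Profile) (c s K : ℝ) (lam : ℂ) (V : H1), Function.Even w.fn →
      C2Bound w K → K ≤ ε → |c - κ / (1 + k ^ 2)| + |s| ≤ ε → M ≤ |lam.im| → V ≠ 0 →
      IsEigen b κ k hk w c s lam V → lam.re = 0 := by
  obtain ⟨C, hC, hsm⟩ := exists_rep_smoothOp b κ k hk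
  set c₀ := κ / (1 + k ^ 2) with hc₀
  have hc₀p : 0 < c₀ := by positivity
  set β := b - 2 with hβ
  set Λ := |β| + C with hΛ
  set R := 2 / c₀ with hR
  set R₀ := 2 / (3 * c₀) with hR₀
  obtain ⟨M, hM, huniq⟩ := transport_unique β C Λ R R₀ hC (by positivity) (by positivity)
  set E := Real.exp (2 * π * (R * (Λ + |β|))) with hE
  have hE0 : 0 < E := Real.exp_pos _
  set M' := 2 * (E * (E * (2 + 2 * π + 2 * π * (R * |β|)) * C)) with hM'
  have hM'0 : 0 ≤ M' := by positivity
  -- The bound c₀/4 on the wave and on the speed keeps c - w between c₀/2 and 3c₀/2, which are the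
  -- reciprocals of R and R₀. The bound 1 serves the smoothing estimate. The summand M' allows the
  -- normalization.
  refine ⟨M + M', by positivity, min 1 (c₀ / 4), by positivity, ?_⟩
  intro w c s K lam V hev hw hK hs hl hV hE'
  have hK1 := hK.trans (min_le_left _ _)
  have hK2 := hK.trans (min_le_right _ _)
  have hs1 : |s| ≤ 1 := by
    have := hs.trans (min_le_left _ _)
    linarith [abs_nonneg (c - c₀)]
  have hc1 : |c - c₀| ≤ c₀ / 4 := by
    have := hs.trans (min_le_right _ _)
    linarith [abs_nonneg s]
  have hcb := abs_le.1 hc1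
  have hw1 : C2Bound w 1 := fun z =>
    ⟨(hw z).1.trans hK1, (hw z).2.1.trans hK1, (hw z).2.2.trans hK1⟩
  have hspeed : ∀ z, c₀ / 2 ≤ c - w.fn z ∧ c - w.fn z ≤ 3 * c₀ / 2 := fun z => by
    have := abs_le.1 ((hw z).1.trans hK2)
    constructor <;> linarith
  have hT : TransportBds w c R R₀ := by
    refine ⟨by positivity, fun z => ?_, fun z => ?_, fun z => (hw1 z).2.1⟩
    · have h1 := hspeed z
      rw [slow, hR₀, ← inv_div]
      exact inv_anti₀ (by linarith) (by linarith)
    · have h1 := hspeed z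
      rw [slow, hR, ← inv_div]
      exact inv_anti₀ (by positivity) h1.1
  -- eigenfunctions and their differences solve a transport equation
  have hsol : ∀ (lam μ : ℂ) (X : H1) (U : L2) (x u : C(Circ, ℂ)), coeff 0 (X : L2) = 0 →
      Rep (X : L2) x → Rep U u →
      (∀ n, Complex.I * nu κ k c s n * coeff n (X : L2) + coeff n (nop b k hk w X)
        = lam * coeff n (X : L2) + μ * coeff n U) → IsTransportSol w c β C lam μ x u := by
    intro lam μ X U x u hX0 hx hu hEq
    obtain ⟨k₁, k₂, hk₁, hd, hn₁, hn₂⟩ := hsm w s X x hw1 hs1 hX0 hx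
    refine ⟨k₁, k₂, hd, hn₁, hn₂, fun z => ?_⟩
    have := classical_equation (fun z => hT.lt z) hEq hx hu hk₁ z
    refine this.congr_deriv ?_
    rw [slow, hβ]
    ring
  have hsol0 : ∀ (lam : ℂ) (X : H1) (x : C(Circ, ℂ)), IsEigen b κ k hk w c s lam X →
      Rep (X : L2) x → IsTransportSol w c β C lam 0 x 0 := fun lam X x hX hx =>
    hsol lam 0 X 0 x 0 hX.1 hx (by rw [Rep, map_zero]) fun n => by rw [hX.2 n]; ring
  have hprep : ∀ (lam : ℂ) (X : H1), M + M' ≤ |lam.im| → X ≠ 0 →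
      IsEigen b κ k hk w c s lam X → |lam.re| ≤ Λ ∧ ∃ (Y : H1) (y : C(Circ, ℂ)),
      IsEigen b κ k hk w c s lam Y ∧ Rep (Y : L2) y ∧ y ((0 : ℝ) : Circ) = 1 := by
    intro lam X hlX hX hXE
    obtain ⟨x, hx⟩ := exists_rep_H1 X
    have hX' : (X : L2) ≠ 0 := fun h => hX (Subtype.ext h)
    have hre := abs_re_le_of_isTransportSol hT (hsol0 lam X x hXE hx) (hx.ne_zero hX')
    have hnorm := hlX.trans (Complex.abs_im_le_norm lam)
    have h1 := transport_norm_le hT hre (by linarith) (hsol0 lam X x hXE hx)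
      (by change M' ≤ ‖lam‖; linarith)
    have hx0 : x ((0 : ℝ) : Circ) ≠ 0 := by
      intro h0
      rw [h0, norm_zero, mul_zero] at h1
      exact hx.ne_zero hX' (norm_le_zero_iff.1 h1)
    refine ⟨hre, (x ((0 : ℝ) : Circ))⁻¹ • X, (x ((0 : ℝ) : Circ))⁻¹ • x, hXE.smul _, hx.smul _, ?_⟩
    rw [ContinuousMap.smul_apply, smul_eq_mul, inv_mul_cancel₀ hx0]
  obtain ⟨U, hU⟩ := exists_conj V
  have hU0 : U ≠ 0 := by
    rintro rfl
    refine hV (Subtype.ext (ext_coeff fun n => ?_))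
    have := hU n
    simp only [ZeroMemClass.coe_zero, map_zero] at this ⊢
    exact (map_eq_zero _).1 this.symm
  have hUE := hE'.conj hev hU
  set lam' := -conj lam with hlam'
  have him : lam'.im = lam.im := by simp [hlam']
  obtain ⟨hre, Y, y, hYE, hy, hy0⟩ := hprep lam V hl hV hE'
  obtain ⟨hre', Y', y', hYE', hy', hy0'⟩ := hprep lam' U (by rw [him]; exact hl) hU0 hUE
  have hnorm := hl.trans (Complex.abs_im_le_norm lam)
  have hnorm' := hl.trans ((congrArg abs him).symm.le.trans (Complex.abs_im_le_norm lam'))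
  have hfin := huniq w c lam lam' y y' hT hre hre' him.symm (by linarith) (by linarith)
    (hsol0 lam' Y' y' hYE' hy')
    (hsol lam (lam - lam') (Y - Y') Y' (y - y') y' (by simp [hYE.1, hYE'.1]) (hy.sub hy') hy'
      fun n => by
        have h1 := hYE.2 n
        have h2 := hYE'.2 n
        simp only [map_sub, AddSubgroupClass.coe_sub]
        linear_combination h1 - h2) hy0 hy0'
  have := congrArg Complex.re hfin
  simp only [hlam', Complex.neg_re, Complex.conj_re] at this
  linarith

end BKP

end

open MeasureTheory AddCircle
open scoped Real ENNReal ContDiff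

noncomputable section

namespace BKP

open ComplexConjugate

/-! ### Parity -/

/-- `ε = 1`: real even functions; `ε = -1`: real odd functions. -/
def Par (ε : ℝ) (V : L2) : Prop := ∀ n, conj (coeff n V) = ε * coeff n V ∧ coeff (-n) V
    = ε * coeff n V

theorem Par.add {ε : ℝ} {U V : L2} (hU : Par ε U) (hV : Par ε V) : Par ε (U + V) := fun n => by
  rw [map_add, map_add, map_add, (hU n).1, (hV n).1, (hU n).2, (hV n).2]
  constructor <;> ring

theorem Par.sub {ε : ℝ} {U V : L2} (hU : Par ε U) (hV : Par ε V) : Par ε (U - V) := fun n => by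
  rw [map_sub, map_sub, map_sub, (hU n).1, (hV n).1, (hU n).2, (hV n).2]
  constructor <;> ring

theorem Par.smul {ε : ℝ} {U : L2} (hU : Par ε U) (t : ℝ) : Par ε ((t : ℂ) • U) := fun n => by
  have e : ∀ m, coeff m ((t : ℂ) • U) = t * coeff m U := fun m => by rw [map_smul, smul_eq_mul]
  rw [e, e, map_mul, Complex.conj_ofReal, (hU n).1, (hU n).2]
  constructor <;> ring

theorem par_zero (ε : ℝ) : Par ε 0 := fun n => by simp

theorem isClosed_par (ε : ℝ) : IsClosed {V : L2 | Par ε V} := by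
  simp only [Par, Set.ofPred_forall, Set.ofPred_and]
  refine isClosed_iInter fun n => IsClosed.inter ?_ ?_
  · exact isClosed_eq (Complex.continuous_conj.comp (continuous_coeff n))
      (continuous_const.mul (continuous_coeff n))
  · exact isClosed_eq (continuous_coeff (-n)) (continuous_const.mul (continuous_coeff n))

theorem par_anti {ε : ℝ} {f : L2} (hf : Par (-ε) f) : Par ε (anti f : L2) := fun n => by
  rw [coeff_anti, coeff_anti, map_mul, (hf n).1, (hf n).2, symD, symD]
  constructor
  · simp
    ring
  · push_cast
    rw [mul_neg, inv_neg]
    ring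

/-- The kernel is real and unchanged when both frequencies change sign, so the convolution keeps the
parity. The remaining factor ∂_z(1 - k²∂²)⁻¹ reverses it. -/
theorem par_nop {b k ε : ℝ} {hk : 0 < k} {w : Profile} (hw : Function.Even w.fn) {V : H1}
    (hV : Par ε (V : L2)) : Par (-ε) (nop b k hk w V) := by
  have hc1 : ∀ n, conj (conv b k w V n) = ε * conv b k w V n := fun n => by
    refine (Complex.hasSum_conj'.2 (hasSum_conv b k w V n)).unique
      (((hasSum_conv b k w V n).mul_left (ε : ℂ)).congr_fun fun m => ?_)
    simp only [map_mul, Complex.conj_ofReal, conj_hat_of_even hw, (hV m).1]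
    ring
  have hc2 : ∀ n, conv b k w V (-n) = ε * conv b k w V n := fun n => by
    have h1 := (Equiv.hasSum_iff (Equiv.neg ℤ)).2 (hasSum_conv b k w V (-n))
    refine h1.unique (((hasSum_conv b k w V n).mul_left (ε : ℂ)).congr_fun fun m => ?_)
    rw [Function.comp_apply, Equiv.neg_apply, (hV m).2, show -n - -m = -(n - m) by ring,
      hat_neg_of_even w hw]
    have : kern b k (-(n - m)) (-m) = kern b k (n - m) m := by
      rw [kern, kern]; push_cast; ring
    rw [this]
    ring
  intro n
  rw [coeff_nop, coeff_nop, hc2, map_mul, hc1, map_neg, map_mul, symD, symD, symS, symS]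
  constructor
  · simp
    ring
  · push_cast
    rw [neg_sq]
    ring

theorem par_bmult {ε : ℝ} {m : ℤ → ℝ} (h : ∃ C : ℝ, ∀ n, ‖(m n : ℂ)‖ ≤ C) (hm : ∀ n, m (-n) = m n)
    {V : L2} (hV : Par ε V) : Par ε (bmult (fun n => (m n : ℂ)) h V) := fun n => by
  rw [coeff_bmult, coeff_bmult, map_mul, Complex.conj_ofReal, (hV n).1, (hV n).2, hm]
  constructor <;> ring

/-! ### The invariant plane -/

/-- `cos z` as an element of `H¹`. -/
def cosH : H1 := (1 / 2 : ℂ) • (expoH 1 + expoH (-1))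

/-- `sin z` as an element of `H¹`. -/
def sinH : H1 := (1 / (2 * Complex.I) : ℂ) • (expoH 1 - expoH (-1))

theorem coeff_cosH (n : ℤ) :
    coeff n (cosH : L2) = (1 / 2) * ((if n = 1 then 1 else 0) + if n = -1 then 1 else 0) := by
  rw [cosH, SetLike.val_smul, map_smul, AddMemClass.coe_add, map_add, coeff_expoH one_ne_zero,
    coeff_expoH (by norm_num), smul_eq_mul]

theorem coeff_sinH (n : ℤ) : coeff n (sinH : L2)
    = (1 / (2 * Complex.I)) * ((if n = 1 then 1 else 0) - if n = -1 then 1 else 0) := by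
  rw [sinH, SetLike.val_smul, map_smul, AddSubgroupClass.coe_sub, map_sub, coeff_expoH one_ne_zero,
    coeff_expoH (by norm_num), smul_eq_mul]

theorem norm_dz_cosH_le : ‖dz cosH‖ ≤ 1 := by
  rw [cosH, map_smul, map_add, norm_smul]
  have h1 := norm_dz_expoH_le 1
  have h2 := norm_dz_expoH_le (-1)
  have h3 := norm_add_le (dz (expoH 1)) (dz (expoH (-1)))
  have : ‖(1 / 2 : ℂ)‖ = 1 / 2 := by norm_num
  rw [this]
  norm_num at h1 h2
  linarith

theorem norm_dz_sinH_le : ‖dz sinH‖ ≤ 1 := by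
  rw [sinH, map_smul, map_sub, norm_smul]
  have h1 := norm_dz_expoH_le 1
  have h2 := norm_dz_expoH_le (-1)
  have h3 := norm_sub_le (dz (expoH 1)) (dz (expoH (-1)))
  have : ‖(1 / (2 * Complex.I) : ℂ)‖ = 1 / 2 := by simp
  rw [this]
  norm_num at h1 h2
  linarith

theorem par_cosH : Par 1 (cosH : L2) := fun n => by
  rw [coeff_cosH, coeff_cosH]
  constructor
  · split_ifs <;> simp [Complex.conj_ofNat]
  · simp only [neg_inj, show (-n = 1) ↔ (n = -1) from neg_eq_iff_eq_neg]
    push_cast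
    ring

theorem par_sinH : Par (-1) (sinH : L2) := fun n => by
  rw [coeff_sinH, coeff_sinH]
  constructor
  · split_ifs <;> simp [Complex.conj_ofNat]
  · simp only [neg_inj, show (-n = 1) ↔ (n = -1) from neg_eq_iff_eq_neg]
    push_cast
    ring

/-- The span of `cos + E` and `sin + O` is invariant under the linearized operator, which maps
`cos + E` to `q (sin + O)` and `sin + O` to `p (cos + E)`. -/
structure InvPair (b κ k : ℝ) (hk : 0 < k) (w : Profile) (c s : ℝ) (E O : H1) (p q : ℝ) : Prop where
  even_low : ∀ n : ℤ, |n| ≤ 1 → coeff n (E : L2) = 0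
  odd_low : ∀ n : ℤ, |n| ≤ 1 → coeff n (O : L2) = 0
  even_eq : ∀ n, Complex.I * nu κ k c s n * coeff n ((cosH + E : H1) : L2)
    + coeff n (nop b k hk w (cosH + E)) = q * coeff n ((sinH + O : H1) : L2)
  odd_eq : ∀ n, Complex.I * nu κ k c s n * coeff n ((sinH + O : H1) : L2)
    + coeff n (nop b k hk w (sinH + O)) = p * coeff n ((cosH + E : H1) : L2)

/-- The symbol of the inverse of the linearized operator on the modes `|n| ≥ 2`, acting on
derivatives. -/
def invSymbol (κ k c s : ℝ) (n : ℤ) : ℝ := if |n| ≤ 1 then 0 else n / nu κ k c s n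

theorem nu_neg (κ k c s : ℝ) (n : ℤ) : nu κ k c s (-n) = -nu κ k c s n := by
  rw [nu, nu]
  push_cast
  rw [neg_sq, neg_mul, neg_mul, div_neg]
  ring

theorem invSymbol_neg (κ k c s : ℝ) (n : ℤ) : invSymbol κ k c s (-n) = invSymbol κ k c s n := by
  rw [invSymbol, invSymbol, abs_neg, nu_neg]
  push_cast
  rw [neg_div_neg_eq]

theorem le_abs_nu {κ k c s : ℝ} (hκ : 0 < κ) (hs : |c - κ / (1 + k ^ 2)| + |s|
    ≤ gap κ k / 4) {n : ℤ}
    (hn : 2 ≤ |n|) : 3 * gap κ k / 4 * |(n : ℝ)| ≤ |nu κ k c s n| := by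
  have hn0 : n ≠ 0 := by rintro rfl; simp at hn
  have h1 := gap_mul_le_abs_nu0 (k := k) hκ hn
  have h2 := (abs_nu_sub_nu0_le κ k c s hn0).trans
    (mul_le_mul_of_nonneg_right hs (abs_nonneg (n : ℝ)))
  have h3 := abs_sub_abs_le_abs_sub (nu0 κ k n) (nu κ k c s n)
  rw [abs_sub_comm] at h3
  linarith

theorem norm_invSymbol_le {κ k c s : ℝ} (hκ : 0 < κ) (hk : 0 < k)
    (hs : |c - κ / (1 + k ^ 2)| + |s| ≤ gap κ k / 4) (n : ℤ) :
    ‖(invSymbol κ k c s n : ℂ)‖ ≤ 2 / gap κ k := by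
  have hg := gap_pos hκ hk
  rw [Complex.norm_real, Real.norm_eq_abs, invSymbol]
  split_ifs with h
  · rw [abs_zero]; positivity
  · have hn : 2 ≤ |n| := by lia
    have h1 := le_abs_nu hκ hs hn
    have hn1 := one_le_abs_cast (n := n) (by rintro rfl; simp at hn)
    rw [abs_div, div_le_div_iff₀ (lt_of_lt_of_le (by positivity) h1) hg]
    nlinarith

theorem nu_one (κ k c s : ℝ) : nu κ k c s 1 = c - κ / (1 + k ^ 2) - s / (1 + k ^ 2) := by
  rw [nu]; simp

/-! ### The fixed point problem for the invariant plane -/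

section FixedPoint

variable (b κ k : ℝ) (hk : 0 < k) (w : Profile) (c s : ℝ)

/-- The off-diagonal entry determined by the even vector. -/
def evenEntry (F : L2) : ℝ := -nu κ k c s 1 - 2 * (coeff 1 (nop b k hk w (cosH + anti F))).im

/-- The off-diagonal entry determined by the odd vector. -/
def oddEntry (G : L2) : ℝ := nu κ k c s 1 + 2 * (coeff 1 (nop b k hk w (sinH + anti G))).re

/-- The map whose fixed point is the invariant plane. -/
def planeMap (h : ∃ C : ℝ, ∀ n, ‖(invSymbol κ k c s n : ℂ)‖ ≤ C) (x : L2 × L2) : L2 × L2 :=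
  (bmult (fun n => (invSymbol κ k c s n : ℂ)) h
      ((evenEntry b κ k hk w c s x.1 : ℂ) • (anti x.2 : L2) - nop b k hk w (cosH + anti x.1)),
    bmult (fun n => (invSymbol κ k c s n : ℂ)) h
      ((oddEntry b κ k hk w c s x.2 : ℂ) • (anti x.1 : L2) - nop b k hk w (sinH + anti x.2)))

variable {b κ k hk w c s}

theorem coeff_zero_cosH_add (F : L2) : coeff 0 ((cosH + anti F : H1) : L2) = 0 := by
  simp [coeff_cosH, coeff_anti, symD]

theorem coeff_zero_sinH_add (F : L2) : coeff 0 ((sinH + anti F : H1) : L2) = 0 := by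
  simp [coeff_sinH, coeff_anti, symD]

theorem norm_anti_le (F : L2) : ‖(anti F : L2)‖ ≤ ‖F‖ :=
  (norm_le_norm_dz _ (by simp [coeff_anti, symD])).trans (norm_dz_anti_le F)

theorem norm_nop_cosH_add_le {K : ℝ} (hw : C2Bound w K) (F : L2) :
    ‖nop b k hk w (cosH + anti F)‖ ≤ nopC b k * K * (1 + ‖F‖) := by
  refine (norm_nop_le b k hk hw _ (coeff_zero_cosH_add F)).trans ?_
  have := mul_nonneg (nopC_nonneg b k) hw.nonneg
  gcongr
  rw [map_add]
  exact (norm_add_le _ _).trans (add_le_add norm_dz_cosH_le (norm_dz_anti_le F))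

theorem norm_nop_sinH_add_le {K : ℝ} (hw : C2Bound w K) (F : L2) :
    ‖nop b k hk w (sinH + anti F)‖ ≤ nopC b k * K * (1 + ‖F‖) := by
  refine (norm_nop_le b k hk hw _ (coeff_zero_sinH_add F)).trans ?_
  have := mul_nonneg (nopC_nonneg b k) hw.nonneg
  gcongr
  rw [map_add]
  exact (norm_add_le _ _).trans (add_le_add norm_dz_sinH_le (norm_dz_anti_le F))

theorem norm_nop_anti_sub_le {K : ℝ} (hw : C2Bound w K) (V : H1) (F G : L2) :
    ‖nop b k hk w (V + anti F) - nop b k hk w (V + anti G)‖ ≤ nopC b k * K * ‖F - G‖ := by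
  rw [← map_sub, add_sub_add_left_eq_sub, ← map_sub]
  refine (norm_nop_le b k hk hw _ (by simp [coeff_anti, symD])).trans ?_
  have := mul_nonneg (nopC_nonneg b k) hw.nonneg
  gcongr
  exact norm_dz_anti_le _

theorem abs_evenEntry_le {K : ℝ} (hw : C2Bound w K) (F : L2) :
    |evenEntry b κ k hk w c s F| ≤ |nu κ k c s 1| + 2 * (nopC b k * K * (1 + ‖F‖)) := by
  refine (abs_sub _ _).trans ?_
  rw [abs_neg, abs_mul, abs_two]
  gcongr
  exact (Complex.abs_im_le_norm _).trans ((norm_coeff_le _ _).trans (norm_nop_cosH_add_le hw F))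

theorem abs_oddEntry_le {K : ℝ} (hw : C2Bound w K) (F : L2) :
    |oddEntry b κ k hk w c s F| ≤ |nu κ k c s 1| + 2 * (nopC b k * K * (1 + ‖F‖)) := by
  refine (abs_add_le _ _).trans ?_
  rw [abs_mul, abs_two]
  gcongr
  exact (Complex.abs_re_le_norm _).trans ((norm_coeff_le _ _).trans (norm_nop_sinH_add_le hw F))

theorem abs_evenEntry_sub_le {K : ℝ} (hw : C2Bound w K) (F G : L2) :
    |evenEntry b κ k hk w c s F - evenEntry b κ k hk w c s G| ≤ 2 * (nopC b k * K * ‖F - G‖) := by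
  have e : evenEntry b κ k hk w c s F - evenEntry b κ k hk w c s G
      = -(2 * (coeff 1 (nop b k hk w (cosH + anti F) - nop b k hk w (cosH + anti G))).im) := by
    rw [evenEntry, evenEntry, map_sub, Complex.sub_im]; ring
  rw [e, abs_neg, abs_mul, abs_two]
  gcongr
  exact (Complex.abs_im_le_norm _).trans ((norm_coeff_le _ _).trans (norm_nop_anti_sub_le hw _ F G))

theorem abs_oddEntry_sub_le {K : ℝ} (hw : C2Bound w K) (F G : L2) :
    |oddEntry b κ k hk w c s F - oddEntry b κ k hk w c s G| ≤ 2 * (nopC b k * K * ‖F - G‖) := by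
  have e : oddEntry b κ k hk w c s F - oddEntry b κ k hk w c s G
      = 2 * (coeff 1 (nop b k hk w (sinH + anti F) - nop b k hk w (sinH + anti G))).re := by
    rw [oddEntry, oddEntry, map_sub, Complex.sub_re]; ring
  rw [e, abs_mul, abs_two]
  gcongr
  exact (Complex.abs_re_le_norm _).trans ((norm_coeff_le _ _).trans (norm_nop_anti_sub_le hw _ F G))

/-- The unknowns are F = E' and G = O'. The rows |n| ≥ 2 are solved by dividing by ν_n, while the
entries are read off from the mode 1. The map is quadratic through the products of an entry with E
or O, but contracts on the unit ball. Parity is built into the complete set, because the entries are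
defined by real and imaginary parts and are the true coefficients only for the right parity. -/
theorem exists_fixedPoint_planeMap {K : ℝ} (hκ : 0 < κ) (hev : Function.Even w.fn)
    (hw : C2Bound w K) (hs : |c - κ / (1 + k ^ 2)| + |s| ≤ gap κ k / 4)
    (hK : nopC b k * K ≤ gap κ k / 320) (hν : |nu κ k c s 1| ≤ gap κ k / 320)
    (h : ∃ C : ℝ, ∀ n, ‖(invSymbol κ k c s n : ℂ)‖ ≤ C) :
    ∃ F G : L2, Par (-1) F ∧ Par 1 G ∧ ‖F‖ ≤ 1 ∧ ‖G‖ ≤ 1 ∧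
      planeMap b κ k hk w c s h (F, G) = (F, G) := by
  have hg := gap_pos hκ hk
  set N := nopC b k * K with hN
  have hN0 : 0 ≤ N := mul_nonneg (nopC_nonneg b k) hw.nonneg
  have hm := norm_bmult_le h (norm_invSymbol_le hκ hk hs)
  set S : Set (L2 × L2) := {x | (Par (-1) x.1 ∧ Par 1 x.2) ∧ ‖x.1‖ ≤ 1 ∧ ‖x.2‖ ≤ 1} with hS
  have hSc : IsClosed S := by
    refine IsClosed.inter (IsClosed.inter ?_ ?_) (IsClosed.inter ?_ ?_)
    · exact (isClosed_par (-1)).preimage continuous_fst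
    · exact (isClosed_par 1).preimage continuous_snd
    · exact isClosed_le continuous_fst.norm continuous_const
    · exact isClosed_le continuous_snd.norm continuous_const
  have hmaps : Set.MapsTo (planeMap b κ k hk w c s h) S S := by
    rintro ⟨F, G⟩ ⟨⟨hF, hG⟩, hF1, hG1⟩
    have hEp : Par 1 ((cosH + anti F : H1) : L2) := par_cosH.add (par_anti (by simpa using hF))
    have hOp : Par (-1) ((sinH + anti G : H1) : L2) :=
      par_sinH.add (par_anti (by simpa using hG))
    simp only at hF hG hF1 hG1
    have hq := abs_evenEntry_le (b := b) (κ := κ) (c := c) (s := s) (hk := hk) hw F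
    have hp := abs_oddEntry_le (b := b) (κ := κ) (c := c) (s := s) (hk := hk) hw G
    have h1 := norm_nop_cosH_add_le (b := b) (hk := hk) hw F
    have h2 := norm_nop_sinH_add_le (b := b) (hk := hk) hw G
    -- In units of gap/320: at most 1 from ν_1, and at most 2·(1 + 1) from `nop` on the unit ball,
    -- in total 5/320 = 1/64.
    have hq' : |evenEntry b κ k hk w c s F| ≤ gap κ k / 64 := by nlinarith
    have hp' : |oddEntry b κ k hk w c s G| ≤ gap κ k / 64 := by nlinarith
    have hx : ∀ (e : ℝ) (X Y : L2), |e| ≤ gap κ k / 64 → ‖X‖ ≤ 1 → ‖Y‖ ≤ gap κ k / 64 →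
        ‖bmult (fun n => (invSymbol κ k c s n : ℂ)) h ((e : ℂ) • (anti X : L2) - Y)‖ ≤ 1 := by
      intro e X Y he hX hY
      refine (hm _).trans ?_
      rw [div_mul_eq_mul_div, div_le_one hg]
      have h3 := norm_sub_le ((e : ℂ) • (anti X : L2)) Y
      rw [norm_smul, Complex.norm_real, Real.norm_eq_abs] at h3
      have h4 : |e| * ‖(anti X : L2)‖ ≤ gap κ k / 64 * 1 :=
        mul_le_mul he ((norm_anti_le X).trans hX) (norm_nonneg _) (by positivity)
      linarith
    refine ⟨⟨?_, ?_⟩, ?_, ?_⟩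
    · refine par_bmult h (invSymbol_neg κ k c s) (Par.sub (Par.smul ?_ _) (par_nop hev hEp))
      exact par_anti (by simpa using hG)
    · refine par_bmult h (invSymbol_neg κ k c s) (Par.sub (Par.smul ?_ _) ?_)
      · exact par_anti (by simpa using hF)
      · have := par_nop (b := b) (hk := hk) hev hOp
        rwa [neg_neg] at this
    · exact hx _ _ _ hq' hG1 (by nlinarith)
    · exact hx _ _ _ hp' hF1 (by nlinarith)
  have hcontr : ContractingWith (1 / 2) (hmaps.restrict (planeMap b κ k hk w c s h) S S) := by
    refine ⟨by norm_num, LipschitzWith.of_dist_le_mul ?_⟩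
    rintro ⟨⟨F, G⟩, ⟨hF, hG⟩, hF1, hG1⟩ ⟨⟨F', G'⟩, ⟨hF', hG'⟩, hF1', hG1'⟩
    simp only at hF hG hF1 hG1 hF' hG' hF1' hG1'
    rw [Subtype.dist_eq, Subtype.dist_eq, Set.MapsTo.val_restrict_apply,
        Set.MapsTo.val_restrict_apply]
    simp only [dist_eq_norm, Prod.norm_def, planeMap, Prod.fst_sub, Prod.snd_sub, ← map_sub]
    set d := max ‖F - F'‖ ‖G - G'‖ with hd
    have hdF : ‖F - F'‖ ≤ d := le_max_left _ _
    have hdG : ‖G - G'‖ ≤ d := le_max_right _ _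
    have hd0 : 0 ≤ d := (norm_nonneg _).trans hdF
    have hx : ∀ (e e' : ℝ) (X X' Y Y' : L2), |e| ≤ gap κ k / 64 → |e - e'| ≤ gap κ k / 64 * d →
        ‖X'‖ ≤ 1 → ‖X - X'‖ ≤ d → ‖Y - Y'‖ ≤ gap κ k / 64 * d →
        ‖bmult (fun n => (invSymbol κ k c s n : ℂ)) h ((e : ℂ) • (anti X : L2) - Y
          - ((e' : ℂ) • (anti X' : L2) - Y'))‖ ≤ 1 / 2 * d := by
      intro e e' X X' Y Y' he hee hX hXX hY
      refine (hm _).trans ?_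
      rw [div_mul_eq_mul_div, div_le_iff₀ hg]
      have e1 : (e : ℂ) • (anti X : L2) - Y - ((e' : ℂ) • (anti X' : L2) - Y')
          = (e : ℂ) • ((anti X : L2) - (anti X' : L2)) + ((e - e' : ℝ) : ℂ) • (anti X' : L2)
            - (Y - Y') := by
        push_cast
        module
      have e2 : (anti X : L2) - (anti X' : L2) = (anti (X - X') : L2) := by rw [map_sub]; rfl
      rw [e1, e2]
      have h3 := norm_sub_le ((e : ℂ) • (anti (X - X') : L2) + ((e - e' : ℝ) : ℂ) • (anti X' : L2))
        (Y - Y')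
      have h4 := norm_add_le ((e : ℂ) • (anti (X - X') : L2)) (((e - e' : ℝ) : ℂ) • (anti X' : L2))
      rw [norm_smul, norm_smul, Complex.norm_real, Complex.norm_real, Real.norm_eq_abs,
        Real.norm_eq_abs] at h4
      have h5 : |e| * ‖(anti (X - X') : L2)‖ ≤ gap κ k / 64 * d :=
        mul_le_mul he ((norm_anti_le _).trans hXX) (norm_nonneg _) (by positivity)
      have h6 : |e - e'| * ‖(anti X' : L2)‖ ≤ gap κ k / 64 * d * 1 :=
        mul_le_mul hee ((norm_anti_le _).trans hX) (norm_nonneg _) (by positivity)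
      have h7 : 0 ≤ gap κ k * d := by positivity
      linarith
    have hq := abs_evenEntry_le (b := b) (κ := κ) (c := c) (s := s) (hk := hk) hw F
    have hp := abs_oddEntry_le (b := b) (κ := κ) (c := c) (s := s) (hk := hk) hw G
    have hq' : |evenEntry b κ k hk w c s F| ≤ gap κ k / 64 := by nlinarith
    have hp' : |oddEntry b κ k hk w c s G| ≤ gap κ k / 64 := by nlinarith
    have hNF : N * ‖F - F'‖ ≤ gap κ k / 320 * d := mul_le_mul hK hdF (norm_nonneg _) (by positivity)
    have hNG : N * ‖G - G'‖ ≤ gap κ k / 320 * d := mul_le_mul hK hdG (norm_nonneg _) (by positivity)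
    have h7 : 0 ≤ gap κ k * d := by positivity
    refine max_le ?_ ?_
    · refine hx _ _ _ _ _ _ hq' ((abs_evenEntry_sub_le hw F F').trans ?_) hG1' hdG
        ((norm_nop_anti_sub_le hw _ F F').trans ?_) <;> linarith
    · refine hx _ _ _ _ _ _ hp' ((abs_oddEntry_sub_le hw G G').trans ?_) hF1' hdF
        ((norm_nop_anti_sub_le hw _ G G').trans ?_) <;> linarith
  obtain ⟨⟨F, G⟩, ⟨⟨hF, hG⟩, hF1, hG1⟩, hfix, -⟩ := hcontr.exists_fixedPoint' hSc.isComplete hmaps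
    (x := (0, 0)) ⟨⟨par_zero _, par_zero _⟩, by simp, by simp⟩ (edist_ne_top _ _)
  exact ⟨F, G, hF, hG, hF1, hG1, hfix⟩

end FixedPoint

end BKP

end

/-! ### The invariant plane: existence, spectral completeness, dependence on s -/

open MeasureTheory AddCircle
open scoped Real ENNReal ContDiff

noncomputable section

namespace BKP

open ComplexConjugate

theorem coeff_add_H (U V : H1) (n : ℤ) :
    coeff n ((U + V : H1) : L2) = coeff n (U : L2) + coeff n (V : L2) := by
  rw [Submodule.coe_add, map_add]

theorem coeff_sub_H (U V : H1) (n : ℤ) :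
    coeff n ((U - V : H1) : L2) = coeff n (U : L2) - coeff n (V : L2) := by
  rw [Submodule.coe_sub, map_sub]

theorem coeff_smul_H (t : ℂ) (V : H1) (n : ℤ) :
    coeff n ((t • V : H1) : L2) = t * coeff n (V : L2) := by
  rw [SetLike.val_smul, map_smul, smul_eq_mul]

theorem coeff_cosH_of_two_le {n : ℤ} (hn : 2 ≤ |n|) : coeff n (cosH : L2) = 0 := by
  rw [coeff_cosH, if_neg (by rintro rfl; simp at hn), if_neg (by rintro rfl; simp at hn)]
  simp

theorem coeff_sinH_of_two_le {n : ℤ} (hn : 2 ≤ |n|) : coeff n (sinH : L2) = 0 := by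
  rw [coeff_sinH, if_neg (by rintro rfl; simp at hn), if_neg (by rintro rfl; simp at hn)]
  simp

theorem cases_low (n : ℤ) : n = 0 ∨ n = 1 ∨ n = -1 ∨ 2 ≤ |n| := by
  rw [le_abs]
  lia

theorem coeff_zero_nop' (b k : ℝ) (hk : 0 < k) (w : Profile) (V : H1) :
    coeff 0 (nop b k hk w V) = 0 := by
  rw [coeff_nop]; simp [symD]

theorem coeff_planeMap_fst {b κ k : ℝ} {hk : 0 < k} {w : Profile} {c s : ℝ}
    {h : ∃ C : ℝ, ∀ n, ‖(invSymbol κ k c s n : ℂ)‖ ≤ C} (F G : L2) (n : ℤ) :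
    coeff n (planeMap b κ k hk w c s h (F, G)).1 = invSymbol κ k c s n *
      (evenEntry b κ k hk w c s F * coeff n (anti G : L2)
        - coeff n (nop b k hk w (cosH + anti F))) := by
  simp only [planeMap]
  rw [coeff_bmult, map_sub, map_smul, smul_eq_mul]

theorem coeff_planeMap_snd {b κ k : ℝ} {hk : 0 < k} {w : Profile} {c s : ℝ}
    {h : ∃ C : ℝ, ∀ n, ‖(invSymbol κ k c s n : ℂ)‖ ≤ C} (F G : L2) (n : ℤ) :
    coeff n (planeMap b κ k hk w c s h (F, G)).2 = invSymbol κ k c s n *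
      (oddEntry b κ k hk w c s G * coeff n (anti F : L2)
        - coeff n (nop b k hk w (sinH + anti G))) := by
  simp only [planeMap]
  rw [coeff_bmult, map_sub, map_smul, smul_eq_mul]

theorem nu_ne_zero {κ k c s : ℝ} (hκ : 0 < κ) (hk : 0 < k)
    (hs : |c - κ / (1 + k ^ 2)| + |s| ≤ gap κ k / 4) {n : ℤ} (hn : 2 ≤ |n|) :
    nu κ k c s n ≠ 0 := by
  have hg := gap_pos hκ hk
  have h1 := le_abs_nu hκ hs hn
  have hn1 := one_le_abs_cast (n := n) (by rintro rfl; simp at hn)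
  have : 0 < |nu κ k c s n| := lt_of_lt_of_le (by positivity) h1
  exact abs_pos.1 this

theorem row_of_invSymbol {κ k c s : ℝ} (hκ : 0 < κ) (hk : 0 < k)
    (hs : |c - κ / (1 + k ^ 2)| + |s| ≤ gap κ k / 4) {n : ℤ} (hn : 2 ≤ |n|) {F : L2} {X : ℂ}
    (h : coeff n F = invSymbol κ k c s n * X) :
    Complex.I * nu κ k c s n * coeff n (anti F : L2) = X := by
  have hν : (nu κ k c s n : ℂ) ≠ 0 := by exact_mod_cast nu_ne_zero hκ hk hs hn
  have hn0 : (n : ℂ) ≠ 0 := by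
    have : n ≠ 0 := by rintro rfl; simp at hn
    exact_mod_cast this
  rw [coeff_anti, h, invSymbol, if_neg (by lia), symD]
  push_cast
  have hI := Complex.I_ne_zero
  field_simp

/-- The fixed point solves the rows |n| ≥ 2. The definition of the entries solves the row 1, parity
carries this over to the row -1, and the row 0 is trivial. -/
theorem exists_invPair {b κ k : ℝ} {hk : 0 < k} {w : Profile} {c s K : ℝ} (hκ : 0 < κ)
    (hev : Function.Even w.fn) (hw : C2Bound w K)
    (hs : |c - κ / (1 + k ^ 2)| + |s| ≤ gap κ k / 4)
    (hK : nopC b k * K ≤ gap κ k / 320) (hν : |nu κ k c s 1| ≤ gap κ k / 320) :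
    ∃ (E O : H1) (p q : ℝ), InvPair b κ k hk w c s E O p q ∧ |p| ≤ gap κ k / 64 ∧
      |q| ≤ gap κ k / 64 := by
  have hg := gap_pos hκ hk
  have h : ∃ C : ℝ, ∀ n, ‖(invSymbol κ k c s n : ℂ)‖ ≤ C := ⟨_, norm_invSymbol_le hκ hk hs⟩
  obtain ⟨F, G, hF, hG, hF1, hG1, hfix⟩ := exists_fixedPoint_planeMap (hk :=
      hk) hκ hev hw hs hK hν h
  have hN0 : 0 ≤ nopC b k * K := mul_nonneg (nopC_nonneg b k) hw.nonneg
  have hq := abs_evenEntry_le (b := b) (κ := κ) (c := c) (s := s) (hk := hk) hw F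
  have hp := abs_oddEntry_le (b := b) (κ := κ) (c := c) (s := s) (hk := hk) hw G
  have hf1 : ∀ n, coeff n F = invSymbol κ k c s n *
      (evenEntry b κ k hk w c s F * coeff n (anti G : L2)
        - coeff n (nop b k hk w (cosH + anti F))) := fun n => by
    rw [← coeff_planeMap_fst (b := b) (hk := hk) (w := w) (h := h) F G n, hfix]
  have hg1 : ∀ n, coeff n G = invSymbol κ k c s n *
      (oddEntry b κ k hk w c s G * coeff n (anti F : L2)
        - coeff n (nop b k hk w (sinH + anti G))) := fun n => by
    rw [← coeff_planeMap_snd (b := b) (hk := hk) (w := w) (h := h) F G n, hfix]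
  have hEp : Par 1 ((cosH + anti F : H1) : L2) := par_cosH.add (par_anti (by simpa using hF))
  have hOp : Par (-1) ((sinH + anti G : H1) : L2) := par_sinH.add (par_anti (by simpa using hG))
  have hX := par_nop (b := b) (hk := hk) hev hEp
  have hY := par_nop (b := b) (hk := hk) hev hOp
  have lowF : ∀ n : ℤ, |n| ≤ 1 → coeff n (anti F : L2) = 0 := fun n hn => by
    rw [coeff_anti, hf1, invSymbol, if_pos hn]; simp
  have lowG : ∀ n : ℤ, |n| ≤ 1 → coeff n (anti G : L2) = 0 := fun n hn => by
    rw [coeff_anti, hg1, invSymbol, if_pos hn]; simp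
  refine ⟨anti F, anti G, oddEntry b κ k hk w c s G, evenEntry b κ k hk w c s F,
    ⟨lowF, lowG, fun n => ?_, fun n => ?_⟩, by nlinarith, by nlinarith⟩
  · set X := nop b k hk w (cosH + anti F) with hXd
    have hre : ((coeff 1 X).im : ℂ) = -Complex.I * coeff 1 X := by
      have := (hX 1).1
      rw [Complex.ext_iff] at this
      simp at this
      apply Complex.ext <;> simp
      linarith [this]
    have hq' : (evenEntry b κ k hk w c s F : ℂ) = -nu κ k c s 1 + 2 * Complex.I * coeff 1 X := by
      rw [evenEntry, ← hXd]; push_cast; rw [hre]; ring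
    have hm1 : coeff (-1) X = - coeff 1 X := by simpa using (hX 1).2
    rcases cases_low n with rfl | rfl | rfl | hn
    · rw [coeff_zero_nop', coeff_zero_cosH_add, coeff_zero_sinH_add]; simp
    · rw [coeff_add_H, coeff_add_H, lowF 1 (by simp), lowG 1 (by simp), coeff_cosH, coeff_sinH,
        hq']
      simp
      ring_nf
      rw [Complex.I_sq]
      ring
    · rw [hm1, coeff_add_H, coeff_add_H, lowF (-1) (by simp), lowG (-1) (by simp), coeff_cosH,
        coeff_sinH, hq', nu_neg]
      simp
      ring_nf
      rw [Complex.I_sq]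
      ring
    · rw [coeff_add_H, coeff_add_H, coeff_cosH_of_two_le hn, coeff_sinH_of_two_le hn, zero_add,
        zero_add, row_of_invSymbol hκ hk hs hn (hf1 n)]
      ring
  · set X := nop b k hk w (sinH + anti G) with hXd
    have hre : ((coeff 1 X).re : ℂ) = coeff 1 X := by
      have := (hY 1).1
      rw [Complex.ext_iff] at this
      simp at this
      apply Complex.ext <;> simp
      linarith [this]
    have hq' : (oddEntry b κ k hk w c s G : ℂ) = nu κ k c s 1 + 2 * coeff 1 X := by
      rw [oddEntry, ← hXd]; push_cast; rw [hre]
    have hm1 : coeff (-1) X = coeff 1 X := by simpa using (hY 1).2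
    rcases cases_low n with rfl | rfl | rfl | hn
    · rw [coeff_zero_nop', coeff_zero_cosH_add, coeff_zero_sinH_add]; simp
    · rw [coeff_add_H, coeff_add_H, lowF 1 (by simp), lowG 1 (by simp), coeff_cosH, coeff_sinH,
        hq']
      simp
      ring_nf
      simp
      ring
    · rw [hm1, coeff_add_H, coeff_add_H, lowF (-1) (by simp), lowG (-1) (by simp), coeff_cosH,
        coeff_sinH, hq', nu_neg]
      simp
      ring_nf
      simp
      ring
    · rw [coeff_add_H, coeff_add_H, coeff_cosH_of_two_le hn, coeff_sinH_of_two_le hn, zero_add,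
        zero_add, row_of_invSymbol hκ hk hs hn (hg1 n)]
      ring

/-- For |n| ≥ 2 the frequencies are at least (3/4)·gap·|n|, and |Im λ| ≤ gap/2 is at most
(1/4)·gap·|n|. The half that is left allows `norm_dz_le_of_gap`. -/
theorem norm_dz_le_of_low {b κ k : ℝ} (hκ : 0 < κ) (hk : 0 < k) {w : Profile} {c s K : ℝ} {lam : ℂ}
    (hw : C2Bound w K) (hs : |c - κ / (1 + k ^ 2)| + |s| ≤ gap κ k / 4)
    (hK : nopC b k * K ≤ gap κ k / 320) (hlam : |lam.im| ≤ gap κ k / 2)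
    {D : H1} (hD : ∀ n : ℤ, |n| ≤ 1 → coeff n (D : L2) = 0) {Y : L2}
    (hY : ∀ n : ℤ, 2 ≤ |n| → (Complex.I * nu κ k c s n - lam) * coeff n (D : L2)
      + coeff n (nop b k hk w D) = coeff n Y) : ‖dz D‖ ≤ 4 / gap κ k * ‖Y‖ := by
  have hg := gap_pos hκ hk
  have := norm_dz_le_of_gap (g := gap κ k / 2) (lam := lam) (c := c) (κ := κ) (s := s) (D := D)
    (Y := Y) hk hw (by positivity) (by linarith) {n : ℤ | |n| ≤ 1} (fun n _ hn => ?_)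
    (hD 0 (by simp)) (fun n hn => hD n hn) (fun n _ hn => hY n ?_)
  · convert this using 2
    field_simp
    norm_num
  · have hn2 : 2 ≤ |n| := by
      simp only [Set.mem_ofPred_eq] at hn; lia
    have h1 := le_abs_nu hκ hs hn2
    have h2 := abs_sub_le_norm (nu κ k c s n) lam
    have h3 := abs_sub_abs_le_abs_sub (nu κ k c s n) lam.im
    have h4 : (2 : ℝ) ≤ |(n : ℝ)| := by exact_mod_cast hn2
    nlinarith
  · simp only [Set.mem_ofPred_eq] at hn; lia

section Pair

variable {b κ k : ℝ} {hk : 0 < k} {w : Profile} {c s K : ℝ} {E O : H1} {p q : ℝ}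

/-- The fixed point gives only the bound 1. Here E and O are shown to be as small as the wave: the
forcing is `nop` on cos and sin, and the coupling through p and q is absorbed. -/
theorem InvPair.norm_dz_le (h : InvPair b κ k hk w c s E O p q) (hκ : 0 < κ) (hw : C2Bound w K)
    (hs : |c - κ / (1 + k ^ 2)| + |s| ≤ gap κ k / 4) (hK : nopC b k * K ≤ gap κ k / 320)
    (hp : |p| ≤ gap κ k / 64) (hq : |q| ≤ gap κ k / 64) :
    ‖dz E‖ ≤ 8 * (nopC b k * K) / gap κ k ∧ ‖dz O‖ ≤ 8 * (nopC b k * K) / gap κ k := by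
  have hg := gap_pos hκ hk
  set N := nopC b k * K
  have hN0 : 0 ≤ N := mul_nonneg (nopC_nonneg b k) hw.nonneg
  have hE := norm_le_norm_dz E (h.even_low 0 (by simp))
  have hO := norm_le_norm_dz O (h.odd_low 0 (by simp))
  have c1 := (norm_nop_le b k hk hw cosH (by simp [coeff_cosH])).trans
    (mul_le_of_le_one_right hN0 norm_dz_cosH_le)
  have s1 := (norm_nop_le b k hk hw sinH (by simp [coeff_sinH])).trans
    (mul_le_of_le_one_right hN0 norm_dz_sinH_le)
  have h1 := norm_dz_le_of_low (lam := 0) (Y := (q : ℂ) • (O : L2) - nop b k hk w cosH) hκ hk hw hs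
      hK
    (by simp; positivity) h.even_low (fun n hn => by
      have := h.even_eq n
      rw [coeff_add_H, coeff_add_H, coeff_cosH_of_two_le hn, coeff_sinH_of_two_le hn, map_add,
        map_add] at this
      rw [map_sub, map_smul, smul_eq_mul]
      linear_combination this)
  have h2 := norm_dz_le_of_low (lam := 0) (Y := (p : ℂ) • (E : L2) - nop b k hk w sinH) hκ hk hw hs
      hK
    (by simp; positivity) h.odd_low (fun n hn => by
      have := h.odd_eq n
      rw [coeff_add_H, coeff_add_H, coeff_cosH_of_two_le hn, coeff_sinH_of_two_le hn, map_add,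
        map_add] at this
      rw [map_sub, map_smul, smul_eq_mul]
      linear_combination this)
  have h3 := norm_sub_le ((q : ℂ) • (O : L2)) (nop b k hk w cosH)
  have h4 := norm_sub_le ((p : ℂ) • (E : L2)) (nop b k hk w sinH)
  rw [norm_smul, Complex.norm_real, Real.norm_eq_abs] at h3 h4
  have h5 : |q| * ‖(O : L2)‖ ≤ gap κ k / 64 * ‖dz O‖ :=
    mul_le_mul hq hO (norm_nonneg _) (by positivity)
  have h6 : |p| * ‖(E : L2)‖ ≤ gap κ k / 64 * ‖dz E‖ :=
    mul_le_mul hp hE (norm_nonneg _) (by positivity)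
  rw [div_mul_eq_mul_div, le_div_iff₀ hg] at h1 h2
  rw [le_div_iff₀ hg, le_div_iff₀ hg]
  set g := gap κ k
  constructor <;> nlinarith

theorem InvPair.even_entry (h : InvPair b κ k hk w c s E O p q) :
    (q : ℂ) = -nu κ k c s 1 + 2 * Complex.I * coeff 1 (nop b k hk w (cosH + E)) := by
  have := h.even_eq 1
  rw [coeff_add_H, coeff_add_H, h.even_low 1 (by simp), h.odd_low 1 (by simp), coeff_cosH,
    coeff_sinH] at this
  simp only [if_true, show ¬((1 : ℤ) = -1) by decide, if_false] at this
  have e : (1 / (2 * Complex.I) : ℂ) = -Complex.I / 2 := by simp; ring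
  rw [e] at this
  linear_combination (-2 * Complex.I) * this + (nu κ k c s 1 + q) * Complex.I_sq

theorem InvPair.odd_entry (h : InvPair b κ k hk w c s E O p q) :
    (p : ℂ) = nu κ k c s 1 + 2 * coeff 1 (nop b k hk w (sinH + O)) := by
  have := h.odd_eq 1
  rw [coeff_add_H, coeff_add_H, h.even_low 1 (by simp), h.odd_low 1 (by simp), coeff_cosH,
    coeff_sinH] at this
  simp only [if_true, show ¬((1 : ℤ) = -1) by decide, if_false] at this
  have e : (1 / (2 * Complex.I) : ℂ) = -Complex.I / 2 := by simp; ring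
  rw [e] at this
  linear_combination (-2) * this + (- nu κ k c s 1) * Complex.I_sq

/-- Solutions of `(A - λ) V = x φ + y ψ` lie in the invariant plane. -/
theorem InvPair.eq_of_solution (h : InvPair b κ k hk w c s E O p q) (hκ : 0 < κ) (hw : C2Bound w K)
    (hs : |c - κ / (1 + k ^ 2)| + |s| ≤ gap κ k / 4) (hK : nopC b k * K ≤ gap κ k / 320)
    (hp : |p| ≤ gap κ k / 64) (hq : |q| ≤ gap κ k / 64) {lam : ℂ} (hlam : |lam.im| ≤ gap κ k / 2)
    {V : H1} (hV : coeff 0 (V : L2) = 0) {x y : ℂ}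
    (hVe : ∀ n, Complex.I * nu κ k c s n * coeff n (V : L2) + coeff n (nop b k hk w V)
      - lam * coeff n (V : L2) = x * coeff n ((cosH + E : H1) : L2)
        + y * coeff n ((sinH + O : H1) : L2)) :
    ∃ e f : ℂ, e = coeff 1 (V : L2) + coeff (-1) (V : L2) ∧
      f = Complex.I * (coeff 1 (V : L2) - coeff (-1) (V : L2)) ∧
      V = e • (cosH + E) + f • (sinH + O) ∧ x + lam * e = f * p ∧ y + lam * f = e * q := by
  have hg := gap_pos hκ hk
  set e := coeff 1 (V : L2) + coeff (-1) (V : L2) with he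
  set f := Complex.I * (coeff 1 (V : L2) - coeff (-1) (V : L2)) with hf
  obtain ⟨hE, hO⟩ := h.norm_dz_le hκ hw hs hK hp hq
  set D : H1 := V - (e • (cosH + E) + f • (sinH + O)) with hD
  set X := x + lam * e - f * p with hX
  set Y := y + lam * f - e * q with hY
  have hi : (1 / (2 * Complex.I) : ℂ) = -Complex.I / 2 := by simp; ring
  have hDc : ∀ n, coeff n (D : L2) = coeff n (V : L2)
      - (e * coeff n ((cosH + E : H1) : L2) + f * coeff n ((sinH + O : H1) : L2)) := fun n => by
    rw [hD, coeff_sub_H, coeff_add_H, coeff_smul_H, coeff_smul_H]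
  have hDn : ∀ n, coeff n (nop b k hk w D) = coeff n (nop b k hk w V)
      - (e * coeff n (nop b k hk w (cosH + E)) + f * coeff n (nop b k hk w (sinH + O))) := fun n =>
          by
    rw [hD, map_sub, map_add, map_smul, map_smul, map_sub, map_add, map_smul, map_smul, smul_eq_mul,
      smul_eq_mul]
  have hrow : ∀ n, (Complex.I * nu κ k c s n - lam) * coeff n (D : L2) + coeff n (nop b k hk w D)
      = X * coeff n ((cosH + E : H1) : L2) + Y * coeff n ((sinH + O : H1) : L2) := fun n => by
    rw [hDc, hDn, hX, hY]
    linear_combination hVe n - e * h.even_eq n - f * h.odd_eq n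
  have hlow : ∀ n : ℤ, |n| ≤ 1 → coeff n (D : L2) = 0 := fun n hn => by
    rw [hDc, coeff_add_H, coeff_add_H, h.even_low n hn, h.odd_low n hn, coeff_cosH, coeff_sinH, hi,
      he, hf]
    rcases cases_low n with rfl | rfl | rfl | hn'
    · simp [hV]
    · simp only [if_true, show ¬((1 : ℤ) = -1) by decide, if_false]
      linear_combination (coeff 1 (V : L2) - coeff (-1) (V : L2)) / 2 * Complex.I_sq
    · simp only [if_true, show ¬((-1 : ℤ) = 1) by decide, if_false]
      linear_combination -(coeff 1 (V : L2) - coeff (-1) (V : L2)) / 2 * Complex.I_sq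
    · lia
  have h1 := norm_dz_le_of_low (Y := X • (E : L2) + Y • (O : L2)) hκ hk hw hs hK hlam hlow
    (fun n hn => by
      rw [hrow, coeff_add_H, coeff_add_H, coeff_cosH_of_two_le hn, coeff_sinH_of_two_le hn, map_add,
        map_smul, map_smul, smul_eq_mul, smul_eq_mul, zero_add, zero_add])
  have r1 := hrow 1
  have r2 := hrow (-1)
  rw [hlow 1 (by simp), coeff_add_H, coeff_add_H, h.even_low 1 (by simp), h.odd_low 1 (by simp),
    coeff_cosH, coeff_sinH, hi] at r1
  rw [hlow (-1) (by simp), coeff_add_H, coeff_add_H, h.even_low (-1) (by simp),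
    h.odd_low (-1) (by simp), coeff_cosH, coeff_sinH, hi] at r2
  simp only [if_true, show ¬((1 : ℤ) = -1) by decide, show ¬((-1 : ℤ) = 1) by decide, if_false]
    at r1 r2
  -- The rows ±1 contain no diagonal term, since D vanishes there, so X and Y are small multiples of
  -- ‖dz D‖. The rows |n| ≥ 2 bound ‖dz D‖ by ‖XE + YO‖, which is smaller still, and everything
  -- vanishes.
  have hXe : X = coeff 1 (nop b k hk w D) + coeff (-1) (nop b k hk w D) := by
    linear_combination -r1 - r2
  have hYe : Y = Complex.I * (coeff 1 (nop b k hk w D) - coeff (-1) (nop b k hk w D)) := by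
    linear_combination -Complex.I * (r1 - r2) + Y * Complex.I_sq
  have hn := norm_nop_le b k hk hw D (hlow 0 (by simp))
  set N := nopC b k * K
  have hN0 : 0 ≤ N := mul_nonneg (nopC_nonneg b k) hw.nonneg
  have b1 := (norm_coeff_le 1 (nop b k hk w D)).trans hn
  have b2 := (norm_coeff_le (-1) (nop b k hk w D)).trans hn
  have hXb : ‖X‖ ≤ 2 * (N * ‖dz D‖) := by
    rw [hXe]; exact (norm_add_le _ _).trans (by linarith)
  have hYb : ‖Y‖ ≤ 2 * (N * ‖dz D‖) := by
    rw [hYe, norm_mul, Complex.norm_I, one_mul]; exact (norm_sub_le _ _).trans (by linarith)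
  have hE' := (norm_le_norm_dz E (h.even_low 0 (by simp))).trans hE
  have hO' := (norm_le_norm_dz O (h.odd_low 0 (by simp))).trans hO
  have hr : 8 * N / gap κ k ≤ 1 / 40 := by
    rw [div_le_iff₀ hg]; linarith
  have h2 := norm_add_le (X • (E : L2)) (Y • (O : L2))
  rw [norm_smul, norm_smul] at h2
  have h3 : ‖X‖ * ‖(E : L2)‖ ≤ 2 * (N * ‖dz D‖) * (1 / 40) :=
    mul_le_mul hXb (hE'.trans hr) (norm_nonneg _) (by positivity)
  have h4 : ‖Y‖ * ‖(O : L2)‖ ≤ 2 * (N * ‖dz D‖) * (1 / 40) :=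
    mul_le_mul hYb (hO'.trans hr) (norm_nonneg _) (by positivity)
  rw [div_mul_eq_mul_div, le_div_iff₀ hg] at h1
  have h5 : N * ‖dz D‖ ≤ gap κ k / 320 * ‖dz D‖ :=
    mul_le_mul_of_nonneg_right hK (norm_nonneg _)
  have hz : ‖dz D‖ = 0 := by
    by_contra hne
    have : 0 < gap κ k * ‖dz D‖ := mul_pos hg (lt_of_le_of_ne (norm_nonneg _) (Ne.symm hne))
    linarith
  rw [hz, mul_zero, mul_zero] at hXb hYb
  have hD0 : D = 0 := by
    have h6 := norm_le_norm_dz D (hlow 0 (by simp))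
    rw [hz] at h6
    exact Subtype.ext (norm_le_zero_iff.1 h6)
  refine ⟨e, f, rfl, rfl, sub_eq_zero.1 hD0, ?_, ?_⟩
  · exact sub_eq_zero.1 (norm_le_zero_iff.1 hXb)
  · exact sub_eq_zero.1 (norm_le_zero_iff.1 hYb)

theorem abs_nu_sub_le (κ k c s s' : ℝ) {n : ℤ} (hn : n ≠ 0) :
    |nu κ k c s n - nu κ k c s' n| ≤ |s - s'| := by
  have e : nu κ k c s n - nu κ k c s' n = -((s - s') / (n * (1 + k ^ 2 * (n : ℝ) ^ 2))) := by
    rw [nu, nu]; ring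
  have h1 := one_le_abs_cast hn
  have h2 : 1 ≤ |(n : ℝ) * (1 + k ^ 2 * (n : ℝ) ^ 2)| := by
    rw [abs_mul, abs_of_pos (one_add_pos k n)]
    nlinarith [mul_nonneg (sq_nonneg k) (sq_nonneg (n : ℝ))]
  rw [e, abs_neg, abs_div]
  exact div_le_self (abs_nonneg _) h2

/-- Subtracting the rows for s and s' leaves (ν_n(s) - ν_n(s'))·E'_n as an additional source. It is
at most |s - s'| times E', without loss of derivatives. -/
theorem norm_dz_sub_le {s' : ℝ} {E E' : H1} (hκ : 0 < κ)
    (hw : C2Bound w K) (hs : |c - κ / (1 + k ^ 2)| + |s| ≤ gap κ k / 4)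
    (hK : nopC b k * K ≤ gap κ k / 320) (W W' : H1) (r r' : ℝ)
    (hE : ∀ n : ℤ, |n| ≤ 1 → coeff n (E : L2) = 0)
    (hE' : ∀ n : ℤ, |n| ≤ 1 → coeff n (E' : L2) = 0)
    (hrow : ∀ n : ℤ, 2 ≤ |n| → Complex.I * nu κ k c s n * coeff n (E : L2)
      - Complex.I * nu κ k c s' n * coeff n (E' : L2) + coeff n (nop b k hk w (E - E'))
        = r * coeff n (W : L2) - r' * coeff n (W' : L2)) :
    ‖dz (E - E')‖ ≤ 4 / gap κ k * (|r| * ‖((W - W' : H1) : L2)‖ + |r - r'| * ‖(W' : L2)‖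
      + |s - s'| * ‖(E' : L2)‖) := by
  have hg := gap_pos hκ hk
  obtain ⟨Z, hZ⟩ := exists_coeff_eq_of_le
    (x := fun n => Complex.I * ((nu κ k c s n - nu κ k c s' n : ℝ) : ℂ) * coeff n (E' : L2))
    (K := |s - s'|) (Y := (E' : L2)) fun n => by
      rcases eq_or_ne n 0 with rfl | hn
      · simp only [hE' 0 (by simp)]; simp
      · rw [norm_mul, norm_mul, Complex.norm_I, one_mul, Complex.norm_real, Real.norm_eq_abs]
        exact mul_le_mul_of_nonneg_right (abs_nu_sub_le κ k c s s' hn) (norm_nonneg _)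
  have hZn : ‖Z‖ ≤ |s - s'| * ‖(E' : L2)‖ := norm_le_of_coeff_le (abs_nonneg _) fun n => by
    rw [hZ]
    rcases eq_or_ne n 0 with rfl | hn
    · simp only [hE' 0 (by simp)]; simp
    · rw [norm_mul, norm_mul, Complex.norm_I, one_mul, Complex.norm_real, Real.norm_eq_abs]
      exact mul_le_mul_of_nonneg_right (abs_nu_sub_le κ k c s s' hn) (norm_nonneg _)
  have h1 := norm_dz_le_of_low (lam := 0) (D := E - E')
    (Y := (r : ℂ) • ((W - W' : H1) : L2) + ((r - r' : ℝ) : ℂ) • (W' : L2) - Z) hκ hk hw hs hK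
    (by simp; positivity) (fun n hn => by rw [coeff_sub_H, hE n hn, hE' n hn, sub_zero])
    (fun n hn => by
      rw [map_sub (coeff n), map_add (coeff n), map_smul, map_smul, hZ, coeff_sub_H, coeff_sub_H,
          smul_eq_mul,
        smul_eq_mul]
      push_cast
      linear_combination hrow n hn)
  refine h1.trans (mul_le_mul_of_nonneg_left ?_ (by positivity))
  refine (norm_sub_le _ _).trans (add_le_add ((norm_add_le _ _).trans (add_le_add ?_ ?_)) hZn)
  · rw [norm_smul, Complex.norm_real, Real.norm_eq_abs]
  · rw [norm_smul, Complex.norm_real, Real.norm_eq_abs]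

/-- Here x and y stand for the norms of the derivatives of E - E' and O - O', d for |s - s'|, N for
the size of `nop`, and r for the bound 8N/g of E and O. The estimate for O - O' is the same with x
and y exchanged. -/
theorem contraction_bound {g N d r x y t A B C τ : ℝ} (hg : 0 < g) (hd0 : 0 ≤ d)
    (hN0 : 0 ≤ N) (hNr : N * r ≤ g / 320 * (1 / 40)) (hx : 0 ≤ x) (hA : 0 ≤ A)
    (hB : 0 ≤ B) (ht : |t| ≤ g / 64) (hAy : A ≤ y) (hBr : B ≤ r) (hCr : C ≤ r)
    (hτ : τ ≤ d + 2 * (N * x)) (hxx : x ≤ 4 / g * (|t| * A + τ * B + d * C)) :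
    g * x ≤ 4 * (g / 64 * y + g / 6400 * x + 2 * (d * r)) := by
  rw [div_mul_eq_mul_div, le_div_iff₀ hg] at hxx
  have t1 : |t| * A ≤ g / 64 * y := mul_le_mul ht hAy hA (by positivity)
  have t2 : τ * B ≤ (d + 2 * (N * x)) * r := mul_le_mul hτ hBr hB (by positivity)
  have t3 : d * C ≤ d * r := mul_le_mul_of_nonneg_left hCr hd0
  have t4 : N * r * x ≤ g / 320 * (1 / 40) * x := mul_le_mul_of_nonneg_right hNr hx
  have t5 : (d + 2 * (N * x)) * r = d * r + 2 * (N * r * x) := by ring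
  linarith

/-- Adding the two coupled inequalities absorbs x and y and leaves x + y = O(dr/g). With r = 8N/g
and one more factor N this is quadratic in the wave. -/
theorem sum_le_of_contraction {g N d x y t t' A B C A' B' C' τ τ' : ℝ} (hg : 0 < g) (hd0 : 0 ≤ d)
    (hN0 : 0 ≤ N) (hN : N ≤ g / 320) (hx : 0 ≤ x) (hy : 0 ≤ y) (hA : 0 ≤ A) (hB : 0 ≤ B)
    (hA' : 0 ≤ A') (hB' : 0 ≤ B') (ht : |t| ≤ g / 64) (ht' : |t'| ≤ g / 64) (hAy : A ≤ y)
    (hAx : A' ≤ x) (hBr : B ≤ 8 * N / g) (hCr : C ≤ 8 * N / g) (hBr' : B' ≤ 8 * N / g)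
    (hCr' : C' ≤ 8 * N / g) (hτ : τ ≤ d + 2 * (N * x)) (hτ' : τ' ≤ d + 2 * (N * y))
    (hxx : x ≤ 4 / g * (|t| * A + τ * B + d * C))
    (hyy : y ≤ 4 / g * (|t'| * A' + τ' * B' + d * C')) {z : ℝ} (hz : z ≤ x + y) :
    2 * (N * z) ≤ 512 * N ^ 2 / g ^ 2 * d := by
  set r := 8 * N / g with hr
  have hr0 : 0 ≤ r := by positivity
  have hr1 : r ≤ 1 / 40 := by rw [hr, div_le_iff₀ hg]; linarith
  have hNr : N * r ≤ g / 320 * (1 / 40) := mul_le_mul hN hr1 hr0 (by positivity)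
  have bx := contraction_bound hg hd0 hN0 hNr hx hA hB ht hAy hBr hCr hτ hxx
  have bY := contraction_bound hg hd0 hN0 hNr hy hA' hB' ht' hAx hBr' hCr' hτ' hyy
  have hgx : 0 ≤ g * x := by positivity
  have hgy : 0 ≤ g * y := by positivity
  have hsum : x + y ≤ 32 * (d * r) / g := by
    rw [le_div_iff₀ hg]
    have : 0 ≤ d * r := by positivity
    linarith
  have := mul_le_mul_of_nonneg_left (hz.trans hsum) hN0
  have e : 512 * N ^ 2 / g ^ 2 * d = 2 * (N * (32 * (d * r) / g)) := by
    rw [hr]; field_simp; ring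
  rw [e]
  linarith

theorem InvPair.even_entry_sub {s' : ℝ} {E' O' : H1} {p' q' : ℝ}
    (h : InvPair b κ k hk w c s E O p q) (h' : InvPair b κ k hk w c s' E' O' p' q')
    (hw : C2Bound w K) :
    |q - q' - (s - s') / (1 + k ^ 2)| ≤ 2 * (nopC b k * K * ‖dz (E - E')‖) := by
  have hν : nu κ k c s 1 - nu κ k c s' 1 = -((s - s') / (1 + k ^ 2)) := by
    rw [nu_one, nu_one]; ring
  have e : ((q - q' - (s - s') / (1 + k ^ 2) : ℝ) : ℂ)
      = 2 * Complex.I * coeff 1 (nop b k hk w (E - E')) := by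
    have e1 : (E - E' : H1) = (cosH + E) - (cosH + E') := by abel
    have e2 : ((nu κ k c s 1 - nu κ k c s' 1 : ℝ) : ℂ) = ((-((s - s') / (1 + k ^ 2)) : ℝ) : ℂ) := by
      rw [hν]
    rw [e1, map_sub, map_sub]
    push_cast at e2 ⊢
    rw [h.even_entry, h'.even_entry]
    linear_combination -e2
  have := congrArg norm e
  rw [Complex.norm_real, norm_mul, norm_mul, Complex.norm_I, Real.norm_eq_abs] at this
  rw [this]
  have h2 : ‖(2 : ℂ)‖ = 2 := by norm_num
  rw [h2, mul_one]
  exact mul_le_mul_of_nonneg_left ((norm_coeff_le _ _).trans (norm_nop_le b k hk hw (E - E') (by rw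
      [coeff_sub_H, h.even_low 0 (by simp), h'.even_low 0 (by simp), sub_zero]))) zero_le_two

theorem InvPair.odd_entry_sub {s' : ℝ} {E' O' : H1} {p' q' : ℝ}
    (h : InvPair b κ k hk w c s E O p q) (h' : InvPair b κ k hk w c s' E' O' p' q')
    (hw : C2Bound w K) :
    |p - p' + (s - s') / (1 + k ^ 2)| ≤ 2 * (nopC b k * K * ‖dz (O - O')‖) := by
  have hν : nu κ k c s 1 - nu κ k c s' 1 = -((s - s') / (1 + k ^ 2)) := by
    rw [nu_one, nu_one]; ring
  have e : ((p - p' + (s - s') / (1 + k ^ 2) : ℝ) : ℂ)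
      = 2 * coeff 1 (nop b k hk w (O - O')) := by
    have e1 : (O - O' : H1) = (sinH + O) - (sinH + O') := by abel
    have e2 : ((nu κ k c s 1 - nu κ k c s' 1 : ℝ) : ℂ) = ((-((s - s') / (1 + k ^ 2)) : ℝ) : ℂ) := by
      rw [hν]
    rw [e1, map_sub, map_sub]
    push_cast at e2 ⊢
    rw [h.odd_entry, h'.odd_entry]
    linear_combination e2
  have := congrArg norm e
  rw [Complex.norm_real, norm_mul, Real.norm_eq_abs] at this
  rw [this]
  have h2 : ‖(2 : ℂ)‖ = 2 := by norm_num
  rw [h2]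
  exact mul_le_mul_of_nonneg_left ((norm_coeff_le _ _).trans (norm_nop_le b k hk hw (O - O') (by
    rw [coeff_sub_H, h.odd_low 0 (by simp), h'.odd_low 0 (by simp), sub_zero]))) zero_le_two

/-- The entries depend on s directly through ν_1, which is affine with slope -1/(1+k²), and
indirectly through `nop` applied to E or O. The change of E and O is of order N|s - s'|, and `nop`
adds a further factor N. -/
theorem InvPair.entries_sub {s' : ℝ} {E' O' : H1} {p' q' : ℝ}
    (h : InvPair b κ k hk w c s E O p q) (h' : InvPair b κ k hk w c s' E' O' p' q') (hκ : 0 < κ)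
    (hw : C2Bound w K) (hs : |c - κ / (1 + k ^ 2)| + |s| ≤ gap κ k / 4)
    (hs' : |c - κ / (1 + k ^ 2)| + |s'| ≤ gap κ k / 4) (hK : nopC b k * K ≤ gap κ k / 320)
    (hp : |p| ≤ gap κ k / 64) (hq : |q| ≤ gap κ k / 64)
    (hp' : |p'| ≤ gap κ k / 64) (hq' : |q'| ≤ gap κ k / 64) :
    |q - q' - (s - s') / (1 + k ^ 2)| ≤ 512 * (nopC b k * K) ^ 2 / gap κ k ^ 2 * |s - s'| ∧
    |p - p' + (s - s') / (1 + k ^ 2)| ≤ 512 * (nopC b k * K) ^ 2 / gap κ k ^ 2 * |s - s'| := by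
  have hg := gap_pos hκ hk
  obtain ⟨hE, hO⟩ := h'.norm_dz_le hκ hw hs' hK hp' hq'
  set N := nopC b k * K
  have hN0 : 0 ≤ N := mul_nonneg (nopC_nonneg b k) hw.nonneg
  have hE' := (norm_le_norm_dz E' (h'.even_low 0 (by simp))).trans hE
  have hO' := (norm_le_norm_dz O' (h'.odd_low 0 (by simp))).trans hO
  have lowE : ∀ n : ℤ, |n| ≤ 1 → coeff n ((E - E' : H1) : L2) = 0 := fun n hn => by
    rw [coeff_sub_H, h.even_low n hn, h'.even_low n hn, sub_zero]
  have lowO : ∀ n : ℤ, |n| ≤ 1 → coeff n ((O - O' : H1) : L2) = 0 := fun n hn => by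
    rw [coeff_sub_H, h.odd_low n hn, h'.odd_low n hn, sub_zero]
  have hdE := norm_le_norm_dz _ (lowE 0 (by simp))
  have hdO := norm_le_norm_dz _ (lowO 0 (by simp))
  have hqd := h.even_entry_sub h' hw
  have hpd := h.odd_entry_sub h' hw
  have hfrac : |(s - s') / (1 + k ^ 2)| ≤ |s - s'| := by
    rw [abs_div, abs_of_pos (by positivity : 0 < 1 + k ^ 2)]
    exact div_le_self (abs_nonneg _) (by nlinarith [sq_nonneg k])
  have hq1 : |q - q'| ≤ |s - s'| + 2 * (N * ‖dz (E - E')‖) := by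
    have := abs_add_le (q - q' - (s - s') / (1 + k ^ 2)) ((s - s') / (1 + k ^ 2))
    rw [sub_add_cancel] at this
    linarith
  have hp1 : |p - p'| ≤ |s - s'| + 2 * (N * ‖dz (O - O')‖) := by
    have := abs_sub (p - p' + (s - s') / (1 + k ^ 2)) ((s - s') / (1 + k ^ 2))
    rw [add_sub_cancel_right] at this
    linarith
  have kE := norm_dz_sub_le (s' := s') (E := E) (E' := E') hκ hw hs hK O O' q q' h.even_low
      h'.even_low fun n hn => by
    have a1 := h.even_eq n
    have a2 := h'.even_eq n
    rw [coeff_add_H, coeff_add_H, coeff_cosH_of_two_le hn, coeff_sinH_of_two_le hn, map_add,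
      map_add] at a1 a2
    rw [map_sub, map_sub]
    linear_combination a1 - a2
  have kO := norm_dz_sub_le (s' := s') (E := O) (E' := O') hκ hw hs hK E E' p p' h.odd_low
      h'.odd_low fun n hn => by
    have a1 := h.odd_eq n
    have a2 := h'.odd_eq n
    rw [coeff_add_H, coeff_add_H, coeff_cosH_of_two_le hn, coeff_sinH_of_two_le hn, map_add,
      map_add] at a1 a2
    rw [map_sub, map_sub]
    linear_combination a1 - a2
  have hsum := fun {z : ℝ} => sum_le_of_contraction (z := z) hg (abs_nonneg (s - s')) hN0 hK
    (norm_nonneg (dz (E - E'))) (norm_nonneg (dz (O - O'))) (norm_nonneg _) (norm_nonneg _)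
    (norm_nonneg _) (norm_nonneg _) hq hp hdO hdE hO' hE' hE' hO' hq1 hp1 kE kO
  exact ⟨hqd.trans (hsum (le_add_of_nonneg_right (norm_nonneg _))),
    hpd.trans (hsum (le_add_of_nonneg_left (norm_nonneg _)))⟩

end Pair

end BKP

end

open MeasureTheory AddCircle
open scoped Real ENNReal ContDiff

noncomputable section

namespace BKP

open ComplexConjugate

/-! ### Algebra of profiles -/

namespace Profile

/-- The sum of two profiles. -/
def add (u v : Profile) : Profile :=
  ⟨fun z => u.fn z + v.fn z, u.smooth.add v.smooth, u.periodic.add v.periodic⟩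

/-- The product of two profiles. -/
def mul (u v : Profile) : Profile :=
  ⟨fun z => u.fn z * v.fn z, u.smooth.mul v.smooth, u.periodic.mul v.periodic⟩

/-- A multiple of a profile. -/
def smul (r : ℝ) (u : Profile) : Profile :=
  ⟨fun z => r * u.fn z, contDiff_const.mul u.smooth, fun z => by simp only [u.periodic z]⟩

/-- The profile `cos`. -/
def cos : Profile := ⟨Real.cos, Real.contDiff_cos, Real.cos_periodic⟩

theorem onCirc_apply_coe (u : Profile) (z : ℝ) : u.onCirc (z : Circ) = (u.fn z : ℂ) := rfl

theorem toL2_congr {u v : Profile} (h : ∀ z, u.fn z = v.fn z) : u.toL2 = v.toL2 := by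
  have : u.onCirc = v.onCirc := by
    ext x
    induction x using QuotientAddGroup.induction_on with
    | H z => rw [onCirc_apply_coe, onCirc_apply_coe, h z]
  refine Lp.ext ?_
  filter_upwards [coeFn_toL2 u, coeFn_toL2 v] with x h1 h2
  rw [h1, h2, this]

theorem toL2_add (u v : Profile) : (u.add v).toL2 = u.toL2 + v.toL2 := by
  refine Lp.ext ?_
  filter_upwards [coeFn_toL2 u, coeFn_toL2 v, coeFn_toL2 (u.add v), Lp.coeFn_add u.toL2 v.toL2]
    with x h1 h2 h3 h4
  rw [h3, h4, Pi.add_apply, h1, h2]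
  induction x using QuotientAddGroup.induction_on with
  | H z => exact Complex.ofReal_add _ _

theorem toL2_smul (r : ℝ) (u : Profile) : (smul r u).toL2 = (r : ℂ) • u.toL2 := by
  refine Lp.ext ?_
  filter_upwards [coeFn_toL2 u, coeFn_toL2 (smul r u), Lp.coeFn_smul (r : ℂ) u.toL2]
    with x h1 h2 h3
  rw [h2, h3, Pi.smul_apply, h1]
  induction x using QuotientAddGroup.induction_on with
  | H z => exact Complex.ofReal_mul _ _

theorem toL2_mul (u v : Profile) : (u.mul v).toL2 = mulOp u v.toL2 := by
  refine Lp.ext ?_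
  filter_upwards [coeFn_toL2 v, coeFn_toL2 (u.mul v), coeFn_mulOp u v.toL2] with x h1 h2 h3
  rw [h2, h3, h1]
  induction x using QuotientAddGroup.induction_on with
  | H z => exact Complex.ofReal_mul _ _

theorem hat_congr {u v : Profile} (h : ∀ z, u.fn z = v.fn z) (n : ℤ) : u.hat n = v.hat n := by
  rw [← coeff_toL2, ← coeff_toL2, toL2_congr h]

theorem hat_add (u v : Profile) (n : ℤ) : (u.add v).hat n = u.hat n + v.hat n := by
  rw [← coeff_toL2, toL2_add, map_add, coeff_toL2, coeff_toL2]

theorem hat_smul (r : ℝ) (u : Profile) (n : ℤ) : (smul r u).hat n = r * u.hat n := by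
  rw [← coeff_toL2, toL2_smul, map_smul, coeff_toL2, smul_eq_mul]

theorem hasSum_hat_mul (u v : Profile) (n : ℤ) :
    HasSum (fun m => u.hat (n - m) * v.hat m) ((u.mul v).hat n) := by
  have h := hasSum_coeff_mulOp u v.toL2 n
  rw [← toL2_mul, coeff_toL2] at h
  simpa only [coeff_toL2] using h

/-- A profile as an element of `H¹`. -/
def toH1 (w : Profile) : H1 := ⟨w.toL2, by
  change Memℓp _ 2
  have : (fun n => symD n * coeff n w.toL2) = fun n => coeff n w.deriv.toL2 := by
    ext n
    rw [coeff_toL2, coeff_toL2, hat_deriv, symD]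
  rw [this]
  exact memlp_coeff _⟩

theorem coeff_toH1 (w : Profile) (n : ℤ) : coeff n (w.toH1 : L2) = w.hat n := coeff_toL2 w n

/-- The quadratic part of the wave equation. -/
def quad (b k : ℝ) (w : Profile) : Profile :=
  (smul ((b + 1) / 2) (w.mul w)).add
    ((smul (-k ^ 2) (w.mul w.deriv.deriv)).add (smul (-((b - 1) / 2 * k ^ 2)) (w.deriv.mul
        w.deriv)))

theorem quad_fn (b k : ℝ) (w : Profile) (z : ℝ) : (quad b k w).fn z = (b + 1) / 2 * w.fn z ^ 2
    - k ^ 2 * w.fn z * w.deriv.deriv.fn z - (b - 1) / 2 * k ^ 2 * w.deriv.fn z ^ 2 := by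
  simp only [quad, add, smul, mul]
  ring

theorem hat_deriv_deriv (w : Profile) (n : ℤ) : w.deriv.deriv.hat n = -(n : ℂ) ^ 2 * w.hat n := by
  rw [hat_deriv, hat_deriv]
  linear_combination (n : ℂ) ^ 2 * w.hat n * Complex.I_sq

/-- Adding the convolution to itself after the exchange m ↔ n - m symmetrizes the term ww''. This is
the origin of the factor 2. -/
theorem hasSum_quad (b k : ℝ) (w : Profile) (n : ℤ) :
    HasSum (fun m => kern b k (n - m) m * (w.hat (n - m) * w.hat m)) (2 * (quad b k w).hat n) := by
  have h1 := (hasSum_hat_mul w w n).mul_left (((b + 1) / 2 : ℝ) : ℂ)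
  have h2 := (hasSum_hat_mul w w.deriv.deriv n).mul_left ((-k ^ 2 : ℝ) : ℂ)
  have h3 := (hasSum_hat_mul w.deriv w.deriv n).mul_left ((-((b - 1) / 2 * k ^ 2) : ℝ) : ℂ)
  have h := h1.add (h2.add h3)
  have h' := (Equiv.hasSum_iff (Equiv.subLeft n)).2 h
  have e : (quad b k w).hat n = ((b + 1) / 2 : ℝ) * (w.mul w).hat n
      + ((-k ^ 2 : ℝ) * (w.mul w.deriv.deriv).hat n
        + (-((b - 1) / 2 * k ^ 2) : ℝ) * (w.deriv.mul w.deriv).hat n) := by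
    rw [quad, hat_add, hat_add, hat_smul, hat_smul, hat_smul]
  rw [two_mul, e]
  refine (h.add h').congr_fun fun m => ?_
  simp only [Function.comp_apply, Equiv.subLeft_apply, sub_sub_cancel, hat_deriv, kern]
  push_cast
  ring_nf
  rw [Complex.I_sq]
  ring

end Profile

/-! ### The wave equation and the translation mode in Fourier variables -/

open Profile

theorem IsWave.quad_hat {b κ k a c : ℝ} {w : Profile} (h : IsWave b κ k a w c) (n : ℤ) :
    (quad b k w).hat n = -((κ - c - c * k ^ 2 * (n : ℝ) ^ 2 : ℝ) : ℂ) * w.hat n := by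
  have e : ∀ z, (quad b k w).fn z
      = ((smul (-(κ - c)) w).add (smul (-(c * k ^ 2)) w.deriv.deriv)).fn z := fun z => by
    rw [quad_fn]
    simp only [add, smul]
    linarith [h.equation z]
  rw [hat_congr e, hat_add, hat_smul, hat_smul, hat_deriv_deriv]
  push_cast
  ring

theorem IsWave.hasSum_kern {b κ k a c : ℝ} {w : Profile} (h : IsWave b κ k a w c) (n : ℤ) :
    HasSum (fun m => kern b k (n - m) m * (w.hat (n - m) * w.hat m))
      (-2 * ((κ - c - c * k ^ 2 * (n : ℝ) ^ 2 : ℝ) : ℂ) * w.hat n) := by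
  have := hasSum_quad b k w n
  rw [h.quad_hat] at this
  convert this using 1
  ring

/-- The derivative of the wave equation. By symmetry of the kernel the factors im and i(n - m)
average to in/2, and the sum in the wave equation for the mode n reappears. -/
theorem IsWave.conv_deriv {b κ k a c : ℝ} {w : Profile} (h : IsWave b κ k a w c) (n : ℤ) :
    conv b k w w.deriv.toH1 n
      = -(Complex.I * n) * ((κ - c - c * k ^ 2 * (n : ℝ) ^ 2 : ℝ) : ℂ) * w.hat n := by
  have h1 := hasSum_conv b k w w.deriv.toH1 n
  have h2 := (Equiv.hasSum_iff (Equiv.subLeft n)).2 h1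
  have h3 := (h.hasSum_kern n).mul_left (Complex.I * n)
  have := (h1.add h2).unique (h3.congr_fun fun m => ?_)
  · linear_combination this / 2
  · simp only [Function.comp_apply, Equiv.subLeft_apply, sub_sub_cancel, coeff_toH1, hat_deriv,
      kern_comm b k m]
    push_cast
    ring

/-- The translation mode. -/
theorem IsWave.isEigen_deriv {b κ k a c : ℝ} {hk : 0 < k} {w : Profile} (h : IsWave b κ k a w c) :
    IsEigen b κ k hk w c 0 0 w.deriv.toH1 := by
  refine ⟨by rw [coeff_toH1, hat_deriv]; simp, fun n => ?_⟩
  rw [coeff_nop, h.conv_deriv, coeff_toH1, hat_deriv, nu, zero_div, sub_zero, symD, symS]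
  have h1 : (1 + (k : ℂ) ^ 2 * (n : ℂ) ^ 2) ≠ 0 := by exact_mod_cast (one_add_pos k n).ne'
  have h2 : 1 / (1 + (k : ℂ) ^ 2 * (n : ℂ) ^ 2) * (1 + (k : ℂ) ^ 2 * (n : ℂ) ^ 2) = 1 :=
    one_div_mul_cancel h1
  push_cast
  linear_combination -(Complex.I ^ 2 * (n : ℂ) ^ 2 * w.hat n * c) * h2

theorem IsWave.hat_one {b κ k a c : ℝ} {w : Profile} (h : IsWave b κ k a w c) :
    w.hat 1 = (a / 2 : ℝ) := by
  have h1 : w.hat 1 + w.hat (-1) = a := by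
    rw [← h.amplitude, hat_eq_integral, hat_eq_integral, ← smul_add,
      ← intervalIntegral.integral_add]
    · have e : ∀ z : ℝ, fourier (-1) (z : Circ) * (w.fn z : ℂ) + fourier (- -1) (z : Circ) * (w.fn
        z : ℂ)
          = ((2 * (w.fn z * Real.cos z) : ℝ) : ℂ) := fun z => by
        rw [fourier_coe_apply, fourier_coe_apply]
        have hπ : (π : ℂ) ≠ 0 := by exact_mod_cast Real.pi_ne_zero
        have e1 : 2 * (π : ℂ) * Complex.I * ((-1 : ℤ) : ℂ) * z / ((2 * π : ℝ) : ℂ)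
            = -z * Complex.I := by
          push_cast; field_simp
        have e2 : 2 * (π : ℂ) * Complex.I * ((- -1 : ℤ) : ℂ) * z / ((2 * π : ℝ) : ℂ)
            = z * Complex.I := by
          push_cast; field_simp
        rw [e1, e2]
        push_cast
        rw [Complex.cos]
        ring
      simp only [e]
      rw [intervalIntegral.integral_ofReal, intervalIntegral.integral_const_mul, Complex.real_smul,
        ← Complex.ofReal_mul]
      congr 1
      ring
    · exact (((map_continuous (fourier (-1))).comp (AddCircle.continuous_mk' _)).mul
        (Complex.continuous_ofReal.comp w.smooth.continuous)).intervalIntegrable _ _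
    · exact (((map_continuous (fourier (- -1))).comp (AddCircle.continuous_mk' _)).mul
        (Complex.continuous_ofReal.comp w.smooth.continuous)).intervalIntegrable _ _
  rw [hat_neg_of_even w h.even] at h1
  push_cast
  linear_combination h1 / 2

/-! ### Eigenvalues on the invariant plane -/

section Pair

variable {b κ k : ℝ} {hk : 0 < k} {w : Profile} {c s K : ℝ} {E O : H1} {p q : ℝ}

theorem InvPair.sq_eq_of_isEigen (h : InvPair b κ k hk w c s E O p q) (hκ : 0 < κ)
    (hw : C2Bound w K) (hs : |c - κ / (1 + k ^ 2)| + |s| ≤ gap κ k / 4)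
    (hK : nopC b k * K ≤ gap κ k / 320) (hp : |p| ≤ gap κ k / 64) (hq : |q|
        ≤ gap κ k / 64) {lam : ℂ}
    (hlam : |lam.im| ≤ gap κ k / 2) {V : H1} (hV : IsEigen b κ k hk w c s lam V) (hV0 : V ≠ 0) :
    lam ^ 2 = p * q := by
  obtain ⟨e, f, -, -, hVe, h1, h2⟩ := h.eq_of_solution hκ hw hs hK hp hq hlam hV.1 (x := 0) (y := 0)
    (fun n => by linear_combination hV.2 n)
  have h3 : (lam ^ 2 - p * q) * e = 0 := by linear_combination lam * h1 + p * h2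
  have h4 : (lam ^ 2 - p * q) * f = 0 := by linear_combination q * h1 + lam * h2
  by_contra hne
  rw [← sub_eq_zero] at hne
  refine hV0 ?_
  rw [hVe, (mul_eq_zero.1 h3).resolve_left hne, (mul_eq_zero.1 h4).resolve_left hne, zero_smul,
    zero_smul, add_zero]

/-- At s = 0 the derivative w' lies in the kernel, hence in the plane. Its component along sin + O
is -a ≠ 0, and the operator maps sin + O to p(cos + E). -/
theorem InvPair.odd_entry_eq_zero {a : ℝ} (h : InvPair b κ k hk w c 0 E O p q) (hκ : 0 < κ)
    (hw : C2Bound w K) (hs : |c - κ / (1 + k ^ 2)| ≤ gap κ k / 4)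
    (hK : nopC b k * K ≤ gap κ k / 320) (hp : |p| ≤ gap κ k / 64) (hq : |q| ≤ gap κ k / 64)
    (hwave : IsWave b κ k a w c) (ha : a ≠ 0) : p = 0 := by
  have hV := hwave.isEigen_deriv (hk := hk)
  obtain ⟨e, f, -, hf, -, h1, -⟩ := h.eq_of_solution (lam := 0) hκ hw (by simpa using hs) hK hp hq
    (by
      rw [Complex.zero_im, abs_zero]
      exact (half_pos (gap_pos hκ hk)).le) hV.1 (x := 0) (y := 0) (fun n =>
          by linear_combination hV.2 n)
  have hf' : f = -a := by
    rw [hf, coeff_toH1, coeff_toH1, hat_deriv, hat_deriv, hat_neg_of_even w hwave.even,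
      hwave.hat_one]
    push_cast
    linear_combination (a : ℂ) * Complex.I_sq
  rw [hf', zero_mul, zero_add] at h1
  have : (-a * p : ℂ) = 0 := h1.symm
  have ha' : (a : ℂ) ≠ 0 := by exact_mod_cast ha
  have : (p : ℂ) = 0 := by simpa [ha'] using this
  exact_mod_cast this

theorem InvPair.isSimpleEigenvalue {ℓ : ℝ} (h : InvPair b κ k hk w c (ℓ ^ 2) E O p q) (hκ : 0 < κ)
    (hw : C2Bound w K) (hs : |c - κ / (1 + k ^ 2)| + |ℓ ^ 2| ≤ gap κ k / 4)
    (hK : nopC b k * K ≤ gap κ k / 320) (hp : |p| ≤ gap κ k / 64) (hq : |q|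
        ≤ gap κ k / 64) {lam : ℂ}
    (hlam : |lam.im| ≤ gap κ k / 2) (hlam0 : lam ≠ 0) (hsq : lam ^ 2 = p * q) :
    IsSimpleEigenvalue (A 1 b κ k hk w c ℓ) lam := by
  have hp0 : (p : ℂ) ≠ 0 := fun h0 => hlam0 (by simpa [h0] using hsq)
  -- The eigenvector of the matrix with off-diagonal entries p, q, for λ² = pq.
  set v : H1 := (p : ℂ) • (cosH + E) + lam • (sinH + O) with hv
  have hvc : ∀ n, coeff n (v : L2) = p * coeff n ((cosH + E : H1) : L2)
      + lam * coeff n ((sinH + O : H1) : L2) := fun n => by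
    rw [hv, coeff_add_H, coeff_smul_H, coeff_smul_H]
  have h0 : coeff 0 (v : L2) = 0 := by
    rw [hvc, coeff_add_H, coeff_add_H, h.even_low 0 (by simp), h.odd_low 0 (by simp), coeff_cosH,
      coeff_sinH]
    simp
  have hveig : IsEigen b κ k hk w c (ℓ ^ 2) lam v := by
    refine ⟨h0, fun n => ?_⟩
    rw [hvc, hv, map_add, map_smul, map_smul, map_add, map_smul, map_smul, smul_eq_mul, smul_eq_mul]
    linear_combination p * h.even_eq n + lam * h.odd_eq n
      - hsq * coeff n ((sinH + O : H1) : L2)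
  have hvne : v ≠ 0 := fun hv0 => by
    have h1 := hvc 1
    have h2 := hvc (-1)
    rw [hv0, coeff_add_H, coeff_add_H, h.even_low 1 (by simp), h.odd_low 1 (by simp), coeff_cosH,
      coeff_sinH] at h1
    rw [hv0, coeff_add_H, coeff_add_H, h.even_low (-1) (by simp), h.odd_low (-1) (by simp),
      coeff_cosH, coeff_sinH] at h2
    simp at h1 h2
    exact hp0 (by linear_combination -h1 - h2)
  let x : (A 1 b κ k hk w c ℓ).domain := ⟨⟨(v : L2), h0⟩, v.2⟩
  refine ⟨x, ?_, (A_eq_smul_iff x).2 hveig, fun u hu => ?_, fun u hu => ?_⟩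
  · intro hx
    apply hvne
    have := congrArg (fun y : (A 1 b κ k hk w c ℓ).domain => ((y : L20) : L2)) hx
    exact Subtype.ext this
  · have hu' := (A_eq_smul_iff u).1 hu
    obtain ⟨e, f, -, -, hUe, h1, h2⟩ := h.eq_of_solution hκ hw hs hK hp hq hlam hu'.1 (x :=
        0) (y := 0)
      (fun n => by linear_combination hu'.2 n)
    refine ⟨f / lam, ?_⟩
    have h3 : e = f / lam * p := by
      field_simp
      linear_combination h1
    have h4 : f = f / lam * lam := by field_simp
    have h5 : (⟨((u : L20) : L2), u.2⟩ : H1) = (f / lam) • v := by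
      rw [hUe, hv, smul_add (f / lam), smul_smul, smul_smul, ← h3, ← h4]
    have h6 := congrArg (fun y : H1 => (y : L2)) h5
    exact Subtype.ext (Subtype.ext h6)
  · set U : H1 := ⟨((u : L20) : L2), u.2⟩ with hU
    have hrow : ∀ n, Complex.I * nu κ k c (ℓ ^ 2) n * coeff n (U : L2) + coeff n (nop b k hk w U)
        - lam * coeff n (U : L2) = p * coeff n ((cosH + E : H1) : L2)
          + lam * coeff n ((sinH + O : H1) : L2) := fun n => by
      have h1 := congrArg (fun y : L20 => coeff n (y : L2)) hu
      have h2 : coeff n ((A 1 b κ k hk w c ℓ u - lam • (u : L20) : L20) : L2)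
          = coeff n (linOp 1 b κ k hk w c ℓ U) - lam * coeff n (U : L2) := by
        rw [Submodule.coe_sub, map_sub, coe_A_apply, SetLike.val_smul, map_smul, smul_eq_mul]
      rw [← hvc, ← coeff_linOp, ← h2]
      exact h1
    obtain ⟨e, f, -, -, -, h1, h2⟩ := h.eq_of_solution hκ hw hs hK hp hq hlam (coeff_zero_L20 _)
        hrow
    -- A Jordan chain would also lie in the plane, and there its two equations combine with λ² = pq
    -- to 2λ² = 0.
    have : 2 * lam ^ 2 = 0 := by linear_combination lam * h2 + q * h1 - (f - 1) * hsq
    simp [hlam0] at this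

end Pair

end BKP

end

open MeasureTheory AddCircle
open scoped Real ENNReal ContDiff

noncomputable section

namespace BKP

open ComplexConjugate

/-! ### A priori bounds for small waves -/

theorem Profile.hasDerivAt (w : Profile) (z : ℝ) : HasDerivAt w.fn (w.deriv.fn z) z :=
  (w.smooth.differentiable (by simp) z).hasDerivAt

theorem integral_cos_sq_period : ∫ z in (0 : ℝ)..2 * π, Real.cos z ^ 2 = π := by
  rw [integral_cos_sq]
  simp

theorem integral_sub_mul_cos {r : ℝ → ℝ} (hr : Continuous r) (t : ℝ) :
    ∫ z in (0 : ℝ)..2 * π, (r z - t * Real.cos z) * Real.cos z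
      = (∫ z in (0 : ℝ)..2 * π, r z * Real.cos z) - t * π := by
  have i1 : IntervalIntegrable (fun z => r z * Real.cos z) volume 0 (2 * π) :=
    (hr.mul Real.continuous_cos).intervalIntegrable _ _
  have i2 : IntervalIntegrable (fun z => t * Real.cos z ^ 2) volume 0 (2 * π) :=
    (continuous_const.mul (Real.continuous_cos.pow 2)).intervalIntegrable _ _
  have e : t * π = ∫ z in (0 : ℝ)..2 * π, t * Real.cos z ^ 2 := by
    rw [intervalIntegral.integral_const_mul, integral_cos_sq_period]
  rw [e, ← intervalIntegral.integral_sub i1 i2]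
  congr 1
  ext z
  ring

theorem abs_mul_add_le {x y η θ : ℝ} (hx : |x| ≤ η) (hy : |y| ≤ η) :
    |x * Real.cos θ + y * Real.sin θ| ≤ 2 * η := by
  refine (abs_add_le _ _).trans ?_
  rw [abs_mul, abs_mul]
  have h1 := mul_le_of_le_one_right (abs_nonneg x) (Real.abs_cos_le_one θ)
  have h2 := mul_le_of_le_one_right (abs_nonneg y) (Real.abs_sin_le_one θ)
  linarith

/-- Bounds for even periodic solutions of `r'' + r = ρ` which are orthogonal to `cos`. -/
theorem ode_bound {r r₁ r₂ : ℝ → ℝ} (h1 : ∀ z, HasDerivAt r (r₁ z) z)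
    (h2 : ∀ z, HasDerivAt r₁ (r₂ z) z) (hev : Function.Even r) (hper : Function.Periodic r (2 * π))
    (hcos : ∫ z in (0 : ℝ)..2 * π, r z * Real.cos z = 0) {η : ℝ} (hη : ∀ z, |r z + r₂ z| ≤ η)
    (z : ℝ) : |r z| ≤ 100 * η ∧ |r₁ z| ≤ 100 * η ∧ |r₂ z| ≤ 101 * η := by
  have hη0 : 0 ≤ η := (abs_nonneg _).trans (hη 0)
  have hπ := Real.pi_pos
  have hπ4 := Real.pi_le_four
  have hr0 : r₁ 0 = 0 := by
    have h3 : HasDerivAt (fun z => r (-z)) (-(r₁ (-0))) 0 := by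
      have := (h1 (-0)).comp (0 : ℝ) (hasDerivAt_neg (0 : ℝ))
      simpa [Function.comp_def] using this
    have h4 : (fun z => r (-z)) = r := funext hev
    rw [h4] at h3
    have := h3.unique (h1 0)
    rw [neg_zero] at this
    linarith
  have hper1 : Function.Periodic r₁ (2 * π) := fun z => by
    have h3 : HasDerivAt (fun z => r (z + 2 * π)) (r₁ (z + 2 * π)) z :=
      (h1 (z + 2 * π)).comp_add_const z (2 * π)
    have h4 : (fun z => r (z + 2 * π)) = r := funext hper
    rw [h4] at h3
    exact h3.unique (h1 z)
  have hc : Continuous r := continuous_iff_continuousAt.2 fun z => (h1 z).continuousAt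
  -- Rotating (r, r') by the angle z removes the homogeneous motion: f' and g' involve only r + r''.
  -- Over one period they change by at most 2πη ≤ 8η; evenness gives g(0) = 0.
  set f : ℝ → ℝ := fun z => r z * Real.cos z - r₁ z * Real.sin z with hf
  set g : ℝ → ℝ := fun z => r z * Real.sin z + r₁ z * Real.cos z with hg
  have hfd : ∀ z, HasDerivAt f (-(r z + r₂ z) * Real.sin z) z := fun z => by
    exact (((h1 z).mul (Real.hasDerivAt_cos z)).sub
      ((h2 z).mul (Real.hasDerivAt_sin z))).congr_deriv (by ring)
  have hgd : ∀ z, HasDerivAt g ((r z + r₂ z) * Real.cos z) z := fun z => by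
    exact (((h1 z).mul (Real.hasDerivAt_sin z)).add
      ((h2 z).mul (Real.hasDerivAt_cos z))).congr_deriv (by ring)
  have hfb : ∀ z ∈ Set.Icc 0 (2 * π), |f z - r 0| ≤ 8 * η := fun z hz => by
    have := (convex_univ (𝕜 := ℝ) (E := ℝ)).norm_image_sub_le_of_norm_hasDerivWithin_le (f := f)
      (C := η) (fun x _ => (hfd x).hasDerivWithinAt) (fun x _ => by
        rw [Real.norm_eq_abs, abs_mul, abs_neg]
        exact (mul_le_of_le_one_right (abs_nonneg _) (Real.abs_sin_le_one _)).trans (hη x))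
      (Set.mem_univ 0) (Set.mem_univ z)
    rw [Real.norm_eq_abs, Real.norm_eq_abs, sub_zero, abs_of_nonneg hz.1] at this
    have e : f 0 = r 0 := by simp [hf]
    rw [e] at this
    nlinarith [hz.2]
  have hgb : ∀ z ∈ Set.Icc 0 (2 * π), |g z| ≤ 8 * η := fun z hz => by
    have := (convex_univ (𝕜 := ℝ) (E := ℝ)).norm_image_sub_le_of_norm_hasDerivWithin_le (f := g)
      (C := η) (fun x _ => (hgd x).hasDerivWithinAt) (fun x _ => by
        rw [Real.norm_eq_abs, abs_mul]
        exact (mul_le_of_le_one_right (abs_nonneg _) (Real.abs_cos_le_one _)).trans (hη x))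
      (Set.mem_univ 0) (Set.mem_univ z)
    rw [Real.norm_eq_abs, Real.norm_eq_abs, sub_zero, abs_of_nonneg hz.1] at this
    have e : g 0 = 0 := by simp [hg, hr0]
    rw [e, sub_zero] at this
    nlinarith [hz.2]
  have hrep : ∀ z, r z = f z * Real.cos z + g z * Real.sin z := fun z => by
    simp only [hf, hg]
    linear_combination (-r z) * Real.sin_sq_add_cos_sq z
  have hrep1 : ∀ z, r₁ z = g z * Real.cos z + -f z * Real.sin z := fun z => by
    simp only [hf, hg]
    linear_combination (-r₁ z) * Real.sin_sq_add_cos_sq z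
  -- Only f(0) = r(0) is left free, and orthogonality to cos determines it up to O(η).
  have h0 : |r 0| ≤ 32 * η := by
    have e : ∫ z in (0 : ℝ)..2 * π, (r z - r 0 * Real.cos z) * Real.cos z = -(r 0 * π) := by
      rw [integral_sub_mul_cos hc, hcos, zero_sub]
    have := intervalIntegral.norm_integral_le_of_norm_le_const (a := 0) (b := 2 * π) (C := 16 * η)
      (f := fun z => (r z - r 0 * Real.cos z) * Real.cos z) fun z hz => by
        rw [Set.uIoc_of_le (by positivity)] at hz
        have hz' : z ∈ Set.Icc 0 (2 * π) := ⟨hz.1.le, hz.2⟩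
        rw [Real.norm_eq_abs, abs_mul]
        refine (mul_le_of_le_one_right (abs_nonneg _) (Real.abs_cos_le_one _)).trans ?_
        have e2 : r z - r 0 * Real.cos z = (f z - r 0) * Real.cos z + g z * Real.sin z := by
          linear_combination hrep z
        rw [e2]
        linarith [abs_mul_add_le (θ := z) (hfb z hz') (hgb z hz')]
    rw [e, Real.norm_eq_abs, abs_neg, abs_mul, abs_of_pos hπ, sub_zero,
      abs_of_pos (by positivity : 0 < 2 * π)] at this
    have h3 : |r 0| * π ≤ 32 * η * π := by linarith
    exact le_of_mul_le_mul_right h3 hπ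
  have main : ∀ z, |r z| ≤ 100 * η ∧ |r₁ z| ≤ 100 * η := by
    have key : ∀ z ∈ Set.Icc 0 (2 * π), |r z| ≤ 100 * η ∧ |r₁ z| ≤ 100 * η := fun z hz => by
      have hf' : |f z| ≤ 40 * η := by
        have := abs_add_le (f z - r 0) (r 0)
        rw [sub_add_cancel] at this
        linarith [hfb z hz]
      have hg' : |g z| ≤ 40 * η := by linarith [hgb z hz]
      constructor
      · rw [hrep]
        linarith [abs_mul_add_le (θ := z) hf' hg']
      · rw [hrep1]
        linarith [abs_mul_add_le (θ := z) hg' (by rwa [abs_neg] : |-f z| ≤ 40 * η)]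
    intro z
    obtain ⟨y, hy, hye⟩ := hper.exists_mem_Ico₀ (by positivity) z
    obtain ⟨y', hy', hye'⟩ := hper1.exists_mem_Ico₀ (by positivity) z
    exact ⟨hye ▸ (key y ⟨hy.1, hy.2.le⟩).1, hye' ▸ (key y' ⟨hy'.1, hy'.2.le⟩).2⟩
  refine ⟨(main z).1, (main z).2, ?_⟩
  have := abs_sub (r z + r₂ z) (r z)
  rw [add_sub_cancel_left] at this
  linarith [hη z, (main z).1]

/-- The constant in the bounds for the quadratic part of the wave equation. -/
def quadC (b k : ℝ) : ℝ := |(b + 1) / 2| + k ^ 2 + |(b - 1) / 2 * k ^ 2|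

theorem quadC_nonneg (b k : ℝ) : 0 ≤ quadC b k := by unfold quadC; positivity

theorem abs_mul_sub_mul_le {x y x' y' M ρ : ℝ} (hx : |x| ≤ M) (hy' : |y'| ≤ M)
    (hxx : |x - x'| ≤ ρ) (hyy : |y - y'| ≤ ρ) : |x * y - x' * y'| ≤ 2 * M * ρ := by
  have e : x * y - x' * y' = x * (y - y') + (x - x') * y' := by ring
  have hM : 0 ≤ M := (abs_nonneg _).trans hx
  have hρ : 0 ≤ ρ := (abs_nonneg _).trans hxx
  rw [e]
  refine (abs_add_le _ _).trans ?_
  rw [abs_mul, abs_mul]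
  have h1 := mul_le_mul hx hyy (abs_nonneg _) hM
  have h2 := mul_le_mul hxx hy' (abs_nonneg _) hρ
  linarith

theorem abs_quad_sub_le (b k : ℝ) {x₀ x₁ x₂ y₀ y₁ y₂ M ρ : ℝ} (h0 : |x₀| ≤ M) (h1 : |x₁| ≤ M)
    (g0 : |y₀| ≤ M) (g1 : |y₁| ≤ M) (g2 : |y₂| ≤ M)
    (d0 : |x₀ - y₀| ≤ ρ) (d1 : |x₁ - y₁| ≤ ρ) (d2 : |x₂ - y₂| ≤ ρ) :
    |((b + 1) / 2 * x₀ ^ 2 - k ^ 2 * x₀ * x₂ - (b - 1) / 2 * k ^ 2 * x₁ ^ 2)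
      - ((b + 1) / 2 * y₀ ^ 2 - k ^ 2 * y₀ * y₂ - (b - 1) / 2 * k ^ 2 * y₁ ^ 2)|
      ≤ quadC b k * (2 * M * ρ) := by
  have a1 := abs_mul_sub_mul_le h0 g0 d0 d0
  have a2 := abs_mul_sub_mul_le h0 g2 d0 d2
  have a3 := abs_mul_sub_mul_le h1 g1 d1 d1
  have e : ((b + 1) / 2 * x₀ ^ 2 - k ^ 2 * x₀ * x₂ - (b - 1) / 2 * k ^ 2 * x₁ ^ 2)
      - ((b + 1) / 2 * y₀ ^ 2 - k ^ 2 * y₀ * y₂ - (b - 1) / 2 * k ^ 2 * y₁ ^ 2)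
      = (b + 1) / 2 * (x₀ * x₀ - y₀ * y₀) - k ^ 2 * (x₀ * x₂ - y₀ * y₂)
        - (b - 1) / 2 * k ^ 2 * (x₁ * x₁ - y₁ * y₁) := by ring
  rw [e, quadC, add_mul, add_mul]
  refine (abs_sub _ _).trans (add_le_add ((abs_sub _ _).trans (add_le_add ?_ ?_)) ?_)
  · rw [abs_mul]; exact mul_le_mul_of_nonneg_left a1 (abs_nonneg _)
  · rw [abs_mul, abs_of_nonneg (sq_nonneg k)]; exact mul_le_mul_of_nonneg_left a2 (sq_nonneg k)
  · rw [abs_mul]; exact mul_le_mul_of_nonneg_left a3 (abs_nonneg _)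

/-- Bounds for a small wave in terms of its amplitude. -/
structure WaveBounds (κ k B a : ℝ) (w : Profile) (c : ℝ) : Prop where
  bound : C2Bound w (B * |a|)
  speed : |c - κ / (1 + k ^ 2)| ≤ B * a ^ 2
  hat_bound : ∃ X : L2, ‖X‖ ≤ B * a ^ 2 ∧
    ∀ n : ℤ, |n| ≠ 1 → (1 + (n : ℝ) ^ 2) * ‖w.hat n‖ ≤ ‖coeff n X‖
  tail : ∃ X : L2, ‖X‖ ≤ B * |a| ^ 3 ∧
    ∀ n : ℤ, 3 ≤ |n| → (1 + (n : ℝ) ^ 2) * ‖w.hat n‖ ≤ ‖coeff n X‖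

open Profile

/-- The profile without its leading part `a cos`. -/
def Profile.rest (w : Profile) (a : ℝ) : Profile := w.add (smul (-a) cos)

theorem rest_fn (w : Profile) (a z : ℝ) : (w.rest a).fn z = w.fn z - a * Real.cos z := by
  simp only [rest, add, smul, cos]; ring

theorem rest_deriv_fn (w : Profile) (a z : ℝ) :
    (w.rest a).deriv.fn z = w.deriv.fn z + a * Real.sin z := by
  have h : HasDerivAt (w.rest a).fn (w.deriv.fn z - a * -Real.sin z) z := by
    have e : (w.rest a).fn = fun z => w.fn z - a * Real.cos z := funext (rest_fn w a)
    rw [e]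
    exact (w.hasDerivAt z).sub ((Real.hasDerivAt_cos z).const_mul a)
  rw [((w.rest a).hasDerivAt z).unique h]
  ring

theorem rest_deriv2_fn (w : Profile) (a z : ℝ) :
    (w.rest a).deriv.deriv.fn z = w.deriv.deriv.fn z + a * Real.cos z := by
  have h : HasDerivAt (w.rest a).deriv.fn (w.deriv.deriv.fn z + a * Real.cos z) z := by
    have e : (w.rest a).deriv.fn = fun z => w.deriv.fn z + a * Real.sin z :=
      funext (rest_deriv_fn w a)
    rw [e]
    exact (w.deriv.hasDerivAt z).add ((Real.hasDerivAt_sin z).const_mul a)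
  exact ((w.rest a).deriv.hasDerivAt z).unique h

theorem IsWave.integral_rest {b κ k a c : ℝ} {w : Profile} (h : IsWave b κ k a w c) :
    ∫ z in (0 : ℝ)..2 * π, (w.rest a).fn z * Real.cos z = 0 := by
  simp only [rest_fn]
  rw [integral_sub_mul_cos w.smooth.continuous]
  have := h.amplitude
  rw [one_div, inv_mul_eq_iff_eq_mul₀ Real.pi_ne_zero] at this
  rw [this]; ring

/-- The coefficient of the linear part of the wave equation. -/
def stiff (κ k : ℝ) : ℝ := κ * k ^ 2 / (1 + k ^ 2)

theorem stiff_pos {κ k : ℝ} (hκ : 0 < κ) (hk : 0 < k) : 0 < stiff κ k := by unfold stiff; positivity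

/-- At the bifurcation speed the linear part is a multiple of w + w'', which does not see a cos z.
The speed correction and the quadratic terms go to the right side. -/
theorem IsWave.rest_equation {b κ k a c : ℝ} {w : Profile} (h : IsWave b κ k a w c) (z : ℝ) :
    stiff κ k * ((w.rest a).fn z + (w.rest a).deriv.deriv.fn z)
      = (c - κ / (1 + k ^ 2)) * (w.fn z - k ^ 2 * w.deriv.deriv.fn z) - (quad b k w).fn z := by
  have h1 := h.equation z
  have h2 : (1 : ℝ) + k ^ 2 ≠ 0 := by positivity
  have e : κ = κ / (1 + k ^ 2) + stiff κ k := by unfold stiff; field_simp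
  have e2 : stiff κ k = κ / (1 + k ^ 2) * k ^ 2 := by unfold stiff; field_simp
  rw [rest_fn, rest_deriv2_fn, quad_fn]
  set c0 := κ / (1 + k ^ 2)
  rw [e, e2] at h1
  rw [e2]
  linear_combination h1

theorem rest_even {w : Profile} (h : Function.Even w.fn) (a : ℝ) : Function.Even (w.rest a).fn :=
  fun z => by rw [rest_fn, rest_fn, h z, Real.cos_neg]

theorem IsWave.c2Bound_rest {b κ k a c : ℝ} {w : Profile} (h : IsWave b κ k a w c) (hκ : 0 < κ)
    (hk : 0 < k) {M : ℝ} (hM : ∀ z, |(c - κ / (1 + k ^ 2)) * (w.fn z - k ^ 2 * w.deriv.deriv.fn z)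
      - (quad b k w).fn z| ≤ M) : C2Bound (w.rest a) (101 * (M / stiff κ k)) := by
  have hA := stiff_pos hκ hk
  intro z
  have hη : ∀ z, |(w.rest a).fn z + (w.rest a).deriv.deriv.fn z| ≤ M / stiff κ k := fun z => by
    rw [le_div_iff₀ hA]
    have := hM z
    rw [← h.rest_equation, abs_mul, abs_of_pos hA] at this
    linarith
  have h0 := (abs_nonneg _).trans (hη 0)
  have := ode_bound (w.rest a).hasDerivAt (w.rest a).deriv.hasDerivAt (rest_even h.even a)
    (w.rest a).periodic h.integral_rest hη z
  exact ⟨by linarith [this.1], by linarith [this.2.1], this.2.2⟩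

theorem abs_quad_le (b k : ℝ) {w : Profile} {M K : ℝ} (hM : C2Bound w M) (hK : C2Bound w K) (z : ℝ)
    :
    |(quad b k w).fn z| ≤ quadC b k * (M * K) := by
  obtain ⟨h0, h1, h2⟩ := hM z
  obtain ⟨g0, g1, g2⟩ := hK z
  have hM0 := hM.nonneg
  rw [quad_fn, quadC, add_mul, add_mul]
  refine (abs_sub _ _).trans (add_le_add ((abs_sub _ _).trans (add_le_add ?_ ?_)) ?_)
  · rw [abs_mul, pow_two, abs_mul]
    exact mul_le_mul_of_nonneg_left (mul_le_mul h0 g0 (abs_nonneg _) hM0) (abs_nonneg _)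
  · rw [mul_assoc, abs_mul, abs_mul, abs_of_nonneg (sq_nonneg k)]
    exact mul_le_mul_of_nonneg_left (mul_le_mul h0 g2 (abs_nonneg _) hM0) (sq_nonneg k)
  · rw [abs_mul, pow_two, pow_two, abs_mul (w.deriv.fn z)]
    exact mul_le_mul_of_nonneg_left (mul_le_mul h1 g1 (abs_nonneg _) hM0) (abs_nonneg _)

theorem abs_linear_part_le (k : ℝ) {w : Profile} {K γ g : ℝ} (hK : C2Bound w K) (hγ : |γ| ≤ g)
    (z : ℝ) : |γ * (w.fn z - k ^ 2 * w.deriv.deriv.fn z)| ≤ g * ((1 + k ^ 2) * K) := by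
  have hK0 := hK.nonneg
  obtain ⟨g0, g1, g2⟩ := hK z
  rw [abs_mul]
  refine mul_le_mul hγ ?_ (abs_nonneg _) ((abs_nonneg _).trans hγ)
  refine (abs_sub _ _).trans ?_
  rw [abs_mul, abs_of_nonneg (sq_nonneg k)]
  nlinarith [mul_le_mul_of_nonneg_left g2 (sq_nonneg k)]

theorem c2Bound_of_rest {w : Profile} {a K : ℝ} (h : C2Bound (w.rest a) K) :
    C2Bound w (|a| + K) := by
  intro z
  obtain ⟨h0, h1, h2⟩ := h z
  rw [rest_fn] at h0
  rw [rest_deriv_fn] at h1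
  rw [rest_deriv2_fn] at h2
  have hc : |a * Real.cos z| ≤ |a| := by
    rw [abs_mul]; exact mul_le_of_le_one_right (abs_nonneg _) (Real.abs_cos_le_one _)
  have hs : |a * Real.sin z| ≤ |a| := by
    rw [abs_mul]; exact mul_le_of_le_one_right (abs_nonneg _) (Real.abs_sin_le_one _)
  have t0 := abs_add_le (w.fn z - a * Real.cos z) (a * Real.cos z)
  have t1 := abs_sub (w.deriv.fn z + a * Real.sin z) (a * Real.sin z)
  have t2 := abs_sub (w.deriv.deriv.fn z + a * Real.cos z) (a * Real.cos z)
  rw [sub_add_cancel] at t0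
  rw [add_sub_cancel_right] at t1 t2
  exact ⟨by linarith, by linarith, by linarith⟩

/-- The right side of the equation for the rest is at most δ times the current bound K. For small δ
each pass improves K to |a| + K/2, and the iteration converges to 2|a|. -/
theorem IsWave.c2Bound_amplitude {b κ k a c δ : ℝ} {w : Profile} (h : IsWave b κ k a w c) (hκ : 0
    < κ)
    (hk : 0 < k) (hw : C2Bound w δ) (hγ : |c - κ / (1 + k ^ 2)| ≤ δ)
    (hδ : 101 * (δ * (1 + k ^ 2 + quadC b k) / stiff κ k) ≤ 1 / 2) : C2Bound w (2 * |a|) := by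
  have hA := stiff_pos hκ hk
  have step : ∀ K, C2Bound w K → C2Bound w (|a| + K / 2) := fun K hK => by
    have h1 := c2Bound_of_rest (h.c2Bound_rest hκ hk (M := δ * (1 + k ^ 2 + quadC b k) * K) fun z
        => by
      refine (abs_sub _ _).trans ?_
      have h1 := abs_linear_part_le k hK hγ z
      have h2 := abs_quad_le b k hw hK z
      linarith)
    have hK0 := hK.nonneg
    have h2 : 101 * (δ * (1 + k ^ 2 + quadC b k) * K / stiff κ k) ≤ K / 2 := by
      have := mul_le_mul_of_nonneg_right hδ hK0
      calc _ = 101 * (δ * (1 + k ^ 2 + quadC b k) / stiff κ k) * K := by ring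
        _ ≤ _ := by linarith
    exact fun z => ⟨(h1 z).1.trans (by linarith), (h1 z).2.1.trans (by linarith),
      (h1 z).2.2.trans (by linarith)⟩
  have hn : ∀ n : ℕ, C2Bound w (2 * |a| + δ / 2 ^ n) := fun n => by
    induction n with
    | zero =>
      exact fun z => ⟨(hw z).1.trans (by simp), (hw z).2.1.trans (by simp),
        (hw z).2.2.trans (by simp)⟩
    | succ n ih =>
      have := step _ ih
      convert this using 1
      rw [pow_succ]
      ring
  have hlim : Filter.Tendsto (fun n : ℕ => 2 * |a| + δ / 2 ^ n) Filter.atTop (nhds (2 * |a|)) := by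
    have : Filter.Tendsto (fun n : ℕ => δ / 2 ^ n) Filter.atTop (nhds 0) := by
      have := (tendsto_pow_atTop_nhds_zero_of_lt_one (r := (1 / 2 : ℝ)) (by norm_num)
        (by norm_num)).const_mul δ
      simpa [div_eq_mul_inv] using this
    simpa using this.const_add (2 * |a|)
  exact fun z => ⟨ge_of_tendsto' hlim fun n => (hn n z).1, ge_of_tendsto' hlim fun n =>
      (hn n z).2.1,
    ge_of_tendsto' hlim fun n => (hn n z).2.2⟩

theorem smul_cos_deriv_fn (a z : ℝ) : (smul a cos).deriv.fn z = -(a * Real.sin z) := by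
  have h : HasDerivAt (smul a cos).fn (a * -Real.sin z) z := (Real.hasDerivAt_cos z).const_mul a
  rw [((smul a cos).hasDerivAt z).unique h]
  ring

theorem smul_cos_deriv2_fn (a z : ℝ) : (smul a cos).deriv.deriv.fn z = -(a * Real.cos z) := by
  have h : HasDerivAt (smul a cos).deriv.fn (-(a * Real.cos z)) z := by
    have e : (smul a cos).deriv.fn = fun z => -(a * Real.sin z) := funext (smul_cos_deriv_fn a)
    rw [e]
    exact ((Real.hasDerivAt_sin z).const_mul a).neg
  exact ((smul a cos).deriv.hasDerivAt z).unique h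

theorem c2Bound_smul_cos (a : ℝ) : C2Bound (smul a cos) |a| := fun z => by
  have hc : |a * Real.cos z| ≤ |a| := by
    rw [abs_mul]; exact mul_le_of_le_one_right (abs_nonneg _) (Real.abs_cos_le_one _)
  have hs : |a * Real.sin z| ≤ |a| := by
    rw [abs_mul]; exact mul_le_of_le_one_right (abs_nonneg _) (Real.abs_sin_le_one _)
  rw [smul_cos_deriv_fn, smul_cos_deriv2_fn, abs_neg, abs_neg]
  exact ⟨hc, hs, hc⟩

theorem hat_smul_cos (a : ℝ) {n : ℤ} (hn : |n| ≠ 1) : (smul a cos).hat n = 0 := by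
  have h1 := hat_deriv_deriv (smul a cos) n
  have h2 : (smul a cos).deriv.deriv.hat n = ((-1 : ℝ) : ℂ) * (smul a cos).hat n := by
    rw [← hat_smul]
    refine hat_congr (fun z => ?_) n
    rw [smul_cos_deriv2_fn]
    simp [smul, cos]
  rw [h2] at h1
  have h3 : ((n : ℂ) ^ 2 - 1) * (smul a cos).hat n = 0 := by
    push_cast at h1
    linear_combination h1
  refine (mul_eq_zero.1 h3).resolve_left fun h => hn ?_
  have h4 : n ^ 2 = 1 := by
    have : (n : ℂ) ^ 2 = 1 := by linear_combination h
    exact_mod_cast this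
  rw [← sq_eq_sq₀ (abs_nonneg n) zero_le_one, sq_abs, h4, one_pow]

/-- Products of two modes ±1 live on the modes 0 and ±2 only. -/
theorem hat_quad_smul_cos (b k a : ℝ) {n : ℤ} (hn : |n| = 1 ∨ 3 ≤ |n|) :
    (quad b k (smul a cos)).hat n = 0 := by
  have h := hasSum_quad b k (smul a cos) n
  have h2 := h.unique (hasSum_zero.congr_fun fun m => ?_)
  · simpa using h2
  · by_cases hm : |m| = 1
    · rw [hat_smul_cos a (n := n - m) (by
        rcases abs_cases m with ⟨h1, -⟩ | ⟨h1, -⟩ <;> rcases abs_cases n with ⟨h2, -⟩ | ⟨h2, -⟩ <;>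
          rcases abs_cases (n - m) with ⟨h3, -⟩ | ⟨h3, -⟩ <;> lia)]
      simp
    · rw [hat_smul_cos a hm]
      simp

theorem hat_rest (w : Profile) (a : ℝ) {n : ℤ} (hn : |n| ≠ 1) : (w.rest a).hat n = w.hat n := by
  rw [Profile.rest, hat_add, hat_smul_cos _ hn, add_zero]

theorem norm_hat_le (w : Profile) {K : ℝ} (h : ∀ z, |w.fn z| ≤ K) (n : ℤ) : ‖w.hat n‖ ≤ K := by
  rw [← coeff_toL2]
  exact (norm_coeff_le _ _).trans (norm_toL2_le w h)

theorem IsWave.speed_mul {b κ k a c : ℝ} {w : Profile} (h : IsWave b κ k a w c) :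
    (quad b k w).hat 1 = (((c - κ / (1 + k ^ 2)) * (1 + k ^ 2) * (a / 2) : ℝ) : ℂ) := by
  have h2 : (1 : ℝ) + k ^ 2 ≠ 0 := by positivity
  rw [h.quad_hat, h.hat_one, ← Complex.ofReal_neg, ← Complex.ofReal_mul]
  congr 1
  push_cast
  field_simp
  ring

theorem abs_speed_le {γ T a M : ℝ} (ha : a ≠ 0) (hT : 1 ≤ T) (h : |γ * T * (a / 2)| ≤ M * |a|) :
    |γ| ≤ 2 * M := by
  have ha' : 0 < |a| := abs_pos.2 ha
  rw [abs_mul, abs_mul, abs_div, abs_two, abs_of_pos (by linarith : 0 < T)] at h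
  have h1 : |γ| * (|a| / 2) ≤ |γ| * T * (|a| / 2) :=
    mul_le_mul_of_nonneg_right (le_mul_of_one_le_right (abs_nonneg _) hT) (by positivity)
  have h2 : |γ| * |a| ≤ 2 * M * |a| := by linarith
  exact le_of_mul_le_mul_right h2 ha'

/-- A bootstrap. The row 1 first gives the speed correction to order |a|, whence w - a cos = O(a²).
The quadratic terms of w then differ from those of a cos by O(|a|³), and the latter do not meet the
modes ±1 and |n| ≥ 3. This improves the speed to O(a²) and the tail to O(|a|³). -/
theorem IsWave.waveBounds {b κ k a c δ : ℝ} {w : Profile} (h : IsWave b κ k a w c) (hκ : 0 < κ)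
    (hk : 0 < k) (ha : a ≠ 0) (hw : C2Bound w δ) (hγ : |c - κ / (1 + k ^ 2)| ≤ δ)
    (hδ : 101 * (δ * (1 + k ^ 2 + quadC b k) / stiff κ k) ≤ 1 / 2)
    {R B : ℝ} (hR : R = 101 * ((16 * quadC b k * (1 + k ^ 2) + 4 * quadC b k) / stiff κ k))
    (hB : B = 2 + 2 * R + 8 * quadC b k * R + 8 * quadC b k * R / stiff κ k) :
    WaveBounds κ k B a w c := by
  have hA := stiff_pos hκ hk
  have hC := quadC_nonneg b k
  have hT : 1 ≤ 1 + k ^ 2 := by nlinarith [sq_nonneg k]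
  have hK := h.c2Bound_amplitude hκ hk hw hγ hδ
  have ha0 : 0 < |a| := abs_pos.2 ha
  have hR0 : 0 ≤ R := by rw [hR]; positivity
  set C := quadC b k with hCd
  have hq : ∀ z, |(quad b k w).fn z| ≤ 4 * C * a ^ 2 := fun z => by
    refine (abs_quad_le b k hK hK z).trans (le_of_eq ?_)
    rw [← sq_abs a]; ring
  have hγ1 : |c - κ / (1 + k ^ 2)| ≤ 2 * (4 * C * |a|) := by
    refine abs_speed_le ha hT ?_
    have := norm_hat_le _ hq 1
    rw [h.speed_mul, Complex.norm_real, Real.norm_eq_abs] at this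
    refine this.trans (le_of_eq ?_)
    rw [← sq_abs a]; ring
  have hrest : C2Bound (w.rest a) (R * a ^ 2) := by
    have := h.c2Bound_rest hκ hk (M := (16 * C * (1 + k ^ 2) + 4 * C) * a ^ 2) fun z => by
      refine (abs_sub _ _).trans ?_
      have h1 := abs_linear_part_le k hK hγ1 z
      have h2 := hq z
      have e : 2 * (4 * C * |a|) * ((1 + k ^ 2) * (2 * |a|)) = 16 * C * (1 + k ^ 2) * a ^ 2 := by
        rw [← sq_abs a]; ring
      linarith
    convert this using 1
    rw [hR]; ring
  set Z : Profile := (quad b k w).add (smul (-1) (quad b k (smul a cos))) with hZ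
  have hZb : ∀ z, |Z.fn z| ≤ 4 * C * R * |a| ^ 3 := fun z => by
    obtain ⟨k0, k1, -⟩ := hK z
    obtain ⟨g0, g1, g2⟩ := c2Bound_smul_cos a z
    obtain ⟨d0, d1, d2⟩ := hrest z
    have e0 : (smul a cos).fn z = a * Real.cos z := rfl
    rw [rest_fn] at d0
    rw [rest_deriv_fn, ← sub_neg_eq_add] at d1
    rw [rest_deriv2_fn, ← sub_neg_eq_add] at d2
    rw [smul_cos_deriv_fn] at g1
    rw [smul_cos_deriv2_fn] at g2
    rw [e0] at g0
    have hle : |a| ≤ 2 * |a| := by linarith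
    have := abs_quad_sub_le b k k0 k1 (g0.trans hle) (g1.trans hle) (g2.trans hle) d0 d1 d2
    have eZ : Z.fn z = (quad b k w).fn z - (quad b k (smul a cos)).fn z := by
      simp only [hZ, add, smul]; ring
    rw [eZ, quad_fn, quad_fn, smul_cos_deriv_fn, smul_cos_deriv2_fn, e0]
    refine this.trans (le_of_eq ?_)
    rw [← sq_abs a]; ring
  have hZh : ∀ n : ℤ, |n| = 1 ∨ 3 ≤ |n| → Z.hat n = (quad b k w).hat n := fun n hn => by
    rw [hZ, hat_add, hat_smul, hat_quad_smul_cos b k a hn, mul_zero, add_zero]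
  have hR1 : 0 ≤ 8 * C * R := by positivity
  have hR2 : 0 ≤ 8 * C * R / stiff κ k := by positivity
  have hC1 : 0 ≤ C * R := by positivity
  refine ⟨fun z => ?_, ?_, ?_, ?_⟩
  · have hle : 2 * |a| ≤ B * |a| := mul_le_mul_of_nonneg_right (by linarith) ha0.le
    exact ⟨(hK z).1.trans hle, (hK z).2.1.trans hle, (hK z).2.2.trans hle⟩
  · have h1 : |c - κ / (1 + k ^ 2)| ≤ 2 * (4 * C * R * a ^ 2) := by
      refine abs_speed_le ha hT ?_
      have := norm_hat_le _ hZb 1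
      rw [hZh 1 (by simp), h.speed_mul, Complex.norm_real, Real.norm_eq_abs] at this
      refine this.trans (le_of_eq ?_)
      rw [← sq_abs a]; ring
    refine h1.trans ?_
    have : 8 * C * R * a ^ 2 ≤ B * a ^ 2 := mul_le_mul_of_nonneg_right (by linarith) (sq_nonneg a)
    linarith
  · refine ⟨((w.rest a).add (smul (-1) (w.rest a).deriv.deriv)).toL2, ?_, fun n hn => le_of_eq ?_⟩
    · refine (norm_toL2_le _ (K := 2 * R * a ^ 2) fun z => ?_).trans
        (mul_le_mul_of_nonneg_right (by linarith) (sq_nonneg a))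
      have e : ((w.rest a).add (smul (-1) (w.rest a).deriv.deriv)).fn z
          = (w.rest a).fn z - (w.rest a).deriv.deriv.fn z := by
        simp only [add, smul]; ring
      rw [e]
      refine (abs_sub _ _).trans ?_
      linarith [(hrest z).1, (hrest z).2.2]
    · rw [coeff_toL2, hat_add, hat_smul, hat_deriv_deriv, hat_rest _ _ hn]
      have e : w.hat n + ((-1 : ℝ) : ℂ) * (-(n : ℂ) ^ 2 * w.hat n)
          = ((1 + (n : ℝ) ^ 2 : ℝ) : ℂ) * w.hat n := by push_cast; ring
      rw [e, norm_mul, Complex.norm_real, Real.norm_eq_abs, abs_of_pos (by positivity)]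
  · refine ⟨(smul (2 / stiff κ k) Z).toL2, ?_, fun n hn => ?_⟩
    · refine (norm_toL2_le _ (K := 8 * C * R / stiff κ k * |a| ^ 3) fun z => ?_).trans
        (mul_le_mul_of_nonneg_right (by linarith) (by positivity))
      have e : (smul (2 / stiff κ k) Z).fn z = 2 / stiff κ k * Z.fn z := rfl
      rw [e, abs_mul, abs_of_pos (by positivity)]
      have := mul_le_mul_of_nonneg_left (hZb z) (by positivity : 0 ≤ 2 / stiff κ k)
      refine this.trans (le_of_eq ?_)
      ring
    · rw [coeff_toL2, hat_smul, hZh n (Or.inr hn), h.quad_hat, norm_mul, norm_mul, norm_neg,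
        Complex.norm_real, Complex.norm_real, Real.norm_eq_abs, Real.norm_eq_abs, ← mul_assoc,
        abs_of_pos (by positivity : 0 < 2 / stiff κ k)]
      refine mul_le_mul_of_nonneg_right ?_ (norm_nonneg _)
      rw [div_mul_eq_mul_div, le_div_iff₀ hA]
      have h2 : (1 : ℝ) + k ^ 2 ≠ 0 := by positivity
      -- For |n| ≥ 3 the linear coefficient is dominated by stiff·(n² - 1) ≥ (4/5)·stiff·(1 + n²),
      -- of which the speed correction takes at most 3/10. Half of stiff·(1 + n²) remains, which
      -- explains the factor 2/stiff above.
      have e : κ - c - c * k ^ 2 * (n : ℝ) ^ 2 = -(stiff κ k * ((n : ℝ) ^ 2 - 1)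
          + (c - κ / (1 + k ^ 2)) * (1 + k ^ 2 * (n : ℝ) ^ 2)) := by
        unfold stiff; field_simp; ring
      have hn9 : (9 : ℝ) ≤ (n : ℝ) ^ 2 := by
        rw [← sq_abs]
        have : (3 : ℝ) ≤ |(n : ℝ)| := by exact_mod_cast hn
        nlinarith
      have hδA : δ * (1 + k ^ 2) ≤ 3 / 10 * stiff κ k := by
        have hδ0 := hw.nonneg
        have : δ * (1 + k ^ 2 + C) ≤ stiff κ k / 202 := by
          rw [← mul_div_assoc, div_le_iff₀ hA] at hδ
          linarith
        nlinarith [mul_nonneg hδ0 hC]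
      have hlow : |(c - κ / (1 + k ^ 2)) * (1 + k ^ 2 * (n : ℝ) ^ 2)|
          ≤ 3 / 10 * stiff κ k * (1 + (n : ℝ) ^ 2) := by
        rw [abs_mul, abs_of_pos (one_add_pos k n)]
        have h1 : 1 + k ^ 2 * (n : ℝ) ^ 2 ≤ (1 + k ^ 2) * (1 + (n : ℝ) ^ 2) := by
          nlinarith [sq_nonneg k, sq_nonneg (n : ℝ)]
        calc _ ≤ δ * ((1 + k ^ 2) * (1 + (n : ℝ) ^ 2)) :=
              mul_le_mul hγ h1 (one_add_pos k n).le hw.nonneg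
          _ = δ * (1 + k ^ 2) * (1 + (n : ℝ) ^ 2) := by ring
          _ ≤ _ := mul_le_mul_of_nonneg_right hδA (by positivity)
      rw [e, abs_neg]
      have h3 := le_abs_self (stiff κ k * ((n : ℝ) ^ 2 - 1)
          + (c - κ / (1 + k ^ 2)) * (1 + k ^ 2 * (n : ℝ) ^ 2))
      have h4 := (abs_le.1 hlow).1
      have h5 : 4 / 5 * (1 + (n : ℝ) ^ 2) * stiff κ k ≤ stiff κ k * ((n : ℝ) ^ 2 - 1) := by
        nlinarith
      linarith

end BKP

end

open MeasureTheory AddCircle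
open scoped Real ENNReal ContDiff

noncomputable section

namespace BKP

open ComplexConjugate

/-! ### The off-diagonal entry at zero transverse wave number -/

/-- The constant in the bounds for `kern`. -/
def kernC (b k : ℝ) : ℝ := |b + 1| + 9 * k ^ 2 * (1 + |b - 1|)

theorem kernC_nonneg (b k : ℝ) : 0 ≤ kernC b k := by unfold kernC; positivity

/-- For bounded n the frequency m differs from -j by a bounded amount, so the growth of the kernel
can be charged to the profile alone, whose coefficients are bounded with the weight 1 + j². -/
theorem abs_kern_le (b k : ℝ) {n : ℤ} (hn : |n| ≤ 2) (m : ℤ) :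
    |kern b k (n - m) m| ≤ kernC b k * (1 + ((n - m : ℤ) : ℝ) ^ 2) := by
  set j : ℝ := ((n - m : ℤ) : ℝ) with hj
  have hm : (m : ℝ) = n - j := by rw [hj]; push_cast; ring
  have hn2 : (n : ℝ) ^ 2 ≤ 4 := by
    have : |(n : ℝ)| ≤ 2 := by exact_mod_cast hn
    rw [← sq_abs]
    nlinarith [abs_nonneg (n : ℝ)]
  have hs : j ^ 2 + (m : ℝ) ^ 2 ≤ 9 * (1 + j ^ 2) := by
    rw [hm]; nlinarith [sq_nonneg ((n : ℝ) + j)]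
  have hjm : |j * m| ≤ j ^ 2 + (m : ℝ) ^ 2 := by
    rw [abs_le]; constructor <;> nlinarith [sq_nonneg (j + m), sq_nonneg (j - m)]
  rw [kern, kernC, add_mul]
  refine (abs_add_le _ _).trans (add_le_add ?_ ?_)
  · exact le_mul_of_one_le_right (abs_nonneg _) (by nlinarith [sq_nonneg j])
  · rw [abs_mul, abs_of_nonneg (sq_nonneg k)]
    have h1 : |j ^ 2 + (m : ℝ) ^ 2 + (b - 1) * (j * m)|
        ≤ (1 + |b - 1|) * (9 * (1 + j ^ 2)) := by
      refine (abs_add_le _ _).trans ?_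
      rw [abs_mul, abs_of_nonneg (by positivity : 0 ≤ j ^ 2 + (m : ℝ) ^ 2)]
      have := mul_le_mul_of_nonneg_left (hjm.trans hs) (abs_nonneg (b - 1))
      linarith
    have := mul_le_mul_of_nonneg_left h1 (sq_nonneg k)
    linarith

/-- Finitely many terms of a row are treated exactly. The others are estimated by Cauchy–Schwarz,
with X carrying the weighted coefficients of the profile. Two sequences Y, Y' are admitted because
`exists_entry_eq` compares E with the wave. -/
theorem row_tail_bound {b k : ℝ} {w : Profile} {n : ℤ} (hn : |n| ≤ 2) {y : ℤ → ℂ} {S : ℂ}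
    (hS : HasSum (fun m => kern b k (n - m) m * (w.hat (n - m) * y m)) S) (F : Finset ℤ) {X Y Y' :
        L2}
    (hX : ∀ m ∉ F, (1 + ((n - m : ℤ) : ℝ) ^ 2) * ‖w.hat (n - m)‖ ≤ ‖coeff (n - m) X‖)
    (hY : ∀ m ∉ F, ‖y m‖ ≤ ‖coeff m Y‖ + ‖coeff m Y'‖) :
    ‖S - ∑ m ∈ F, kern b k (n - m) m * (w.hat (n - m) * y m)‖ ≤ kernC b k * (‖X‖ * (‖Y‖ + ‖Y'‖)) :=
        by
  set f : ℤ → ℂ := fun m => kern b k (n - m) m * (w.hat (n - m) * y m) with hf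
  have hF : HasSum (fun m => if m ∈ F then f m else 0) (∑ m ∈ F, f m) := by
    have : HasSum (fun m => if m ∈ F then f m else 0) (∑ m ∈ F, if m ∈ F then f m else 0) :=
      hasSum_sum_of_ne_finset_zero fun m hm => by simp [hm]
    rwa [Finset.sum_congr rfl fun m hm => if_pos hm] at this
  obtain ⟨t, ht, htle⟩ := exists_hasSum_mul_norm_coeff X Y (Equiv.subLeft n)
  obtain ⟨t', ht', htle'⟩ := exists_hasSum_mul_norm_coeff X Y' (Equiv.subLeft n)
  have hC := kernC_nonneg b k
  have h1 := (hS.sub hF).norm_le_of_bounded ((ht.add ht').mul_left (kernC b k)) fun m => by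
    by_cases hm : m ∈ F
    · simp only [hm, if_true, hf, sub_self, norm_zero]
      positivity
    · simp only [hm, if_false, sub_zero, hf, Equiv.subLeft_apply]
      rw [norm_mul, norm_mul, Complex.norm_real, Real.norm_eq_abs]
      have h2 := mul_le_mul_of_nonneg_right (abs_kern_le b k hn m) (norm_nonneg (w.hat (n - m)))
      have h3 := mul_le_mul_of_nonneg_left (hX m hm) hC
      have h23 : |kern b k (n - m) m| * ‖w.hat (n - m)‖ ≤ kernC b k * ‖coeff (n - m) X‖ :=
        h2.trans (by rw [mul_assoc]; exact h3)
      have h4 := mul_le_mul h23 (hY m hm) (norm_nonneg _)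
        (by positivity)
      calc _ = |kern b k (n - m) m| * ‖w.hat (n - m)‖ * ‖y m‖ := by ring
        _ ≤ _ := h4
        _ = _ := by ring
  refine h1.trans (mul_le_mul_of_nonneg_left ?_ hC)
  rw [mul_add]
  exact add_le_add htle htle'

theorem conv_cosH (b k : ℝ) (w : Profile) (n : ℤ) :
    conv b k w cosH n = (kern b k (n - 1) 1 * w.hat (n - 1)
      + kern b k (n + 1) (-1) * w.hat (n + 1)) / 2 := by
  have h := hasSum_conv b k w cosH n
  have h2 : HasSum (fun m => kern b k (n - m) m * (w.hat (n - m) * coeff m (cosH : L2)))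
      (∑ m ∈ ({1, -1} : Finset ℤ), kern b k (n - m) m * (w.hat (n - m) * coeff m (cosH : L2))) :=
    hasSum_sum_of_ne_finset_zero fun m hm => by
      rw [Finset.mem_insert, Finset.mem_singleton, not_or] at hm
      simp [coeff_cosH, hm.1, hm.2]
  rw [h.unique h2, Finset.sum_pair (by decide), coeff_cosH, coeff_cosH, sub_neg_eq_add]
  simp
  ring

/-- A small wave together with the invariant plane at zero transverse wave number. -/
structure ZeroData (b κ k : ℝ) (hk : 0 < k) (B a : ℝ) (w : Profile) (c : ℝ) (E O : H1) (p q : ℝ) :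
    Prop where
  amp_ne : a ≠ 0
  amp_le : |a| ≤ 1
  wave : IsWave b κ k a w c
  bounds : WaveBounds κ k B a w c
  pair : InvPair b κ k hk w c 0 E O p q
  even_le : ‖dz E‖ ≤ B * |a|
  odd_le : ‖dz O‖ ≤ B * |a|
  speed_le : |c - κ / (1 + k ^ 2)| ≤ gap κ k / 4

namespace ZeroData

variable {b κ k : ℝ} {hk : 0 < k} {B a : ℝ} {w : Profile} {c : ℝ} {E O : H1} {p q : ℝ}

theorem amp_pos (h : ZeroData b κ k hk B a w c E O p q) : 0 < |a| := abs_pos.2 h.amp_ne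

theorem const_nonneg (h : ZeroData b κ k hk B a w c E O p q) : 0 ≤ B :=
  nonneg_of_mul_nonneg_left ((norm_nonneg _).trans h.even_le) h.amp_pos

theorem norm_hat_le_sq (h : ZeroData b κ k hk B a w c E O p q) {n : ℤ} (hn : |n| ≠ 1) :
    ‖w.hat n‖ ≤ B * |a| ^ 2 := by
  obtain ⟨X, hX, hXn⟩ := h.bounds.hat_bound
  rw [sq_abs]
  refine le_trans ?_ (((hXn n hn).trans (norm_coeff_le _ _)).trans hX)
  exact le_mul_of_one_le_left (norm_nonneg _) (by nlinarith [sq_nonneg (n : ℝ)])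

theorem norm_hat_le_cube (h : ZeroData b κ k hk B a w c E O p q) {n : ℤ} (hn : 3 ≤ |n|) :
    ‖w.hat n‖ ≤ B * |a| ^ 3 := by
  obtain ⟨X, hX, hXn⟩ := h.bounds.tail
  refine le_trans ?_ (((hXn n hn).trans (norm_coeff_le _ _)).trans hX)
  exact le_mul_of_one_le_left (norm_nonneg _) (by nlinarith [sq_nonneg (n : ℝ)])

theorem norm_even_le (h : ZeroData b κ k hk B a w c E O p q) : ‖(E : L2)‖ ≤ B * |a| :=
  (norm_le_norm_dz E (h.pair.even_low 0 (by simp))).trans h.even_le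

theorem norm_odd_coeff_le (h : ZeroData b κ k hk B a w c E O p q) (n : ℤ) :
    ‖coeff n (O : L2)‖ ≤ B * |a| :=
  (norm_coeff_le _ _).trans ((norm_le_norm_dz O (h.pair.odd_low 0 (by simp))).trans h.odd_le)

theorem norm_even_coeff_le (h : ZeroData b κ k hk B a w c E O p q) (n : ℤ) :
    ‖coeff n (E : L2)‖ ≤ B * |a| := (norm_coeff_le _ _).trans h.norm_even_le

theorem norm_nop_even_le (h : ZeroData b κ k hk B a w c E O p q) :
    ‖nop b k hk w E‖ ≤ nopC b k * B ^ 2 * |a| ^ 2 := by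
  have hB := h.const_nonneg
  have hN := nopC_nonneg b k
  refine (norm_nop_le b k hk h.bounds.bound E (h.pair.even_low 0 (by simp))).trans ?_
  have := mul_le_mul_of_nonneg_left h.even_le (by positivity : 0 ≤ nopC b k * (B * |a|))
  refine this.trans (le_of_eq (by ring))

theorem pow_le_pow (h : ZeroData b κ k hk B a w c E O p q) {m n : ℕ} (hmn : m ≤ n) :
    |a| ^ n ≤ |a| ^ m := pow_le_pow_of_le_one (abs_nonneg a) h.amp_le hmn

/-- A first bound for the entry. -/
theorem abs_entry_le (h : ZeroData b κ k hk B a w c E O p q) :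
    |q| ≤ (B + 2 * (nopC b k * B + nopC b k * B ^ 2)) * |a| := by
  have hB := h.const_nonneg
  have hN := nopC_nonneg b k
  have h1 : ‖nop b k hk w cosH‖ ≤ nopC b k * B * |a| := by
    refine (norm_nop_le b k hk h.bounds.bound cosH (by simp [coeff_cosH])).trans ?_
    have := mul_le_mul_of_nonneg_left norm_dz_cosH_le (by positivity : 0 ≤ nopC b k * (B * |a|))
    refine this.trans (le_of_eq (by ring))
  have h2 := congrArg norm h.pair.even_entry
  rw [Complex.norm_real, Real.norm_eq_abs] at h2
  have h3 := norm_add_le (-nu κ k c 0 1 : ℂ) (2 * Complex.I * coeff 1 (nop b k hk w (cosH + E)))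
  have h4 := (norm_coeff_le 1 (nop b k hk w (cosH + E))).trans
    ((le_of_eq (by rw [map_add])).trans (norm_add_le (nop b k hk w cosH) (nop b k hk w E)))
  have hν : ‖(-nu κ k c 0 1 : ℂ)‖ ≤ B * |a| := by
    rw [norm_neg, Complex.norm_real, Real.norm_eq_abs, nu_one, zero_div, sub_zero]
    refine h.bounds.speed.trans ?_
    rw [← sq_abs]
    have := mul_le_mul_of_nonneg_left (h.pow_le_pow one_le_two) hB
    rwa [pow_one] at this
  have h5 : ‖(2 * Complex.I * coeff 1 (nop b k hk w (cosH + E)) : ℂ)‖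
      = 2 * ‖coeff 1 (nop b k hk w (cosH + E))‖ := by
    rw [norm_mul, norm_mul, Complex.norm_I]; norm_num
  have h6 : nopC b k * B ^ 2 * |a| ^ 2 ≤ nopC b k * B ^ 2 * |a| ^ 1 :=
    mul_le_mul_of_nonneg_left (h.pow_le_pow one_le_two) (by positivity)
  rw [pow_one] at h6
  rw [h2]
  have h7 := h.norm_nop_even_le
  rw [h5] at h3
  linarith

theorem even_row (h : ZeroData b κ k hk B a w c E O p q) {n : ℤ} (hn : 2 ≤ |n|) :
    nu κ k c 0 n * coeff n (E : L2)
      = Complex.I * (coeff n (nop b k hk w cosH) + coeff n (nop b k hk w E))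
        - Complex.I * (q * coeff n (O : L2)) := by
  have := h.pair.even_eq n
  rw [coeff_add_H, coeff_add_H, coeff_cosH_of_two_le hn, coeff_sinH_of_two_le hn, map_add,
    map_add] at this
  linear_combination (-Complex.I) * this + (nu κ k c 0 n * coeff n (E : L2)) * Complex.I_sq

end ZeroData

/-- The function cos reaches the mode 3 only through the coefficients 2 and 4 of the wave, which are
O(a²). The remaining terms are products of two small quantities. -/
theorem exists_third_coeff_bound (b κ k B : ℝ) (hκ : 0 < κ) (hk : 0 < k) : ∃ C,
    ∀ (a : ℝ) (w : Profile) (c : ℝ) (E O : H1) (p q : ℝ), ZeroData b κ k hk B a w c E O p q →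
      ‖coeff 3 (E : L2)‖ ≤ C * |a| ^ 2 := by
  have hg := gap_pos hκ hk
  refine ⟨((1 / k ^ 2 + 1) * ((|kern b k 2 1| + |kern b k 4 (-1)|) / 2 * B) + nopC b k * B ^ 2
    + (B + 2 * (nopC b k * B + nopC b k * B ^ 2)) * B) / gap κ k, fun a w c E O p q h => ?_⟩
  have hB := h.const_nonneg
  have hn : (2 : ℤ) ≤ |3| := by norm_num
  have h1 := congrArg norm (h.even_row hn)
  rw [norm_mul, Complex.norm_real, Real.norm_eq_abs] at h1
  have h2 := norm_sub_le (Complex.I * (coeff 3 (nop b k hk w cosH) + coeff 3 (nop b k hk w E)))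
    (Complex.I * (q * coeff 3 (O : L2)))
  rw [norm_mul, norm_mul, norm_mul, Complex.norm_I, one_mul, one_mul, Complex.norm_real,
    Real.norm_eq_abs] at h2
  have h3 := norm_add_le (coeff 3 (nop b k hk w cosH)) (coeff 3 (nop b k hk w E))
  have h4 := (norm_coeff_le 3 _).trans h.norm_nop_even_le
  have h5 := mul_le_mul h.abs_entry_le (h.norm_odd_coeff_le 3) (norm_nonneg _)
    ((abs_nonneg _).trans h.abs_entry_le)
  have h6 : ‖conv b k w cosH 3‖ ≤ (|kern b k 2 1| + |kern b k 4 (-1)|) / 2 * B * |a| ^ 2 := by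
    rw [conv_cosH, norm_div]
    have e1 := norm_add_le ((kern b k (3 - 1) 1 : ℂ) * w.hat (3 - 1))
      (kern b k (3 + 1) (-1) * w.hat (3 + 1))
    rw [norm_mul, norm_mul, Complex.norm_real, Complex.norm_real, Real.norm_eq_abs,
      Real.norm_eq_abs] at e1
    norm_num at e1 ⊢
    have e2 := mul_le_mul_of_nonneg_left (h.norm_hat_le_sq (n := 2) (by norm_num))
      (abs_nonneg (kern b k 2 1))
    have e3 := mul_le_mul_of_nonneg_left (h.norm_hat_le_sq (n := 4) (by norm_num))
      (abs_nonneg (kern b k 4 (-1)))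
    rw [sq_abs] at e2 e3
    linarith
  have h7 : ‖coeff 3 (nop b k hk w cosH)‖ ≤ (1 / k ^ 2 + 1) * ‖conv b k w cosH 3‖ := by
    rw [coeff_nop, norm_mul, norm_neg]
    exact mul_le_mul_of_nonneg_right (norm_DS_le hk 3) (norm_nonneg _)
  have h8 := mul_le_mul_of_nonneg_left h6 (by positivity : 0 ≤ 1 / k ^ 2 + 1)
  have hν := le_abs_nu (k := k) (c := c) (s := 0) hκ (by simpa using h.speed_le) hn
  have h9 : gap κ k ≤ |nu κ k c 0 3| := by
    norm_num at hν; linarith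
  have h10 := mul_le_mul_of_nonneg_right h9 (norm_nonneg (coeff 3 (E : L2)))
  rw [div_mul_eq_mul_div, le_div_iff₀ hg]
  linarith

/-- The entry is determined by the second coefficient of the even vector. -/
theorem exists_entry_eq (b κ k B : ℝ) (hκ : 0 < κ) (hk : 0 < k) : ∃ C,
    ∀ (a : ℝ) (w : Profile) (c : ℝ) (E O : H1) (p q : ℝ), ZeroData b κ k hk B a w c E O p q →
      ‖(q : ℂ) - kern b k (-1) 2 * a / (1 + k ^ 2) * coeff 2 (E : L2)‖ ≤ C * |a| ^ 4 := by
  obtain ⟨C3, hC3⟩ := exists_third_coeff_bound b κ k B hκ hk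
  refine ⟨2 * (kernC b k * (B * (2 * B)) + |kern b k (-2) 3| * (B * (C3 + B))),
    fun a w c E O p q h => ?_⟩
  have hB := h.const_nonneg
  have ha := h.amp_pos
  have hac : (a : ℂ) ≠ 0 := by exact_mod_cast h.amp_ne
  have hT : (1 + (k : ℂ) ^ 2) ≠ 0 := by
    have : (1 + k ^ 2 : ℝ) ≠ 0 := by positivity
    exact_mod_cast this
  obtain ⟨X2, hX2, hX2n⟩ := h.bounds.hat_bound
  obtain ⟨X3, hX3, hX3n⟩ := h.bounds.tail
  have hS := (hasSum_conv b k w (cosH + E) 1).sub ((h.wave.hasSum_kern 1).mul_left (1 / (2 * a) :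
      ℂ))
  set S := conv b k w (cosH + E) 1
    - 1 / (2 * a) * (-2 * ((κ - c - c * k ^ 2 * ((1 : ℤ) : ℝ) ^ 2 : ℝ) : ℂ) * w.hat 1) with hSd
  -- Subtracting the wave equation divided by 2a removes the speed from the row 1. The sequence is
  -- of order 1 only at m = ±1, where it equals 1/2 - 1/4.
  set y : ℤ → ℂ := fun m => coeff m ((cosH + E : H1) : L2) - w.hat m / (2 * a) with hy
  have hS' : HasSum (fun m => kern b k (1 - m) m * (w.hat (1 - m) * y m)) S := by
    refine hS.congr_fun fun m => ?_
    simp only [hy]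
    ring
  have hqS : (q : ℂ) = 2 / (1 + k ^ 2) * S := by
    rw [h.pair.even_entry, coeff_nop, hSd, h.wave.hat_one, nu_one, symD, symS]
    push_cast
    field_simp
    ring_nf
    rw [Complex.I_sq]
    ring
  -- These five values of m are those with |1 - m| ≤ 2. All others involve coefficients of the wave
  -- of order |a|³.
  have htail := row_tail_bound (by norm_num) hS' ({0, 1, -1, 2, 3} : Finset ℤ) (X := X3) (Y :=
      (E : L2))
    (Y' := (1 / (2 * a) : ℂ) • X2) (fun m hm => hX3n _ (by
      simp only [Finset.mem_insert, Finset.mem_singleton, not_or] at hm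
      rw [le_abs]
      omega)) (fun m hm => by
      simp only [Finset.mem_insert, Finset.mem_singleton, not_or] at hm
      have hm2 : 2 ≤ |m| := by rw [le_abs]; omega
      simp only [hy]
      rw [coeff_add_H, coeff_cosH_of_two_le hm2, zero_add, map_smul, smul_eq_mul]
      refine (norm_sub_le _ _).trans (add_le_add_right ?_ _)
      rw [div_eq_mul_one_div, mul_comm, norm_mul, norm_mul]
      refine mul_le_mul_of_nonneg_left ?_ (norm_nonneg _)
      refine le_trans ?_ (hX2n m (by omega))
      exact le_mul_of_one_le_left (norm_nonneg _) (by nlinarith [sq_nonneg (m : ℝ)]))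
  -- The coefficient 0 of the wave enters at m = 0 and m = 1 with opposite signs, the coefficient 2
  -- at m = -1 and m = 2. Both cancel by symmetry of the kernel.
  have hsum : ∑ m ∈ ({0, 1, -1, 2, 3} : Finset ℤ), kern b k (1 - m) m * (w.hat (1 - m) * y m)
      = kern b k (-1) 2 * (a / 2) * coeff 2 (E : L2)
        + kern b k (-2) 3 * (w.hat (-2) * (coeff 3 (E : L2) - w.hat 3 / (2 * a))) := by
    have hy0 : y 0 = -(w.hat 0 / (2 * a)) := by
      simp only [hy]
      rw [coeff_add_H, h.pair.even_low 0 (by simp), coeff_cosH]; simp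
    have hy1 : y 1 = 1 / 4 := by
      simp only [hy]
      rw [coeff_add_H, h.pair.even_low 1 (by simp), coeff_cosH, h.wave.hat_one]
      push_cast
      simp
      field_simp
      norm_num
    have hym : y (-1) = 1 / 4 := by
      simp only [hy]
      rw [coeff_add_H, h.pair.even_low (-1) (by simp), coeff_cosH, hat_neg_of_even w h.wave.even,
        h.wave.hat_one]
      push_cast
      simp
      field_simp
      norm_num
    have hy2 : y 2 = coeff 2 (E : L2) - w.hat 2 / (2 * a) := by
      simp only [hy]
      rw [coeff_add_H, coeff_cosH_of_two_le (by norm_num), zero_add]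
    have hy3 : y 3 = coeff 3 (E : L2) - w.hat 3 / (2 * a) := by
      simp only [hy]
      rw [coeff_add_H, coeff_cosH_of_two_le (by norm_num), zero_add]
    have e : ∑ m ∈ ({0, 1, -1, 2, 3} : Finset ℤ), kern b k (1 - m) m * (w.hat (1 - m) * y m)
        = kern b k 1 0 * (w.hat 1 * y 0) + (kern b k 0 1 * (w.hat 0 * y 1)
          + (kern b k 2 (-1) * (w.hat 2 * y (-1)) + (kern b k (-1) 2 * (w.hat (-1) * y 2)
            + kern b k (-2) 3 * (w.hat (-2) * y 3)))) := by
      rw [Finset.sum_insert (by decide), Finset.sum_insert (by decide),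
        Finset.sum_insert (by decide), Finset.sum_insert (by decide), Finset.sum_singleton]
      norm_num
    rw [e, hy0, hy1, hym, hy2, hy3, hat_neg_of_even w h.wave.even 1, h.wave.hat_one,
      kern_comm b k 1 0, kern_comm b k 2 (-1)]
    push_cast
    field_simp
    ring
  rw [hsum] at htail
  have hY' : ‖(1 / (2 * a) : ℂ) • X2‖ ≤ B * |a| := by
    rw [norm_smul, norm_div, norm_one, norm_mul, Complex.norm_real, Real.norm_eq_abs,
      Complex.norm_two, one_div_mul_eq_div, div_le_iff₀ (by positivity)]
    rw [← sq_abs] at hX2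
    have : 0 ≤ B * |a| ^ 2 := by positivity
    nlinarith
  have ht1 : kernC b k * (‖X3‖ * (‖(E : L2)‖ + ‖(1 / (2 * a) : ℂ) • X2‖))
      ≤ kernC b k * (B * |a| ^ 3 * (2 * B * |a|)) := by
    refine mul_le_mul_of_nonneg_left ?_ (kernC_nonneg b k)
    exact mul_le_mul hX3 (by linarith [h.norm_even_le]) (by positivity) (by positivity)
  have hw3 : ‖w.hat 3 / (2 * a)‖ ≤ B * |a| ^ 2 := by
    rw [norm_div, norm_mul, Complex.norm_real, Real.norm_eq_abs, Complex.norm_two,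
      div_le_iff₀ (by positivity)]
    have := h.norm_hat_le_cube (n := 3) (by norm_num)
    have h0 : 0 ≤ B * |a| ^ 3 := by positivity
    nlinarith
  have h3 : ‖(kern b k (-2) 3 : ℂ) * (w.hat (-2) * (coeff 3 (E : L2) - w.hat 3 / (2 * a)))‖
      ≤ |kern b k (-2) 3| * (B * |a| ^ 2 * ((C3 + B) * |a| ^ 2)) := by
    rw [norm_mul, norm_mul, Complex.norm_real, Real.norm_eq_abs]
    refine mul_le_mul_of_nonneg_left ?_ (abs_nonneg _)
    refine mul_le_mul (h.norm_hat_le_sq (by norm_num)) ?_ (norm_nonneg _) (by positivity)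
    refine (norm_sub_le _ _).trans ?_
    linarith [hC3 a w c E O p q h]
  have e : (q : ℂ) - kern b k (-1) 2 * a / (1 + k ^ 2) * coeff 2 (E : L2)
      = 2 / (1 + k ^ 2) * ((S - (kern b k (-1) 2 * (a / 2) * coeff 2 (E : L2)
        + kern b k (-2) 3 * (w.hat (-2) * (coeff 3 (E : L2) - w.hat 3 / (2 * a)))))
        + kern b k (-2) 3 * (w.hat (-2) * (coeff 3 (E : L2) - w.hat 3 / (2 * a)))) := by
    rw [hqS]
    field_simp
    ring
  have hn2 : ‖(2 / (1 + k ^ 2) : ℂ)‖ ≤ 2 := by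
    have : (2 / (1 + k ^ 2) : ℂ) = ((2 / (1 + k ^ 2) : ℝ) : ℂ) := by push_cast; ring
    rw [this, Complex.norm_real, Real.norm_eq_abs, abs_of_pos (by positivity),
      div_le_iff₀ (by positivity)]
    nlinarith [sq_nonneg k]
  rw [e, norm_mul]
  have h5 := (norm_add_le _ _).trans (add_le_add (htail.trans ht1) h3)
  refine (mul_le_mul hn2 h5 (norm_nonneg _) zero_le_two).trans (le_of_eq ?_)
  ring

theorem exists_entry_bound (b κ k B : ℝ) (hκ : 0 < κ) (hk : 0 < k) : ∃ C ≥ 0,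
    ∀ (a : ℝ) (w : Profile) (c : ℝ) (E O : H1) (p q : ℝ), ZeroData b κ k hk B a w c E O p q →
      |q| ≤ C * |a| ^ 2 := by
  obtain ⟨C, hC⟩ := exists_entry_eq b κ k B hκ hk
  refine ⟨|C| + |kern b k (-1) 2| * |B|, by positivity, fun a w c E O p q h => ?_⟩
  have hB := h.const_nonneg
  have ha := h.amp_pos
  have h1 := hC a w c E O p q h
  have h2 : ‖(kern b k (-1) 2 * a / (1 + k ^ 2) : ℂ)‖ ≤ |kern b k (-1) 2| * |a| := by
    have e : (kern b k (-1) 2 * a / (1 + k ^ 2) : ℂ)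
        = ((kern b k (-1) 2 * a / (1 + k ^ 2) : ℝ) : ℂ) := by push_cast; ring
    rw [e, Complex.norm_real, Real.norm_eq_abs, abs_div, abs_mul,
      abs_of_pos (by positivity : 0 < 1 + k ^ 2)]
    exact div_le_self (by positivity) (by nlinarith [sq_nonneg k])
  have h3 := mul_le_mul h2 (h.norm_even_coeff_le 2) (norm_nonneg _) (by positivity)
  rw [← norm_mul] at h3
  have h4 := norm_add_le ((q : ℂ) - kern b k (-1) 2 * a / (1 + k ^ 2) * coeff 2 (E : L2))
    (kern b k (-1) 2 * a / (1 + k ^ 2) * coeff 2 (E : L2))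
  rw [sub_add_cancel, Complex.norm_real, Real.norm_eq_abs] at h4
  have h5 : C * |a| ^ 4 ≤ |C| * |a| ^ 2 :=
    mul_le_mul (le_abs_self C) (h.pow_le_pow (by norm_num)) (by positivity) (abs_nonneg _)
  have h6 : |kern b k (-1) 2| * |B| * |a| ^ 2 = |kern b k (-1) 2| * |a| * (B * |a|) := by
    rw [abs_of_nonneg hB]; ring
  rw [add_mul, h6]
  linarith

/-- In the row 2 only the product of cos with the mode 1 of the wave is of order a. The other
contributions, including qO_2 and the speed correction times E_2, are O(|a|³), since q = O(a²). -/
theorem exists_second_coeff_eq (b κ k B : ℝ) (hκ : 0 < κ) (hk : 0 < k) : ∃ C,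
    ∀ (a : ℝ) (w : Profile) (c : ℝ) (E O : H1) (p q : ℝ), ZeroData b κ k hk B a w c E O p q →
      ‖coeff 2 (E : L2) - (kern b k 1 1 / (12 * stiff κ k) * a : ℝ)‖ ≤ C * |a| ^ 3 := by
  obtain ⟨C3, hC3⟩ := exists_third_coeff_bound b κ k B hκ hk
  obtain ⟨Cq, hCq0, hCq⟩ := exists_entry_bound b κ k B hκ hk
  have hA := stiff_pos hκ hk
  -- The unperturbed frequency of the mode 2.
  set ν := 6 * stiff κ k / (1 + 4 * k ^ 2) with hν
  have hν0 : 0 < ν := by positivity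
  refine ⟨(2 * (|kern b k 3 (-1)| * B + |kern b k (-1) 3| * (B * |C3|) + kernC b k * (B * B))
    + Cq * B + 2 * B * B) / ν, fun a w c E O p q h => ?_⟩
  have hB := h.const_nonneg
  have ha := h.amp_pos
  obtain ⟨X2, hX2, hX2n⟩ := h.bounds.hat_bound
  have hT : (1 + 4 * (k : ℂ) ^ 2) ≠ 0 := by
    have : (1 + 4 * k ^ 2 : ℝ) ≠ 0 := by positivity
    exact_mod_cast this
  have hAc : (stiff κ k : ℂ) ≠ 0 := by exact_mod_cast hA.ne'
  -- the perturbation of the frequency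
  have hfreq : nu κ k c 0 2 = ν + 2 * (c - κ / (1 + k ^ 2)) := by
    have h1 : (1 : ℝ) + k ^ 2 ≠ 0 := by positivity
    have h2 : (1 : ℝ) + 4 * k ^ 2 ≠ 0 := by positivity
    have e : 1 + k ^ 2 * ((2 : ℤ) : ℝ) ^ 2 = 1 + 4 * k ^ 2 := by push_cast; ring
    rw [nu, hν, stiff, zero_div, sub_zero, e]
    push_cast
    field_simp
    ring
  have htail := row_tail_bound (by norm_num) (hasSum_conv b k w E 2) ({1, 3} : Finset ℤ) (X := X2)
    (Y := (E : L2)) (Y' := 0) (fun m hm => hX2n _ (by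
      simp only [Finset.mem_insert, Finset.mem_singleton, not_or] at hm
      intro e
      rcases abs_eq (zero_le_one' ℤ) |>.1 e with e | e <;> omega)) (fun m _ => by simp)
  rw [Finset.sum_pair (by decide), h.pair.even_low 1 (by simp), norm_zero, add_zero, mul_zero,
    mul_zero, zero_add] at htail
  norm_num at htail
  have ht : kernC b k * (‖X2‖ * ‖(E : L2)‖) ≤ kernC b k * (B * B) * |a| ^ 3 := by
    rw [← sq_abs] at hX2
    have := mul_le_mul_of_nonneg_left
      (mul_le_mul hX2 h.norm_even_le (norm_nonneg _) (by positivity)) (kernC_nonneg b k)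
    refine this.trans (le_of_eq ?_)
    ring
  have h3 : ‖(kern b k (-1) 3 : ℂ) * (w.hat (-1) * coeff 3 (E : L2))‖
      ≤ |kern b k (-1) 3| * (B * |C3|) * |a| ^ 3 := by
    rw [norm_mul, norm_mul, Complex.norm_real, Real.norm_eq_abs, mul_assoc]
    refine mul_le_mul_of_nonneg_left ?_ (abs_nonneg _)
    have h1 : ‖w.hat (-1)‖ ≤ B * |a| := norm_hat_le w (fun z => (h.bounds.bound z).1) _
    have h2 : ‖coeff 3 (E : L2)‖ ≤ |C3| * |a| ^ 2 := (hC3 a w c E O p q h).trans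
      (mul_le_mul_of_nonneg_right (le_abs_self _) (by positivity))
    refine (mul_le_mul h1 h2 (norm_nonneg _) (by positivity)).trans (le_of_eq ?_)
    ring
  have h4 : ‖(kern b k 3 (-1) : ℂ) * w.hat 3 / 2‖ ≤ |kern b k 3 (-1)| * B * |a| ^ 3 := by
    rw [norm_div, norm_mul, Complex.norm_real, Real.norm_eq_abs, Complex.norm_two, mul_assoc]
    have h1 := mul_le_mul_of_nonneg_left (h.norm_hat_le_cube (n := 3) (by norm_num))
      (abs_nonneg (kern b k 3 (-1)))
    have h2 : 0 ≤ |kern b k 3 (-1)| * ‖w.hat 3‖ := by positivity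
    linarith
  have hcos : conv b k w cosH 2 = kern b k 1 1 * (a / 4) + kern b k 3 (-1) * w.hat 3 / 2 := by
    rw [conv_cosH]
    norm_num
    rw [h.wave.hat_one]
    push_cast
    ring
  have hrow := h.even_row (n := 2) (by norm_num)
  rw [coeff_nop, coeff_nop, hfreq, hcos, symD, symS] at hrow
  have e : (ν : ℂ) * (coeff 2 (E : L2) - (kern b k 1 1 / (12 * stiff κ k) * a : ℝ))
      = 2 / (1 + 4 * k ^ 2) * ((kern b k 3 (-1) * w.hat 3 / 2
          + (conv b k w E 2 - kern b k (-1) 3 * (w.hat (-1) * coeff 3 (E : L2))))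
          + kern b k (-1) 3 * (w.hat (-1) * coeff 3 (E : L2)))
        - Complex.I * (q * coeff 2 (O : L2))
        - 2 * ((c - κ / (1 + k ^ 2) : ℝ) : ℂ) * coeff 2 (E : L2) := by
    have e1 : ((1 / (1 + k ^ 2 * ((2 : ℤ) : ℝ) ^ 2) : ℝ) : ℂ) = 1 / (1 + 4 * (k : ℂ) ^ 2) := by
      push_cast; ring
    have e2 : (ν : ℂ) = 6 * stiff κ k / (1 + 4 * (k : ℂ) ^ 2) := by rw [hν]; push_cast; ring
    have e3 : (ν : ℂ) * ((kern b k 1 1 / (12 * stiff κ k) * a : ℝ) : ℂ)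
        = 2 / (1 + 4 * k ^ 2) * (kern b k 1 1 * (a / 4)) := by
      rw [e2]; push_cast; field_simp; ring
    rw [mul_sub, e3]
    rw [e1] at hrow
    push_cast at hrow ⊢
    linear_combination hrow - (2 / (1 + 4 * (k : ℂ) ^ 2)) * (kern b k 1 1 * (a / 4)
      + kern b k 3 (-1) * w.hat 3 / 2 + conv b k w E 2) * Complex.I_sq
  have hn2 : ‖(2 / (1 + 4 * k ^ 2) : ℂ)‖ ≤ 2 := by
    have : (2 / (1 + 4 * k ^ 2) : ℂ) = ((2 / (1 + 4 * k ^ 2) : ℝ) : ℂ) := by push_cast; ring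
    rw [this, Complex.norm_real, Real.norm_eq_abs, abs_of_pos (by positivity),
      div_le_iff₀ (by positivity)]
    nlinarith [sq_nonneg k]
  have g1 := mul_le_mul hn2 ((norm_add_le _ _).trans (add_le_add
    ((norm_add_le _ _).trans (add_le_add h4 (htail.trans ht))) h3)) (norm_nonneg _) zero_le_two
  have g2 : ‖Complex.I * (q * coeff 2 (O : L2))‖ ≤ Cq * B * |a| ^ 3 := by
    rw [norm_mul, norm_mul, Complex.norm_I, one_mul, Complex.norm_real, Real.norm_eq_abs]
    refine (mul_le_mul (hCq a w c E O p q h) (h.norm_odd_coeff_le 2) (norm_nonneg _)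
      (by positivity)).trans (le_of_eq ?_)
    ring
  have g3 : ‖2 * ((c - κ / (1 + k ^ 2) : ℝ) : ℂ) * coeff 2 (E : L2)‖ ≤ 2 * B * B * |a| ^ 3 := by
    rw [norm_mul, norm_mul, Complex.norm_two, Complex.norm_real, Real.norm_eq_abs]
    have h1 := h.bounds.speed
    rw [← sq_abs a] at h1
    refine (mul_le_mul (mul_le_mul_of_nonneg_left h1 zero_le_two) (h.norm_even_coeff_le 2)
      (norm_nonneg _) (by positivity)).trans (le_of_eq ?_)
    ring
  have e' := congrArg norm e
  rw [norm_mul, Complex.norm_real, Real.norm_eq_abs, abs_of_pos hν0] at e'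
  refine le_of_mul_le_mul_left ?_ hν0
  rw [e']
  refine (norm_sub_le _ _).trans ((add_le_add ((norm_sub_le _ _).trans (add_le_add
    ((norm_mul _ _).le.trans g1) g2)) g3).trans (le_of_eq ?_))
  field_simp
  ring

/-- The entry at zero transverse wave number. -/
theorem exists_entry_asymptotics (b κ k B : ℝ) (hκ : 0 < κ) (hk : 0 < k) : ∃ C ≥ 0,
    ∀ (a : ℝ) (w : Profile) (c : ℝ) (E O : H1) (p q : ℝ), ZeroData b κ k hk B a w c E O p q →
      |q - ellSq b κ k a / (1 + k ^ 2)| ≤ C * a ^ 4 := by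
  obtain ⟨C1, hC1⟩ := exists_entry_eq b κ k B hκ hk
  obtain ⟨C2, hC2⟩ := exists_second_coeff_eq b κ k B hκ hk
  refine ⟨|C1| + |kern b k (-1) 2| * |C2|, by positivity, fun a w c E O p q h => ?_⟩
  have h1 := hC1 a w c E O p q h
  have h2 := hC2 a w c E O p q h
  have hA := stiff_pos hκ hk
  have e : ((q - ellSq b κ k a / (1 + k ^ 2) : ℝ) : ℂ)
      = (q - kern b k (-1) 2 * a / (1 + k ^ 2) * coeff 2 (E : L2))
        + kern b k (-1) 2 * a / (1 + k ^ 2)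
          * (coeff 2 (E : L2) - (kern b k 1 1 / (12 * stiff κ k) * a : ℝ)) := by
    -- The two factors of ℓ_a² are the kernels of the interactions (-1, 2) and (1, 1): they equal
    -- (b+1) + (7-2b)k² and (b+1)(1+k²).
    have e1 : ellSq b κ k a / (1 + k ^ 2)
        = kern b k (-1) 2 * a / (1 + k ^ 2) * (kern b k 1 1 / (12 * stiff κ k) * a) := by
      rw [ellSq, kern, kern, stiff]
      push_cast
      field_simp
      ring
    rw [e1]
    push_cast
    ring
  have h3 : ‖(kern b k (-1) 2 * a / (1 + k ^ 2) : ℂ)‖ ≤ |kern b k (-1) 2| * |a| := by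
    have e : (kern b k (-1) 2 * a / (1 + k ^ 2) : ℂ)
        = ((kern b k (-1) 2 * a / (1 + k ^ 2) : ℝ) : ℂ) := by push_cast; ring
    rw [e, Complex.norm_real, Real.norm_eq_abs, abs_div, abs_mul,
      abs_of_pos (by positivity : 0 < 1 + k ^ 2)]
    exact div_le_self (by positivity) (by nlinarith [sq_nonneg k])
  have h4 := mul_le_mul h3 h2 (norm_nonneg _) (by positivity)
  rw [← norm_mul] at h4
  have e' := congrArg norm e
  rw [Complex.norm_real, Real.norm_eq_abs] at e'
  rw [e']
  have ha4 : |a| ^ 4 = a ^ 4 := by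
    rw [show (4 : ℕ) = 2 * 2 by norm_num, pow_mul, sq_abs, ← pow_mul]
  have h5 : C1 * |a| ^ 4 ≤ |C1| * a ^ 4 := by
    rw [ha4]; exact mul_le_mul_of_nonneg_right (le_abs_self _) (by positivity)
  have h6 : |kern b k (-1) 2| * |a| * (C2 * |a| ^ 3) ≤ |kern b k (-1) 2| * |C2| * a ^ 4 := by
    rw [← ha4]
    have : C2 * (|kern b k (-1) 2| * |a| ^ 4) ≤ |C2| * (|kern b k (-1) 2| * |a| ^ 4) :=
      mul_le_mul_of_nonneg_right (le_abs_self _) (by positivity)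
    linarith
  refine (norm_add_le _ _).trans ?_
  rw [add_mul]
  linarith

end BKP

end

open MeasureTheory AddCircle
open scoped Real ENNReal ContDiff

noncomputable section

namespace BKP

open ComplexConjugate Filter Topology

/-! ### The spectrum for small waves -/

theorem eventually_mul_lt (X : ℝ) {Y : ℝ} (hY : 0 < Y) : ∀ᶠ δ in 𝓝[>] (0 : ℝ), X * δ < Y := by
  have h : Tendsto (fun δ : ℝ => X * δ) (𝓝[>] 0) (𝓝 (X * 0)) :=
    (tendsto_id.const_mul X).mono_left nhdsWithin_le_nhds
  rw [mul_zero] at h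
  exact h.eventually (gt_mem_nhds hY)

/-- Only eigenvalues near the origin can leave the imaginary axis. -/
theorem exists_regimes (b κ k : ℝ) (hκ : 0 < κ) (hk : 0 < k) : ∃ δ > 0,
    ∀ (w : Profile) (c ℓ K : ℝ), Function.Even w.fn → C2Bound w K → K ≤ δ →
      |c - κ / (1 + k ^ 2)| + |ℓ ^ 2| ≤ δ → ∀ z ∈ spec (A 1 b κ k hk w c ℓ),
        z.re = 0 ∨ |z.im| ≤ gap κ k / 2 ∧ ∃ V : H1, V ≠ 0 ∧ IsEigen b κ k hk w c (ℓ ^ 2) z V := by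
  obtain ⟨M, hM, ε₁, hε₁, h1⟩ := re_eq_zero_of_large b κ k hκ hk
  -- The intermediate regime has to reach up to the threshold M of the large one. The maximum with
  -- `gap` meets the hypothesis of the lemma.
  obtain ⟨ε₂, hε₂, h2⟩ := re_eq_zero_of_intermediate b κ k hκ hk (max M (gap κ k)) (le_max_right _
      _)
  have hc0 : 0 < κ / (1 + k ^ 2) := by positivity
  obtain ⟨δ, ⟨⟨⟨hδ1, hδ2⟩, hδ3⟩, hδ0⟩⟩ := ((((eventually_mul_lt 1 hε₁).and
    (eventually_mul_lt 1 hε₂)).and (eventually_mul_lt (nopC b k + 1) hc0)).and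
      self_mem_nhdsWithin).exists
  rw [one_mul] at hδ1 hδ2
  refine ⟨δ, hδ0, fun w c ℓ K hev hw hK hs z hz => ?_⟩
  have hN := mul_le_mul_of_nonneg_left hK (nopC_nonneg b k)
  have hc : nopC b k * K < c := by
    have h3 := (abs_le.1 (le_refl |c - κ / (1 + k ^ 2)|)).1
    have h4 := abs_nonneg (ℓ ^ 2)
    linarith
  obtain ⟨V, hV0, hV⟩ := exists_eigen_of_mem_spec hκ hk hw hc hz
  rcases le_or_gt M |z.im| with hl | hl
  · exact Or.inl (h1 w c (ℓ ^ 2) K z V hev hw (hK.trans hδ1.le) (hs.trans hδ1.le) hl hV0 hV)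
  · rcases le_or_gt (gap κ k / 2) |z.im| with hm | hm
    · exact Or.inl (h2 w c (ℓ ^ 2) K z V hev hw (hK.trans hδ2.le) (hs.trans hδ2.le) hm
        (hl.le.trans (le_max_left _ _)) hV0 hV)
    · exact Or.inr ⟨hm.le, V, hV0, hV⟩

theorem re_eq_zero_of_sq_nonpos {z : ℂ} {r : ℝ} (h : z ^ 2 = r) (hr : r ≤ 0) : z.re = 0 := by
  have h1 := congrArg Complex.re h
  have h2 := congrArg Complex.im h
  rw [pow_two] at h1 h2
  simp only [Complex.mul_re, Complex.mul_im, Complex.ofReal_re, Complex.ofReal_im] at h1 h2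
  have h3 : z.re * z.im = 0 := by linarith
  rcases mul_eq_zero.1 h3 with h4 | h4
  · exact h4
  · rw [h4] at h1
    exact pow_eq_zero_iff two_ne_zero |>.1 (le_antisymm (by nlinarith) (sq_nonneg z.re))

theorem WaveBounds.mono {κ k B B' a c : ℝ} {w : Profile} (h : WaveBounds κ k B a w c) (hB : B
    ≤ B') :
    WaveBounds κ k B' a w c := by
  have h1 : B * |a| ≤ B' * |a| := mul_le_mul_of_nonneg_right hB (abs_nonneg a)
  have h2 : B * a ^ 2 ≤ B' * a ^ 2 := mul_le_mul_of_nonneg_right hB (sq_nonneg a)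
  have h3 : B * |a| ^ 3 ≤ B' * |a| ^ 3 := mul_le_mul_of_nonneg_right hB (by positivity)
  obtain ⟨X, hX, hXn⟩ := h.hat_bound
  obtain ⟨Y, hY, hYn⟩ := h.tail
  exact ⟨fun z => ⟨(h.bound z).1.trans h1, (h.bound z).2.1.trans h1, (h.bound z).2.2.trans h1⟩,
    h.speed.trans h2, ⟨X, hX.trans h2, hXn⟩, ⟨Y, hY.trans h3, hYn⟩⟩

/-- The entries `p`, `q` of the linearized operator on the invariant plane, as functions of the
square `s` of the transverse wave number; `θ` is the deviation from the slopes `∓ 1 / (1 + k²)`. -/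
structure Entries (b κ k : ℝ) (hk : 0 < k) (w : Profile) (c σ θ : ℝ) (p q : ℝ → ℝ) : Prop where
  sq_eq : ∀ ℓ : ℝ, ℓ ^ 2 ≤ σ → ∀ z : ℂ, |z.im| ≤ gap κ k / 2 → ∀ V : H1, V ≠ 0 →
    IsEigen b κ k hk w c (ℓ ^ 2) z V → z ^ 2 = p (ℓ ^ 2) * q (ℓ ^ 2)
  simple : ∀ ℓ : ℝ, ℓ ^ 2 ≤ σ → ∀ z : ℂ, |z.im| ≤ gap κ k / 2 → z ≠ 0 →
    z ^ 2 = p (ℓ ^ 2) * q (ℓ ^ 2) → IsSimpleEigenvalue (A 1 b κ k hk w c ℓ) z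
  odd_zero : p 0 = 0
  even_sub : ∀ s s', 0 ≤ s → s ≤ σ → 0 ≤ s' → s' ≤ σ →
    |q s - q s' - (s - s') / (1 + k ^ 2)| ≤ θ * |s - s'|
  odd_sub : ∀ s s', 0 ≤ s → s ≤ σ → 0 ≤ s' → s' ≤ σ →
    |p s - p s' + (s - s') / (1 + k ^ 2)| ≤ θ * |s - s'|

theorem exists_entries {b κ k a c K σ : ℝ} {hk : 0 < k} {w : Profile} (hκ : 0 < κ) (ha : a ≠ 0)
    (hwave : IsWave b κ k a w c) (hw : C2Bound w K) (hσ : 0 ≤ σ)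
    (hs : |c - κ / (1 + k ^ 2)| + σ ≤ gap κ k / 320) (hK : nopC b k * K ≤ gap κ k / 320) :
    ∃ p q : ℝ → ℝ, Entries b κ k hk w c σ (512 * (nopC b k * K) ^ 2 / gap κ k ^ 2) p q ∧
      ∃ E O : H1, InvPair b κ k hk w c 0 E O (p 0) (q 0) ∧
        ‖dz E‖ ≤ 8 * (nopC b k * K) / gap κ k ∧ ‖dz O‖ ≤ 8 * (nopC b k * K) / gap κ k := by
  have hg := gap_pos hκ hk
  have hT : 0 < 1 + k ^ 2 := by positivity
  have hsmall : ∀ s, 0 ≤ s → s ≤ σ → |c - κ / (1 + k ^ 2)| + |s| ≤ gap κ k / 4 := fun s h0 h1 => by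
    rw [abs_of_nonneg h0]; linarith
  have hex : ∀ s, ∃ pq : ℝ × ℝ, 0 ≤ s → s ≤ σ → ∃ E O : H1, InvPair b κ k hk w c s E O pq.1 pq.2 ∧
      |pq.1| ≤ gap κ k / 64 ∧ |pq.2| ≤ gap κ k / 64 := fun s => by
    by_cases h : 0 ≤ s ∧ s ≤ σ
    · have hν : |nu κ k c s 1| ≤ gap κ k / 320 := by
        rw [nu_one]
        refine (abs_sub _ _).trans ?_
        rw [abs_div, abs_of_nonneg h.1, abs_of_pos hT]
        have : s / (1 + k ^ 2) ≤ s := div_le_self h.1 (by nlinarith [sq_nonneg k])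
        linarith [h.2]
      obtain ⟨E, O, p, q, h1, h2, h3⟩ :=
        exists_invPair (hk := hk) hκ hwave.even hw (hsmall s h.1 h.2) hK hν
      exact ⟨(p, q), fun _ _ => ⟨E, O, h1, h2, h3⟩⟩
    · exact ⟨0, fun h0 h1 => absurd ⟨h0, h1⟩ h⟩
  choose pq hpq using hex
  refine ⟨fun s => (pq s).1, fun s => (pq s).2, ⟨?_, ?_, ?_, ?_, ?_⟩, ?_⟩
  · intro ℓ hℓ z hz V hV0 hV
    obtain ⟨E, O, h, hp, hq⟩ := hpq (ℓ ^ 2) (sq_nonneg ℓ) hℓ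
    exact h.sq_eq_of_isEigen hκ hw (hsmall _ (sq_nonneg ℓ) hℓ) hK hp hq hz hV hV0
  · intro ℓ hℓ z hz hz0 hsq
    obtain ⟨E, O, h, hp, hq⟩ := hpq (ℓ ^ 2) (sq_nonneg ℓ) hℓ
    exact h.isSimpleEigenvalue hκ hw (hsmall _ (sq_nonneg ℓ) hℓ) hK hp hq hz hz0 hsq
  · obtain ⟨E, O, h, hp, hq⟩ := hpq 0 le_rfl hσ
    exact h.odd_entry_eq_zero hκ hw (by simpa using hsmall 0 le_rfl hσ) hK hp hq hwave ha
  · intro s s' h0 h1 h0' h1'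
    obtain ⟨E, O, h, hp, hq⟩ := hpq s h0 h1
    obtain ⟨E', O', h', hp', hq'⟩ := hpq s' h0' h1'
    exact (h.entries_sub h' hκ hw (hsmall s h0 h1) (hsmall s' h0' h1') hK hp hq hp' hq').1
  · intro s s' h0 h1 h0' h1'
    obtain ⟨E, O, h, hp, hq⟩ := hpq s h0 h1
    obtain ⟨E', O', h', hp', hq'⟩ := hpq s' h0' h1'
    exact (h.entries_sub h' hκ hw (hsmall s h0 h1) (hsmall s' h0' h1') hK hp hq hp' hq').2
  · obtain ⟨E, O, h, hp, hq⟩ := hpq 0 le_rfl hσ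
    obtain ⟨hE, hO⟩ := h.norm_dz_le hκ hw (hsmall 0 le_rfl hσ) hK hp hq
    exact ⟨E, O, h, hE, hO⟩

namespace Entries

variable {b κ k : ℝ} {hk : 0 < k} {w : Profile} {c σ θ : ℝ} {p q : ℝ → ℝ}

/-- The deviation θ is at most half of the slope 1/(1+k²), so q increases at least with the other
half. -/
theorem even_add_le (h : Entries b κ k hk w c σ θ p q) (hθ : θ ≤ 1 / (2 * (1 + k ^ 2))) {s s' : ℝ}
    (hs' : 0 ≤ s') (hss : s' ≤ s) (hs : s ≤ σ) : q s' + (s - s') / (2 * (1 + k ^ 2)) ≤ q s := by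
  have h1 := (abs_le.1 (h.even_sub s s' (hs'.trans hss) hs hs' (hss.trans hs))).1
  rw [abs_of_nonneg (sub_nonneg.2 hss)] at h1
  have h2 := mul_le_mul_of_nonneg_right hθ (sub_nonneg.2 hss)
  have h3 : (s - s') / (1 + k ^ 2) = 2 * ((s - s') / (2 * (1 + k ^ 2))) := by
    have : (1 : ℝ) + k ^ 2 ≠ 0 := by positivity
    field_simp
  rw [one_div_mul_eq_div] at h2
  linarith

theorem odd_le (h : Entries b κ k hk w c σ θ p q) (hθ : θ ≤ 1 / (2 * (1 + k ^ 2))) {s : ℝ}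
    (hs0 : 0 ≤ s) (hs : s ≤ σ) : p s ≤ -(s / (2 * (1 + k ^ 2))) := by
  have h1 := (abs_le.1 (h.odd_sub s 0 hs0 hs le_rfl (hs0.trans hs))).2
  rw [h.odd_zero, sub_zero, sub_zero, abs_of_nonneg hs0] at h1
  have h2 := mul_le_mul_of_nonneg_right hθ hs0
  have h3 : s / (1 + k ^ 2) = 2 * (s / (2 * (1 + k ^ 2))) := by
    have : (1 : ℝ) + k ^ 2 ≠ 0 := by positivity
    field_simp
  rw [one_div_mul_eq_div] at h2
  linarith

theorem continuousOn (h : Entries b κ k hk w c σ θ p q) : ContinuousOn q (Set.Icc 0 σ) := by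
  have : LipschitzOnWith (Real.toNNReal (|θ| + 1)) q (Set.Icc 0 σ) := by
    refine LipschitzOnWith.of_dist_le_mul fun s hs s' hs' => ?_
    rw [Real.coe_toNNReal _ (by positivity), Real.dist_eq, Real.dist_eq]
    have h1 := h.even_sub s s' hs.1 hs.2 hs'.1 hs'.2
    have h2 := abs_add_le (q s - q s' - (s - s') / (1 + k ^ 2)) ((s - s') / (1 + k ^ 2))
    rw [sub_add_cancel] at h2
    have h3 : |(s - s') / (1 + k ^ 2)| ≤ |s - s'| := by
      rw [abs_div, abs_of_pos (by positivity : 0 < 1 + k ^ 2)]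
      exact div_le_self (abs_nonneg _) (by nlinarith [sq_nonneg k])
    have h4 := mul_le_mul_of_nonneg_right (le_abs_self θ) (abs_nonneg (s - s'))
    linarith
  exact this.continuousOn

/-- Here p ≤ 0 ≤ q, so the eigenvalues near 0 have nonpositive squares. -/
theorem imaginary_of_nonneg (h : Entries b κ k hk w c σ θ p q) (hθ : θ
    ≤ 1 / (2 * (1 + k ^ 2))) {ℓ : ℝ}
    (hℓ : ℓ ^ 2 ≤ σ) (hq : 0 ≤ q (ℓ ^ 2))
    (hreg : ∀ z ∈ spec (A 1 b κ k hk w c ℓ), z.re = 0 ∨ |z.im| ≤ gap κ k / 2 ∧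
      ∃ V : H1, V ≠ 0 ∧ IsEigen b κ k hk w c (ℓ ^ 2) z V) :
    ImaginarySpectrum (A 1 b κ k hk w c ℓ) := by
  intro z hz
  rcases hreg z hz with h0 | ⟨him, V, hV0, hV⟩
  · exact h0
  · have h1 := h.sq_eq ℓ hℓ z him V hV0 hV
    have h2 := h.odd_le hθ (sq_nonneg ℓ) hℓ
    have h3 : 0 ≤ ℓ ^ 2 / (2 * (1 + k ^ 2)) := by positivity
    refine re_eq_zero_of_sq_nonpos (r := p (ℓ ^ 2) * q (ℓ ^ 2)) (by rw [h1]; push_cast; ring) ?_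
    exact mul_nonpos_of_nonpos_of_nonneg (by linarith) hq

/-- Both entries are negative, so λ² = pq > 0 has exactly two real roots. -/
theorem pair_of_neg (h : Entries b κ k hk w c σ θ p q) (hθ : θ ≤ 1 / (2 * (1 + k ^ 2)))
    (hκ : 0 < κ) {ℓ : ℝ} (hℓ : ℓ ^ 2 ≤ σ) (hℓ0 : ℓ ≠ 0) (hq : q (ℓ ^ 2) < 0)
    (hreg : ∀ z ∈ spec (A 1 b κ k hk w c ℓ), z.re = 0 ∨ |z.im| ≤ gap κ k / 2 ∧
      ∃ V : H1, V ≠ 0 ∧ IsEigen b κ k hk w c (ℓ ^ 2) z V) :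
    ∃ μ : ℝ, 0 < μ ∧ IsSimpleEigenvalue (A 1 b κ k hk w c ℓ) (μ : ℂ) ∧
      IsSimpleEigenvalue (A 1 b κ k hk w c ℓ) (-μ : ℂ) ∧
      ∀ z ∈ spec (A 1 b κ k hk w c ℓ), z ≠ (μ : ℂ) → z ≠ (-μ : ℂ) → z.re = 0 := by
  have hg := gap_pos hκ hk
  have h2 := h.odd_le hθ (sq_nonneg ℓ) hℓ
  have h3 : 0 < ℓ ^ 2 / (2 * (1 + k ^ 2)) := by positivity
  have hpq : 0 < p (ℓ ^ 2) * q (ℓ ^ 2) := mul_pos_of_neg_of_neg (by linarith) hq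
  set μ := Real.sqrt (p (ℓ ^ 2) * q (ℓ ^ 2)) with hμ
  have hμ0 : 0 < μ := Real.sqrt_pos.2 hpq
  have hsq : (μ : ℂ) ^ 2 = p (ℓ ^ 2) * q (ℓ ^ 2) := by
    rw [← Complex.ofReal_pow, Real.sq_sqrt hpq.le, Complex.ofReal_mul]
  have hμc : (μ : ℂ) ≠ 0 := by exact_mod_cast hμ0.ne'
  refine ⟨μ, hμ0, h.simple ℓ hℓ _ ?_ hμc hsq, h.simple ℓ hℓ _ ?_ (neg_ne_zero.2 hμc) ?_, ?_⟩
  · rw [Complex.ofReal_im, abs_zero]; positivity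
  · rw [Complex.neg_im, Complex.ofReal_im, neg_zero, abs_zero]; positivity
  · rw [neg_sq, hsq]
  · intro z hz hz1 hz2
    rcases hreg z hz with h0 | ⟨him, V, hV0, hV⟩
    · exact h0
    · have h1 := h.sq_eq ℓ hℓ z him V hV0 hV
      rw [← hsq] at h1
      rcases sq_eq_sq_iff_eq_or_eq_neg.1 h1 with h4 | h4
      · exact absurd h4 hz1
      · exact absurd h4 hz2

/-- The transition point. -/
theorem exists_transition (h : Entries b κ k hk w c σ θ p q) (hθ : θ ≤ 1 / (2 * (1 + k ^ 2)))
    (hq : q 0 < 0) (hqσ : -q 0 < σ / (2 * (1 + k ^ 2))) (hσ : 0 < σ) (hθ0 : 0 ≤ θ) :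
    ∃ L, 0 < L ∧ L ≤ σ ∧ q L = 0 ∧
      |L - -((1 + k ^ 2) * q 0)| ≤ (1 + k ^ 2) * (θ * (2 * (1 + k ^ 2) * |q 0|)) := by
  have hT : 0 < 1 + k ^ 2 := by positivity
  have h1 := h.even_add_le hθ le_rfl hσ.le le_rfl
  rw [sub_zero] at h1
  -- By its slope q has become positive at σ, because -q(0) is small against σ.
  obtain ⟨L, hL, hqL⟩ := intermediate_value_Icc hσ.le h.continuousOn
    (⟨hq.le, by linarith⟩ : (0 : ℝ) ∈ Set.Icc (q 0) (q σ))
  have hL0 : 0 < L := lt_of_le_of_ne hL.1 fun h0 => by rw [← h0] at hqL; linarith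
  refine ⟨L, hL0, hL.2, hqL, ?_⟩
  have h2 := h.even_add_le hθ le_rfl hL.1 hL.2
  rw [hqL, sub_zero] at h2
  have h3 : L ≤ 2 * (1 + k ^ 2) * |q 0| := by
    rw [abs_of_neg hq]
    have : L / (2 * (1 + k ^ 2)) ≤ -q 0 := by linarith
    rw [div_le_iff₀ (by positivity)] at this
    linarith
  have h4 := h.even_sub L 0 hL.1 hL.2 le_rfl hσ.le
  rw [hqL, sub_zero, abs_of_pos hL0] at h4
  have e : L - -((1 + k ^ 2) * q 0) = -((1 + k ^ 2) * (0 - q 0 - L / (1 + k ^ 2))) := by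
    field_simp
    ring
  rw [e, abs_neg, abs_mul, abs_of_pos hT]
  exact mul_le_mul_of_nonneg_left (h4.trans (mul_le_mul_of_nonneg_left h3 hθ0)) hT.le

end Entries

end BKP

end

/-! ### Choice of the constants and description of the spectrum -/

open MeasureTheory AddCircle
open scoped Real ENNReal ContDiff

noncomputable section

namespace BKP

open ComplexConjugate Filter Topology

theorem ellSq_eq_mul_sq (b κ k a : ℝ) : ellSq b κ k a = ellSq b κ k 1 * a ^ 2 := by
  rw [ellSq, ellSq]; ring

theorem sub_sign_bound {q₀ e T Cq a : ℝ} (hT : 1 ≤ T)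
    (h : |q₀ - e * a ^ 2 / T| ≤ Cq * a ^ 4) (ha : a ≠ 0)
    (hs : Cq * T * a ^ 2 < |e|) : (e < 0 → q₀ < 0) ∧ (0 < e → 0 < q₀) := by
  have hT0 : 0 < T := by linarith
  have ha2 : 0 < a ^ 2 := by positivity
  obtain ⟨h1, h2⟩ := abs_le.1 h
  have h3 : Cq * a ^ 4 * T < |e| * a ^ 2 := by
    have := mul_lt_mul_of_pos_right hs ha2
    calc _ = Cq * T * a ^ 2 * a ^ 2 := by ring
      _ < _ := this
  have h4 : e * a ^ 2 / T * T = e * a ^ 2 := div_mul_cancel₀ _ hT0.ne'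
  constructor
  · intro he
    rw [abs_of_neg he] at h3
    have h5 := mul_le_mul_of_nonneg_right h2 hT0.le
    by_contra hq
    have := mul_nonneg (not_lt.1 hq) hT0.le
    nlinarith
  · intro he
    rw [abs_of_pos he] at h3
    have h5 := mul_le_mul_of_nonneg_right h1 hT0.le
    by_contra hq
    have := mul_nonneg (neg_nonneg.2 (not_lt.1 hq)) hT0.le
    nlinarith

set_option maxHeartbeats 1000000 in
theorem exists_spectral_description (b κ k : ℝ) (hκ : 0 < κ) (hk : 0 < k) :
    ∃ δ > 0, ∃ ε > 0, ∃ C > 0, ∀ a : ℝ, 0 < |a| → |a| < ε →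
      ∀ (w : Profile) (c : ℝ), IsWave b κ k a w c → IsSmall κ k δ w c →
        (ellSq b κ k a < 0 →
          ∃ L : ℝ, 0 < L ∧ |L - (-ellSq b κ k a)| ≤ C * a ^ 4 ∧
            ∀ ℓ : ℝ, |ℓ| < ε →
              (L < ℓ ^ 2 → ImaginarySpectrum (A 1 b κ k hk w c ℓ)) ∧
              (ℓ ≠ 0 → ℓ ^ 2 < L →
                ∃ μ : ℝ, 0 < μ ∧
                  IsSimpleEigenvalue (A 1 b κ k hk w c ℓ) (μ : ℂ) ∧
                  IsSimpleEigenvalue (A 1 b κ k hk w c ℓ) (-μ : ℂ) ∧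
                  ∀ z ∈ spec (A 1 b κ k hk w c ℓ), z ≠ (μ : ℂ) → z ≠ (-μ : ℂ) → z.re = 0)) ∧
        (0 < ellSq b κ k a →
          ∀ ℓ : ℝ, |ℓ| < ε → ImaginarySpectrum (A 1 b κ k hk w c ℓ)) := by
  have hg := gap_pos hκ hk
  have hA := stiff_pos hκ hk
  have hN := nopC_nonneg b k
  have hQ := quadC_nonneg b k
  obtain ⟨δr, hδr, hreg⟩ := exists_regimes b κ k hκ hk
  obtain ⟨R, hR⟩ : ∃ R, R = 101 * ((16 * quadC b k * (1 + k ^ 2) + 4 * quadC b k) / stiff κ k) :=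
    ⟨_, rfl⟩
  obtain ⟨B₀, hB₀⟩ : ∃ B, B = 2 + 2 * R + 8 * quadC b k * R + 8 * quadC b k * R / stiff κ k :=
    ⟨_, rfl⟩
  have hR0 : 0 ≤ R := by rw [hR]; positivity
  have hB0 : 0 ≤ B₀ := by rw [hB₀]; positivity
  -- One constant for the bounds of the wave and for the size of E and O.
  set B := B₀ + 8 * (nopC b k * B₀) / gap κ k with hB
  have hBle : B₀ ≤ B := le_add_of_nonneg_right (by positivity)
  obtain ⟨Cq, hCq0, hCq⟩ := exists_entry_asymptotics b κ k B hκ hk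
  set e := ellSq b κ k 1 with he
  set D := 512 * (nopC b k * B₀) ^ 2 / gap κ k ^ 2 with hD
  have hD0 : 0 ≤ D := by positivity
  have hT1 : 1 ≤ 1 + k ^ 2 := by nlinarith [sq_nonneg k]
  obtain ⟨δ, ⟨⟨hδ1, hδ2⟩, hδ3⟩, hδ0⟩ := ((((eventually_mul_lt 2 hδr).and
    (eventually_mul_lt (101 * ((1 + k ^ 2 + quadC b k) / stiff κ k)) one_half_pos)).and
      (eventually_mul_lt 640 hg)).and self_mem_nhdsWithin).exists
  set σ := min (δr / 2) (gap κ k / 640) with hσ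
  have hσ0 : 0 < σ := lt_min (by positivity) (by positivity)
  -- For e = 0 both cases of the conclusion are void; the value 1 only keeps the threshold for ε
  -- positive.
  have he' : 0 < if e = 0 then 1 else |e| := by
    split_ifs with h
    · norm_num
    · exact abs_pos.2 h
  obtain ⟨ε, ⟨⟨⟨⟨⟨hε1, hε2⟩, hε3⟩, hε4⟩, hε5⟩, hε6⟩, hε0⟩ :=
    (((((((eventually_mul_lt 1 one_pos).and (eventually_mul_lt 1 hσ0)).and
      (eventually_mul_lt (nopC b k * B₀) (by positivity : 0 < gap κ k / 320))).and
      (eventually_mul_lt D (by positivity : 0 < 1 / (2 * (1 + k ^ 2))))).and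
      (eventually_mul_lt (Cq * (1 + k ^ 2)) he')).and
      (eventually_mul_lt (|e| + Cq) (by positivity : 0 < σ / (2 * (1 + k ^ 2))))).and
      self_mem_nhdsWithin).exists
  have hε0' : 0 < ε := hε0
  rw [one_mul] at hε1 hε2
  -- The first summand is the error of the linear approximation of q up to its zero, the second the
  -- error of q(0). The last ensures positivity.
  refine ⟨δ, hδ0, ε, hε0, (1 + k ^ 2) * (D * (2 * (1 + k ^ 2) * (|e| + Cq))) + (1 + k ^ 2) * Cq + 1,
    by positivity, fun a ha0 haε w c hwave hsmall => ?_⟩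
  have ha : a ≠ 0 := abs_pos.1 ha0
  have ha1 : |a| ≤ 1 := (haε.trans hε1).le
  have ha2 : a ^ 2 ≤ ε := by
    rw [← sq_abs]
    nlinarith
  have hwδ : C2Bound w δ := fun z =>
    ⟨(hsmall.fn_lt z).le, (hsmall.deriv_lt z).le, (hsmall.deriv2_lt z).le⟩
  have hγ := hsmall.speed_lt.le
  have hWB : WaveBounds κ k B₀ a w c := hwave.waveBounds hκ hk ha hwδ hγ (by
    calc _ = 101 * ((1 + k ^ 2 + quadC b k) / stiff κ k) * δ := by ring
      _ ≤ _ := hδ2.le) hR hB₀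
  have hNa : nopC b k * (B₀ * |a|) ≤ gap κ k / 320 := by
    rw [← mul_assoc]
    exact (mul_le_mul_of_nonneg_left haε.le (by positivity)).trans hε3.le
  have hσg : σ ≤ gap κ k / 640 := min_le_right _ _
  obtain ⟨p, q, hE, E, O, hpair, hEn, hOn⟩ := exists_entries (hk := hk) hκ ha hwave hWB.bound hσ0.le
    (by linarith) hNa
  have hθe : 512 * (nopC b k * (B₀ * |a|)) ^ 2 / gap κ k ^ 2 = D * a ^ 2 := by
    rw [hD, ← sq_abs a]; ring
  rw [hθe] at hE
  have hθ : D * a ^ 2 ≤ 1 / (2 * (1 + k ^ 2)) :=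
    (mul_le_mul_of_nonneg_left ha2 hD0).trans hε4.le
  have hle : 8 * (nopC b k * (B₀ * |a|)) / gap κ k ≤ B * |a| := by
    have e1 : 8 * (nopC b k * (B₀ * |a|)) / gap κ k = 8 * (nopC b k * B₀) / gap κ k * |a| := by ring
    rw [e1]
    exact mul_le_mul_of_nonneg_right (le_add_of_nonneg_left hB0) (abs_nonneg a)
  have hq0 := hCq a w c E O (p 0) (q 0) ⟨ha, ha1, hwave, hWB.mono hBle, hpair, hEn.trans hle,
    hOn.trans hle, by linarith⟩
  rw [ellSq_eq_mul_sq, ← he] at hq0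
  have ha4 : a ^ 4 ≤ a ^ 2 := by
    rw [← sq_abs, show a ^ 4 = |a| ^ 4 by
      rw [show (4 : ℕ) = 2 * 2 by norm_num, pow_mul, pow_mul, sq_abs]]
    exact pow_le_pow_of_le_one (abs_nonneg a) ha1 (by norm_num)
  have hq0b : |q 0| ≤ (|e| + Cq) * a ^ 2 := by
    have h1 := abs_add_le (q 0 - e * a ^ 2 / (1 + k ^ 2)) (e * a ^ 2 / (1 + k ^ 2))
    rw [sub_add_cancel] at h1
    have h2 : |e * a ^ 2 / (1 + k ^ 2)| ≤ |e| * a ^ 2 := by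
      rw [abs_div, abs_mul, abs_of_nonneg (sq_nonneg a), abs_of_pos (by positivity : 0 < 1 + k ^ 2)]
      exact div_le_self (by positivity) hT1
    have h3 := mul_le_mul_of_nonneg_left ha4 hCq0
    linarith
  have hsign : e ≠ 0 → Cq * (1 + k ^ 2) * a ^ 2 < |e| := fun hne => by
    rw [if_neg hne] at hε5
    exact (mul_le_mul_of_nonneg_left ha2 (by positivity)).trans_lt hε5
  have hsgn := fun hne => sub_sign_bound hT1 hq0 ha (hsign hne)
  have hℓσ : ∀ ℓ : ℝ, |ℓ| < ε → ℓ ^ 2 ≤ σ := fun ℓ hℓ => by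
    rw [← sq_abs]
    nlinarith [abs_nonneg ℓ]
  have hreg' : ∀ ℓ : ℝ, |ℓ| < ε → ∀ z ∈ spec (A 1 b κ k hk w c ℓ), z.re = 0 ∨
      |z.im| ≤ gap κ k / 2 ∧ ∃ V : H1, V ≠ 0 ∧ IsEigen b κ k hk w c (ℓ ^ 2) z V := fun ℓ hℓ => by
    refine hreg w c ℓ δ hwave.even hwδ (by linarith) ?_
    have h1 : |ℓ ^ 2| ≤ δr / 2 := by
      rw [abs_of_nonneg (sq_nonneg ℓ)]
      exact (hℓσ ℓ hℓ).trans (min_le_left _ _)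
    linarith
  rw [ellSq_eq_mul_sq, ← he]
  have ha2p : 0 < a ^ 2 := by positivity
  constructor
  · intro hneg
    have hen : e < 0 := by
      by_contra h
      exact absurd hneg (not_lt.2 (mul_nonneg (not_lt.1 h) ha2p.le))
    have hqneg := (hsgn hen.ne).1 hen
    have hqσ : -q 0 < σ / (2 * (1 + k ^ 2)) := by
      have h1 := mul_le_mul_of_nonneg_left ha2 (by positivity : 0 ≤ |e| + Cq)
      linarith [neg_abs_le (q 0), neg_le_abs (q 0)]
    obtain ⟨L, hL0, hLσ, hqL, hLb⟩ := hE.exists_transition hθ hqneg hqσ hσ0 (by positivity)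
    refine ⟨L, hL0, ?_, fun ℓ hℓ => ⟨fun hlt => ?_, fun hℓ0 hlt => ?_⟩⟩
    · have h1 : |(1 + k ^ 2) * q 0 - e * a ^ 2| ≤ (1 + k ^ 2) * (Cq * a ^ 4) := by
        have e1 : (1 + k ^ 2) * q 0 - e * a ^ 2 = (1 + k ^ 2) * (q 0 - e * a ^ 2 / (1 + k ^ 2)) :=
            by
          field_simp
        rw [e1, abs_mul, abs_of_pos (by positivity : 0 < 1 + k ^ 2)]
        exact mul_le_mul_of_nonneg_left hq0 (by positivity)
      have h2 := abs_sub (L - -((1 + k ^ 2) * q 0)) ((1 + k ^ 2) * q 0 - e * a ^ 2)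
      have e2 : L - -((1 + k ^ 2) * q 0) - ((1 + k ^ 2) * q 0 - e * a ^ 2) = L - -(e * a ^ 2) := by
        ring
      rw [e2] at h2
      have h3 : (1 + k ^ 2) * (D * a ^ 2 * (2 * (1 + k ^ 2) * |q 0|))
          ≤ (1 + k ^ 2) * (D * a ^ 2 * (2 * (1 + k ^ 2) * ((|e| + Cq) * a ^ 2))) := by
        gcongr
      have h4 : 0 ≤ a ^ 4 := by positivity
      calc _ ≤ _ := h2
        _ ≤ (1 + k ^ 2) * (D * a ^ 2 * (2 * (1 + k ^ 2) * ((|e| + Cq) * a ^ 2)))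
            + (1 + k ^ 2) * (Cq * a ^ 4) := add_le_add (hLb.trans h3) h1
        _ ≤ _ := by linarith
    · have h1 := hE.even_add_le hθ hL0.le hlt.le (hℓσ ℓ hℓ)
      rw [hqL, zero_add] at h1
      have h2 : 0 ≤ (ℓ ^ 2 - L) / (2 * (1 + k ^ 2)) := div_nonneg (by linarith) (by positivity)
      exact hE.imaginary_of_nonneg hθ (hℓσ ℓ hℓ) (h2.trans h1) (hreg' ℓ hℓ)
    · have h1 := hE.even_add_le hθ (sq_nonneg ℓ) hlt.le hLσ
      rw [hqL] at h1
      have h2 : 0 < (L - ℓ ^ 2) / (2 * (1 + k ^ 2)) := div_pos (by linarith) (by positivity)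
      exact hE.pair_of_neg hθ hκ (hℓσ ℓ hℓ) hℓ0 (by linarith) (hreg' ℓ hℓ)
  · intro hpos ℓ hℓ
    have hep : 0 < e := by
      by_contra h
      exact absurd hpos (not_lt.2 (mul_nonpos_of_nonpos_of_nonneg (not_lt.1 h) ha2p.le))
    have hqpos := (hsgn hep.ne').2 hep
    have h1 := hE.even_add_le hθ le_rfl (sq_nonneg ℓ) (hℓσ ℓ hℓ)
    rw [sub_zero] at h1
    have h2 : 0 ≤ ℓ ^ 2 / (2 * (1 + k ^ 2)) := by positivity
    exact hE.imaginary_of_nonneg hθ (hℓσ ℓ hℓ) (by linarith) (hreg' ℓ hℓ)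

end BKP

end

open MeasureTheory AddCircle
open scoped Real ENNReal ContDiff

noncomputable section

namespace BKP

open scoped BoundedContinuousFunction

/-! ### The equation `v'' + v = x` -/

/-- Continuous even `2π`-periodic functions which are orthogonal to `cos`. -/
structure IsForcing (x : ℝ → ℝ) : Prop where
  cont : Continuous x
  even : Function.Even x
  periodic : Function.Periodic x (2 * π)
  orth : ∫ z in (0 : ℝ)..2 * π, x z * Real.cos z = 0

theorem intervalIntegrable_mul_cos {f : ℝ → ℝ} (hf : Continuous f) :
    IntervalIntegrable (fun z => f z * Real.cos z) volume 0 (2 * π) :=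
  (hf.mul Real.continuous_cos).intervalIntegrable _ _

/-- The primitive of `x cos` that vanishes at `0`. -/
def cosInt (x : ℝ → ℝ) (z : ℝ) : ℝ := ∫ t in (0 : ℝ)..z, x t * Real.cos t

/-- The primitive of `x sin` that vanishes at `0`. -/
def sinInt (x : ℝ → ℝ) (z : ℝ) : ℝ := ∫ t in (0 : ℝ)..z, x t * Real.sin t

theorem hasDerivAt_cosInt {x : ℝ → ℝ} (hx : Continuous x) (z : ℝ) :
    HasDerivAt (cosInt x) (x z * Real.cos z) z :=
  (hx.mul Real.continuous_cos).integral_hasStrictDerivAt 0 z |>.hasDerivAt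

theorem hasDerivAt_sinInt {x : ℝ → ℝ} (hx : Continuous x) (z : ℝ) :
    HasDerivAt (sinInt x) (x z * Real.sin z) z :=
  (hx.mul Real.continuous_sin).integral_hasStrictDerivAt 0 z |>.hasDerivAt

theorem cosInt_neg {x : ℝ → ℝ} (hx : Function.Even x) (z : ℝ) : cosInt x (-z) = -cosInt x z := by
  have h := intervalIntegral.integral_comp_neg (a := 0) (b := z) fun t => x t * Real.cos t
  simp only [hx _, Real.cos_neg, neg_zero] at h
  rw [cosInt, cosInt, intervalIntegral.integral_symm, h]

theorem sinInt_neg {x : ℝ → ℝ} (hx : Function.Even x) (z : ℝ) : sinInt x (-z) = sinInt x z := by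
  have h := intervalIntegral.integral_comp_neg (a := 0) (b := z) fun t => x t * Real.sin t
  simp only [hx _, Real.sin_neg, neg_zero, mul_neg, intervalIntegral.integral_neg] at h
  rw [sinInt, sinInt, intervalIntegral.integral_symm, ← h, neg_neg]

theorem IsForcing.cosInt_periodic {x : ℝ → ℝ} (hx : IsForcing x) :
    Function.Periodic (cosInt x) (2 * π) := fun z => by
  have hc : Continuous fun t => x t * Real.cos t := hx.cont.mul Real.continuous_cos
  have hp : Function.Periodic (fun t => x t * Real.cos t) (2 * π) :=
    hx.periodic.mul Real.cos_periodic
  rw [cosInt, ← intervalIntegral.integral_add_adjacent_intervals (hc.intervalIntegrable 0 z)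
    (hc.intervalIntegrable z _), hp.intervalIntegral_add_eq z 0, zero_add, hx.orth, add_zero,
    cosInt]

/-- The integrand is odd, so its integral over a period vanishes. For the cosine integral the
orthogonality to cos was needed instead. -/
theorem IsForcing.sinInt_periodic {x : ℝ → ℝ} (hx : IsForcing x) :
    Function.Periodic (sinInt x) (2 * π) := fun z => by
  have hc : Continuous fun t => x t * Real.sin t := hx.cont.mul Real.continuous_sin
  have hp : Function.Periodic (fun t => x t * Real.sin t) (2 * π) :=
    hx.periodic.mul Real.sin_periodic
  have h0 : ∫ t in (-π)..(-π + 2 * π), x t * Real.sin t = 0 := by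
    rw [show -π + 2 * π = π by ring, ← intervalIntegral.integral_add_adjacent_intervals
      (hc.intervalIntegrable (-π) 0) (hc.intervalIntegrable 0 π), intervalIntegral.integral_symm]
    have := sinInt_neg hx.even π
    rw [sinInt, sinInt] at this
    rw [this, neg_add_cancel]
  rw [sinInt, ← intervalIntegral.integral_add_adjacent_intervals (hc.intervalIntegrable 0 z)
    (hc.intervalIntegrable z _), hp.intervalIntegral_add_eq z (-π), h0, add_zero, sinInt]

/-- The first cosine coefficient. -/
def cosCoeff (f : ℝ → ℝ) : ℝ := 1 / π * ∫ z in (0 : ℝ)..2 * π, f z * Real.cos z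

/-- A solution of `v'' + v = x`. -/
def partSol (x : ℝ → ℝ) (z : ℝ) : ℝ := Real.sin z * cosInt x z - Real.cos z * sinInt x z

/-- The solution of `v'' + v = x` which is even and orthogonal to `cos`. -/
def sol (x : ℝ → ℝ) (z : ℝ) : ℝ := partSol x z - cosCoeff (partSol x) * Real.cos z

/-- The derivative of `sol`. -/
def solDeriv (x : ℝ → ℝ) (z : ℝ) : ℝ :=
  Real.cos z * cosInt x z + Real.sin z * sinInt x z + cosCoeff (partSol x) * Real.sin z

theorem continuous_partSol {x : ℝ → ℝ} (hx : Continuous x) : Continuous (partSol x) := by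
  have h1 : Continuous (cosInt x) :=
    continuous_iff_continuousAt.2 fun z => (hasDerivAt_cosInt hx z).continuousAt
  have h2 : Continuous (sinInt x) :=
    continuous_iff_continuousAt.2 fun z => (hasDerivAt_sinInt hx z).continuousAt
  exact (Real.continuous_sin.mul h1).sub (Real.continuous_cos.mul h2)

theorem hasDerivAt_sol {x : ℝ → ℝ} (hx : Continuous x) (z : ℝ) :
    HasDerivAt (sol x) (solDeriv x z) z := by
  have h := (((Real.hasDerivAt_sin z).mul (hasDerivAt_cosInt hx z)).sub
    ((Real.hasDerivAt_cos z).mul (hasDerivAt_sinInt hx z))).sub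
    ((Real.hasDerivAt_cos z).const_mul (cosCoeff (partSol x)))
  exact h.congr_deriv (by rw [solDeriv]; ring)

theorem hasDerivAt_solDeriv {x : ℝ → ℝ} (hx : Continuous x) (z : ℝ) :
    HasDerivAt (solDeriv x) (x z - sol x z) z := by
  have h := (((Real.hasDerivAt_cos z).mul (hasDerivAt_cosInt hx z)).add
    ((Real.hasDerivAt_sin z).mul (hasDerivAt_sinInt hx z))).add
    ((Real.hasDerivAt_sin z).const_mul (cosCoeff (partSol x)))
  refine h.congr_deriv ?_
  rw [sol, partSol]
  linear_combination x z * Real.sin_sq_add_cos_sq z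

theorem continuous_sol {x : ℝ → ℝ} (hx : Continuous x) : Continuous (sol x) :=
  continuous_iff_continuousAt.2 fun z => (hasDerivAt_sol hx z).continuousAt

theorem continuous_solDeriv {x : ℝ → ℝ} (hx : Continuous x) : Continuous (solDeriv x) :=
  continuous_iff_continuousAt.2 fun z => (hasDerivAt_solDeriv hx z).continuousAt

namespace IsForcing

variable {x y : ℝ → ℝ}

theorem sol_even (hx : IsForcing x) : Function.Even (sol x) := fun z => by
  rw [sol, sol, partSol, partSol, cosInt_neg hx.even, sinInt_neg hx.even, Real.cos_neg,
    Real.sin_neg]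
  ring

theorem solDeriv_neg (hx : IsForcing x) (z : ℝ) : solDeriv x (-z) = -solDeriv x z := by
  rw [solDeriv, solDeriv, cosInt_neg hx.even, sinInt_neg hx.even, Real.cos_neg, Real.sin_neg]
  ring

theorem sol_periodic (hx : IsForcing x) : Function.Periodic (sol x) (2 * π) := fun z => by
  rw [sol, sol, partSol, partSol, hx.cosInt_periodic z, hx.sinInt_periodic z, Real.cos_add_two_pi,
    Real.sin_add_two_pi]

theorem solDeriv_periodic (hx : IsForcing x) : Function.Periodic (solDeriv x) (2 * π) := fun z => by
  rw [solDeriv, solDeriv, hx.cosInt_periodic z, hx.sinInt_periodic z, Real.cos_add_two_pi,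
    Real.sin_add_two_pi]

theorem sol_orth (hx : IsForcing x) : ∫ z in (0 : ℝ)..2 * π, sol x z * Real.cos z = 0 := by
  have := integral_sub_mul_cos (continuous_partSol hx.cont) (cosCoeff (partSol x))
  simp only [sol]
  rw [this, cosCoeff]
  field_simp
  ring

theorem zero : IsForcing fun _ => 0 :=
  ⟨continuous_const, fun _ => rfl, fun _ => rfl, by simp⟩

theorem sub (hx : IsForcing x) (hy : IsForcing y) : IsForcing fun z => x z - y z where
  cont := hx.cont.sub hy.cont
  even z := by simp only [hx.even z, hy.even z]
  periodic z := by simp only [hx.periodic z, hy.periodic z]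
  orth := by
    simp only [sub_mul]
    rw [intervalIntegral.integral_sub
      (intervalIntegrable_mul_cos hx.cont)
      (intervalIntegrable_mul_cos hy.cont), hx.orth, hy.orth, sub_zero]

theorem sol_isForcing (hx : IsForcing x) : IsForcing (sol x) :=
  ⟨continuous_sol hx.cont, hx.sol_even, hx.sol_periodic, hx.sol_orth⟩

theorem sol_sub_bound (hx : IsForcing x) (hy : IsForcing y) {η : ℝ} (h : ∀ z, |x z - y z| ≤ η)
    (z : ℝ) : |sol x z - sol y z| ≤ 101 * η ∧ |solDeriv x z - solDeriv y z| ≤ 101 * η ∧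
      |(x z - sol x z) - (y z - sol y z)| ≤ 101 * η := by
  have hs := hx.sol_isForcing.sub hy.sol_isForcing
  have hη : 0 ≤ η := (abs_nonneg _).trans (h 0)
  obtain ⟨h1, h2, h3⟩ := ode_bound (r := fun z => sol x z - sol y z)
    (r₁ := fun z => solDeriv x z - solDeriv y z)
    (r₂ := fun z => (x z - sol x z) - (y z - sol y z))
    (fun z => (hasDerivAt_sol hx.cont z).sub (hasDerivAt_sol hy.cont z))
    (fun z => (hasDerivAt_solDeriv hx.cont z).sub (hasDerivAt_solDeriv hy.cont z))
    hs.even hs.periodic hs.orth (η := η) (fun z => by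
      rw [show sol x z - sol y z + (x z - sol x z - (y z - sol y z)) = x z - y z by ring]
      exact h z) z
  exact ⟨by linarith, by linarith, h3⟩

theorem sol_bound (hx : IsForcing x) {η : ℝ} (h : ∀ z, |x z| ≤ η)
    (z : ℝ) : |sol x z| ≤ 101 * η ∧ |solDeriv x z| ≤ 101 * η ∧ |x z - sol x z| ≤ 101 * η := by
  have hη : 0 ≤ η := (abs_nonneg _).trans (h 0)
  obtain ⟨h1, h2, h3⟩ := ode_bound (hasDerivAt_sol hx.cont) (hasDerivAt_solDeriv hx.cont)
    hx.sol_even hx.sol_periodic hx.sol_orth (η := η) (fun z => by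
      rw [add_sub_cancel]
      exact h z) z
  exact ⟨by linarith, by linarith, h3⟩

end IsForcing

/-! ### The fixed point equation for the waves -/

/-- The profile divided by the amplitude. -/
def ansatz (x : ℝ → ℝ) (z : ℝ) : ℝ := Real.cos z + sol x z

/-- The derivative of `ansatz`. -/
def ansatz₁ (x : ℝ → ℝ) (z : ℝ) : ℝ := -Real.sin z + solDeriv x z

/-- The second derivative of `ansatz`. -/
def ansatz₂ (x : ℝ → ℝ) (z : ℝ) : ℝ := -Real.cos z + (x z - sol x z)

/-- The quadratic part of the wave equation. -/
def quadAnsatz (b k : ℝ) (x : ℝ → ℝ) (z : ℝ) : ℝ :=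
  (b + 1) / 2 * ansatz x z ^ 2 - k ^ 2 * ansatz x z * ansatz₂ x z
    - (b - 1) / 2 * k ^ 2 * ansatz₁ x z ^ 2

/-- The correction of the speed divided by the amplitude. -/
def speedCorr (b k : ℝ) (x : ℝ → ℝ) : ℝ := cosCoeff (quadAnsatz b k x) / (1 + k ^ 2)

/-- The map whose fixed points are waves of amplitude `a`. -/
def waveMap (b κ k a : ℝ) (x : ℝ → ℝ) (z : ℝ) : ℝ :=
  a / stiff κ k * (speedCorr b k x * (ansatz x z - k ^ 2 * ansatz₂ x z) - quadAnsatz b k x z)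

theorem cosCoeff_cos : cosCoeff Real.cos = 1 := by
  have h : ∀ z : ℝ, Real.cos z * Real.cos z = Real.cos z ^ 2 := fun z => (sq _).symm
  simp only [cosCoeff, h, integral_cos_sq_period]
  field_simp

theorem abs_cosCoeff_le {f : ℝ → ℝ} {M : ℝ} (h : ∀ z, |f z| ≤ M) : |cosCoeff f| ≤ 2 * M := by
  have hπ := Real.pi_pos
  have := intervalIntegral.norm_integral_le_of_norm_le_const (a := 0) (b := 2 * π) (C := M)
    (f := fun z => f z * Real.cos z) fun z _ => by
      rw [Real.norm_eq_abs, abs_mul]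
      exact (mul_le_of_le_one_right (abs_nonneg _) (Real.abs_cos_le_one _)).trans (h z)
  rw [Real.norm_eq_abs, sub_zero, abs_of_pos (by positivity : 0 < 2 * π)] at this
  rw [cosCoeff, abs_mul, abs_of_pos (by positivity : 0 < 1 / π), one_div,
    inv_mul_le_iff₀ hπ]
  linarith

theorem cosCoeff_sub {f g : ℝ → ℝ} (hf : Continuous f) (hg : Continuous g) :
    cosCoeff (fun z => f z - g z) = cosCoeff f - cosCoeff g := by
  simp only [cosCoeff, sub_mul]
  rw [intervalIntegral.integral_sub (intervalIntegrable_mul_cos hf)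
    (intervalIntegrable_mul_cos hg)]
  ring

theorem cosCoeff_const_mul (t : ℝ) (f : ℝ → ℝ) : cosCoeff (fun z => t * f z) = t * cosCoeff f := by
  simp only [cosCoeff, mul_assoc]
  rw [intervalIntegral.integral_const_mul]
  ring

theorem cosCoeff_add {f g : ℝ → ℝ} (hf : Continuous f) (hg : Continuous g) :
    cosCoeff (fun z => f z + g z) = cosCoeff f + cosCoeff g := by
  simp only [cosCoeff, add_mul]
  rw [intervalIntegral.integral_add (intervalIntegrable_mul_cos hf)
    (intervalIntegrable_mul_cos hg)]
  ring

theorem continuous_ansatz {x : ℝ → ℝ} (hx : Continuous x) : Continuous (ansatz x) :=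
  Real.continuous_cos.add (continuous_sol hx)

theorem continuous_ansatz₁ {x : ℝ → ℝ} (hx : Continuous x) : Continuous (ansatz₁ x) :=
  Real.continuous_sin.neg.add (continuous_solDeriv hx)

theorem continuous_ansatz₂ {x : ℝ → ℝ} (hx : Continuous x) : Continuous (ansatz₂ x) :=
  Real.continuous_cos.neg.add (hx.sub (continuous_sol hx))

theorem continuous_quadAnsatz (b k : ℝ) {x : ℝ → ℝ} (hx : Continuous x) :
    Continuous (quadAnsatz b k x) := by
  have h0 := continuous_ansatz hx
  have h1 := continuous_ansatz₁ hx
  have h2 := continuous_ansatz₂ hx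
  unfold quadAnsatz
  fun_prop

namespace IsForcing

variable {x y : ℝ → ℝ}

theorem cosCoeff_eq_zero (hx : IsForcing x) : cosCoeff x = 0 := by
  rw [cosCoeff, hx.orth, mul_zero]

theorem cosCoeff_ansatz (hx : IsForcing x) : cosCoeff (ansatz x) = 1 := by
  have := cosCoeff_add Real.continuous_cos (continuous_sol hx.cont)
  rw [cosCoeff_cos, hx.sol_isForcing.cosCoeff_eq_zero, add_zero] at this
  exact this

theorem cosCoeff_ansatz₂ (hx : IsForcing x) : cosCoeff (ansatz₂ x) = -1 := by
  have := cosCoeff_sub hx.cont (continuous_ansatz hx.cont)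
  rw [hx.cosCoeff_eq_zero, hx.cosCoeff_ansatz, zero_sub] at this
  rw [← this]
  congr 1
  ext z
  rw [ansatz₂, ansatz]
  ring

/-- The first cosine coefficients of the ansatz and of its second derivative are 1 and -1. The
correction of the speed is the number that makes the image orthogonal to cos, as solvability
requires. -/
theorem waveMap_isForcing (b κ : ℝ) {k : ℝ} (a : ℝ) (hx : IsForcing x) :
    IsForcing (waveMap b κ k a x) := by
  have h0 := continuous_ansatz hx.cont
  have h2 := continuous_ansatz₂ hx.cont
  have hq := continuous_quadAnsatz b k hx.cont
  refine ⟨?_, fun z => ?_, fun z => ?_, ?_⟩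
  · unfold waveMap
    fun_prop
  · simp only [waveMap, quadAnsatz, ansatz, ansatz₁, ansatz₂, hx.even z, hx.sol_even z,
      hx.solDeriv_neg, Real.cos_neg, Real.sin_neg]
    ring
  · simp only [waveMap, quadAnsatz, ansatz, ansatz₁, ansatz₂, hx.periodic z, hx.sol_periodic z,
      hx.solDeriv_periodic z, Real.cos_add_two_pi, Real.sin_add_two_pi]
  · have hk : (1 : ℝ) + k ^ 2 ≠ 0 := by positivity
    have h : cosCoeff (waveMap b κ k a x) = 0 := by
      have e : cosCoeff (waveMap b κ k a x) = a / stiff κ k * (speedCorr b k x *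
          (cosCoeff (ansatz x) - k ^ 2 * cosCoeff (ansatz₂ x)) - cosCoeff (quadAnsatz b k x)) := by
        rw [← cosCoeff_const_mul, ← cosCoeff_sub h0 (by fun_prop), ← cosCoeff_const_mul,
          ← cosCoeff_sub (by fun_prop) hq, ← cosCoeff_const_mul]
        rfl
      rw [e, hx.cosCoeff_ansatz, hx.cosCoeff_ansatz₂, speedCorr]
      field_simp
      ring
    rw [cosCoeff, mul_eq_zero] at h
    exact h.resolve_left (by positivity)

theorem ansatz_bound (hx : IsForcing x) (h : ∀ z, |x z| ≤ 1) (z : ℝ) :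
    |ansatz x z| ≤ 102 ∧ |ansatz₁ x z| ≤ 102 ∧ |ansatz₂ x z| ≤ 102 := by
  obtain ⟨h1, h2, h3⟩ := hx.sol_bound h z
  have hc := Real.abs_cos_le_one z
  have hs := Real.abs_sin_le_one z
  refine ⟨(abs_add_le _ _).trans (by linarith), (abs_add_le _ _).trans ?_,
    (abs_add_le _ _).trans ?_⟩ <;> rw [abs_neg] <;> linarith

theorem ansatz_sub_bound (hx : IsForcing x) (hy : IsForcing y) {η : ℝ} (h : ∀ z, |x z - y z| ≤ η)
    (z : ℝ) : |ansatz x z - ansatz y z| ≤ 102 * η ∧ |ansatz₁ x z - ansatz₁ y z| ≤ 102 * η ∧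
      |ansatz₂ x z - ansatz₂ y z| ≤ 102 * η := by
  obtain ⟨h1, h2, h3⟩ := hx.sol_sub_bound hy h z
  have hη : 0 ≤ η := (abs_nonneg _).trans (h 0)
  simp only [ansatz, ansatz₁, ansatz₂, add_sub_add_left_eq_sub]
  exact ⟨by linarith, by linarith, by linarith⟩

theorem quadAnsatz_bound (b k : ℝ) (hx : IsForcing x) (h : ∀ z, |x z| ≤ 1) (z : ℝ) :
    |quadAnsatz b k x z| ≤ quadC b k * (2 * 102 * 102) := by
  obtain ⟨h0, h1, h2⟩ := hx.ansatz_bound h z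
  have := abs_quad_sub_le b k (y₀ := 0) (y₁ := 0) (y₂ := 0) (x₂ := ansatz₂ x z) (ρ := 102) h0 h1
    (by norm_num) (by norm_num) (by norm_num) (by rwa [sub_zero]) (by rwa [sub_zero])
    (by rwa [sub_zero])
  simpa [quadAnsatz] using this

theorem quadAnsatz_sub_bound (b k : ℝ) (hx : IsForcing x) (hy : IsForcing y)
    (h1 : ∀ z, |x z| ≤ 1) (h2 : ∀ z, |y z| ≤ 1) {η : ℝ} (h : ∀ z, |x z - y z| ≤ η) (z : ℝ) :
    |quadAnsatz b k x z - quadAnsatz b k y z| ≤ quadC b k * (2 * 102 * 102) * η := by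
  obtain ⟨a0, a1, -⟩ := hx.ansatz_bound h1 z
  obtain ⟨b0, b1, b2⟩ := hy.ansatz_bound h2 z
  obtain ⟨d0, d1, d2⟩ := hx.ansatz_sub_bound hy h z
  have := abs_quad_sub_le b k a0 a1 b0 b1 b2 d0 d1 d2
  refine this.trans (le_of_eq (by ring))

theorem speedCorr_bound (b k : ℝ) (hx : IsForcing x) (h : ∀ z, |x z| ≤ 1) :
    |speedCorr b k x| ≤ 2 * (quadC b k * (2 * 102 * 102)) := by
  rw [speedCorr, abs_div, abs_of_pos (by positivity : 0 < 1 + k ^ 2)]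
  refine (div_le_self (abs_nonneg _) (by nlinarith [sq_nonneg k])).trans ?_
  exact abs_cosCoeff_le (hx.quadAnsatz_bound b k h)

theorem speedCorr_sub_bound (b k : ℝ) (hx : IsForcing x) (hy : IsForcing y)
    (h1 : ∀ z, |x z| ≤ 1) (h2 : ∀ z, |y z| ≤ 1) {η : ℝ} (h : ∀ z, |x z - y z| ≤ η) :
    |speedCorr b k x - speedCorr b k y| ≤ 2 * (quadC b k * (2 * 102 * 102) * η) := by
  rw [speedCorr, speedCorr, ← sub_div, abs_div, abs_of_pos (by positivity : 0 < 1 + k ^ 2)]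
  refine (div_le_self (abs_nonneg _) (by nlinarith [sq_nonneg k])).trans ?_
  rw [← cosCoeff_sub (continuous_quadAnsatz b k hx.cont) (continuous_quadAnsatz b k hy.cont)]
  exact abs_cosCoeff_le (hx.quadAnsatz_sub_bound b k hy h1 h2 h)

end IsForcing

/-- A Lipschitz constant of `waveMap` divided by the amplitude. -/
def waveMapC (b κ k : ℝ) : ℝ :=
  quadC b k * (2 * 102 * 102) * (4 * ((1 + k ^ 2) * 102) + 1) / stiff κ k

namespace IsForcing

variable {x y : ℝ → ℝ}

theorem waveMap_bound (b : ℝ) {κ k : ℝ} (hκ : 0 < κ) (hk : 0 < k) (a : ℝ) (hx : IsForcing x)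
    (h : ∀ z, |x z| ≤ 1) (z : ℝ) : |waveMap b κ k a x z| ≤ |a| * waveMapC b κ k := by
  have hA := stiff_pos hκ hk
  obtain ⟨h0, -, h2⟩ := hx.ansatz_bound h z
  have hq := hx.quadAnsatz_bound b k h z
  have hs := hx.speedCorr_bound b k h
  set K := quadC b k * (2 * 102 * 102) with hK
  have hK0 : 0 ≤ K := (abs_nonneg _).trans hq
  have h3 : |ansatz x z - k ^ 2 * ansatz₂ x z| ≤ (1 + k ^ 2) * 102 := by
    refine (abs_sub _ _).trans ?_
    rw [abs_mul, abs_of_nonneg (sq_nonneg k)]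
    nlinarith [mul_le_mul_of_nonneg_left h2 (sq_nonneg k)]
  have h4 := mul_le_mul hs h3 (abs_nonneg _) (by positivity)
  rw [← abs_mul] at h4
  rw [waveMap, abs_mul, abs_div, abs_of_pos hA, waveMapC, ← hK, div_mul_eq_mul_div, mul_div_assoc']
  refine div_le_div_of_nonneg_right (mul_le_mul_of_nonneg_left ?_ (abs_nonneg a)) hA.le
  refine (abs_sub _ _).trans ((add_le_add h4 hq).trans ?_)
  have : 0 ≤ K * ((1 + k ^ 2) * 102) := by positivity
  linarith

theorem waveMap_sub_bound (b : ℝ) {κ k : ℝ} (hκ : 0 < κ) (hk : 0 < k) (a : ℝ) (hx : IsForcing x)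
    (hy : IsForcing y) (h1 : ∀ z, |x z| ≤ 1) (h2 : ∀ z, |y z| ≤ 1) {η : ℝ}
    (h : ∀ z, |x z - y z| ≤ η) (z : ℝ) :
    |waveMap b κ k a x z - waveMap b κ k a y z| ≤ |a| * waveMapC b κ k * η := by
  have hA := stiff_pos hκ hk
  have hη : 0 ≤ η := (abs_nonneg _).trans (h 0)
  obtain ⟨a0, -, a2⟩ := hx.ansatz_bound h1 z
  obtain ⟨d0, -, d2⟩ := hx.ansatz_sub_bound hy h z
  have hq := hx.quadAnsatz_sub_bound b k hy h1 h2 h z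
  have hs := hx.speedCorr_sub_bound b k hy h1 h2 h
  have hs' := hy.speedCorr_bound b k h2
  have hK0' := (abs_nonneg _).trans (hx.quadAnsatz_bound b k h1 z)
  set K := quadC b k * (2 * 102 * 102) with hK
  have hK0 : 0 ≤ K := hK0'
  have h3 : |ansatz x z - k ^ 2 * ansatz₂ x z| ≤ (1 + k ^ 2) * 102 := by
    refine (abs_sub _ _).trans ?_
    rw [abs_mul, abs_of_nonneg (sq_nonneg k)]
    nlinarith [mul_le_mul_of_nonneg_left a2 (sq_nonneg k)]
  have h4 : |(ansatz x z - ansatz y z) - k ^ 2 * (ansatz₂ x z - ansatz₂ y z)|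
      ≤ (1 + k ^ 2) * 102 * η := by
    refine (abs_sub _ _).trans ?_
    rw [abs_mul, abs_of_nonneg (sq_nonneg k)]
    nlinarith [mul_le_mul_of_nonneg_left d2 (sq_nonneg k)]
  have h5 := mul_le_mul hs h3 (abs_nonneg _) (by positivity)
  have h6 := mul_le_mul hs' h4 (abs_nonneg _) (by positivity)
  rw [← abs_mul] at h5 h6
  have e : waveMap b κ k a x z - waveMap b κ k a y z = a / stiff κ k *
      ((speedCorr b k x - speedCorr b k y) * (ansatz x z - k ^ 2 * ansatz₂ x z)
        + speedCorr b k y * ((ansatz x z - ansatz y z) - k ^ 2 * (ansatz₂ x z - ansatz₂ y z))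
        - (quadAnsatz b k x z - quadAnsatz b k y z)) := by
    rw [waveMap, waveMap]; ring
  rw [e, abs_mul, abs_div, abs_of_pos hA, waveMapC, ← hK, div_mul_eq_mul_div, mul_div_assoc',
    div_mul_eq_mul_div, mul_assoc]
  refine div_le_div_of_nonneg_right (mul_le_mul_of_nonneg_left ?_ (abs_nonneg a)) hA.le
  refine (abs_sub _ _).trans ((add_le_add ((abs_add_le _ _).trans (add_le_add h5 h6)) hq).trans ?_)
  linarith

end IsForcing

/-- The forcing terms in the closed unit ball. -/
def forcingBall : Set (ℝ →ᵇ ℝ) := {x | IsForcing x ∧ ‖x‖ ≤ 1}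

theorem isClosed_forcingBall : IsClosed forcingBall := by
  have e : forcingBall = {x : ℝ →ᵇ ℝ | ∀ z, x (-z) = x z} ∩ {x | ∀ z, x (z + 2 * π) = x z} ∩
      {x | ∫ z in (0 : ℝ)..2 * π, x z * Real.cos z = 0} ∩ {x | ‖x‖ ≤ 1} := by
    ext x
    exact ⟨fun h => ⟨⟨⟨h.1.even, h.1.periodic⟩, h.1.orth⟩, h.2⟩,
      fun h => ⟨⟨x.continuous, h.1.1.1, h.1.1.2, h.1.2⟩, h.2⟩⟩
  have ev : ∀ z : ℝ, Continuous fun x : ℝ →ᵇ ℝ => x z := fun z => continuous_eval_const z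
  rw [e]
  refine ((IsClosed.inter ?_ ?_).inter ?_).inter (isClosed_le continuous_norm continuous_const)
  · rw [Set.ofPred_forall]
    exact isClosed_iInter fun z => isClosed_eq (ev _) (ev _)
  · rw [Set.ofPred_forall]
    exact isClosed_iInter fun z => isClosed_eq (ev _) (ev _)
  · refine isClosed_eq ?_ continuous_const
    refine intervalIntegral.continuous_parametric_intervalIntegral_of_continuous' ?_ _ _
    exact continuous_eval.mul (Real.continuous_cos.comp continuous_snd)

/-- Both the size and the Lipschitz constant of the map are at most |a|·waveMapC. For small a it is
a contraction of the unit ball of forcing terms, which is closed in the bounded continuous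
functions. -/
theorem exists_waveMap_fixed (b : ℝ) {κ k : ℝ} (hκ : 0 < κ) (hk : 0 < k) {a : ℝ}
    (ha : |a| * waveMapC b κ k ≤ 1 / 2) :
    ∃ x : ℝ → ℝ, IsForcing x ∧ (∀ z, |x z| ≤ 1) ∧ waveMap b κ k a x = x := by
  have : CompleteSpace forcingBall := isClosed_forcingBall.completeSpace_coe
  have : Nonempty forcingBall := ⟨⟨0, IsForcing.zero, by simp⟩⟩
  have hb : ∀ x : forcingBall, ∀ z, |x.1 z| ≤ 1 := fun x z =>
    (x.1.norm_coe_le_norm z).trans x.2.2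
  let f : forcingBall → ℝ →ᵇ ℝ := fun x =>
    BoundedContinuousFunction.ofNormedAddCommGroup (waveMap b κ k a x.1)
      (x.2.1.waveMap_isForcing b κ a).cont (1 / 2)
      fun z => (x.2.1.waveMap_bound b hκ hk a (hb x) z).trans ha
  have hf : ∀ x, f x ∈ forcingBall := fun x => by
    refine ⟨x.2.1.waveMap_isForcing b κ a, ?_⟩
    exact (BoundedContinuousFunction.norm_ofNormedAddCommGroup_le _ (by norm_num) _).trans
      (by norm_num)
  let F : forcingBall → forcingBall := fun x => ⟨f x, hf x⟩
  have hF : ContractingWith (1 / 2) F := by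
    refine ⟨by rw [← NNReal.coe_lt_coe]; norm_num, LipschitzWith.of_dist_le_mul fun x y => ?_⟩
    have hd : ∀ z, |x.1 z - y.1 z| ≤ dist x y := fun z => by
      rw [← Real.dist_eq]
      exact BoundedContinuousFunction.dist_coe_le_dist z
    rw [Subtype.dist_eq]
    refine (BoundedContinuousFunction.dist_le (by positivity)).2 fun z => ?_
    rw [Real.dist_eq]
    refine (x.2.1.waveMap_sub_bound b hκ hk a y.2.1 (hb x) (hb y) hd z).trans ?_
    push_cast
    exact mul_le_mul_of_nonneg_right ha dist_nonneg
  refine ⟨(ContractingWith.fixedPoint F hF).1, (ContractingWith.fixedPoint F hF).2.1, hb _, ?_⟩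
  have h := congrArg Subtype.val hF.fixedPoint_isFixedPt
  exact congrArg (fun g : ℝ →ᵇ ℝ => (g : ℝ → ℝ)) h

end BKP

end

open MeasureTheory AddCircle
open scoped Real ENNReal ContDiff

noncomputable section

namespace BKP

/-! ### Existence of small waves -/

/-- Bootstrapping: `u` is smooth if `u''` is as regular as `u` and `u'`. -/
theorem contDiff_of_hasDerivAt {u u₁ u₂ : ℝ → ℝ} (h1 : ∀ z, HasDerivAt u (u₁ z) z)
    (h2 : ∀ z, HasDerivAt u₁ (u₂ z) z)
    (h3 : ∀ n : ℕ, ContDiff ℝ n u → ContDiff ℝ n u₁ → ContDiff ℝ n u₂) : ContDiff ℝ ∞ u := by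
  have d1 : deriv u = u₁ := funext fun z => (h1 z).deriv
  have d2 : deriv u₁ = u₂ := funext fun z => (h2 z).deriv
  have key : ∀ n : ℕ, ContDiff ℝ n u ∧ ContDiff ℝ n u₁ := fun n => by
    induction n with
    | zero =>
      exact ⟨contDiff_zero.2 (continuous_iff_continuousAt.2 fun z => (h1 z).continuousAt),
        contDiff_zero.2 (continuous_iff_continuousAt.2 fun z => (h2 z).continuousAt)⟩
    | succ n ih =>
      have e : ((n + 1 : ℕ) : WithTop ℕ∞) = n + 1 := by push_cast; rfl
      rw [e, contDiff_succ_iff_deriv, contDiff_succ_iff_deriv, d1, d2]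
      exact ⟨⟨fun z => (h1 z).differentiableAt, by simp, ih.2⟩,
        ⟨fun z => (h2 z).differentiableAt, by simp, h3 n ih.1 ih.2⟩⟩
  exact contDiff_infty.2 fun n => (key n).1

theorem hasDerivAt_ansatz {x : ℝ → ℝ} (hx : Continuous x) (z : ℝ) :
    HasDerivAt (ansatz x) (ansatz₁ x z) z :=
  (Real.hasDerivAt_cos z).add (hasDerivAt_sol hx z)

theorem hasDerivAt_ansatz₁ {x : ℝ → ℝ} (hx : Continuous x) (z : ℝ) :
    HasDerivAt (ansatz₁ x) (ansatz₂ x z) z :=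
  (Real.hasDerivAt_sin z).neg.add (hasDerivAt_solDeriv hx z)

theorem wave_equation_of_fixed {b κ k a : ℝ} (hκ : 0 < κ) (hk : 0 < k) {x : ℝ → ℝ}
    (hfix : waveMap b κ k a x = x) (z : ℝ) :
    (κ - (κ / (1 + k ^ 2) + a * speedCorr b k x)) * ansatz x z
      + (κ / (1 + k ^ 2) + a * speedCorr b k x) * k ^ 2 * ansatz₂ x z
      + a * quadAnsatz b k x z = 0 := by
  have hA := stiff_pos hκ hk
  have h := congrFun hfix z
  have e : x z = ansatz x z + ansatz₂ x z := by rw [ansatz, ansatz₂]; ring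
  rw [waveMap, div_mul_eq_mul_div, div_eq_iff hA.ne', e] at h
  have h2 : (1 : ℝ) + k ^ 2 ≠ 0 := by positivity
  have e1 : κ = κ / (1 + k ^ 2) + stiff κ k := by unfold stiff; field_simp
  have e2 : stiff κ k = κ / (1 + k ^ 2) * k ^ 2 := by unfold stiff; field_simp
  have e3 : κ - (κ / (1 + k ^ 2) + a * speedCorr b k x) = stiff κ k - a * speedCorr b k x := by
    linear_combination e1
  have e4 : (κ / (1 + k ^ 2) + a * speedCorr b k x) * k ^ 2
      = stiff κ k + a * speedCorr b k x * k ^ 2 := by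
    rw [e2]; ring
  rw [e3, e4]
  linear_combination -h

/-- Since c - w > 0, the equation can be solved for the second derivative, which becomes a smooth
expression in the function and its first derivative. -/
theorem contDiff_ansatz {b κ k a : ℝ} (hκ : 0 < κ) (hk : 0 < k) {x : ℝ → ℝ} (hx : IsForcing x)
    (hfix : waveMap b κ k a x = x)
    (hpos : ∀ z, a * ansatz x z < κ / (1 + k ^ 2) + a * speedCorr b k x) :
    ContDiff ℝ ∞ (ansatz x) := by
  set c := κ / (1 + k ^ 2) + a * speedCorr b k x with hc
  have hD : ∀ z, k ^ 2 * (c - a * ansatz x z) ≠ 0 := fun z =>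
    (mul_pos (by positivity) (sub_pos.2 (hpos z))).ne'
  have e : ansatz₂ x = fun z => -((κ - c) * ansatz x z + a * ((b + 1) / 2 * ansatz x z ^ 2
      - (b - 1) / 2 * k ^ 2 * ansatz₁ x z ^ 2)) / (k ^ 2 * (c - a * ansatz x z)) := funext fun z =>
          by
    have h := wave_equation_of_fixed hκ hk hfix z
    rw [← hc, quadAnsatz] at h
    rw [eq_div_iff (hD z)]
    linear_combination h
  refine contDiff_of_hasDerivAt (hasDerivAt_ansatz hx.cont) (hasDerivAt_ansatz₁ hx.cont)
    fun n h0 h1 => ?_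
  rw [e]
  refine ContDiff.div ?_ ?_ hD
  · fun_prop
  · fun_prop

theorem exists_small_wave (b : ℝ) {κ k : ℝ} (hκ : 0 < κ) (hk : 0 < k) {δ : ℝ} (hδ : 0 < δ) :
    ∃ ε > 0, ∀ a : ℝ, |a| < ε → ∃ (w : Profile) (c : ℝ), IsWave b κ k a w c ∧ IsSmall κ k δ w c :=
        by
  have hQ := quadC_nonneg b k
  have hc0 : 0 < κ / (1 + k ^ 2) := by positivity
  -- The three conditions give the contraction, the smallness of wave and speed correction, and the
  -- positivity of c - w.
  obtain ⟨ε, ⟨⟨⟨h1, h2⟩, h3⟩, hε⟩⟩ :=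
    ((((eventually_mul_lt (waveMapC b κ k) one_half_pos).and
      (eventually_mul_lt (2 * (quadC b k * (2 * 102 * 102)) + 102) hδ)).and
      (eventually_mul_lt (2 * (quadC b k * (2 * 102 * 102)) + 102) hc0)).and
      self_mem_nhdsWithin).exists
  have hε0 : 0 < ε := hε
  refine ⟨ε, hε0, fun a ha => ?_⟩
  have hC : 0 ≤ waveMapC b κ k := by
    have := stiff_pos hκ hk
    unfold waveMapC
    positivity
  obtain ⟨x, hx, hb, hfix⟩ := exists_waveMap_fixed b hκ hk (a := a) (by
    linarith [mul_le_mul_of_nonneg_right ha.le hC])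
  have hS := hx.speedCorr_bound b k hb
  set K := 2 * (quadC b k * (2 * 102 * 102)) with hK
  have hK0 : 0 ≤ K := by positivity
  have hKa := mul_le_mul_of_nonneg_left ha.le hK0
  have hSa : |a * speedCorr b k x| ≤ |a| * K := by
    rw [abs_mul]
    exact mul_le_mul_of_nonneg_left hS (abs_nonneg a)
  have hwa : ∀ {y : ℝ}, |y| ≤ 102 → |a * y| ≤ |a| * 102 := fun hy => by
    rw [abs_mul]
    exact mul_le_mul_of_nonneg_left hy (abs_nonneg a)
  have hlt : ∀ {y : ℝ}, |y| ≤ 102 → |a * y| < δ := fun hy => by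
    nlinarith [hwa hy]
  have hsm := contDiff_ansatz hκ hk hx hfix fun z => by
    have h4 := (le_abs_self _).trans (hwa (hx.ansatz_bound hb z).1)
    have h5 := (neg_le_abs _).trans hSa
    nlinarith
  let w : Profile :=
    { fn := fun z => a * ansatz x z
      smooth := contDiff_const.mul hsm
      periodic := fun z => by
        simp only [ansatz, hx.sol_periodic z, Real.cos_add_two_pi] }
  have hw1 : ∀ z, w.deriv.fn z = a * ansatz₁ x z := fun z =>
    (w.hasDerivAt z).unique ((hasDerivAt_ansatz hx.cont z).const_mul a)
  have hw2 : ∀ z, w.deriv.deriv.fn z = a * ansatz₂ x z := fun z => by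
    have h := w.deriv.hasDerivAt z
    rw [funext hw1] at h
    exact h.unique ((hasDerivAt_ansatz₁ hx.cont z).const_mul a)
  have hw : ∀ z, w.fn z = a * ansatz x z := fun _ => rfl
  refine ⟨w, κ / (1 + k ^ 2) + a * speedCorr b k x, ⟨fun z => ?_, fun z => ?_, ?_⟩,
    ⟨fun z => ?_, fun z => ?_, fun z => ?_, ?_⟩⟩
  · simp only [hw, ansatz, hx.sol_even z, Real.cos_neg]
  · have h := wave_equation_of_fixed hκ hk hfix z
    rw [hw, hw1, hw2]
    rw [quadAnsatz] at h
    linear_combination a * h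
  · have h := cosCoeff_const_mul a (ansatz x)
    rw [hx.cosCoeff_ansatz, mul_one] at h
    exact h
  · exact hlt (hx.ansatz_bound hb z).1
  · rw [hw1]
    exact hlt (hx.ansatz_bound hb z).2.1
  · rw [hw2]
    exact hlt (hx.ansatz_bound hb z).2.2
  · rw [add_sub_cancel_left]
    nlinarith [abs_nonneg a]

end BKP

end

theorem lemma4p5 (b κ k : ℝ) (hκ : 0 < κ) (hk : 0 < k) :
    ∃ δ > 0, ∃ ε > 0, ∃ C > 0,
      (∀ a : ℝ, 0 < |a| → |a| < ε →
        ∃ (w : BKP.Profile) (c : ℝ), BKP.IsWave b κ k a w c ∧ BKP.IsSmall κ k δ w c) ∧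
      ∀ a : ℝ, 0 < |a| → |a| < ε →
        ∀ (w : BKP.Profile) (c : ℝ), BKP.IsWave b κ k a w c → BKP.IsSmall κ k δ w c →
          (BKP.ellSq b κ k a < 0 →
            ∃ L : ℝ, 0 < L ∧ |L - (-BKP.ellSq b κ k a)| ≤ C * a ^ 4 ∧
              ∀ ℓ : ℝ, |ℓ| < ε →
                (L < ℓ ^ 2 → BKP.ImaginarySpectrum (BKP.A 1 b κ k hk w c ℓ)) ∧
                (ℓ ≠ 0 → ℓ ^ 2 < L →
                  ∃ μ : ℝ, 0 < μ ∧
                    BKP.IsSimpleEigenvalue (BKP.A 1 b κ k hk w c ℓ) (μ : ℂ) ∧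
                    BKP.IsSimpleEigenvalue (BKP.A 1 b κ k hk w c ℓ) (-μ : ℂ) ∧
                    ∀ z ∈ BKP.spec (BKP.A 1 b κ k hk w c ℓ),
                      z ≠ (μ : ℂ) → z ≠ (-μ : ℂ) → z.re = 0)) ∧
          (0 < BKP.ellSq b κ k a →
            ∀ ℓ : ℝ, |ℓ| < ε → BKP.ImaginarySpectrum (BKP.A 1 b κ k hk w c ℓ)) := by
  obtain ⟨δ, hδ, ε₁, hε₁, C, hC, hspec⟩ := BKP.exists_spectral_description b κ k hκ hk
  -- The δ of the spectral part is prescribed to the existence part, so that both speak of the same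
  -- class of waves.
  obtain ⟨ε₂, hε₂, hex⟩ := BKP.exists_small_wave b hκ hk hδ
  refine ⟨δ, hδ, min ε₁ ε₂, lt_min hε₁ hε₂, C, hC,
    fun a _ ha => hex a (ha.trans_le (min_le_right _ _)), fun a ha0 ha w c hw hs => ?_⟩
  obtain ⟨h1, h2⟩ := hspec a ha0 (ha.trans_le (min_le_left _ _)) w c hw hs
  refine ⟨fun hneg => ?_, fun hpos ℓ hℓ => h2 hpos ℓ (hℓ.trans_le (min_le_left _ _))⟩
  obtain ⟨L, hL, hLC, h⟩ := h1 hneg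
  exact ⟨L, hL, hLC, fun ℓ hℓ => h ℓ (hℓ.trans_le (min_le_left _ _))⟩
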